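/- Let $\mathbb S^1=\mathbb R/2\pi\mathbb Z$ and, for $0<r\le\infty$, $\mathcal C_r=\mathbb S^1\times[0,r)$. Let $p\ge 1$ be an integer and $\lambda>1$. Let $F:\mathcal C_\infty\to\mathcal C_\infty$ be the map $$F(x,y)=\Big(\tfrac2p\arctan\big(\lambda^2\tan(px/2)\big),\; y\sqrt{\tfrac{\cos^2(px/2)}{\lambda^2}+\lambda^2\sin^2(px/2)}\Big),$$ where the first coordinate is given by the formula for $|x|<\pi/p$ and is extended to the continuous circle map that commutes with the translation by $2\pi/p$. **Proposition.** There is $\delta>0$, depending only on $p$ and $\lambda$, such that every $C^2$ diffeomorphism $G$ of $\mathcal C_1$ onto its image in $\mathcal C_\infty$ that preserves the boundary circle $\mathbb S^1\times\{0\}$ and has a lift to the universal cover whose difference from the lift of $F$ is, together with its derivatives of order one and two, uniformly smaller than $\delta$ on $\mathbb R\times[0,1)$, is a boundary map of degree $p$ on $\mathcal C_1$. Here a $C^2$ diffeomorphism $G$ of $\mathcal C_r$ onto its image in $\mathcal C_\infty$, preserving the boundary circle, is a *boundary map of degree $p$* if there is a $C^2$ diffeomorphism $H:\mathcal C_r\to\mathcal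 C_r$ such that $F_*=H\circ G\circ H^{-1}$ (defined at the points that it maps into $\mathcal C_r$) has the following properties, where $\ell_j=\{x=\pi j/p\}$. 1. The fixed points of $F_*$ in $\mathcal C_r$ are exactly the points $(\pi j/p,0)$, $0\le j\le 2p$, and each is a hyperbolic saddle. 2. $F_*$ preserves $\mathbb S^1\times\{0\}$ and its restriction to this circle is Morse–Smale; each stable or unstable manifold (in $\mathcal C_r$) of a fixed point that is not contained in $\mathbb S^1\times\{0\}$ is contained in some $\ell_j$, $0\le j\le 2p$. 3. There are $0<r_-<r_+<r$ and $\epsilon_j>0$ such that, with $$R^+=\bigcup_{0\le i<p}\Big(\big(\tfrac{2i\pi}{p}-\epsilon_{2i},\tfrac{2i\pi}{p}+\epsilon_{2i}\big)\times[r_-,r_+)\Big)\setminus\ell_{2i},$$ $$R^-=\bigcup_{0\le i<p}\Big(\big(\tfrac{(2i+1)\pi}{p}-\epsilon_{2i+1},\tfrac{(2i+1)\pi}{p}+\epsilon_{2i+1}\big)\times[r_-,r_+)\Big)\setminus\ell_{2i+1},$$ for every $z\in R^+$ there is a least integer $\hat n(z)\ge1$ such that $F_*^k(z)$ is defined and lies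 in $\mathcal C_r$ for all $k\le\hat n(z)$ and $F_*^{\hat n(z)}(z)\in R^-$. 4. The sets $R^+$, $R^-$ are disjoint, and $T:R^+\to R^-$, $T(z)=F_*^{\hat n(z)}(z)$, has a *hyperbolic cone structure*. Namely, write $D_zT$ for the derivative of $F_*^{\hat n(z)}$ at $z$, which is invertible. There are numbers $0<\alpha_0<\alpha<1<\sigma$ and two continuous line fields $E^u,E^s$ on $R^+\cup R^-$, given by continuous nowhere zero vector fields, such that the cones $C^{u,s}(\beta;z)=\{0\}\cup\{v:\angle(v,E^{u,s}(z))<\beta\}$ satisfy: - $C^u(\alpha;z)\cap C^s(\alpha;z)=\{0\}$ for all $z\in R^+\cup R^-$; - for all $z\in R^+$: $D_zT(C^u(\alpha;z))\subset C^u(\alpha_0;T(z))$, and $|D_zT(v)|\ge\sigma|v|$ for all $v\in C^u(\alpha;z)$; - for all $z\in R^+$: $(D_zT)^{-1}(C^s(\alpha;T(z)))\subset C^s(\alpha_0;z)$, and $|(D_zT)^{-1}(v)|\ge\sigma|v|$ for all $v\in C^s(\alpha;T(z))$. -/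

import Mathlib

open Set Filter Topology

namespace CylinderDynamics

noncomputable section

/-! The cylinder and its universal cover -/

/-- The bi-infinite cylinder: circle of length `2π` times the line. -/
abbrev Cylinder : Type := Real.Angle × ℝ

/-- The half-open cylinder with boundary circle `y = 0`: circle times `[0, r)`. -/
def Cyl (r : ℝ) : Set Cylinder := {z | 0 ≤ z.2 ∧ z.2 < r}

/-- The universal cover of `Cyl r`. -/
def strip (r : ℝ) : Set (ℝ × ℝ) := {w | 0 ≤ w.2 ∧ w.2 < r}

/-- The closed upper half plane, the local model of a surface with boundary. -/
def upperHalf : Set (ℝ × ℝ) := {w | 0 ≤ w.2}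

/-- The covering map `(x, y) ↦ (x mod 2π, y)`; its local inverses are the standard charts. -/
def cov (w : ℝ × ℝ) : Cylinder := ((w.1 : Real.Angle), w.2)

/-- `F` is of class `C^2` at the point `z` of the half cylinder (up to the boundary), read in the
standard charts. -/
def C2At (F : Cylinder → Cylinder) (z : Cylinder) : Prop :=
  ∃ (f : ℝ × ℝ → ℝ × ℝ) (a : ℝ × ℝ), cov a = z ∧
    (∀ᶠ w in 𝓝[upperHalf] a, cov (f w) = F (cov w)) ∧ ContDiffWithinAt ℝ 2 f upperHalf a

/-- `L` is the derivative of `F` at the point `z` of the half cylinder, in the standard charts. -/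
def HasDerivAtPt (F : Cylinder → Cylinder) (L : (ℝ × ℝ) →L[ℝ] (ℝ × ℝ)) (z : Cylinder) : Prop :=
  ∃ (f : ℝ × ℝ → ℝ × ℝ) (a : ℝ × ℝ), cov a = z ∧
    (∀ᶠ w in 𝓝[upperHalf] a, cov (f w) = F (cov w)) ∧ HasFDerivWithinAt f L upperHalf a

/-- `G` is a `C^2` diffeomorphism of `Cyl r` onto its image in the half cylinder `y ≥ 0`, preserving
the boundary circle.  The values of `G` outside `Cyl r` are irrelevant. -/
structure IsC2Embedding (r : ℝ) (G : Cylinder → Cylinder) : Prop where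
  c2 : ∀ z ∈ Cyl r, C2At G z
  inj : InjOn G (Cyl r)
  nonneg : ∀ z ∈ Cyl r, 0 ≤ (G z).2
  boundary : ∀ z ∈ Cyl r, ((G z).2 = 0 ↔ z.2 = 0)
  deriv : ∀ z ∈ Cyl r, ∃ L : (ℝ × ℝ) ≃L[ℝ] (ℝ × ℝ),
    HasDerivAtPt G (L : (ℝ × ℝ) →L[ℝ] (ℝ × ℝ)) z

/-- `H` is a `C^2` change of coordinates of `Cyl r`.  The requirement that `H` be a bijection of the
whole cylinder only says that it also sends the complement of `Cyl r` to itself; nothing else about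
the values there matters, so that conjugating a map with `H` does not create or destroy the property
of a point to be mapped out of `Cyl r`. -/
structure IsC2Coordinates (r : ℝ) (H : Cylinder ≃ Cylinder) : Prop where
  mem_iff : ∀ z, H z ∈ Cyl r ↔ z ∈ Cyl r
  c2 : ∀ z ∈ Cyl r, C2At H z
  c2_symm : ∀ z ∈ Cyl r, C2At H.symm z

/-! The model map -/

/-- The angular part of the lift of the model map: the continuous function that equals
`(2/p) arctan (λ² tan (p x / 2))` for `|x| < π / p` and commutes with the translation by `2π / p`
(see the two lemmas below). -/
def modelAngle (p : ℕ) (lam x : ℝ) : ℝ :=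
  x + 2 / p * Real.arctan ((lam ^ 2 - 1) * (Real.sin (p * x / 2) * Real.cos (p * x / 2)) /
    (Real.cos (p * x / 2) ^ 2 + lam ^ 2 * Real.sin (p * x / 2) ^ 2))

/-- The lift to the universal cover of the model map. -/
def modelLift (p : ℕ) (lam : ℝ) (w : ℝ × ℝ) : ℝ × ℝ :=
  (modelAngle p lam w.1,
    w.2 * √(Real.cos (p * w.1 / 2) ^ 2 / lam ^ 2 + lam ^ 2 * Real.sin (p * w.1 / 2) ^ 2))

theorem modelAngle_eq {p : ℕ} (hp : 1 ≤ p) {lam : ℝ} {x : ℝ}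
    (hx : |x| < Real.pi / p) :
    modelAngle p lam x = 2 / p * Real.arctan (lam ^ 2 * Real.tan (p * x / 2)) := by
  have hp' : (0 : ℝ) < p := by exact_mod_cast hp
  obtain ⟨h1, h2⟩ := abs_lt.1 hx
  have h1' : -(Real.pi / 2) < p * x / 2 := by
    have := mul_lt_mul_of_pos_left h1 hp'
    have e : (p : ℝ) * -(Real.pi / p) = -Real.pi := by field_simp
    linarith
  have h2' : p * x / 2 < Real.pi / 2 := by
    have := mul_lt_mul_of_pos_left h2 hp'
    have e : (p : ℝ) * (Real.pi / p) = Real.pi := by field_simp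
    linarith
  unfold modelAngle
  set θ := (p : ℝ) * x / 2 with hθ
  have hxθ : x = 2 / p * θ := by rw [hθ]; field_simp
  have hc : 0 < Real.cos θ := Real.cos_pos_of_mem_Ioo ⟨h1', h2'⟩
  have hadd := Real.arctan_add (x := lam ^ 2 * Real.tan θ) (y := -Real.tan θ)
    (by nlinarith [mul_nonneg (sq_nonneg lam) (sq_nonneg (Real.tan θ))])
  rw [Real.arctan_neg, Real.arctan_tan h1' h2'] at hadd
  have e : (lam ^ 2 * Real.tan θ + -Real.tan θ) / (1 - lam ^ 2 * Real.tan θ * -Real.tan θ) =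
      (lam ^ 2 - 1) * (Real.sin θ * Real.cos θ) /
        (Real.cos θ ^ 2 + lam ^ 2 * Real.sin θ ^ 2) := by
    have hd : 0 < Real.cos θ ^ 2 + lam ^ 2 * Real.sin θ ^ 2 := by positivity
    have hd' : 0 < 1 - lam ^ 2 * Real.tan θ * -Real.tan θ := by
      nlinarith [mul_nonneg (sq_nonneg lam) (sq_nonneg (Real.tan θ))]
    rw [div_eq_div_iff hd'.ne' hd.ne', Real.tan_eq_sin_div_cos]
    field_simp
    ring
  rw [e] at hadd
  rw [← hadd]
  nth_rewrite 1 [hxθ]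
  ring

theorem modelLift_add {p : ℕ} (hp : 1 ≤ p) (lam x y : ℝ) :
    modelLift p lam (x + 2 * Real.pi / p, y) =
      modelLift p lam (x, y) + (2 * Real.pi / p, 0) := by
  have hp' : (0 : ℝ) < p := by exact_mod_cast hp
  have e : (p : ℝ) * (x + 2 * Real.pi / p) / 2 = p * x / 2 + Real.pi := by field_simp
  simp only [modelLift, modelAngle, e, Real.sin_add_pi, Real.cos_add_pi, Prod.mk_add_mk]
  ext <;> simp
  ring

/-- `G` is `C^2`-close, up to `δ`, to the model map on `Cyl 1`: some lift of `G` is uniformly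
`δ`-close on `strip 1` to the lift of the model, with its derivatives of order one and two. -/
def C2CloseToModel (p : ℕ) (lam δ : ℝ) (G : Cylinder → Cylinder) : Prop :=
  ∃ g : ℝ × ℝ → ℝ × ℝ, ContDiffOn ℝ 2 g (strip 1) ∧
    (∀ w ∈ strip 1, cov (g w) = G (cov w)) ∧
    ∀ k : ℕ, k ≤ 2 → ∀ w ∈ strip 1,
      ‖iteratedFDerivWithin ℝ k (fun w => g w - modelLift p lam w) (strip 1) w‖ < δ

/-! Morse-Smale circle maps, saddles, invariant manifolds -/

/-- `c` is the derivative of the circle map `f` at `x`. -/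
def HasCircleDerivAt (f : Real.Angle → Real.Angle) (c : ℝ) (x : Real.Angle) : Prop :=
  ∃ (g : ℝ → ℝ) (a : ℝ), (a : Real.Angle) = x ∧
    (∀ᶠ t in 𝓝 a, ((g t : ℝ) : Real.Angle) = f (t : Real.Angle)) ∧ HasDerivAt g c a

/-- `f` is a `C^1` diffeomorphism of the circle. -/
def IsCircleDiffeo (f : Real.Angle → Real.Angle) : Prop :=
  Function.Bijective f ∧ ∀ x, ∃ (g : ℝ → ℝ) (a : ℝ), (a : Real.Angle) = x ∧
    (∀ᶠ t in 𝓝 a, ((g t : ℝ) : Real.Angle) = f (t : Real.Angle)) ∧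
    ContDiffAt ℝ 1 g a ∧ deriv g a ≠ 0

/-- The set of non-wandering points. -/
def nonWandering (f : Real.Angle → Real.Angle) : Set Real.Angle :=
  {x | ∀ U ∈ 𝓝 x, ∃ n : ℕ, 0 < n ∧ (f^[n] '' U ∩ U).Nonempty}

/-- Morse-Smale diffeomorphisms of the circle: the non-wandering set is finite and consists of
hyperbolic periodic points.  (Transversality of stable and unstable manifolds is automatic in
dimension one: each of them is either open or a single point, and a stable and an unstable manifold
that meet are never both a single point.) -/
def IsMorseSmale (f : Real.Angle → Real.Angle) : Prop :=
  IsCircleDiffeo f ∧ (nonWandering f).Finite ∧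
    ∀ x ∈ nonWandering f, ∃ n : ℕ, 0 < n ∧ f^[n] x = x ∧
      ∃ c : ℝ, HasCircleDerivAt f^[n] c x ∧ |c| ≠ 1

/-- A fixed point `z` of `F` is a hyperbolic saddle. -/
def IsHyperbolicSaddle (F : Cylinder → Cylinder) (z : Cylinder) : Prop :=
  F z = z ∧ ∃ L : (ℝ × ℝ) →L[ℝ] (ℝ × ℝ), HasDerivAtPt F L z ∧
    ∃ μ ν : ℝ, 0 < |μ| ∧ |μ| < 1 ∧ 1 < |ν| ∧
      Module.End.HasEigenvalue (L : (ℝ × ℝ) →ₗ[ℝ] (ℝ × ℝ)) μ ∧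
      Module.End.HasEigenvalue (L : (ℝ × ℝ) →ₗ[ℝ] (ℝ × ℝ)) ν

/-- The stable manifold of `P` for the map `F`, which is defined on `Cyl r`. -/
def stableManifold (r : ℝ) (F : Cylinder → Cylinder) (P : Cylinder) : Set Cylinder :=
  {z | (∀ n : ℕ, F^[n] z ∈ Cyl r) ∧ Tendsto (fun n : ℕ => F^[n] z) atTop (𝓝 P)}

/-- The unstable manifold of `P` for the map `F`, which is defined on `Cyl r`: the points with a
backward orbit in `Cyl r` that converges to `P`. -/
def unstableManifold (r : ℝ) (F : Cylinder → Cylinder) (P : Cylinder) : Set Cylinder :=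
  {z | ∃ w : ℕ → Cylinder, w 0 = z ∧ (∀ n, w n ∈ Cyl r) ∧ (∀ n, F (w (n + 1)) = w n) ∧
    Tendsto w atTop (𝓝 P)}

/-! Cone structures -/

/-- Euclidean norm of a tangent vector. -/
def eucl (v : ℝ × ℝ) : ℝ := ‖WithLp.toLp 2 v‖

/-- The complete cone of aperture `α` around the line spanned by `e`: the zero vector and the vectors
whose (Euclidean) angle with that line is less than `α`. -/
def cone (e : ℝ × ℝ) (α : ℝ) : Set (ℝ × ℝ) :=
  {v | v = 0 ∨ InnerProductGeometry.angle (WithLp.toLp 2 v) (WithLp.toLp 2 e) < α ∨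
    InnerProductGeometry.angle (WithLp.toLp 2 v) (WithLp.toLp 2 (-e)) < α}

/-- A piecewise smooth map `T : Rp → Rm`, with (invertible) derivatives `DT z`, has a hyperbolic cone
structure.  The two cone fields are the cones around two continuous line fields, spanned by `eu` and
`es`.  Since `T` need be neither injective nor onto, the condition on the derivative of its inverse
is imposed on every local inverse branch `T z ↦ z`. -/
def HasHyperbolicConeStructure (Rp Rm : Set Cylinder) (T : Cylinder → Cylinder)
    (DT : Cylinder → (ℝ × ℝ) ≃L[ℝ] (ℝ × ℝ)) : Prop :=
  Disjoint Rp Rm ∧ MapsTo T Rp Rm ∧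
  ∃ α₀ α σ : ℝ, 0 < α₀ ∧ α₀ < α ∧ α < 1 ∧ 1 < σ ∧
  ∃ eu es : Cylinder → ℝ × ℝ,
    ContinuousOn eu (Rp ∪ Rm) ∧ ContinuousOn es (Rp ∪ Rm) ∧
    (∀ z ∈ Rp ∪ Rm, eu z ≠ 0 ∧ es z ≠ 0 ∧ cone (eu z) α ∩ cone (es z) α = {0}) ∧
    (∀ z ∈ Rp, ∀ v ∈ cone (eu z) α,
      DT z v ∈ cone (eu (T z)) α₀ ∧ σ * eucl v ≤ eucl (DT z v)) ∧
    (∀ z ∈ Rp, ∀ v ∈ cone (es (T z)) α,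
      (DT z).symm v ∈ cone (es z) α₀ ∧ σ * eucl v ≤ eucl ((DT z).symm v))

/-! Boundary maps -/

/-- The vertical line over the angle `π j / p`. -/
def line (p j : ℕ) : Set Cylinder := {z | z.1 = ((Real.pi * j / p : ℝ) : Real.Angle)}

/-- The rectangle of half-width `ε` and height `[rm, rp)` around the vertical line over `π j / p`,
without that line. -/
def rect (p j : ℕ) (ε rm rp : ℝ) : Set Cylinder :=
  (cov '' {w | |w.1 - Real.pi * j / p| < ε ∧ rm ≤ w.2 ∧ w.2 < rp}) \ line p j

/-- The input section: the union of the rectangles around the even lines. -/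
def inputSection (p : ℕ) (ε : ℕ → ℝ) (rm rp : ℝ) : Set Cylinder :=
  ⋃ i ∈ Finset.range p, rect p (2 * i) (ε (2 * i)) rm rp

/-- The output section: the union of the rectangles around the odd lines. -/
def outputSection (p : ℕ) (ε : ℕ → ℝ) (rm rp : ℝ) : Set Cylinder :=
  ⋃ i ∈ Finset.range p, rect p (2 * i + 1) (ε (2 * i + 1)) rm rp

/-- The properties that define a boundary map of degree `p` on `Cyl r`, in adapted coordinates. -/
structure HasBoundaryStructure (p : ℕ) (r : ℝ) (F : Cylinder → Cylinder) : Prop where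
  fixed : {z ∈ Cyl r | F z = z} =
    {z | ∃ j : ℕ, j ≤ 2 * p ∧ z = cov (Real.pi * j / p, 0)}
  saddle : ∀ j : ℕ, j ≤ 2 * p → IsHyperbolicSaddle F (cov (Real.pi * j / p, 0))
  boundary : ∀ x : Real.Angle, (F (x, 0)).2 = 0
  morseSmale : IsMorseSmale (fun x : Real.Angle => (F (x, 0)).1)
  stable : ∀ z ∈ Cyl r, F z = z →
    stableManifold r F z ⊆ {w | w.2 = 0} ∨ ∃ j ≤ 2 * p, stableManifold r F z ⊆ line p j
  unstable : ∀ z ∈ Cyl r, F z = z →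
    unstableManifold r F z ⊆ {w | w.2 = 0} ∨ ∃ j ≤ 2 * p, unstableManifold r F z ⊆ line p j
  transition : ∃ (rm rp : ℝ) (ε : ℕ → ℝ), 0 < rm ∧ rm < rp ∧ rp < r ∧ (∀ j, 0 < ε j) ∧
    ∃ (n : Cylinder → ℕ) (DT : Cylinder → (ℝ × ℝ) ≃L[ℝ] (ℝ × ℝ)),
      (∀ z ∈ inputSection p ε rm rp,
        IsLeast {m : ℕ | 0 < m ∧ (∀ k ≤ m, F^[k] z ∈ Cyl r) ∧
          F^[m] z ∈ outputSection p ε rm rp} (n z) ∧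
        HasDerivAtPt F^[n z] (DT z : (ℝ × ℝ) →L[ℝ] (ℝ × ℝ)) z) ∧
      HasHyperbolicConeStructure (inputSection p ε rm rp) (outputSection p ε rm rp)
        (fun z => F^[n z] z) DT

/-- `G` is a boundary map of degree `p` on `Cyl r`: a `C^2` diffeomorphism of `Cyl r` onto its image
that has the above properties after a `C^2` change of coordinates. -/
def IsBoundaryMap (p : ℕ) (r : ℝ) (G : Cylinder → Cylinder) : Prop :=
  IsC2Embedding r G ∧ ∃ H : Cylinder ≃ Cylinder, IsC2Coordinates r H ∧
    HasBoundaryStructure p r (fun z => H (G (H.symm z)))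

end

end CylinderDynamics

/-! In the coordinates X = y cos(px/2), Y = y sin(px/2) the model is the linear saddle (X, Y) ↦
(X/λ, λY): this is the content of `cos_modelAngle` and `sin_modelAngle`. Even lines are Y = 0, odd
lines are X = 0, and the passage from an even line to the next odd line is the passage of a point
near a linear saddle from one axis to the other. The proof first straightens the invariant curves of
the perturbed map, and then shows that a map close to the model that preserves the boundary and the
lines still behaves like this saddle.

Straightening. Near each line the perturbation is a saddle whose invariant curve transverse to the
boundary is a graph x = πj/p + e_j(y) over the whole height [0, 1). It is found by a graph transform
in cross form (`CrossForm.exists_C1_curve`). Its slope satisfies a fractional linear equation along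
the curve, which is again a cross form, so the slope is C^1 and the curve is C^2
(`SaddleConst.slope_C1`, `exists_invCurve`). Trigonometric interpolation of the e_j gives a small
horizontal displacement of the strip (`exists_coordinates`). In the new coordinates the curves are
vertical lines, and near the boundary the map remains C^{1,1}-close to the model (`C11.conjugate`).

Distortion. Errors must be compared with X and Y, which vanish on the lines. Since the perturbed map
preserves the boundary and the lines, the errors vanish with y, sin and cos and may be divided by
them (`divBound_of_zero`). Hence X and Y are multiplied by factors close to 1/λ and λ, and the
logarithmic differentials dP = d log X and dQ = d log Y, which the model preserves, change at each
step by at most a small multiple of the norm of the tangent vector (`exists_nearLinear`). A transit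
can be arbitrarily long, so these changes must be summable. By `norm_le_dP` the norm of the vector
carries the factor y + |sin cos|, and by `NearLinear.pot_le` this factor is bounded by the increment
of a bounded potential. A discrete Gronwall argument then bounds the total change of dP and dQ,
independently of the length of the orbit (`NearLinear.deriv_orbit`).

Cones. Near an even line a nearly horizontal vector has dQ much larger than dP. This relation
survives the transit, and near an odd line it describes a long, nearly vertical vector
(`cone_block`). The inverse is the same statement with sine and cosine exchanged. So the unstable
field is horizontal on the input section and vertical on the output section, and the stable field is
the other way round.

The remaining properties are softer. Preservation of boundary and lines makes the derivatives at the
fixed points diagonal. On the circle |sin(px/2)| is a Lyapunov function, whence Morse-Smale. The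
decay of X, the growth of Y and the contraction of cot(px/2) confine stable and unstable manifolds.
Closeness of the straightened map to the model is used only below a small height r; higher up it
suffices to know how it acts on the boundary and on the lines, and that it has no fixed points
there. -/

namespace CylinderDynamics

/-! Maps with a bounded Lipschitz derivative -/

section Calculus

variable {E F H : Type*} [NormedAddCommGroup E] [NormedSpace ℝ E] [NormedAddCommGroup F]
  [NormedSpace ℝ F] [NormedAddCommGroup H] [NormedSpace ℝ H]

/-- `u` has on `D` the derivative `u'`, which is bounded by `B` and `B`-Lipschitz. -/
structure Ctl (B : ℝ) (D : Set E) (u : E → F) (u' : E → E →L[ℝ] F) : Prop where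
  deriv : ∀ w ∈ D, HasFDerivWithinAt u (u' w) D w
  bound : ∀ w ∈ D, ‖u' w‖ ≤ B
  lip : ∀ w ∈ D, ∀ z ∈ D, ‖u' w - u' z‖ ≤ B * ‖w - z‖

/-- `u` is small of size `k` on `D`, together with its derivative `u'` and the Lipschitz constant of
the latter. -/
structure C11 (k : ℝ) (D : Set E) (u : E → F) (u' : E → E →L[ℝ] F) : Prop extends
    Ctl k D u u' where
  val : ∀ w ∈ D, ‖u w‖ ≤ k

theorem Ctl.mono {B B' : ℝ} {D : Set E} {u : E → F} {u' : E → E →L[ℝ] F} (h : Ctl B D u u')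
    (hB : B ≤ B') : Ctl B' D u u' :=
  ⟨h.deriv, fun w hw => (h.bound w hw).trans hB,
    fun w hw z hz => (h.lip w hw z hz).trans (by gcongr)⟩

theorem C11.mono {B B' : ℝ} {D : Set E} {u : E → F} {u' : E → E →L[ℝ] F} (h : C11 B D u u')
    (hB : B ≤ B') : C11 B' D u u' :=
  ⟨h.toCtl.mono hB, fun w hw => (h.val w hw).trans hB⟩

theorem Ctl.subset {B : ℝ} {D D' : Set E} {u : E → F} {u' : E → E →L[ℝ] F} (h : Ctl B D u u')
    (hD : D' ⊆ D) : Ctl B D' u u' :=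
  ⟨fun w hw => (h.deriv w (hD hw)).mono hD, fun w hw => h.bound w (hD hw),
    fun w hw z hz => h.lip w (hD hw) z (hD hz)⟩

theorem C11.subset {B : ℝ} {D D' : Set E} {u : E → F} {u' : E → E →L[ℝ] F} (h : C11 B D u u')
    (hD : D' ⊆ D) : C11 B D' u u' :=
  ⟨h.toCtl.subset hD, fun w hw => h.val w (hD hw)⟩

theorem Ctl.congr {B : ℝ} {D : Set E} {u v : E → F} {u' : E → E →L[ℝ] F} (h : Ctl B D u u')
    (e : ∀ w ∈ D, v w = u w) : Ctl B D v u' :=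
  ⟨fun w hw => (h.deriv w hw).congr e (e w hw), h.bound, h.lip⟩

theorem C11.congr {B : ℝ} {D : Set E} {u v : E → F} {u' : E → E →L[ℝ] F} (h : C11 B D u u')
    (e : ∀ w ∈ D, v w = u w) : C11 B D v u' :=
  ⟨h.toCtl.congr e, fun w hw => by rw [e w hw]; exact h.val w hw⟩

theorem Ctl.lipschitz {B : ℝ} {D : Set E} {u : E → F} {u' : E → E →L[ℝ] F} (h : Ctl B D u u')
    (hD : Convex ℝ D) {w z : E} (hw : w ∈ D) (hz : z ∈ D) : ‖u w - u z‖ ≤ B * ‖w - z‖ :=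
  hD.norm_image_sub_le_of_norm_hasFDerivWithin_le h.deriv h.bound hz hw

theorem Ctl.add {B B' : ℝ} {D : Set E} {u v : E → F} {u' v' : E → E →L[ℝ] F} (h : Ctl B D u u')
    (h' : Ctl B' D v v') : Ctl (B + B') D (fun w => u w + v w) (fun w => u' w + v' w) :=
  ⟨fun w hw => (h.deriv w hw).add (h'.deriv w hw),
    fun w hw => (norm_add_le _ _).trans (add_le_add (h.bound w hw) (h'.bound w hw)),
    fun w hw z hz => by
      rw [add_sub_add_comm, add_mul]
      exact (norm_add_le _ _).trans (add_le_add (h.lip w hw z hz) (h'.lip w hw z hz))⟩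

theorem C11.add {B B' : ℝ} {D : Set E} {u v : E → F} {u' v' : E → E →L[ℝ] F} (h : C11 B D u u')
    (h' : C11 B' D v v') : C11 (B + B') D (fun w => u w + v w) (fun w => u' w + v' w) :=
  ⟨h.toCtl.add h'.toCtl,
    fun w hw => (norm_add_le _ _).trans (add_le_add (h.val w hw) (h'.val w hw))⟩

theorem Ctl.neg {B : ℝ} {D : Set E} {u : E → F} {u' : E → E →L[ℝ] F} (h : Ctl B D u u') :
    Ctl B D (fun w => - u w) (fun w => - u' w) :=
  ⟨fun w hw => (h.deriv w hw).neg, fun w hw => by rw [norm_neg]; exact h.bound w hw,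
    fun w hw z hz => by rw [neg_sub_neg, norm_sub_rev]; exact h.lip w hw z hz⟩

theorem C11.neg {B : ℝ} {D : Set E} {u : E → F} {u' : E → E →L[ℝ] F} (h : C11 B D u u') :
    C11 B D (fun w => - u w) (fun w => - u' w) :=
  ⟨h.toCtl.neg, fun w hw => by rw [norm_neg]; exact h.val w hw⟩

theorem C11.sub {B B' : ℝ} {D : Set E} {u v : E → F} {u' v' : E → E →L[ℝ] F} (h : C11 B D u u')
    (h' : C11 B' D v v') : C11 (B + B') D (fun w => u w - v w) (fun w => u' w - v' w) := by
  simpa [sub_eq_add_neg] using h.add h'.neg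

theorem Ctl.id {D : Set E} : Ctl 1 D (fun w : E => w) (fun _ => ContinuousLinearMap.id ℝ E) :=
  ⟨fun w _ => hasFDerivWithinAt_id w D, fun _ _ => ContinuousLinearMap.norm_id_le,
    fun w _ z _ => by simp⟩

/-- The factor (1 + B)^2 is a common majorant: the derivative is bounded by kB and its Lipschitz
constant by kB^2 + kB. What matters is that the bound stays proportional to k. -/
theorem Ctl.comp {k B : ℝ} (hk : 0 ≤ k) (hB : 0 ≤ B) {D : Set E} (hD : Convex ℝ D) {D' : Set F}
    {u : F → H} {u' : F → F →L[ℝ] H} {φ : E → F} {φ' : E → E →L[ℝ] F} (h : Ctl k D' u u')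
    (hφ : Ctl B D φ φ') (hm : MapsTo φ D D') :
    Ctl (k * (1 + B) ^ 2) D (fun w => u (φ w)) (fun w => (u' (φ w)).comp (φ' w)) := by
  refine ⟨fun w hw => (h.deriv _ (hm hw)).comp w (hφ.deriv w hw) hm, fun w hw => ?_,
    fun w hw z hz => ?_⟩
  · calc _ ≤ ‖u' (φ w)‖ * ‖φ' w‖ := ContinuousLinearMap.opNorm_comp_le _ _
      _ ≤ k * B := mul_le_mul (h.bound _ (hm hw)) (hφ.bound w hw) (norm_nonneg _) hk
      _ ≤ _ := by nlinarith [mul_nonneg hk hB, mul_nonneg hk (mul_nonneg hB hB)]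
  · have e : (u' (φ w)).comp (φ' w) - (u' (φ z)).comp (φ' z) =
        (u' (φ w) - u' (φ z)).comp (φ' w) + (u' (φ z)).comp (φ' w - φ' z) := by
      ext v; simp
    rw [e]
    have h1 : ‖u' (φ w) - u' (φ z)‖ ≤ k * (B * ‖w - z‖) :=
      (h.lip _ (hm hw) _ (hm hz)).trans (by gcongr; exact hφ.lipschitz hD hw hz)
    calc _ ≤ ‖u' (φ w) - u' (φ z)‖ * ‖φ' w‖ + ‖u' (φ z)‖ * ‖φ' w - φ' z‖ :=
          (norm_add_le _ _).trans (add_le_add (ContinuousLinearMap.opNorm_comp_le _ _)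
            (ContinuousLinearMap.opNorm_comp_le _ _))
      _ ≤ (k * (B * ‖w - z‖)) * B + k * (B * ‖w - z‖) := by
          gcongr
          · exact hφ.bound w hw
          · exact h.bound _ (hm hz)
          · exact hφ.lip w hw z hz
      _ ≤ _ := by
          have : 0 ≤ k * ‖w - z‖ := by positivity
          nlinarith [mul_nonneg this hB, mul_nonneg this (mul_nonneg hB hB)]

theorem C11.comp {k B : ℝ} (hk : 0 ≤ k) (hB : 0 ≤ B) {D : Set E} (hD : Convex ℝ D) {D' : Set F}
    {u : F → H} {u' : F → F →L[ℝ] H} {φ : E → F} {φ' : E → E →L[ℝ] F} (h : C11 k D' u u')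
    (hφ : Ctl B D φ φ') (hm : MapsTo φ D D') :
    C11 (k * (1 + B) ^ 2) D (fun w => u (φ w)) (fun w => (u' (φ w)).comp (φ' w)) :=
  ⟨h.toCtl.comp hk hB hD hφ hm, fun w hw => (h.val _ (hm hw)).trans (by
    nlinarith [mul_nonneg hk hB, mul_nonneg hk (mul_nonneg hB hB)])⟩

/-- Composition of a fixed smooth map `Φ` with a small perturbation of a map `b`. -/
theorem C11.perturb {k B M : ℝ} (hk : 0 ≤ k) (hB : 0 ≤ B) (hM : 0 ≤ M) {D : Set E}
    (hD : Convex ℝ D) {D' : Set F} (hD' : Convex ℝ D') {Φ : F → H} {Φ' : F → F →L[ℝ] H}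
    {Φ'' : F → F →L[ℝ] F →L[ℝ] H} (h : Ctl M D' Φ Φ') (h' : Ctl M D' Φ' Φ'')
    {b ε : E → F} {b' ε' : E → E →L[ℝ] F} (hb : Ctl B D b b') (hε : C11 k D ε ε')
    (hbm : MapsTo b D D') (hm : MapsTo (fun w => b w + ε w) D D') (hk1 : k ≤ 1) :
    C11 (k * (4 * M * (1 + B) ^ 2)) D (fun w => Φ (b w + ε w) - Φ (b w))
      (fun w => (Φ' (b w + ε w)).comp (b' w + ε' w) - (Φ' (b w)).comp (b' w)) := by
  have val1 : ∀ w ∈ D, ‖Φ (b w + ε w) - Φ (b w)‖ ≤ M * k := fun w hw => by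
    refine (h.lipschitz hD' (hm hw) (hbm hw)).trans ?_
    rw [add_sub_cancel_left]; gcongr; exact hε.val w hw
  have val2 : ∀ w ∈ D, ‖Φ' (b w + ε w) - Φ' (b w)‖ ≤ M * k := fun w hw => by
    refine (h.lip _ (hm hw) _ (hbm hw)).trans ?_
    rw [add_sub_cancel_left]; gcongr; exact hε.val w hw
  have val3 : ∀ w ∈ D, ‖Φ'' (b w + ε w) - Φ'' (b w)‖ ≤ M * k := fun w hw => by
    refine (h'.lip _ (hm hw) _ (hbm hw)).trans ?_
    rw [add_sub_cancel_left]; gcongr; exact hε.val w hw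
  -- The Lipschitz constant of this difference must keep a factor k, which the Lipschitz bound on Φ'
  -- alone does not give. Differentiating once more does, and this is why Φ' itself is required to
  -- have a Lipschitz derivative.
  have lip1 : ∀ w ∈ D, ∀ z ∈ D, ‖(Φ' (b w + ε w) - Φ' (b w)) - (Φ' (b z + ε z) - Φ' (b z))‖ ≤
      (M * k * B + M * k) * ‖w - z‖ := by
    intro w hw z hz
    refine hD.norm_image_sub_le_of_norm_hasFDerivWithin_le
      (f := fun w => Φ' (b w + ε w) - Φ' (b w))
      (f' := fun w => (Φ'' (b w + ε w) - Φ'' (b w)).comp (b' w) + (Φ'' (b w + ε w)).comp (ε' w))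
      (fun x hx => ?_) (fun x hx => ?_) hz hw
    · have h1 := (h'.deriv _ (hm hx)).comp x ((hb.deriv x hx).add (hε.deriv x hx)) hm
      have h2 := (h'.deriv _ (hbm hx)).comp x (hb.deriv x hx) hbm
      refine (h1.sub h2).congr_fderiv ?_
      ext v : 1
      simp [add_sub_right_comm]
    · refine (norm_add_le _ _).trans (add_le_add ?_ ?_)
      · refine (ContinuousLinearMap.opNorm_comp_le _ _).trans ?_
        exact mul_le_mul (val3 x hx) (hb.bound x hx) (norm_nonneg _) (by positivity)
      · refine (ContinuousLinearMap.opNorm_comp_le _ _).trans ?_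
        exact mul_le_mul (h'.bound _ (hm hx)) (hε.bound x hx) (norm_nonneg _) hM
  have lip2 : ∀ w ∈ D, ∀ z ∈ D, ‖Φ' (b w + ε w) - Φ' (b z + ε z)‖ ≤ M * (B + 1) * ‖w - z‖ := by
    intro w hw z hz
    refine (h.lip _ (hm hw) _ (hm hz)).trans ?_
    rw [mul_assoc]
    gcongr
    exact ((hb.add (hε.toCtl.mono hk1)).lipschitz hD hw hz)
  have e : ∀ w, (Φ' (b w + ε w)).comp (b' w + ε' w) - (Φ' (b w)).comp (b' w) =
      (Φ' (b w + ε w) - Φ' (b w)).comp (b' w) + (Φ' (b w + ε w)).comp (ε' w) := by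
    intro w; ext v; simp [add_sub_right_comm]
  have hMk : 0 ≤ M * k := by positivity
  have hMkB : 0 ≤ M * k * B := by positivity
  have hMkBB : 0 ≤ M * k * B * B := by positivity
  refine ⟨⟨fun w hw => ?_, fun w hw => ?_, fun w hw z hz => ?_⟩, fun w hw => ?_⟩
  · exact ((h.deriv _ (hm hw)).comp w ((hb.deriv w hw).add (hε.deriv w hw)) hm).sub
      ((h.deriv _ (hbm hw)).comp w (hb.deriv w hw) hbm)
  · rw [e]
    calc _ ≤ (M * k) * B + M * k := by
          refine (norm_add_le _ _).trans (add_le_add ?_ ?_)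
          · refine (ContinuousLinearMap.opNorm_comp_le _ _).trans ?_
            exact mul_le_mul (val2 w hw) (hb.bound w hw) (norm_nonneg _) hMk
          · refine (ContinuousLinearMap.opNorm_comp_le _ _).trans ?_
            exact mul_le_mul (h.bound _ (hm hw)) (hε.bound w hw) (norm_nonneg _) hM
      _ ≤ _ := by nlinarith
  · rw [e, e]
    have e2 : (Φ' (b w + ε w) - Φ' (b w)).comp (b' w) + (Φ' (b w + ε w)).comp (ε' w) -
        ((Φ' (b z + ε z) - Φ' (b z)).comp (b' z) + (Φ' (b z + ε z)).comp (ε' z)) =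
        (((Φ' (b w + ε w) - Φ' (b w)) - (Φ' (b z + ε z) - Φ' (b z))).comp (b' w) +
        (Φ' (b z + ε z) - Φ' (b z)).comp (b' w - b' z)) +
        ((Φ' (b w + ε w) - Φ' (b z + ε z)).comp (ε' w) +
        (Φ' (b z + ε z)).comp (ε' w - ε' z)) := by
      ext v; simp; abel
    rw [e2]
    have n := norm_nonneg (w - z)
    calc _ ≤ ((M * k * B + M * k) * ‖w - z‖ * B + M * k * (B * ‖w - z‖)) +
          (M * (B + 1) * ‖w - z‖ * k + M * (k * ‖w - z‖)) := by
          refine (norm_add_le _ _).trans (add_le_add ((norm_add_le _ _).trans (add_le_add ?_ ?_))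
            ((norm_add_le _ _).trans (add_le_add ?_ ?_))) <;>
            refine (ContinuousLinearMap.opNorm_comp_le _ _).trans ?_
          · exact mul_le_mul (lip1 w hw z hz) (hb.bound w hw) (norm_nonneg _) (by positivity)
          · exact mul_le_mul (val2 z hz) (hb.lip w hw z hz) (norm_nonneg _) (by positivity)
          · exact mul_le_mul (lip2 w hw z hz) (hε.bound w hw) (norm_nonneg _) (by positivity)
          · exact mul_le_mul (h.bound _ (hm hz)) (hε.lip w hw z hz) (norm_nonneg _) hM
      _ ≤ _ := by
          nlinarith [mul_nonneg hMk n, mul_nonneg hMkB n, mul_nonneg hMkBB n]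
  · refine (val1 w hw).trans ?_
    nlinarith

/-- The inverse of a small perturbation of the identity is controlled. -/
theorem Ctl.inverse [CompleteSpace E] {k : ℝ} (hk1 : k ≤ 1 / 2) {D : Set E}
    (hD : Convex ℝ D) {ε q : E → E} {ε' : E → E →L[ℝ] E} (hε : C11 k D ε ε')
    (hq : MapsTo q D D) (hinv : ∀ w ∈ D, q w + ε (q w) = w) :
    ∃ q' : E → E →L[ℝ] E, Ctl 4 D q q' := by
  -- Since ‖ε'‖ ≤ 1/2, the map id + ε' is invertible by a Neumann series, and its inverse has norm
  -- at most 2.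
  have hunit : ∀ w ∈ D, ∃ A : E ≃L[ℝ] E, (A : E →L[ℝ] E) = ContinuousLinearMap.id ℝ E + ε' w ∧
      ‖(A.symm : E →L[ℝ] E)‖ ≤ 2 := by
    intro w hw
    have hn : ‖-(ε' w)‖ < 1 := by
      rw [norm_neg]; exact ((hε.bound w hw).trans hk1).trans_lt (by norm_num)
    refine ⟨ContinuousLinearEquiv.unitsEquiv ℝ E (Units.oneSub _ hn), ?_, ?_⟩
    · ext v
      simp [ContinuousLinearEquiv.unitsEquiv, ContinuousLinearEquiv.ofUnit]
    · refine ContinuousLinearMap.opNorm_le_bound _ (by norm_num) fun v => ?_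
      set A := ContinuousLinearEquiv.unitsEquiv ℝ E (Units.oneSub _ hn) with hA
      have h1 : A (A.symm v) = v := A.apply_symm_apply v
      have h2 : ∀ x, A x = x + ε' w x := by
        intro x
        simp [hA, ContinuousLinearEquiv.unitsEquiv, ContinuousLinearEquiv.ofUnit]
      rw [h2] at h1
      have h3 : ‖ε' w (A.symm v)‖ ≤ 1 / 2 * ‖A.symm v‖ :=
        (ε' w).le_of_opNorm_le ((hε.bound w hw).trans hk1) _
      have h4 := norm_sub_le_norm_add (A.symm v) (ε' w (A.symm v))
      rw [h1] at h4
      change ‖A.symm v‖ ≤ _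
      linarith
  choose! A hA hA2 using hunit
  have hlip : ∀ w ∈ D, ∀ z ∈ D, ‖q w - q z‖ ≤ 2 * ‖w - z‖ := by
    intro w hw z hz
    have h1 := hε.lipschitz hD (hq hw) (hq hz)
    have h2 : w - z = (q w - q z) + (ε (q w) - ε (q z)) := by
      rw [← add_sub_add_comm, hinv w hw, hinv z hz]
    have h4 := norm_sub_le_norm_add (q w - q z) (ε (q w) - ε (q z))
    rw [← h2] at h4
    have : k * ‖q w - q z‖ ≤ 1 / 2 * ‖q w - q z‖ := by gcongr
    linarith
  refine ⟨fun w => (A (q w)).symm, fun w hw => ?_, fun w hw => ?_, fun w hw z hz => ?_⟩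
  · have hc : ContinuousWithinAt q D w := by
      refine LipschitzOnWith.continuousOn (K := 2) ?_ w hw
      exact LipschitzOnWith.of_dist_le_mul fun x hx y hy => by
        rw [dist_eq_norm, dist_eq_norm]; exact hlip x hx y hy
    have hd : HasFDerivWithinAt (fun w => w + ε w) ((A (q w) : E →L[ℝ] E)) D (q w) := by
      rw [hA _ (hq hw)]
      exact (hasFDerivWithinAt_id _ _).add (hε.deriv _ (hq hw))
    refine HasFDerivWithinAt.of_local_left_inverse (t := D) ?_ hd hw ?_
    · exact tendsto_nhdsWithin_iff.2 ⟨hc, eventually_mem_nhdsWithin.mono fun x hx => hq hx⟩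
    · exact eventually_mem_nhdsWithin.mono fun x hx => hinv x hx
  · exact (hA2 _ (hq hw)).trans (by norm_num)
  · set a := A (q w); set b := A (q z)
    -- Resolvent identity. It bounds the difference by 2 · (k · 2‖w − z‖) · 2, and k ≤ 1/2 produces
    -- the constant 4 of the statement.
    have e : (a.symm : E →L[ℝ] E) - (b.symm : E →L[ℝ] E) =
        ((a.symm : E →L[ℝ] E).comp ((b : E →L[ℝ] E) - (a : E →L[ℝ] E))).comp
          (b.symm : E →L[ℝ] E) := by
      ext v; simp
    have e3 : ‖(b : E →L[ℝ] E) - (a : E →L[ℝ] E)‖ ≤ k * (2 * ‖w - z‖) := by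
      rw [hA _ (hq hw), hA _ (hq hz), add_sub_add_left_eq_sub, norm_sub_rev]
      have hk0 : 0 ≤ k := (norm_nonneg _).trans (hε.val w hw)
      exact (hε.lip _ (hq hw) _ (hq hz)).trans (by gcongr; exact hlip w hw z hz)
    rw [e]
    calc _ ≤ ‖(a.symm : E →L[ℝ] E)‖ * ‖(b : E →L[ℝ] E) - (a : E →L[ℝ] E)‖ *
          ‖(b.symm : E →L[ℝ] E)‖ :=
          (ContinuousLinearMap.opNorm_comp_le _ _).trans (by
            gcongr; exact ContinuousLinearMap.opNorm_comp_le _ _)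
      _ ≤ 2 * (k * (2 * ‖w - z‖)) * 2 := by
          have := hA2 _ (hq hw); have := hA2 _ (hq hz)
          have hk0 : 0 ≤ k := (norm_nonneg _).trans (hε.val w hw)
          gcongr
      _ ≤ _ := by nlinarith [norm_nonneg (w - z)]

end Calculus

/-! The model map -/

section Model

/-- The factor by which the model map multiplies the height. -/
noncomputable def mult (p : ℕ) (lam x : ℝ) : ℝ :=
  √(Real.cos (p * x / 2) ^ 2 / lam ^ 2 + lam ^ 2 * Real.sin (p * x / 2) ^ 2)

theorem modelLift_eq (p : ℕ) (lam : ℝ) (w : ℝ × ℝ) :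
    modelLift p lam w = (modelAngle p lam w.1, w.2 * mult p lam w.1) := rfl

variable {p : ℕ} {lam : ℝ}

theorem mult_radicand_pos (p : ℕ) (hl : 0 < lam) (x : ℝ) :
    0 < Real.cos (p * x / 2) ^ 2 / lam ^ 2 + lam ^ 2 * Real.sin (p * x / 2) ^ 2 := by
  have h1 := Real.sin_sq_add_cos_sq (p * x / 2)
  have h2 : 0 < lam ^ 2 := by positivity
  have h3 : (0 : ℝ) < (lam ^ 2)⁻¹ := by positivity
  rw [div_eq_mul_inv]
  rcases eq_or_ne (Real.sin (p * x / 2)) 0 with h | h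
  · rw [h] at h1 ⊢
    have : Real.cos (p * x / 2) ^ 2 = 1 := by linarith
    rw [this]; simpa using h3
  · have : 0 < Real.sin (p * x / 2) ^ 2 := by positivity
    positivity

theorem mult_pos (p : ℕ) (hl : 0 < lam) (x : ℝ) : 0 < mult p lam x :=
  Real.sqrt_pos.2 (mult_radicand_pos p hl x)

theorem mult_sq (p : ℕ) (hl : 0 < lam) (x : ℝ) : mult p lam x ^ 2 =
    Real.cos (p * x / 2) ^ 2 / lam ^ 2 + lam ^ 2 * Real.sin (p * x / 2) ^ 2 :=
  Real.sq_sqrt (mult_radicand_pos p hl x).le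

theorem inv_le_mult (p : ℕ) (hl : 1 < lam) (x : ℝ) : 1 / lam ≤ mult p lam x := by
  have h1 := Real.sin_sq_add_cos_sq (p * x / 2)
  refine Real.le_sqrt_of_sq_le ?_
  have h2 : 1 < lam ^ 2 := one_lt_pow₀ hl (by norm_num)
  have h3 : 1 / lam ^ 2 ≤ lam ^ 2 := by
    rw [div_le_iff₀ (by positivity)]; nlinarith
  have e : (1 / lam) ^ 2 = Real.cos (p * x / 2) ^ 2 / lam ^ 2 +
      1 / lam ^ 2 * Real.sin (p * x / 2) ^ 2 := by
    linear_combination -(1 / lam ^ 2) * h1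
  rw [e]
  gcongr

theorem mult_le (p : ℕ) (hl : 1 < lam) (x : ℝ) : mult p lam x ≤ lam := by
  have h1 := Real.sin_sq_add_cos_sq (p * x / 2)
  refine Real.sqrt_le_iff.2 ⟨by linarith, ?_⟩
  have h2 : 1 < lam ^ 2 := one_lt_pow₀ hl (by norm_num)
  have h3 : Real.cos (p * x / 2) ^ 2 / lam ^ 2 ≤ lam ^ 2 * Real.cos (p * x / 2) ^ 2 := by
    rw [div_le_iff₀ (by positivity)]
    nlinarith [mul_nonneg (sq_nonneg (Real.cos (p * x / 2))) (by nlinarith : 0 ≤ lam ^ 2 * lam ^ 2 - 1)]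
  nlinarith

theorem angle_denom_pos (p : ℕ) (hl : 0 < lam) (x : ℝ) :
    0 < Real.cos (p * x / 2) ^ 2 + lam ^ 2 * Real.sin (p * x / 2) ^ 2 := by
  have h1 := Real.sin_sq_add_cos_sq (p * x / 2)
  rcases eq_or_ne (Real.sin (p * x / 2)) 0 with h | h
  · rw [h] at h1 ⊢
    have : Real.cos (p * x / 2) ^ 2 = 1 := by linarith
    rw [this]; simp
  · positivity

/-- With s and c the sine and cosine, (c² + λ²s²)² + (λ² − 1)²s²c² = (c² + λ⁴s²)(s² + c²), and c² +
λ⁴s² = λ² mult². This evaluates the square root in the cosine and sine of the arctangent. -/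
theorem angle_one_add_sq (p : ℕ) (hl : 0 < lam) (x : ℝ) :
    1 + ((lam ^ 2 - 1) * (Real.sin (p * x / 2) * Real.cos (p * x / 2)) /
    (Real.cos (p * x / 2) ^ 2 + lam ^ 2 * Real.sin (p * x / 2) ^ 2)) ^ 2 =
    (lam * mult p lam x / (Real.cos (p * x / 2) ^ 2 + lam ^ 2 * Real.sin (p * x / 2) ^ 2)) ^ 2 := by
  have hd := (angle_denom_pos p hl x).ne'
  have h1 := Real.sin_sq_add_cos_sq (p * x / 2)
  rw [div_pow, div_pow, mul_pow lam (mult p lam x), mult_sq p hl, eq_div_iff (pow_ne_zero 2 hd), add_mul,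
    div_mul_cancel₀ _ (pow_ne_zero 2 hd), mul_add, mul_div_cancel₀ _ (by positivity)]
  set s := Real.sin (p * x / 2)
  set c := Real.cos (p * x / 2)
  linear_combination (c ^ 2 + lam ^ 4 * s ^ 2) * h1

/-- Adding the arctangent rotates the rescaled angle px/2, and the addition formula simplifies by
`angle_one_add_sq`. After multiplication by the new height y · mult this says that y cos(px/2) is
divided by λ; `sin_modelAngle` says that y sin(px/2) is multiplied by λ. -/
theorem cos_modelAngle (hp : 1 ≤ p) (hl : 0 < lam) (x : ℝ) :
    Real.cos (p * modelAngle p lam x / 2) = Real.cos (p * x / 2) / (lam * mult p lam x) := by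
  have hp' : (0 : ℝ) < p := by exact_mod_cast hp
  have hd := angle_denom_pos p hl x
  have hm := mult_pos p hl x
  have h1 := Real.sin_sq_add_cos_sq (p * x / 2)
  unfold modelAngle
  rw [show (p : ℝ) * (x + 2 / p * Real.arctan ((lam ^ 2 - 1) * (Real.sin (p * x / 2) *
    Real.cos (p * x / 2)) / (Real.cos (p * x / 2) ^ 2 + lam ^ 2 * Real.sin (p * x / 2) ^ 2))) / 2 =
    p * x / 2 + Real.arctan ((lam ^ 2 - 1) * (Real.sin (p * x / 2) *
    Real.cos (p * x / 2)) / (Real.cos (p * x / 2) ^ 2 + lam ^ 2 * Real.sin (p * x / 2) ^ 2)) by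
    field_simp, Real.cos_add, Real.cos_arctan, Real.sin_arctan, angle_one_add_sq p hl,
    Real.sqrt_sq (by positivity)]
  field_simp
  set s := Real.sin (p * x / 2)
  set c := Real.cos (p * x / 2)
  linear_combination c * h1

theorem sin_modelAngle (hp : 1 ≤ p) (hl : 0 < lam) (x : ℝ) :
    Real.sin (p * modelAngle p lam x / 2) = lam * Real.sin (p * x / 2) / mult p lam x := by
  have hp' : (0 : ℝ) < p := by exact_mod_cast hp
  have hd := angle_denom_pos p hl x
  have hm := mult_pos p hl x
  have h1 := Real.sin_sq_add_cos_sq (p * x / 2)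
  unfold modelAngle
  rw [show (p : ℝ) * (x + 2 / p * Real.arctan ((lam ^ 2 - 1) * (Real.sin (p * x / 2) *
    Real.cos (p * x / 2)) / (Real.cos (p * x / 2) ^ 2 + lam ^ 2 * Real.sin (p * x / 2) ^ 2))) / 2 =
    p * x / 2 + Real.arctan ((lam ^ 2 - 1) * (Real.sin (p * x / 2) *
    Real.cos (p * x / 2)) / (Real.cos (p * x / 2) ^ 2 + lam ^ 2 * Real.sin (p * x / 2) ^ 2)) by
    field_simp, Real.sin_add, Real.cos_arctan, Real.sin_arctan, angle_one_add_sq p hl,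
    Real.sqrt_sq (by positivity)]
  set s := Real.sin (p * x / 2)
  set c := Real.cos (p * x / 2)
  set d := c ^ 2 + lam ^ 2 * s ^ 2 with hdd
  field_simp
  rw [hdd]
  linear_combination lam ^ 2 * s * h1

/-- The geometric reason: the linear map diag(1/λ, λ) preserves area, so in polar coordinates its
angular derivative is the inverse square of its radial factor. -/
theorem hasDerivAt_modelAngle (hp : 1 ≤ p) (hl : 0 < lam) (x : ℝ) :
    HasDerivAt (modelAngle p lam) (1 / mult p lam x ^ 2) x := by
  have hp' : (0 : ℝ) < p := by exact_mod_cast hp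
  have hd := angle_denom_pos p hl x
  have hm := mult_pos p hl x
  have h1 := Real.sin_sq_add_cos_sq (p * x / 2)
  have hθ : HasDerivAt (fun x : ℝ => (p : ℝ) * x / 2) (p / 2) x := by
    simpa using ((hasDerivAt_id x).const_mul (p : ℝ)).div_const 2
  have hs := hθ.sin
  have hc := hθ.cos
  have hq := (((hs.mul hc).const_mul (lam ^ 2 - 1)).div
    ((hc.pow 2).add ((hs.pow 2).const_mul (lam ^ 2))) hd.ne').arctan
  have := (hasDerivAt_id x).add (hq.const_mul (2 / (p : ℝ)))
  have hm2 := mult_sq p hl x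
  refine HasDerivAt.congr_deriv this ?_
  have key := angle_one_add_sq p hl x
  simp only [Pi.add_apply, Pi.mul_apply, Pi.div_apply, Pi.pow_apply]
  rw [key]
  have hm3 : lam ^ 2 * mult p lam x ^ 2 = Real.cos (p * x / 2) ^ 2 +
    lam ^ 4 * Real.sin (p * x / 2) ^ 2 := by rw [hm2]; field_simp
  field_simp
  set s := Real.sin (p * x / 2)
  set c := Real.cos (p * x / 2)
  set m := mult p lam x
  push_cast
  rw [hm3]
  have hcc : c ^ 2 = 1 - s ^ 2 := by linarith
  ring_nf
  simp only [show c ^ 4 = (1 - s ^ 2) ^ 2 by rw [← hcc]; ring, hcc]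
  ring

theorem contDiff_mult (p : ℕ) (hl : 0 < lam) (n : WithTop ℕ∞) : ContDiff ℝ n (mult p lam) := by
  have : (mult p lam) = fun x => √(Real.cos (p * x / 2) ^ 2 / lam ^ 2 +
    lam ^ 2 * Real.sin (p * x / 2) ^ 2) := rfl
  rw [this]
  refine ContDiff.sqrt ?_ fun x => (mult_radicand_pos p hl x).ne'
  fun_prop

theorem contDiff_modelAngle (p : ℕ) (hl : 0 < lam) (n : ℕ∞) :
    ContDiff ℝ n (modelAngle p lam) := by
  unfold modelAngle
  refine contDiff_id.add (contDiff_const.mul (Real.contDiff_arctan.comp ?_))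
  refine ContDiff.div (by fun_prop) (by fun_prop) fun x => (angle_denom_pos p hl x).ne'

theorem contDiff_modelLift (p : ℕ) (hl : 0 < lam) (n : ℕ∞) :
    ContDiff ℝ n (modelLift p lam) :=
  ((contDiff_modelAngle p hl n).comp contDiff_fst).prodMk
    (contDiff_snd.mul ((contDiff_mult p hl n).comp contDiff_fst))

theorem modelLift_add_int (hp : 1 ≤ p) (lam : ℝ) (w : ℝ × ℝ) (n : ℤ) :
    modelLift p lam (w + (2 * Real.pi * n / p, 0)) =
      modelLift p lam w + (2 * Real.pi * n / p, 0) := by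
  have hper : Function.Periodic (fun x => modelLift p lam (x, w.2) - (x, 0)) (2 * Real.pi / p) := by
    intro x
    simp only [modelLift_add hp]
    ext <;> simp
  have h := hper.int_mul n w.1
  simp only [sub_eq_iff_eq_add] at h
  have e : (n : ℝ) * (2 * Real.pi / p) = 2 * Real.pi * n / p := by ring
  rw [e] at h
  have e2 : w + (2 * Real.pi * n / p, 0) = (w.1 + 2 * Real.pi * n / p, w.2) := by
    ext <;> simp
  rw [e2, h]
  ext <;> simp
  ring

theorem modelLift_add_two_pi (hp : 1 ≤ p) (lam : ℝ) (w : ℝ × ℝ) (n : ℤ) :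
    modelLift p lam (w + (2 * Real.pi * n, 0)) = modelLift p lam w + (2 * Real.pi * n, 0) := by
  have hp' : (p : ℝ) ≠ 0 := by positivity
  have := modelLift_add_int hp lam w (p * n)
  push_cast at this
  rwa [show 2 * Real.pi * (p * n) / p = 2 * Real.pi * (n : ℝ) by field_simp] at this

theorem fderiv_add_period {G : Type*} [NormedAddCommGroup G] [NormedSpace ℝ G] {N : ℝ × ℝ → G}
    {a : ℝ × ℝ} (h : ∀ w, N (w + a) = N w) (w : ℝ × ℝ) : fderiv ℝ N (w + a) = fderiv ℝ N w := by
  rw [← fderiv_comp_add_right]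
  exact congrArg (fun g => fderiv ℝ g w) (funext h)

/-- A `C^2` map with a periodic derivative is controlled on the closed strip. -/
theorem exists_ctl_of_periodic {G : Type*} [NormedAddCommGroup G] [NormedSpace ℝ G]
    {f : ℝ × ℝ → G} (hf : ContDiff ℝ 2 f) {c : ℝ} (hc0 : 0 < c)
    (hper : ∀ w, fderiv ℝ f (w + (c, 0)) = fderiv ℝ f w) :
    ∃ M : ℝ, Ctl M {w : ℝ × ℝ | 0 ≤ w.2 ∧ w.2 ≤ 1} f (fderiv ℝ f) := by
  set D := {w : ℝ × ℝ | 0 ≤ w.2 ∧ w.2 ≤ 1} with hD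
  have hf1 : ContDiff ℝ 1 (fderiv ℝ f) := hf.fderiv_right (by norm_num)
  have bound : ∀ N : ℝ × ℝ → ℝ, Continuous N → (∀ w, N (w + (c, 0)) = N w) →
      ∃ M, ∀ w ∈ D, N w ≤ M := by
    intro N hN hper
    have hK : IsCompact (Icc (0 : ℝ) c ×ˢ Icc (0 : ℝ) 1) := isCompact_Icc.prod isCompact_Icc
    obtain ⟨M, hM⟩ := hK.bddAbove_image hN.continuousOn
    refine ⟨M, fun w hw => ?_⟩
    have hp2 : Function.Periodic (fun x => N (x, w.2)) c := fun x => by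
      have := hper (x, w.2)
      simpa using this
    obtain ⟨y, hy, hy2⟩ := hp2.exists_mem_Ico₀ hc0 w.1
    have hy3 : N w = N (y, w.2) := hy2
    rw [hy3]
    exact hM ⟨(y, w.2), ⟨⟨hy.1, hy.2.le⟩, hw⟩, rfl⟩
  obtain ⟨M1, h1⟩ := bound (fun w => ‖fderiv ℝ f w‖) (continuous_norm.comp hf1.continuous)
    fun w => by rw [hper]
  obtain ⟨M2, h2⟩ := bound (fun w => ‖fderiv ℝ (fderiv ℝ f) w‖)
    (continuous_norm.comp (hf1.continuous_fderiv (by norm_num)))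
    fun w => by rw [fderiv_add_period hper]
  have hconv : Convex ℝ D := by
    have : D = Prod.snd ⁻¹' Icc (0 : ℝ) 1 := rfl
    rw [this]
    exact (convex_Icc 0 1).is_linear_preimage ((LinearMap.snd ℝ ℝ ℝ).isLinear)
  have d0 : Differentiable ℝ f := hf.differentiable (by norm_num)
  have d1 : Differentiable ℝ (fderiv ℝ f) := hf1.differentiable (by norm_num)
  refine ⟨max M1 M2, fun w _ => (d0 w).hasFDerivAt.hasFDerivWithinAt,
    fun w hw => (h1 w hw).trans (le_max_left _ _), fun w hw z hz => ?_⟩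
  exact hconv.norm_image_sub_le_of_norm_hasFDerivWithin_le
      (fun w _ => (d1 w).hasFDerivAt.hasFDerivWithinAt)
      (fun w hw => (h2 w hw).trans (le_max_right _ _)) hz hw

/-- On the closed strip the derivatives of the model map are bounded. -/
theorem exists_model_bound (hp : 1 ≤ p) (hl : 0 < lam) : ∃ M : ℝ, 1 ≤ M ∧
    Ctl M {w : ℝ × ℝ | 0 ≤ w.2 ∧ w.2 ≤ 1} (modelLift p lam) (fderiv ℝ (modelLift p lam)) ∧
    Ctl M {w : ℝ × ℝ | 0 ≤ w.2 ∧ w.2 ≤ 1} (fderiv ℝ (modelLift p lam))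
      (fderiv ℝ (fderiv ℝ (modelLift p lam))) := by
  have hp' : (0 : ℝ) < p := by exact_mod_cast hp
  have hc0 : 0 < 2 * Real.pi / p := by have := Real.pi_pos; positivity
  -- Three derivatives, because `C11.perturb` needs the differential of the model to have itself a
  -- Lipschitz derivative.
  have hf : ContDiff ℝ 3 (modelLift p lam) := contDiff_modelLift p hl 3
  have hper : ∀ w, fderiv ℝ (modelLift p lam) (w + (2 * Real.pi / p, 0)) =
      fderiv ℝ (modelLift p lam) w := by
    intro w
    rw [← fderiv_comp_add_right]
    have : (fun x => modelLift p lam (x + (2 * Real.pi / p, 0))) =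
        fun x => modelLift p lam x + (2 * Real.pi / p, 0) := funext fun w => by
      simpa using modelLift_add_int hp lam w 1
    rw [this, fderiv_add_const]
  obtain ⟨M1, h1⟩ := exists_ctl_of_periodic (hf.of_le (by norm_num)) hc0 hper
  obtain ⟨M2, h2⟩ := exists_ctl_of_periodic (hf.fderiv_right (m := 2) (by norm_num)) hc0
    (fderiv_add_period hper)
  exact ⟨max 1 (max M1 M2), le_max_left _ _, h1.mono (by simp), h2.mono (by simp)⟩

end Model

/-! Division of a small function by a function with the same zeros -/

section Division

variable {E F : Type*} [NormedAddCommGroup E] [NormedSpace ℝ E] [NormedAddCommGroup F]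
  [NormedSpace ℝ F]

/-- On the part of D in the ball of radius ‖w − z‖ about w, the derivative differs from `u' w` by at
most B‖w − z‖; the mean value inequality does the rest. -/
theorem Ctl.taylor {B : ℝ} (hB : 0 ≤ B) {D : Set E} (hD : Convex ℝ D) {u : E → F}
    {u' : E → E →L[ℝ] F} (h : Ctl B D u u') {w z : E} (hw : w ∈ D) (hz : z ∈ D) :
    ‖u w - u z - u' w (w - z)‖ ≤ B * ‖w - z‖ ^ 2 := by
  have hs : Convex ℝ (D ∩ Metric.closedBall w ‖w - z‖) := hD.inter (convex_closedBall _ _)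
  have := hs.norm_image_sub_le_of_norm_hasFDerivWithin_le' (f := u) (f' := u') (φ := u' w)
    (C := B * ‖w - z‖) (x := z) (y := w)
    (fun x hx => (h.deriv x hx.1).mono inter_subset_left) (fun x hx => ?_)
    ⟨hz, by simp [dist_eq_norm, norm_sub_rev]⟩ ⟨hw, by simp⟩
  · rw [pow_two, ← mul_assoc]; exact this
  · refine (h.lip x hx.1 w hw).trans ?_
    gcongr
    simpa [dist_eq_norm] using hx.2

/-- The function `r`, with differential `dr`, is a small multiple of `b`, with differential `db`, and
so is the differential of the quotient `r / b`. -/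
def DivBound (K b r : ℝ) (db dr : E →L[ℝ] ℝ) : Prop :=
  |r| ≤ K * |b| ∧ ∀ v, |b * dr v - r * db v| ≤ K * b ^ 2 * ‖v‖

/-- The point z is a common zero of r and b, reached from w in the direction e, at a distance
comparable to |b w|. In this direction r and b agree with t r'e and t b'e up to quadratic errors, so
the leading terms of b r'e − r b'e cancel. In the complementary directions u only b r'u remains, and
it is small because r' is Lipschitz and kills u at z. Both contributions are of order b², as the
differential of a quotient by b requires. -/
theorem divBound_of_zero {k B T : ℝ} (hk : 0 ≤ k) (hB : 0 ≤ B) (hT : 0 ≤ T) {D : Set E}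
    (hD : Convex ℝ D) {r b : E → ℝ} {r' b' : E → E →L[ℝ] ℝ} (hr : C11 k D r r')
    (hb : Ctl B D b b') {w z : E} (hw : w ∈ D) (hz : z ∈ D) (rz : r z = 0) (bz : b z = 0)
    (hT' : ‖w - z‖ ≤ T * |b w|) {t : ℝ} {e : E} (he : ‖e‖ ≤ 1) (hwz : w - z = t • e)
    (hdec : ∀ v, ∃ (α : ℝ) (u : E), v = α • e + u ∧ |α| ≤ ‖v‖ ∧ ‖u‖ ≤ ‖v‖ ∧ r' z u = 0 ∧
      b' w u = 0) :
    DivBound (k * (T + 2 * B * T ^ 2)) (b w) (r w) (b' w) (r' w) := by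
  have hr1 : |r w| ≤ k * (T * |b w|) := by
    have := hr.lipschitz hD hw hz
    rw [rz, sub_zero] at this
    exact this.trans (by gcongr)
  refine ⟨hr1.trans ?_, fun v => ?_⟩
  · have : 0 ≤ k * (B * T ^ 2) * |b w| := by positivity
    nlinarith
  · obtain ⟨α, u, rfl, hα, hu, h1, h2⟩ := hdec v
    set v := α • e + u
    have t1 := hr.toCtl.taylor hk hD hw hz
    have t2 := hb.taylor hB hD hw hz
    rw [rz, sub_zero, hwz, map_smul, smul_eq_mul, ← hwz] at t1
    rw [bz, sub_zero, hwz, map_smul, smul_eq_mul, ← hwz] at t2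
    have hsq : ‖w - z‖ ^ 2 ≤ T ^ 2 * b w ^ 2 := by
      rw [← mul_pow, ← sq_abs (T * b w), abs_mul, abs_of_nonneg hT]
      exact pow_le_pow_left₀ (norm_nonneg _) hT' 2
    have d1 : |r' w e| ≤ k := by
      have := (r' w).le_of_opNorm_le_of_le (hr.bound w hw) he; simpa using this
    have d2 : |b' w e| ≤ B := by
      have := (b' w).le_of_opNorm_le_of_le (hb.bound w hw) he; simpa using this
    have d3 : |r' w u| ≤ k * (T * |b w|) * ‖v‖ := by
      have e1 : r' w u = (r' w - r' z) u := by simp [h1]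
      rw [e1]
      exact (r' w - r' z).le_of_opNorm_le_of_le
        ((hr.lip w hw z hz).trans (by gcongr)) hu
    -- The two products containing t r'e b'e cancel, so b and r may be replaced by their Taylor
    -- remainders.
    have e2 : b w * r' w (α • e + u) - r w * b' w (α • e + u) =
        α * ((b w - t * b' w e) * r' w e - (r w - t * r' w e) * b' w e) + b w * r' w u := by
      simp only [map_add, map_smul, smul_eq_mul, h2]; ring
    rw [Real.norm_eq_abs] at t1 t2
    have d4 : |(b w - t * b' w e) * r' w e - (r w - t * r' w e) * b' w e| ≤
        (B * (T ^ 2 * b w ^ 2)) * k + (k * (T ^ 2 * b w ^ 2)) * B := by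
      refine (abs_sub _ _).trans ?_
      rw [abs_mul, abs_mul]
      gcongr
      · exact t2.trans (by gcongr)
      · exact t1.trans (by gcongr)
    rw [e2]
    calc _ ≤ |α| * |(b w - t * b' w e) * r' w e - (r w - t * r' w e) * b' w e| +
          |b w| * |r' w u| := by
          rw [← abs_mul, ← abs_mul]; exact abs_add_le _ _
      _ ≤ ‖v‖ * ((B * (T ^ 2 * b w ^ 2)) * k + (k * (T ^ 2 * b w ^ 2)) * B) +
          |b w| * (k * (T * |b w|) * ‖v‖) := by gcongr
      _ = _ := by rw [← sq_abs (b w)]; ring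

/-- Perturbation of a logarithmic derivative. -/
theorem DivBound.log_deriv {K b r n N n₀ : ℝ} {db dr n' dN : E →L[ℝ] ℝ} (h : DivBound K b r db dr)
    (hK : 0 ≤ K) (hb : b ≠ 0) (hn₀ : 0 < n₀) (hn : n₀ ≤ n) {c : ℝ} (hc : ‖n'‖ ≤ c)
    (hKn : K ≤ n₀ / 2) (hN : N = n * b + r) (hdN : ∀ v, dN v = b * n' v + n * db v + dr v) (v : E) :
    |dN v / N - db v / b - n' v / n| ≤ K * (2 / n₀ + 2 * c / n₀ ^ 2) * ‖v‖ := by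
  have hn0 : 0 < n := hn₀.trans_le hn
  have hb' : 0 < |b| := abs_pos.2 hb
  -- The perturbation r is at most K|b| ≤ n|b|/2, so N keeps at least half of its main term nb.
  have hNb : n / 2 * |b| ≤ |N| := by
    have : |n * b| - |r| ≤ |N| := by
      rw [hN]
      have := abs_sub_abs_le_abs_sub (n * b) (-r)
      rwa [abs_neg, sub_neg_eq_add] at this
    rw [abs_mul, abs_of_pos hn0] at this
    nlinarith [h.1]
  have hN0 : 0 < |N| := lt_of_lt_of_le (by positivity) hNb
  have hN1 : N ≠ 0 := abs_pos.1 hN0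
  -- Over the common denominator every term of order less than b² cancels; the denominator is itself
  -- of order b².
  have e : dN v / N - db v / b - n' v / n =
      (n * (b * dr v - r * db v) - r * b * n' v) / (N * b * n) := by
    rw [hdN]
    field_simp
    rw [hN]
    ring
  have hc0 : 0 ≤ c := (norm_nonneg _).trans hc
  have h1 : |n * (b * dr v - r * db v) - r * b * n' v| ≤
      n * (K * b ^ 2 * ‖v‖) + K * |b| * |b| * (c * ‖v‖) := by
    refine (abs_sub _ _).trans ?_
    rw [abs_mul, abs_mul, abs_mul, abs_of_pos hn0]
    gcongr
    · exact h.2 v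
    · exact h.1
    · exact n'.le_of_opNorm_le hc v
  rw [e, abs_div, abs_mul, abs_mul, abs_of_pos hn0, div_le_iff₀ (by positivity)]
  refine h1.trans ?_
  have h2 : n / 2 * |b| * |b| * n ≤ |N| * |b| * n := by gcongr
  have h3 : n ≤ 2 / n₀ * (n / 2 * n) := by
    rw [div_mul_eq_mul_div, le_div_iff₀ hn₀]; nlinarith
  have h4 : c ≤ 2 * c / n₀ ^ 2 * (n / 2 * n) := by
    rw [div_mul_eq_mul_div, le_div_iff₀ (by positivity)]
    have : n₀ ^ 2 ≤ n ^ 2 := by gcongr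
    nlinarith [mul_le_mul_of_nonneg_left this hc0]
  calc _ = K * ‖v‖ * (n + c) * (|b| * |b|) := by rw [← sq_abs b]; ring
    _ ≤ K * ‖v‖ * (2 / n₀ * (n / 2 * n) + 2 * c / n₀ ^ 2 * (n / 2 * n)) * (|b| * |b|) := by gcongr
    _ = K * (2 / n₀ + 2 * c / n₀ ^ 2) * ‖v‖ * (n / 2 * |b| * |b| * n) := by ring
    _ ≤ _ := by gcongr

end Division

/-! ### Elementary facts: zeros and differentials of sines, convexity of the strip. -/

/-- Every point is close to a zero of a sine. -/
theorem exists_zero_near {p : ℕ} (hp : 1 ≤ p) (φ x : ℝ) : ∃ x₀ : ℝ,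
    Real.sin (p * x₀ / 2 + φ) = 0 ∧ |x - x₀| ≤ Real.pi / p * |Real.sin (p * x / 2 + φ)| := by
  have hp' : (0 : ℝ) < p := by exact_mod_cast hp
  have hπ := Real.pi_pos
  set θ := p * x / 2 + φ with hθ
  set n : ℤ := round (θ / Real.pi)
  have h1 : |θ - n * Real.pi| ≤ Real.pi / 2 := by
    have := abs_sub_round (θ / Real.pi)
    have e : θ - n * Real.pi = (θ / Real.pi - n) * Real.pi := by field_simp
    rw [e, abs_mul, abs_of_pos hπ]
    nlinarith
  -- Jordan's inequality at the nearest multiple of π. Its factor π/2 and the rescaling x = 2θ/p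
  -- give π/p.
  have h2 := Real.mul_abs_le_abs_sin h1
  rw [Real.sin_sub_int_mul_pi, abs_mul, abs_zpow, abs_neg, abs_one, one_zpow, one_mul] at h2
  refine ⟨2 / p * (n * Real.pi - φ), ?_, ?_⟩
  · rw [show (p : ℝ) * (2 / p * (n * Real.pi - φ)) / 2 + φ = n * Real.pi by field_simp; ring]
    exact Real.sin_int_mul_pi n
  · have e : x - 2 / p * (n * Real.pi - φ) = 2 / p * (θ - n * Real.pi) := by
      rw [hθ]; field_simp; ring
    rw [e, abs_mul, abs_of_pos (by positivity)]
    calc 2 / (p : ℝ) * |θ - n * Real.pi| = Real.pi / p * (2 / Real.pi * |θ - n * Real.pi|) := by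
          field_simp
      _ ≤ _ := by gcongr

theorem convex_strip (r : ℝ) : Convex ℝ (strip r) := by
  have : strip r = Prod.snd ⁻¹' Ico (0 : ℝ) r := rfl
  rw [this]
  exact (convex_Ico 0 r).is_linear_preimage ((LinearMap.snd ℝ ℝ ℝ).isLinear)

theorem Ctl.clm {E F G : Type*} [NormedAddCommGroup E] [NormedSpace ℝ E] [NormedAddCommGroup F]
    [NormedSpace ℝ F] [NormedAddCommGroup G] [NormedSpace ℝ G] {B : ℝ} {D : Set E}
    {u : E → F} {u' : E → E →L[ℝ] F} (h : Ctl B D u u') (A : F →L[ℝ] G) (hA : ‖A‖ ≤ 1) :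
    Ctl B D (fun w => A (u w)) (fun w => A.comp (u' w)) := by
  have key : ∀ (L : E →L[ℝ] F) (b : ℝ), ‖L‖ ≤ b → ‖A.comp L‖ ≤ b := fun L b hL =>
    (ContinuousLinearMap.opNorm_comp_le _ _).trans (by nlinarith [norm_nonneg A, norm_nonneg L])
  refine ⟨fun w hw => A.hasFDerivAt.comp_hasFDerivWithinAt w (h.deriv w hw),
    fun w hw => key _ _ (h.bound w hw), fun w hw z hz => ?_⟩
  rw [← ContinuousLinearMap.comp_sub]
  exact key _ _ (h.lip w hw z hz)

theorem C11.clm {E F G : Type*} [NormedAddCommGroup E] [NormedSpace ℝ E] [NormedAddCommGroup F]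
    [NormedSpace ℝ F] [NormedAddCommGroup G] [NormedSpace ℝ G] {B : ℝ} {D : Set E}
    {u : E → F} {u' : E → E →L[ℝ] F} (h : C11 B D u u') (A : F →L[ℝ] G) (hA : ‖A‖ ≤ 1) :
    C11 B D (fun w => A (u w)) (fun w => A.comp (u' w)) :=
  ⟨h.toCtl.clm A hA, fun w hw => (A.le_of_opNorm_le hA _).trans (by
    rw [one_mul]; exact h.val w hw)⟩

/-- Sines of the first coordinate are controlled. -/
theorem ctl_sin {G : Type*} [NormedAddCommGroup G] [NormedSpace ℝ G] (p : ℕ) (φ : ℝ) {c : ℝ}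
    (hc : 0 ≤ c) {A : G} (hA : ‖A‖ ≤ 1) :
    Ctl (c * (p / 2) * (1 + p / 2)) univ
      (fun w : ℝ × ℝ => (c * Real.sin (p * w.1 / 2 + φ)) • A)
      (fun w => (c * (p / 2) * Real.sin (p * w.1 / 2 + (φ + Real.pi / 2))) •
        (ContinuousLinearMap.fst ℝ ℝ ℝ).smulRight A) := by
  have hn : ‖(ContinuousLinearMap.fst ℝ ℝ ℝ).smulRight A‖ ≤ 1 := by
    rw [ContinuousLinearMap.norm_smulRight_apply]
    exact mul_le_one₀ (ContinuousLinearMap.norm_fst_le ℝ ℝ ℝ) (norm_nonneg _) hA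
  have hp0 : (0 : ℝ) ≤ p / 2 := by positivity
  refine ⟨fun w _ => ?_, fun w _ => ?_, fun w _ z _ => ?_⟩
  · have h1 : HasFDerivAt (fun w : ℝ × ℝ => (p : ℝ) / 2 * w.1 + φ)
        ((p / 2 : ℝ) • ContinuousLinearMap.fst ℝ ℝ ℝ) w :=
      ((hasFDerivAt_fst (𝕜 := ℝ) (p := w)).const_mul (p / 2 : ℝ)).add_const φ
    have h2 := ((h1.sin).const_mul c).smul_const A
    have e : (fun w : ℝ × ℝ => (c * Real.sin (p * w.1 / 2 + φ)) • A) =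
        fun w : ℝ × ℝ => (c * Real.sin (p / 2 * w.1 + φ)) • A := by
      funext w; congr 4; ring
    rw [e]
    refine (h2.congr_fderiv ?_).hasFDerivWithinAt
    ext
    · simp only [← add_assoc, Real.sin_add_pi_div_two]
      simp only [ContinuousLinearMap.coe_comp, Function.comp_apply, ContinuousLinearMap.inl_apply,
        ContinuousLinearMap.smulRight_apply, smul_apply,
        ContinuousLinearMap.coe_fst', smul_eq_mul, mul_one, one_smul]
      congr 1
      ring_nf
    · simp
  · rw [norm_smul, norm_mul, Real.norm_of_nonneg (by positivity)]
    have h1 := Real.abs_sin_le_one (p * w.1 / 2 + (φ + Real.pi / 2))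
    calc _ ≤ (c * (p / 2) * 1) * 1 := by
          gcongr
          exact h1
      _ ≤ _ := by nlinarith [mul_nonneg hc hp0]
  · rw [← sub_smul, ← mul_sub, norm_smul, norm_mul, Real.norm_of_nonneg (by positivity)]
    have h1 := Real.lipschitzWith_sin.dist_le_mul (p * w.1 / 2 + (φ + Real.pi / 2))
      (p * z.1 / 2 + (φ + Real.pi / 2))
    rw [Real.dist_eq, Real.dist_eq] at h1
    have h2 : |(p * w.1 / 2 + (φ + Real.pi / 2)) - (p * z.1 / 2 + (φ + Real.pi / 2))| ≤
        p / 2 * ‖w - z‖ := by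
      have e : (p * w.1 / 2 + (φ + Real.pi / 2)) - (p * z.1 / 2 + (φ + Real.pi / 2)) =
        p / 2 * (w - z).1 := by simp; ring
      rw [e, abs_mul, abs_of_nonneg hp0]
      gcongr
      exact norm_fst_le (w - z)
    calc _ ≤ (c * (p / 2) * (p / 2 * ‖w - z‖)) * 1 := by
          gcongr
          rw [Real.norm_eq_abs]
          refine h1.trans ?_
          simpa using h2
      _ ≤ _ := by nlinarith [mul_nonneg (mul_nonneg hc hp0) (norm_nonneg (w - z))]

/-! Maps close to the model that preserve the lines and the boundary -/

/-- The map `f` with derivative `f'` is `C^{1,1}`-close to the model on `strip r`, and it preserves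
the boundary and the vertical lines. -/
structure NearModel (p : ℕ) (lam k r : ℝ) (f : ℝ × ℝ → ℝ × ℝ)
    (f' : ℝ × ℝ → (ℝ × ℝ) →L[ℝ] (ℝ × ℝ)) : Prop where
  close : C11 k (strip r) (fun w => f w - modelLift p lam w)
    (fun w => f' w - fderiv ℝ (modelLift p lam) w)
  bdry : ∀ x, (f (x, 0)).2 = 0
  lines : ∀ (j : ℤ) (y : ℝ), 0 ≤ y → y < r → (f (Real.pi * j / p, y)).1 = Real.pi * j / p

variable {p : ℕ} {lam k r : ℝ} {f : ℝ × ℝ → ℝ × ℝ} {f' : ℝ × ℝ → (ℝ × ℝ) →L[ℝ] (ℝ × ℝ)}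

theorem NearModel.pos (h : NearModel p lam k r f f') (hr : 0 < r) : 0 ≤ k :=
  (norm_nonneg _).trans (h.close.val (0, 0) ⟨le_rfl, hr⟩)

theorem NearModel.deriv (h : NearModel p lam k r f f') (hl : 0 < lam) {w : ℝ × ℝ}
    (hw : w ∈ strip r) : HasFDerivWithinAt f (f' w) (strip r) w := by
  have h1 := h.close.deriv w hw
  have h2 := ((contDiff_modelLift p hl 1).differentiable (by norm_num) w).hasFDerivAt
  refine ((h1.add h2.hasFDerivWithinAt).congr_fderiv (by simp)).congr (fun x _ => ?_) ?_ <;> simp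

/-- The differential of a function on the strip vanishes along the direction in which it is
constant. -/
theorem fderiv_eq_zero_of_const {r : ℝ} {u : ℝ × ℝ → ℝ} {u' : (ℝ × ℝ) →L[ℝ] ℝ} {z e : ℝ × ℝ}
    (hu : HasFDerivWithinAt u u' (strip r) z) (hz : z ∈ strip r)
    (he : (∃ a, e = (a, 0)) ∨ ∃ a, e = (0, a)) (h0 : ∀ t : ℝ, z + t • e ∈ strip r → u (z + t • e) = 0) :
    u' e = 0 := by
  -- It suffices that the parameters for which the segment stays in the strip determine derivatives
  -- at 0. For a vertical direction they form an interval, which has 0 as an endpoint when z lies on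
  -- the boundary.
  have hcase : ∃ s : Set ℝ, UniqueDiffWithinAt ℝ s 0 ∧ (0 : ℝ) ∈ s ∧
      ∀ t ∈ s, z + t • e ∈ strip r := by
    obtain ⟨hz1, hz2⟩ := hz
    rcases he with ⟨a, rfl⟩ | ⟨a, rfl⟩
    · exact ⟨univ, uniqueDiffWithinAt_univ, mem_univ _, fun t _ => by
        simp [strip, hz1, hz2]⟩
    · rcases eq_or_ne a 0 with rfl | ha
      · exact ⟨univ, uniqueDiffWithinAt_univ, mem_univ _, fun t _ => by simp [strip, hz1, hz2]⟩
      · have hs : Convex ℝ {t : ℝ | z.2 + t * a ∈ Ico 0 r} := by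
          intro x hx y hy b c hb hc hbc
          have := convex_Ico (0 : ℝ) r hx hy hb hc hbc
          simp only [smul_eq_mul, mem_ofPred_eq] at this ⊢
          convert this using 1
          linear_combination (-z.2) * hbc
        refine ⟨_, uniqueDiffWithinAt_convex hs ?_ ?_, by simp [hz1, hz2], fun t ht => ?_⟩
        · refine ⟨((z.2 + r) / 2 - z.2) / a, ?_⟩
          rw [mem_interior_iff_mem_nhds]
          have hc : Continuous fun t : ℝ => z.2 + t * a := by fun_prop
          refine hc.continuousAt.preimage_mem_nhds (Ico_mem_nhds ?_ ?_) <;>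
            · rw [div_mul_cancel₀ _ ha]; linarith
        · exact subset_closure (by simp [hz1, hz2])
        · simpa [strip] using ht
  obtain ⟨s, hs, h0s, hss⟩ := hcase
  have hl : HasDerivWithinAt (fun t : ℝ => z + t • e) e s 0 := by
    simpa using (((hasDerivAt_id (0 : ℝ)).smul_const e).const_add z).hasDerivWithinAt
  have hu' : HasFDerivWithinAt u u' (strip r) (z + (0 : ℝ) • e) := by simpa using hu
  have h1 := hu'.comp_hasDerivWithinAt (0 : ℝ) hl hss
  have h2 : HasDerivWithinAt (u ∘ fun t : ℝ => z + t • e) 0 s 0 :=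
    (hasDerivWithinAt_const (0 : ℝ) s (0 : ℝ)).congr (fun t ht => h0 t (hss t ht)) (h0 0 (hss 0 h0s))
  exact hs.eq_deriv s h1 h2

/-- The differential of `w ↦ sin (p x / 2 + φ)`. -/
noncomputable def dsin (p : ℕ) (φ : ℝ) (w : ℝ × ℝ) : (ℝ × ℝ) →L[ℝ] ℝ :=
  (p / 2 * Real.cos (p * w.1 / 2 + φ)) • ContinuousLinearMap.fst ℝ ℝ ℝ

theorem dsin_apply (p : ℕ) (φ : ℝ) (w v : ℝ × ℝ) :
    dsin p φ w v = p / 2 * Real.cos (p * w.1 / 2 + φ) * v.1 := rfl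

/-- The differential of a sine is a sine with phase shifted by π/2, times a constant functional. So
`ctl_sin` applies twice and gives the two levels of control that `C11.perturb` needs. -/
theorem exists_ctl_sin (p : ℕ) (φ : ℝ) : ∃ M : ℝ, 0 ≤ M ∧
    Ctl M univ (fun w : ℝ × ℝ => Real.sin (p * w.1 / 2 + φ)) (dsin p φ) ∧
    ∃ d, Ctl M univ (dsin p φ) d := by
  have h1 := ctl_sin p φ (c := 1) zero_le_one (A := (1 : ℝ)) (by simp)
  have h2 := ctl_sin p (φ + Real.pi / 2) (c := p / 2) (by positivity)
    (A := ContinuousLinearMap.fst ℝ ℝ ℝ) (ContinuousLinearMap.norm_fst_le ℝ ℝ ℝ)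
  have e1 : (fun w : ℝ × ℝ => (1 * Real.sin (p * w.1 / 2 + φ)) • (1 : ℝ)) =
      fun w : ℝ × ℝ => Real.sin (p * w.1 / 2 + φ) := by funext w; simp
  have e2 : (fun w : ℝ × ℝ => (1 * (p / 2) * Real.sin (p * w.1 / 2 + (φ + Real.pi / 2))) •
        (ContinuousLinearMap.fst ℝ ℝ ℝ).smulRight (1 : ℝ)) = dsin p φ := by
    funext w
    ext <;> simp [dsin, ← add_assoc, Real.sin_add_pi_div_two]
  have e3 : (fun w : ℝ × ℝ => ((p : ℝ) / 2 * Real.sin (p * w.1 / 2 + (φ + Real.pi / 2))) •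
        ContinuousLinearMap.fst ℝ ℝ ℝ) = dsin p φ := by
    funext w
    simp [dsin, ← add_assoc, Real.sin_add_pi_div_two]
  rw [e1, e2] at h1
  rw [e3] at h2
  refine ⟨max _ _, le_trans ?_ (le_max_left _ _), h1.mono (le_max_left _ _), _,
    h2.mono (le_max_right _ _)⟩
  positivity

theorem strip_subset {r : ℝ} (hr : r ≤ 1) : strip r ⊆ {w : ℝ × ℝ | 0 ≤ w.2 ∧ w.2 ≤ 1} :=
  fun _ hw => ⟨hw.1, (hw.2.trans_le hr).le⟩

variable {p : ℕ} {lam : ℝ}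

/-- At height 1 the second coordinate of the model is `mult`, so its derivative is an entry of the
differential of the model, which is bounded on the closed strip. -/
theorem exists_mult_deriv_bound (hp : 1 ≤ p) (hl : 0 < lam) : ∃ M : ℝ, 0 ≤ M ∧
    ∀ x, HasDerivAt (mult p lam) (deriv (mult p lam) x) x ∧ |deriv (mult p lam) x| ≤ M := by
  obtain ⟨M, hM1, hM, -⟩ := exists_model_bound hp hl
  refine ⟨M, by linarith, fun x => ?_⟩
  have hd : HasDerivAt (mult p lam) (deriv (mult p lam) x) x :=
    ((contDiff_mult p hl 1).differentiable (by norm_num) x).hasDerivAt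
  refine ⟨hd, ?_⟩
  have h1 := ((contDiff_modelLift p hl 1).differentiable (by norm_num) (x, (1 : ℝ))).hasFDerivAt
  have h2 : HasDerivAt (fun t : ℝ => (t, (1 : ℝ))) ((1 : ℝ), (0 : ℝ)) x :=
    (hasDerivAt_id x).prodMk (hasDerivAt_const x 1)
  have h3 := (h1.comp_hasDerivAt x h2)
  have h4 : HasDerivAt (mult p lam) ((fderiv ℝ (modelLift p lam) (x, 1)) (1, 0)).2 x := by
    have := (hasFDerivAt_snd (𝕜 := ℝ) (p := modelLift p lam (x, 1))).comp_hasDerivAt x h3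
    refine this.congr_of_eventuallyEq (Eventually.of_forall fun t => ?_)
    simp [modelLift_eq]
  rw [hd.unique h4]
  have h5 := (fderiv ℝ (modelLift p lam) (x, 1)).le_of_opNorm_le_of_le
    (hM.bound (x, 1) ⟨zero_le_one, le_rfl⟩) (x := ((1 : ℝ), (0 : ℝ))) (b := 1) (by simp [Prod.norm_def])
  rw [mul_one] at h5
  exact (norm_snd_le _).trans h5

/-- One step of a nearly linear map, for the sine of the first coordinate. -/
theorem exists_sin_step (hp : 1 ≤ p) (hl : 1 < lam) {φ : ℝ} {n n₁ : ℝ → ℝ} {n₀ c : ℝ}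
    (hn : ∀ x, Real.sin (p * modelAngle p lam x / 2 + φ) = n x * Real.sin (p * x / 2 + φ))
    (hz : ∀ x, Real.sin (p * x / 2 + φ) = 0 → ∃ j : ℤ, x = Real.pi * j / p)
    (hd : ∀ x, HasDerivAt n (n₁ x) x) (hn₀ : 0 < n₀) (hn0 : ∀ x, n₀ ≤ n x)
    (hc : ∀ x, |n₁ x| ≤ c) :
    ∃ K : ℝ, 0 ≤ K ∧ ∀ (k r : ℝ) (f : ℝ × ℝ → ℝ × ℝ) (f' : ℝ × ℝ → (ℝ × ℝ) →L[ℝ] (ℝ × ℝ)),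
      k ≤ 1 → k * K ≤ n₀ / 2 → 0 < r → r ≤ 1 → NearModel p lam k r f f' → ∀ w ∈ strip r,
        (∃ a, Real.sin (p * (f w).1 / 2 + φ) = a * Real.sin (p * w.1 / 2 + φ) ∧
          |a - n w.1| ≤ k * K) ∧
        (Real.sin (p * w.1 / 2 + φ) ≠ 0 → ∀ v : ℝ × ℝ,
          |p / 2 * Real.cos (p * (f w).1 / 2 + φ) * (f' w v).1 / Real.sin (p * (f w).1 / 2 + φ) -
            p / 2 * Real.cos (p * w.1 / 2 + φ) * v.1 / Real.sin (p * w.1 / 2 + φ) -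
            n₁ w.1 * v.1 / n w.1| ≤ k * K * ‖v‖) := by
  obtain ⟨M, hM1, hM, -⟩ := exists_model_bound hp (zero_lt_one.trans hl)
  obtain ⟨N, hN0, hN, d, hNd⟩ := exists_ctl_sin p φ
  have hM0 : 0 ≤ M := by linarith
  have hp' : (0 : ℝ) < p := by exact_mod_cast hp
  have hπ := Real.pi_pos
  set T := Real.pi / p with hT
  have hT0 : 0 ≤ T := by positivity
  set c1 := 4 * N * (1 + M) ^ 2 with hc1
  have hc10 : 0 ≤ c1 := by positivity
  set c2 := T + 2 * N * T ^ 2 with hc2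
  have hc20 : 0 ≤ c2 := by positivity
  have hcc : 0 ≤ c := (abs_nonneg _).trans (hc 0)
  set c3 := 2 / n₀ + 2 * c / n₀ ^ 2 with hc3
  have hc30 : 0 ≤ c3 := by positivity
  refine ⟨c1 * c2 * (1 + c3), by positivity, fun k r f f' hk1 hkK hr hr1 h w hw => ?_⟩
  have hk := h.pos hr
  have hkc : 0 ≤ k * c1 * c2 := by positivity
  have hle : k * c1 * c2 ≤ k * (c1 * c2 * (1 + c3)) := by nlinarith [mul_nonneg hkc hc30]
  have hpert := C11.perturb hk hM0 hN0 (convex_strip r) convex_univ hN hNd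
    (hM.subset (strip_subset hr1)) h.close (mapsTo_univ _ _) (mapsTo_univ _ _) hk1
  -- The error in the exact relation of the model. It is small of class C^{1,1}, and it vanishes
  -- wherever the sine does, because f preserves the lines; hence it can be divided by the sine.
  set R : ℝ × ℝ → ℝ := fun w => Real.sin (p * (f w).1 / 2 + φ) -
    n w.1 * Real.sin (p * w.1 / 2 + φ) with hR
  have hpert2 := hpert.congr (v := R) fun z _ => by
    simp [hR, modelLift_eq, hn]
  obtain ⟨x₀, hx₀, hx₀w⟩ := exists_zero_near hp φ w.1
  obtain ⟨j, rfl⟩ := hz x₀ hx₀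
  set z : ℝ × ℝ := (Real.pi * j / p, w.2) with hzdef
  have hzs : z ∈ strip r := hw
  have hR0 : ∀ y, 0 ≤ y → y < r → R (Real.pi * j / p, y) = 0 := fun y h0 h1 => by
    simp only [hR, h.lines j y h0 h1, hx₀]; simp
  have hwz : w - z = (w.1 - Real.pi * j / p) • ((1 : ℝ), (0 : ℝ)) := by
    ext <;> simp [hzdef]
  have hdiv := divBound_of_zero (by positivity) hN0 hT0 (convex_strip r) hpert2
    (hN.subset (subset_univ _)) hw hzs (hR0 _ hw.1 hw.2) hx₀ (T := T)
    (by rw [hwz, norm_smul]; simpa [Prod.norm_def] using hx₀w) (by simp [Prod.norm_def]) hwz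
    (fun v => ⟨v.1, (0, v.2), by ext <;> simp, norm_fst_le v, by simp [Prod.norm_def], by
      refine fderiv_eq_zero_of_const (hpert2.deriv z hzs) hzs (Or.inr ⟨_, rfl⟩) fun t ht => ?_
      have e : z + t • ((0 : ℝ), v.2) = (Real.pi * j / p, w.2 + t * v.2) := by
        ext <;> simp [hzdef]
      rw [e] at ht ⊢
      exact hR0 _ ht.1 ht.2, by simp [dsin_apply]⟩)
  rw [← hc1, ← hc2] at hdiv
  constructor
  · rcases eq_or_ne (Real.sin (p * w.1 / 2 + φ)) 0 with h0 | h0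
    · refine ⟨n w.1, ?_, by simp; positivity⟩
      have := hdiv.1
      rw [h0, abs_zero, mul_zero] at this
      have h2 := abs_nonpos_iff.1 this
      simp only [hR, h0] at h2 ⊢
      linarith
    · refine ⟨Real.sin (p * (f w).1 / 2 + φ) / Real.sin (p * w.1 / 2 + φ), (div_mul_cancel₀ _ h0).symm, ?_⟩
      have e : Real.sin (p * (f w).1 / 2 + φ) / Real.sin (p * w.1 / 2 + φ) - n w.1 =
        R w / Real.sin (p * w.1 / 2 + φ) := by
        simp only [hR]; rw [sub_div, mul_div_cancel_right₀ _ h0]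
      rw [e, abs_div, div_le_iff₀ (abs_pos.2 h0)]
      exact hdiv.1.trans (mul_le_mul_of_nonneg_right hle (abs_nonneg _))
  · intro h0 v
    have hF := ((contDiff_modelLift p (zero_lt_one.trans hl) 1).differentiable (by norm_num)
      w).hasFDerivAt
    -- The differential of the exact relation `hn`, which is the main term of the logarithmic
    -- derivative.
    have hid : (dsin p φ (modelLift p lam w)).comp (fderiv ℝ (modelLift p lam) w) =
        Real.sin (p * w.1 / 2 + φ) • (n₁ w.1 • ContinuousLinearMap.fst ℝ ℝ ℝ) +
          n w.1 • dsin p φ w := by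
      have a1 := (hasFDerivWithinAt_univ.1 (hN.deriv (modelLift p lam w) (mem_univ _))).comp w hF
      have a2 := ((hd w.1).comp_hasFDerivAt w (hasFDerivAt_fst (𝕜 := ℝ))).mul
        (hasFDerivWithinAt_univ.1 (hN.deriv w (mem_univ _)))
      have e : (fun w : ℝ × ℝ => Real.sin (p * w.1 / 2 + φ)) ∘ modelLift p lam =
          (n ∘ Prod.fst) * fun w : ℝ × ℝ => Real.sin (p * w.1 / 2 + φ) := by
        funext z; simp [modelLift_eq, hn]
      rw [e] at a1
      rw [a1.unique a2]
      simp [add_comm]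
    have key := hdiv.log_deriv hkc h0 hn₀ (hn0 w.1)
      (n' := n₁ w.1 • ContinuousLinearMap.fst ℝ ℝ ℝ) (c := c)
      (N := Real.sin (p * (f w).1 / 2 + φ)) (dN := (dsin p φ (f w)).comp (f' w))
      (by
        rw [norm_smul]
        refine (mul_le_mul_of_nonneg_left (ContinuousLinearMap.norm_fst_le ℝ ℝ ℝ)
          (norm_nonneg _)).trans ?_
        rw [mul_one]; exact hc w.1)
      (by nlinarith) (by simp [hR])
      (fun v => by
        have := congrArg (fun L => L v) hid
        simp only [add_sub_cancel, sub_apply, add_apply, smul_apply,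
          smul_eq_mul] at this ⊢
        linarith) v
    have e : k * c1 * c2 * (2 / n₀ + 2 * c / n₀ ^ 2) * ‖v‖ ≤ k * (c1 * c2 * (1 + c3)) * ‖v‖ := by
      rw [← hc3]
      refine mul_le_mul_of_nonneg_right ?_ (norm_nonneg _)
      nlinarith
    refine le_trans (le_of_eq ?_) (key.trans e)
    simp [dsin_apply]

/-! ### Maps that are nearly linear in the coordinates y cos(px/2) and y sin(px/2). -/

/-- The cosine of the rescaled angle `p x / 2`; it vanishes on the odd lines. -/
noncomputable def co (p : ℕ) (w : ℝ × ℝ) : ℝ := Real.cos (p * w.1 / 2)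

/-- The sine of the rescaled angle `p x / 2`; it vanishes on the even lines. -/
noncomputable def si (p : ℕ) (w : ℝ × ℝ) : ℝ := Real.sin (p * w.1 / 2)

/-- The differential of `log (y cos (p x / 2))`. -/
noncomputable def dP (p : ℕ) (w v : ℝ × ℝ) : ℝ := v.2 / w.2 - p / 2 * (si p w / co p w) * v.1

/-- The differential of `log (y sin (p x / 2))`. -/
noncomputable def dQ (p : ℕ) (w v : ℝ × ℝ) : ℝ := v.2 / w.2 + p / 2 * (co p w / si p w) * v.1

/-- In the coordinates `y cos (p x / 2)` and `y sin (p x / 2)` the map `f` is close to a diagonal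
linear map that contracts the first coordinate and expands the second one. -/
structure NearLinear (p : ℕ) (μ Λ κ r : ℝ) (f : ℝ × ℝ → ℝ × ℝ)
    (f' : ℝ × ℝ → (ℝ × ℝ) →L[ℝ] (ℝ × ℝ)) : Prop where
  step : ∀ w ∈ strip r, ∃ a c s : ℝ, 0 < a ∧ 0 < c ∧ 0 < s ∧ (f w).2 = a * w.2 ∧
    co p (f w) = c * co p w ∧ si p (f w) = s * si p w ∧ a * c ≤ μ ∧ 1 ≤ μ * (a * s) ∧ a * s ≤ Λ ∧
    c ≤ μ * s
  logd : ∀ w ∈ strip r, 0 < w.2 → co p w ≠ 0 → si p w ≠ 0 → ∀ v : ℝ × ℝ,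
    |dP p (f w) (f' w v) - dP p w v| ≤ κ * ‖v‖ ∧ |dQ p (f w) (f' w v) - dQ p w v| ≤ κ * ‖v‖

variable {p : ℕ} {lam : ℝ}

theorem sin_zero_line (hp : 1 ≤ p) (x : ℝ) (h : Real.sin (p * x / 2) = 0) :
    ∃ i : ℤ, x = Real.pi * (2 * i : ℤ) / p := by
  have hp' : (0 : ℝ) < p := by exact_mod_cast hp
  obtain ⟨i, hi⟩ := Real.sin_eq_zero_iff.1 h
  exact ⟨i, by push_cast; field_simp at hi ⊢; linarith⟩

theorem cos_zero_line (hp : 1 ≤ p) (x : ℝ) (h : Real.cos (p * x / 2) = 0) :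
    ∃ i : ℤ, x = Real.pi * (2 * i + 1 : ℤ) / p := by
  have hp' : (0 : ℝ) < p := by exact_mod_cast hp
  obtain ⟨i, hi⟩ := Real.cos_eq_zero_iff.1 h
  exact ⟨i, by push_cast; field_simp at hi ⊢; linarith⟩

/-- The division argument of `exists_sin_step` with the height in place of the sine. The error
vanishes on the boundary, because f preserves it, and the nearby zero is the vertical projection. -/
theorem exists_height_step (hp : 1 ≤ p) (hl : 1 < lam) :
    ∃ K : ℝ, 0 ≤ K ∧ ∀ (k r : ℝ) (f : ℝ × ℝ → ℝ × ℝ) (f' : ℝ × ℝ → (ℝ × ℝ) →L[ℝ] (ℝ × ℝ)),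
      k * K ≤ 1 / lam / 2 → 0 < r → r ≤ 1 → NearModel p lam k r f f' → ∀ w ∈ strip r,
        (∃ a, (f w).2 = a * w.2 ∧ |a - mult p lam w.1| ≤ k * K) ∧
        (0 < w.2 → ∀ v : ℝ × ℝ,
          |(f' w v).2 / (f w).2 - v.2 / w.2 - deriv (mult p lam) w.1 * v.1 / mult p lam w.1| ≤
            k * K * ‖v‖) := by
  have hl0 : 0 < lam := zero_lt_one.trans hl
  obtain ⟨c, hc0, hc⟩ := exists_mult_deriv_bound hp hl0
  set n₀ : ℝ := 1 / lam with hn₀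
  have hn₀p : 0 < n₀ := by positivity
  set c3 := 2 / n₀ + 2 * c / n₀ ^ 2 with hc3
  have hc30 : 0 ≤ c3 := by positivity
  refine ⟨3 * (1 + c3), by positivity, fun k r f f' hkK hr hr1 h w hw => ?_⟩
  have hk := h.pos hr
  have h3 := mul_nonneg hk hc30
  set R : ℝ × ℝ → ℝ := fun w => (f w).2 - mult p lam w.1 * w.2 with hR
  have hRc := (h.close.clm (ContinuousLinearMap.snd ℝ ℝ ℝ)
    (ContinuousLinearMap.norm_snd_le ℝ ℝ ℝ)).congr (v := R) fun z _ => by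
      simp [hR, modelLift_eq, mul_comm]
  have hb := (Ctl.id (D := strip r)).clm (ContinuousLinearMap.snd ℝ ℝ ℝ)
    (ContinuousLinearMap.norm_snd_le ℝ ℝ ℝ)
  set z : ℝ × ℝ := (w.1, 0) with hzdef
  have hz : z ∈ strip r := ⟨le_rfl, hr⟩
  have hwz : w - z = w.2 • ((0 : ℝ), (1 : ℝ)) := by ext <;> simp [hzdef]
  have hR0 : ∀ x, R (x, 0) = 0 := fun x => by simp [hR, h.bdry]
  have hdiv := divBound_of_zero hk zero_le_one zero_le_one (convex_strip r) hRc hb hw hz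
    (hR0 _) rfl (by rw [hwz, norm_smul]; simp [Prod.norm_def]) (by simp [Prod.norm_def]) hwz
    (fun v => ⟨v.2, (v.1, 0), by ext <;> simp, norm_snd_le v, by simp [Prod.norm_def], by
      refine fderiv_eq_zero_of_const (hRc.deriv z hz) hz (Or.inl ⟨_, rfl⟩) fun t ht => ?_
      have e : z + t • (v.1, (0 : ℝ)) = (w.1 + t * v.1, 0) := by
        ext <;> simp [hzdef]
      rw [e]
      exact hR0 _, by simp⟩)
  -- With B = T = 1 the constant T + 2BT² equals 3.
  norm_num at hdiv
  constructor
  · rcases hw.1.eq_or_lt with h0 | h0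
    · refine ⟨mult p lam w.1, ?_, by simp; positivity⟩
      have : w = (w.1, 0) := by ext <;> simp [← h0]
      rw [this, h.bdry]; simp
    · refine ⟨(f w).2 / w.2, (div_mul_cancel₀ _ h0.ne').symm, ?_⟩
      have e : (f w).2 / w.2 - mult p lam w.1 = R w / w.2 := by
        simp only [hR]; rw [sub_div, mul_div_cancel_right₀ _ h0.ne']
      rw [e, abs_div, div_le_iff₀ (abs_pos.2 h0.ne')]
      exact hdiv.1.trans (mul_le_mul_of_nonneg_right (by nlinarith) (abs_nonneg _))
  · intro h0 v
    have hd := (hc w.1).1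
    have hF := ((contDiff_modelLift p hl0 1).differentiable (by norm_num) w).hasFDerivAt
    have hid : (ContinuousLinearMap.snd ℝ ℝ ℝ).comp (fderiv ℝ (modelLift p lam) w) =
        w.2 • (deriv (mult p lam) w.1 • ContinuousLinearMap.fst ℝ ℝ ℝ) +
          mult p lam w.1 • ContinuousLinearMap.snd ℝ ℝ ℝ := by
      have a1 := (hasFDerivAt_snd (𝕜 := ℝ) (p := modelLift p lam w)).comp w hF
      have a2 := (hasFDerivAt_snd (𝕜 := ℝ) (p := w)).mul
        (hd.comp_hasFDerivAt w (hasFDerivAt_fst (𝕜 := ℝ)))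
      have e : Prod.snd ∘ modelLift p lam =
          (fun w : ℝ × ℝ => w.2) * (mult p lam ∘ Prod.fst) := by
        funext z; simp [modelLift_eq]
      rw [e] at a1
      rw [a1.unique a2]
      simp
    have key := hdiv.log_deriv (by positivity) h0.ne' hn₀p (inv_le_mult p hl w.1)
      (n' := deriv (mult p lam) w.1 • ContinuousLinearMap.fst ℝ ℝ ℝ) (c := c)
      (N := (f w).2) (dN := (ContinuousLinearMap.snd ℝ ℝ ℝ).comp (f' w))
      (by
        rw [norm_smul]
        refine (mul_le_mul_of_nonneg_left (ContinuousLinearMap.norm_fst_le ℝ ℝ ℝ)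
          (norm_nonneg _)).trans ?_
        rw [mul_one]; exact (hc w.1).2)
      (by nlinarith) (by simp [hR])
      (fun v => by
        have := congrArg (fun L => L v) hid
        simp only [ContinuousLinearMap.coe_comp, Function.comp_apply, add_apply,
          smul_apply, smul_eq_mul, sub_apply, ContinuousLinearMap.coe_snd',
          ContinuousLinearMap.coe_fst'] at this ⊢
        linarith) v
    refine le_trans (le_of_eq ?_) (key.trans ?_)
    · simp
    · rw [← hc3]
      refine mul_le_mul_of_nonneg_right ?_ (norm_nonneg _)
      nlinarith

/-- The factors a, c, s of height, cosine and sine are η-close to m, 1/(λm) and λ/m. The products ac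
and as are then close to 1/λ and λ, because m cancels, while c/s is close to 1/λ². The hypotheses
`g1` to `g6` only say how small η must be. -/
theorem step_bounds {η m a c s : ℝ} (hl : 1 < lam) (hη : 0 ≤ η) (m0 : 0 < m) (m1 : 1 / lam ≤ m)
    (m2 : m ≤ lam) (g1 : η ≤ 1 / 2) (g2 : η ≤ 1 / lam ^ 2 / 2) (g3 : η ≤ 1 / lam / 2)
    (g4 : η * (2 + lam) ≤ (1 - 1 / lam) / 2) (g5 : η * (lam ^ 2 + 2 + lam) ≤ (lam - 1) / 2)
    (g6 : η * (1 + lam) ≤ (lam - 1) / lam) (ha : -η ≤ a - m ∧ a - m ≤ η)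
    (hc : -η ≤ c - 1 / (lam * m) ∧ c - 1 / (lam * m) ≤ η)
    (hs : -η ≤ s - lam / m ∧ s - lam / m ≤ η) :
    0 < a ∧ 0 < c ∧ 0 < s ∧ a * c ≤ (1 + 1 / lam) / 2 ∧ 1 ≤ (1 + 1 / lam) / 2 * (a * s) ∧
      a * s ≤ 2 * lam ∧ c ≤ (1 + 1 / lam) / 2 * s := by
  have hl0 : 0 < lam := zero_lt_one.trans hl
  obtain ⟨ha1, ha2⟩ := ha
  obtain ⟨hc1, hc2⟩ := hc
  obtain ⟨hs1, hs2⟩ := hs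
  have u1 : 1 / lam ^ 2 ≤ 1 / (lam * m) := by
    rw [pow_two]; gcongr
  have u2 : 1 / (lam * m) ≤ 1 := by
    rw [div_le_one (by positivity)]
    rw [div_le_iff₀ hl0] at m1; linarith
  have s1 : 1 ≤ lam / m := by rw [le_div_iff₀ m0]; linarith
  have s2 : lam / m = lam ^ 2 * (1 / (lam * m)) := by field_simp
  have s3 : lam / m ≤ lam ^ 2 := by rw [s2]; exact mul_le_of_le_one_right (sq_nonneg _) u2
  have e1 : m * (1 / (lam * m)) = 1 / lam := by field_simp
  have e2 : m * (lam / m) = lam := by field_simp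
  have n2 : 0 < 1 / lam ^ 2 := by positivity
  have n1 : 0 < 1 / lam := by positivity
  have hlinv : 1 / lam < 1 := by rw [div_lt_one hl0]; exact hl
  -- The constant μ = (1 + 1/λ)/2 lies between 1/λ and 1, and its inverse is at most (λ + 1)/2,
  -- which leaves room for errors in as, which is close to λ.
  have hμ : 1 ≤ (1 + 1 / lam) / 2 * ((lam + 1) / 2) := by
    have : (1 + 1 / lam) / 2 * ((lam + 1) / 2) - 1 = (lam - 1) ^ 2 / (4 * lam) := by
      field_simp; ring
    have : 0 ≤ (lam - 1) ^ 2 / (4 * lam) := by positivity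
    linarith
  have q2 : lam * (lam - 1) * (1 / lam ^ 2) = (lam - 1) / lam := by field_simp
  generalize 1 / (lam * m) = u at *
  generalize lam / m = s₀ at *
  have a0 : 0 < a := by linarith
  have c0 : 0 < c := by linarith
  have s0 : 0 < s := by linarith
  have hηu : η * u ≤ η * 1 := by gcongr
  have hηm : η * m ≤ η * lam := by gcongr
  have hηs : η * s₀ ≤ η * lam ^ 2 := by gcongr
  have hηη : η * η ≤ η * (1 / 2) := by gcongr
  have hac : a * c ≤ (1 + 1 / lam) / 2 := by
    have : a * c ≤ (m + η) * (u + η) := by gcongr <;> linarith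
    linarith
  have has : a * s ≤ 2 * lam := by
    have : a * s ≤ (m + η) * (s₀ + η) := by gcongr <;> linarith
    linarith
  have has2 : lam - η * (lam ^ 2 + 2 + lam) ≤ a * s := by
    have : (m - η) * (s₀ - η) ≤ a * s := by
      have : 0 ≤ s₀ - η := by linarith
      gcongr <;> linarith
    have := mul_nonneg hη hη
    linarith
  refine ⟨a0, c0, s0, hac, ?_, has, ?_⟩
  · refine hμ.trans ?_
    have : (lam + 1) / 2 ≤ a * s := by linarith
    gcongr
  · have h5 : c ≤ 1 / lam * s := by
      rw [div_mul_eq_mul_div, one_mul, le_div_iff₀ hl0]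
      have q1 : c * lam ≤ (u + η) * lam := by gcongr; linarith
      have q3 : lam * (lam - 1) * (1 / lam ^ 2) ≤ lam * (lam - 1) * u := by
        have : 0 ≤ lam * (lam - 1) := mul_nonneg hl0.le (by linarith)
        gcongr
      rw [q2] at q3
      linarith
    exact h5.trans (mul_le_mul_of_nonneg_right (by linarith) s0.le)

/-- For the model log X and log Y change by constants, so dP and dQ are preserved exactly. The
perturbation is estimated by adding the logarithmic differentials of height, sine and cosine. -/
theorem exists_nearLinear (hp : 1 ≤ p) (hl : 1 < lam) {κ : ℝ} (hκ : 0 < κ) :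
    ∃ k₀ : ℝ, 0 < k₀ ∧ ∀ (k r : ℝ) (f : ℝ × ℝ → ℝ × ℝ) (f' : ℝ × ℝ → (ℝ × ℝ) →L[ℝ] (ℝ × ℝ)),
      k ≤ k₀ → 0 < r → r ≤ 1 → NearModel p lam k r f f' →
        NearLinear p ((1 + 1 / lam) / 2) (2 * lam) κ r f f' := by
  have hl0 : 0 < lam := zero_lt_one.trans hl
  obtain ⟨c, hc0, hc⟩ := exists_mult_deriv_bound hp hl0
  obtain ⟨K₁, hK₁, h1⟩ := exists_height_step hp hl
  have mpos := mult_pos p hl0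
  have ml := mult_le p hl
  have mi := inv_le_mult p hl
  -- Phase 0 gives the sine, with factor λ/mult ≥ 1; phase π/2 below gives the cosine, with factor
  -- 1/(λ mult) ≥ 1/λ².
  have hS := exists_sin_step hp hl (φ := 0) (n := fun x => lam / mult p lam x)
    (n₁ := fun x => lam * -(deriv (mult p lam) x) / mult p lam x ^ 2) (n₀ := 1) (c := lam ^ 3 * c)
    (fun x => by
      simp only [add_zero]; rw [sin_modelAngle hp hl0]; ring)
    (fun x hx => by
      rw [add_zero] at hx
      obtain ⟨i, hi⟩ := sin_zero_line hp x hx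
      exact ⟨2 * i, by exact_mod_cast hi⟩)
    (fun x => by
      have := ((hc x).1.inv (mpos x).ne').const_mul lam
      simp only [div_eq_mul_inv, mul_assoc] at this ⊢
      exact this) one_pos
    (fun x => by rw [le_div_iff₀ (mpos x), one_mul]; exact ml x)
    (fun x => by
      rw [abs_div, abs_mul, abs_neg, abs_of_pos hl0, abs_of_pos (pow_pos (mpos x) 2),
        div_le_iff₀ (pow_pos (mpos x) 2)]
      have e : lam * c = lam ^ 3 * c * (1 / lam) ^ 2 := by field_simp
      calc _ ≤ lam * c := by gcongr; exact (hc x).2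
        _ = _ := e
        _ ≤ _ := by gcongr; exact mi x)
  have hC := exists_sin_step hp hl (φ := Real.pi / 2) (n := fun x => 1 / (lam * mult p lam x))
    (n₁ := fun x => lam⁻¹ * -(deriv (mult p lam) x) / mult p lam x ^ 2) (n₀ := 1 / lam ^ 2)
    (c := lam * c)
    (fun x => by
      simp only [Real.sin_add_pi_div_two]; rw [cos_modelAngle hp hl0]; ring)
    (fun x hx => by
      rw [Real.sin_add_pi_div_two] at hx
      obtain ⟨i, hi⟩ := cos_zero_line hp x hx
      exact ⟨2 * i + 1, by exact_mod_cast hi⟩)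
    (fun x => by
      have := ((hc x).1.inv (mpos x).ne').const_mul lam⁻¹
      simp only [div_eq_mul_inv, mul_assoc, mul_inv, one_mul] at this ⊢
      exact this) (by positivity)
    (fun x => by
      rw [pow_two]
      have := mpos x
      have := ml x
      gcongr)
    (fun x => by
      rw [abs_div, abs_mul, abs_neg, abs_of_pos (inv_pos.2 hl0), abs_of_pos (pow_pos (mpos x) 2),
        div_le_iff₀ (pow_pos (mpos x) 2)]
      have e : lam⁻¹ * c = lam * c * (1 / lam) ^ 2 := by field_simp
      calc _ ≤ lam⁻¹ * c := by gcongr; exact (hc x).2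
        _ = _ := e
        _ ≤ _ := by gcongr; exact mi x)
  obtain ⟨K₂, hK₂, h2⟩ := hS
  obtain ⟨K₃, hK₃, h3⟩ := hC
  simp only [add_zero, Real.sin_add_pi_div_two, Real.cos_add_pi_div_two] at h2 h3
  obtain ⟨η, hη0, hη⟩ : ∃ η : ℝ, 0 < η ∧ (η ≤ 1 / 2 ∧ η ≤ 1 / lam ^ 2 / 2 ∧ η ≤ 1 / lam / 2 ∧
      η * (2 + lam) ≤ (1 - 1 / lam) / 2 ∧ η * (lam ^ 2 + 2 + lam) ≤ (lam - 1) / 2 ∧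
      η * (1 + lam) ≤ (lam - 1) / lam ∧ η ≤ κ / 2) := by
    have ev : ∀ᶠ η : ℝ in 𝓝[>] 0, (η ≤ 1 / 2 ∧ η ≤ 1 / lam ^ 2 / 2 ∧ η ≤ 1 / lam / 2 ∧
      η * (2 + lam) ≤ (1 - 1 / lam) / 2 ∧ η * (lam ^ 2 + 2 + lam) ≤ (lam - 1) / 2 ∧
      η * (1 + lam) ≤ (lam - 1) / lam ∧ η ≤ κ / 2) := by
      have gen : ∀ A B : ℝ, 0 < B → ∀ᶠ η : ℝ in 𝓝[>] 0, η * A ≤ B := fun A B hB => by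
        have : Tendsto (fun η : ℝ => η * A) (𝓝[>] 0) (𝓝 (0 * A)) :=
          ((continuous_id.mul continuous_const).tendsto 0).mono_left nhdsWithin_le_nhds
        rw [zero_mul] at this
        exact this.eventually_le_const hB
      have gen' : ∀ B : ℝ, 0 < B → ∀ᶠ η : ℝ in 𝓝[>] 0, η ≤ B := fun B hB => by
        simpa using gen 1 B hB
      have i1 : 0 < 1 - 1 / lam := by rw [sub_pos, div_lt_one hl0]; exact hl
      have i2 : 0 < lam - 1 := by linarith
      filter_upwards [gen' (1 / 2) (by norm_num), gen' (1 / lam ^ 2 / 2) (by positivity),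
        gen' (1 / lam / 2) (by positivity), gen _ _ (half_pos i1), gen _ _ (half_pos i2),
        gen _ ((lam - 1) / lam) (by positivity), gen' (κ / 2) (by positivity)] with
        η e1 e2 e3 e4 e5 e6 e7 using ⟨e1, e2, e3, e4, e5, e6, e7⟩
    obtain ⟨η, h, h'⟩ := (ev.and self_mem_nhdsWithin).exists
    exact ⟨η, h', h⟩
  obtain ⟨g1, g2, g3, g4, g5, g6, g7⟩ := hη
  set K := K₁ + K₂ + K₃ + 1 with hK
  have hKp : 0 < K := by positivity
  refine ⟨min 1 (η / K), by positivity, fun k r f f' hk hr hr1 h => ?_⟩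
  have hk0 := h.pos hr
  have hk1 : k ≤ 1 := hk.trans (min_le_left _ _)
  have hkK : k * K ≤ η := (le_div_iff₀ hKp).1 (hk.trans (min_le_right _ _))
  have b1 : k * K₁ ≤ η := (mul_le_mul_of_nonneg_left (by linarith) hk0).trans hkK
  have b2 : k * K₂ ≤ η := (mul_le_mul_of_nonneg_left (by linarith) hk0).trans hkK
  have b3 : k * K₃ ≤ η := (mul_le_mul_of_nonneg_left (by linarith) hk0).trans hkK
  replace h1 := h1 k r f f' (by linarith) hr hr1 h
  replace h2 := h2 k r f f' hk1 (by linarith) hr hr1 h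
  replace h3 := h3 k r f f' hk1 (by linarith) hr hr1 h
  refine ⟨fun w hw => ?_, fun w hw hy hco hsi v => ?_⟩
  · obtain ⟨a, ha1, ha2⟩ := (h1 w hw).1
    obtain ⟨s, hs1, hs2⟩ := (h2 w hw).1
    obtain ⟨c', hc1, hc2⟩ := (h3 w hw).1
    have m0 := mpos w.1
    have m1 := mi w.1
    have m2 := ml w.1
    set m := mult p lam w.1
    obtain ⟨a0, c0, s0, q1, q2, q3, q4⟩ := step_bounds hl hη0.le m0 m1 m2 g1 g2 g3 g4 g5 g6
      (abs_le.1 (ha2.trans b1)) (abs_le.1 (hc2.trans b3)) (abs_le.1 (hs2.trans b2))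
    exact ⟨a, c', s, a0, c0, s0, ha1, hc1, hs1, q1, q2, q3, q4⟩
  · have hA := (h1 w hw).2 hy v
    have hB := (h2 w hw).2 hsi v
    have hD := (h3 w hw).2 hco v
    have hm := (mpos w.1).ne'
    have n0 := norm_nonneg v
    set m := mult p lam w.1
    set m₁ := deriv (mult p lam) w.1
    -- The logarithmic derivative of `mult` enters the height with one sign and the sine and cosine
    -- with the other. It cancels in dP and dQ, so only small errors remain.
    have e1 : lam * -m₁ / m ^ 2 * v.1 / (lam / m) = -(m₁ * v.1 / m) := by field_simp
    have e2 : lam⁻¹ * -m₁ / m ^ 2 * v.1 / (1 / (lam * m)) = -(m₁ * v.1 / m) := by field_simp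
    rw [e1] at hB
    rw [e2] at hD
    have hkv1 := mul_le_mul_of_nonneg_right b1 n0
    have hkv2 := mul_le_mul_of_nonneg_right b2 n0
    have hkv3 := mul_le_mul_of_nonneg_right b3 n0
    have hkv4 := mul_le_mul_of_nonneg_right g7 n0
    simp only [dP, dQ, co, si]
    constructor
    · calc _ = |((f' w v).2 / (f w).2 - v.2 / w.2 - m₁ * v.1 / m) +
            (p / 2 * -Real.sin (p * (f w).1 / 2) * (f' w v).1 / Real.cos (p * (f w).1 / 2) -
            p / 2 * -Real.sin (p * w.1 / 2) * v.1 / Real.cos (p * w.1 / 2) -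
            -(m₁ * v.1 / m))| := by congr 1; ring
        _ ≤ k * K₁ * ‖v‖ + k * K₃ * ‖v‖ := (abs_add_le _ _).trans (add_le_add hA hD)
        _ ≤ _ := by linarith
    · calc _ = |((f' w v).2 / (f w).2 - v.2 / w.2 - m₁ * v.1 / m) +
            (p / 2 * Real.cos (p * (f w).1 / 2) * (f' w v).1 / Real.sin (p * (f w).1 / 2) -
            p / 2 * Real.cos (p * w.1 / 2) * v.1 / Real.sin (p * w.1 / 2) -
            -(m₁ * v.1 / m))| := by congr 1; ring
        _ ≤ k * K₁ * ‖v‖ + k * K₂ * ‖v‖ := (abs_add_le _ _).trans (add_le_add hA hB)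
        _ ≤ _ := by linarith

/-! ### Bounded distortion along orbits of nearly linear maps. -/

variable {p : ℕ} {μ Λ κ r : ℝ} {f : ℝ × ℝ → ℝ × ℝ} {f' : ℝ × ℝ → (ℝ × ℝ) →L[ℝ] (ℝ × ℝ)}

theorem si_sq_add_co_sq (p : ℕ) (w : ℝ × ℝ) : si p w ^ 2 + co p w ^ 2 = 1 :=
  Real.sin_sq_add_cos_sq _

theorem abs_si_le (p : ℕ) (w : ℝ × ℝ) : |si p w| ≤ 1 := Real.abs_sin_le_one _

theorem abs_co_le (p : ℕ) (w : ℝ × ℝ) : |co p w| ≤ 1 := Real.abs_cos_le_one _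

theorem one_le_abs_si_add (p : ℕ) (w : ℝ × ℝ) : 1 ≤ |si p w| + |co p w| := by
  have h := si_sq_add_co_sq p w
  rw [← sq_abs (si p w), ← sq_abs (co p w)] at h
  nlinarith [abs_si_le p w, abs_co_le p w, abs_nonneg (si p w), abs_nonneg (co p w)]

/-- Solving for the tangent vector in terms of dP and dQ, by sin² + cos² = 1. The factor sin · cos
is essential: near a line, bounded logarithmic differentials allow only a small horizontal
component. -/
theorem fst_eq_dP (hp : 1 ≤ p) {w : ℝ × ℝ} (hc : co p w ≠ 0) (hs : si p w ≠ 0) (v : ℝ × ℝ) :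
    v.1 = 2 / p * (si p w * co p w) * (dQ p w v - dP p w v) := by
  have hp' : (0 : ℝ) < p := by exact_mod_cast hp
  have h := si_sq_add_co_sq p w
  simp only [dP, dQ]
  generalize si p w = s at *
  generalize co p w = c at *
  have e : 2 / (p : ℝ) * (s * c) * (v.2 / w.2 + p / 2 * (c / s) * v.1 -
      (v.2 / w.2 - p / 2 * (s / c) * v.1)) = (s ^ 2 + c ^ 2) * v.1 := by
    field_simp
    ring
  rw [e, h, one_mul]

theorem snd_eq_dP {w : ℝ × ℝ} (hy : w.2 ≠ 0) (hc : co p w ≠ 0) (hs : si p w ≠ 0) (v : ℝ × ℝ) :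
    v.2 = w.2 * (co p w ^ 2 * dP p w v + si p w ^ 2 * dQ p w v) := by
  have h := si_sq_add_co_sq p w
  simp only [dP, dQ]
  generalize si p w = s at *
  generalize co p w = c at *
  have e : w.2 * (c ^ 2 * (v.2 / w.2 - p / 2 * (s / c) * v.1) +
      s ^ 2 * (v.2 / w.2 + p / 2 * (c / s) * v.1)) = (s ^ 2 + c ^ 2) * v.2 := by
    field_simp
    ring
  rw [e, h, one_mul]

/-- The factor y + |sin cos| is small near the fixed points, where long orbits spend most of their
time. It is the quantity that `NearLinear.pot_le` makes summable along orbits. -/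
theorem norm_le_dP (hp : 1 ≤ p) {w : ℝ × ℝ} (hy : 0 < w.2) (hc : co p w ≠ 0) (hs : si p w ≠ 0)
    (v : ℝ × ℝ) :
    ‖v‖ ≤ 2 * (w.2 + |si p w| * |co p w|) * (|dP p w v| + |dQ p w v|) := by
  have hp' : (1 : ℝ) ≤ p := by exact_mod_cast hp
  have hN : 0 ≤ |dP p w v| + |dQ p w v| := by positivity
  have hsc : 0 ≤ |si p w| * |co p w| := by positivity
  rw [Prod.norm_def]
  refine max_le ?_ ?_
  · rw [Real.norm_eq_abs, fst_eq_dP hp hc hs v, abs_mul, abs_mul, abs_mul,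
      abs_of_nonneg (by positivity : (0 : ℝ) ≤ 2 / p)]
    have h1 : 2 / (p : ℝ) ≤ 2 := div_le_self (by norm_num) hp'
    have h2 : |dQ p w v - dP p w v| ≤ |dP p w v| + |dQ p w v| := by
      rw [add_comm]; exact abs_sub _ _
    calc _ ≤ 2 * (|si p w| * |co p w|) * (|dP p w v| + |dQ p w v|) := by gcongr
      _ ≤ _ := by gcongr; linarith
  · rw [Real.norm_eq_abs, snd_eq_dP hy.ne' hc hs v, abs_mul, abs_of_pos hy]
    have h1 : co p w ^ 2 ≤ 1 := by nlinarith [si_sq_add_co_sq p w, sq_nonneg (si p w)]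
    have h2 : si p w ^ 2 ≤ 1 := by nlinarith [si_sq_add_co_sq p w, sq_nonneg (co p w)]
    have h3 : |co p w ^ 2 * dP p w v + si p w ^ 2 * dQ p w v| ≤ |dP p w v| + |dQ p w v| := by
      refine (abs_add_le _ _).trans ?_
      rw [abs_mul, abs_mul, abs_of_nonneg (sq_nonneg (co p w)), abs_of_nonneg (sq_nonneg (si p w))]
      exact add_le_add (mul_le_of_le_one_left (abs_nonneg _) h1)
        (mul_le_of_le_one_left (abs_nonneg _) h2)
    calc _ ≤ w.2 * (|dP p w v| + |dQ p w v|) := by gcongr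
      _ ≤ _ := by nlinarith

/-- A function that increases along the orbits of a nearly linear map. -/
noncomputable def pot (p : ℕ) (w : ℝ × ℝ) : ℝ :=
  |w.2 * si p w| - |w.2 * co p w| + |si p w| / (|si p w| + |co p w|)

/-- The potential takes values between −1 and 2 at heights at most 1; the 3 reappears in the
smallness condition on κ. -/
theorem pot_sub_le {w z : ℝ × ℝ} (hw : |w.2| ≤ 1) (hz : |z.2| ≤ 1) : pot p z - pot p w ≤ 3 := by
  have key : ∀ w : ℝ × ℝ, |w.2| ≤ 1 → -1 ≤ pot p w ∧ pot p w ≤ 2 := by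
    intro w hw
    have h0 := one_le_abs_si_add p w
    have h1 : |si p w| / (|si p w| + |co p w|) ≤ 1 := by
      rw [div_le_one (by linarith)]; linarith [abs_nonneg (co p w)]
    have h2 : 0 ≤ |si p w| / (|si p w| + |co p w|) := by positivity
    have h3 : |w.2 * si p w| ≤ 1 := by
      rw [abs_mul]; exact mul_le_one₀ hw (abs_nonneg _) (abs_si_le p w)
    have h4 : |w.2 * co p w| ≤ 1 := by
      rw [abs_mul]; exact mul_le_one₀ hw (abs_nonneg _) (abs_co_le p w)
    have := abs_nonneg (w.2 * si p w)
    have := abs_nonneg (w.2 * co p w)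
    unfold pot
    constructor <;> linarith
  linarith [(key w hw).1, (key z hz).2]

namespace NearLinear

theorem abs_x_le (h : NearLinear p μ Λ κ r f f') {w : ℝ × ℝ} (hw : w ∈ strip r) :
    |(f w).2 * co p (f w)| ≤ μ * |w.2 * co p w| := by
  obtain ⟨a, c, s, a0, c0, s0, e1, e2, e3, h1, -, -, -⟩ := h.step w hw
  rw [e1, e2, show a * w.2 * (c * co p w) = a * c * (w.2 * co p w) by ring, abs_mul,
    abs_of_pos (mul_pos a0 c0)]
  gcongr

theorem le_abs_y (h : NearLinear p μ Λ κ r f f') {w : ℝ × ℝ} (hw : w ∈ strip r) :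
    |w.2 * si p w| ≤ μ * |(f w).2 * si p (f w)| := by
  obtain ⟨a, c, s, a0, c0, s0, e1, e2, e3, -, h1, -, -⟩ := h.step w hw
  rw [e1, e3, show a * w.2 * (s * si p w) = a * s * (w.2 * si p w) by ring, abs_mul (a * s),
    abs_of_pos (mul_pos a0 s0), ← mul_assoc]
  exact le_mul_of_one_le_left (abs_nonneg _) h1

theorem abs_y_le (h : NearLinear p μ Λ κ r f f') {w : ℝ × ℝ} (hw : w ∈ strip r) :
    |(f w).2 * si p (f w)| ≤ Λ * |w.2 * si p w| := by
  obtain ⟨a, c, s, a0, c0, s0, e1, e2, e3, -, -, h1, -⟩ := h.step w hw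
  rw [e1, e3, show a * w.2 * (s * si p w) = a * s * (w.2 * si p w) by ring, abs_mul,
    abs_of_pos (mul_pos a0 s0)]
  gcongr

theorem tan_le (h : NearLinear p μ Λ κ r f f') {w : ℝ × ℝ} (hw : w ∈ strip r) :
    |si p w| * |co p (f w)| ≤ μ * (|co p w| * |si p (f w)|) := by
  obtain ⟨a, c, s, a0, c0, s0, e1, e2, e3, -, -, -, h1⟩ := h.step w hw
  rw [e2, e3, abs_mul, abs_mul, abs_of_pos c0, abs_of_pos s0]
  have : 0 ≤ |si p w| * |co p w| := by positivity
  nlinarith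

theorem pos_iff (h : NearLinear p μ Λ κ r f f') {w : ℝ × ℝ} (hw : w ∈ strip r) :
    0 < (f w).2 ↔ 0 < w.2 := by
  obtain ⟨a, c, s, a0, c0, s0, e1, -⟩ := h.step w hw
  rw [e1]; exact mul_pos_iff_of_pos_left a0

theorem nonneg (h : NearLinear p μ Λ κ r f f') {w : ℝ × ℝ} (hw : w ∈ strip r) : 0 ≤ (f w).2 := by
  obtain ⟨a, c, s, a0, c0, s0, e1, -⟩ := h.step w hw
  rw [e1]; exact mul_nonneg a0.le hw.1

theorem co_eq_zero_iff (h : NearLinear p μ Λ κ r f f') {w : ℝ × ℝ} (hw : w ∈ strip r) :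
    co p (f w) = 0 ↔ co p w = 0 := by
  obtain ⟨a, c, s, a0, c0, s0, e1, e2, -⟩ := h.step w hw
  rw [e2]; simp [c0.ne']

theorem si_eq_zero_iff (h : NearLinear p μ Λ κ r f f') {w : ℝ × ℝ} (hw : w ∈ strip r) :
    si p (f w) = 0 ↔ si p w = 0 := by
  obtain ⟨a, c, s, a0, c0, s0, e1, e2, e3, -⟩ := h.step w hw
  rw [e3]; simp [s0.ne']

/-- Since |Y| grows at least by the factor 1/μ and |X| shrinks at least by μ, the difference |Y| −
|X| gains at least (1 − μ)(|X| + |Y|) ≥ (1 − μ)y. The last term of the potential is an increasing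
function of |tan|, which grows by 1/μ as well, and accounts for |sin cos|. -/
theorem pot_le (h : NearLinear p μ Λ κ r f f') (hμ0 : 0 < μ) (hμ1 : μ < 1) {w : ℝ × ℝ}
    (hw : w ∈ strip r) :
    (1 - μ) * (w.2 + |si p w| * |co p w|) ≤ 2 * (pot p (f w) - pot p w) := by
  have hx := h.abs_x_le hw
  have hy := h.le_abs_y hw
  have ht := h.tan_le hw
  have i1 := one_le_abs_si_add p w
  have i2 := one_le_abs_si_add p (f w)
  have hy0 : 0 ≤ w.2 := hw.1
  have a1 := abs_si_le p w
  have a2 := abs_co_le p w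
  unfold pot
  have ex : |w.2 * si p w| + |w.2 * co p w| ≥ w.2 := by
    rw [abs_mul, abs_mul, abs_of_nonneg hy0]; nlinarith
  have hy2 : (1 - μ) * |w.2 * si p w| ≤ |(f w).2 * si p (f w)| - |w.2 * si p w| := by
    nlinarith [abs_nonneg ((f w).2 * si p (f w)), mul_le_mul_of_nonneg_left hy hμ0.le,
      mul_nonneg (sub_nonneg.2 hμ1.le) (mul_nonneg (sub_nonneg.2 hμ1.le) (abs_nonneg ((f w).2 * si p (f w))))]
  have hσ : (1 - μ) * (|si p w| * |co p w|) ≤ 2 * (|si p (f w)| / (|si p (f w)| + |co p (f w)|) -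
      |si p w| / (|si p w| + |co p w|)) := by
    have n1 := abs_nonneg (si p w)
    have n2 := abs_nonneg (co p w)
    have n3 := abs_nonneg (si p (f w))
    have n4 := abs_nonneg (co p (f w))
    have hsq := si_sq_add_co_sq p w
    rw [← sq_abs (si p w), ← sq_abs (co p w)] at hsq
    generalize |si p w| = s at *
    generalize |co p w| = c at *
    generalize |si p (f w)| = s' at *
    generalize |co p (f w)| = c' at *
    have d1 : 0 < s + c := by linarith
    have d2 : 0 < s' + c' := by linarith
    have hsc : (s + c) ^ 2 ≤ 2 := by nlinarith [sq_nonneg (s - c)]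
    rw [div_sub_div _ _ d2.ne' d1.ne', ← mul_div_assoc, le_div_iff₀ (by positivity)]
    have k1 : (1 - μ) * (s' * c) ≤ s' * (s + c) - (s' + c') * s := by nlinarith
    have k2 : s * c * (s' + c') * (s + c) ≤ s' * c * (s + c) ^ 2 := by
      have : s * (s' + c') ≤ s' * (s + c) := by
        have : μ * (c * s') ≤ 1 * (c * s') := by gcongr
        nlinarith
      calc s * c * (s' + c') * (s + c) = s * (s' + c') * (c * (s + c)) := by ring
        _ ≤ s' * (s + c) * (c * (s + c)) := by gcongr
        _ = _ := by ring
    have k3 : s' * c * (s + c) ^ 2 ≤ s' * c * 2 := by gcongr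
    have m0 : 0 ≤ 1 - μ := by linarith
    calc (1 - μ) * (s * c) * ((s' + c') * (s + c)) = (1 - μ) * (s * c * (s' + c') * (s + c)) := by
          ring
      _ ≤ (1 - μ) * (s' * c * 2) := 
          mul_le_mul_of_nonneg_left (k2.trans k3) m0
      _ ≤ _ := by linarith
  have hx2 : (1 - μ) * |w.2 * co p w| ≤ |w.2 * co p w| - |(f w).2 * co p (f w)| := by linarith
  have hex := mul_le_mul_of_nonneg_left ex.le (sub_nonneg.2 hμ1.le)
  have p1 : 0 ≤ (1 - μ) * |w.2 * si p w| := mul_nonneg (by linarith) (abs_nonneg _)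
  have p2 : 0 ≤ (1 - μ) * |w.2 * co p w| := mul_nonneg (by linarith) (abs_nonneg _)
  linarith

end NearLinear

/-- The derivative of the `n`-th iterate. -/
def iterDeriv (f : ℝ × ℝ → ℝ × ℝ) (f' : ℝ × ℝ → (ℝ × ℝ) →L[ℝ] (ℝ × ℝ)) :
    ℕ → ℝ × ℝ → (ℝ × ℝ) →L[ℝ] (ℝ × ℝ)
  | 0, _ => ContinuousLinearMap.id ℝ (ℝ × ℝ)
  | n + 1, w => (f' (f^[n] w)).comp (iterDeriv f f' n w)

namespace NearLinear

theorem orbit (h : NearLinear p μ Λ κ r f f') (hμ0 : 0 < μ) (hΛ : 0 ≤ Λ) {w : ℝ × ℝ}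
    (hy : 0 < w.2) (hc : co p w ≠ 0) (hs : si p w ≠ 0) (n : ℕ)
    (hn : ∀ k < n, f^[k] w ∈ strip r) :
    (0 < (f^[n] w).2 ∧ co p (f^[n] w) ≠ 0 ∧ si p (f^[n] w) ≠ 0) ∧
      |(f^[n] w).2 * co p (f^[n] w)| ≤ μ ^ n * |w.2 * co p w| ∧
      |w.2 * si p w| ≤ μ ^ n * |(f^[n] w).2 * si p (f^[n] w)| ∧
      |(f^[n] w).2 * si p (f^[n] w)| ≤ Λ ^ n * |w.2 * si p w| := by
  induction n with
  | zero => simp [hy, hc, hs]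
  | succ n ih =>
    obtain ⟨⟨h1, h2, h3⟩, h4, h5, h6⟩ := ih fun k hk => hn k (hk.trans (Nat.lt_succ_self n))
    have hw := hn n (Nat.lt_succ_self n)
    rw [Function.iterate_succ_apply']
    refine ⟨⟨(h.pos_iff hw).2 h1, (h.co_eq_zero_iff hw).not.2 h2, (h.si_eq_zero_iff hw).not.2 h3⟩,
      ?_, ?_, ?_⟩
    · refine (h.abs_x_le hw).trans ?_
      rw [pow_succ', mul_assoc]; gcongr
    · refine h5.trans ?_
      rw [pow_succ, mul_assoc]
      gcongr
      exact h.le_abs_y hw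
    · refine (h.abs_y_le hw).trans ?_
      rw [pow_succ', mul_assoc]; gcongr

/-- A discrete Gronwall inequality. One step changes the pair (dP, dQ) by at most 2κ‖u‖, and ‖u‖ is
at most 4/(1 − μ) times the gain of potential times |dP| + |dQ|. The gains telescope, so the bound
does not depend on n except through the potential. -/
theorem deriv_orbit (h : NearLinear p μ Λ κ r f f') (hp : 1 ≤ p) (hμ0 : 0 < μ) (hμ1 : μ < 1)
    (hΛ : 0 ≤ Λ) (hκ : 0 ≤ κ) {w : ℝ × ℝ} (hy : 0 < w.2) (hc : co p w ≠ 0) (hs : si p w ≠ 0) (n : ℕ)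
    (hn : ∀ k < n, f^[k] w ∈ strip r) (v : ℝ × ℝ) :
    |dP p (f^[n] w) (iterDeriv f f' n w v) - dP p w v| +
      |dQ p (f^[n] w) (iterDeriv f f' n w v) - dQ p w v| ≤
      (|dP p w v| + |dQ p w v|) *
        (Real.exp (8 * κ / (1 - μ) * (pot p (f^[n] w) - pot p w)) - 1) := by
  induction n with
  | zero => simp [iterDeriv]
  | succ n ih =>
    have hn' : ∀ k < n, f^[k] w ∈ strip r := fun k hk => hn k (hk.trans (Nat.lt_succ_self n))
    have IH := ih hn'
    obtain ⟨⟨h1, h2, h3⟩, -⟩ := h.orbit hμ0 hΛ hy hc hs n hn'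
    have hw := hn n (Nat.lt_succ_self n)
    rw [Function.iterate_succ_apply']
    change |dP p (f (f^[n] w)) (f' (f^[n] w) (iterDeriv f f' n w v)) - dP p w v| +
      |dQ p (f (f^[n] w)) (f' (f^[n] w) (iterDeriv f f' n w v)) - dQ p w v| ≤ _
    set z := f^[n] w
    set u := iterDeriv f f' n w v
    obtain ⟨s1, s2⟩ := h.logd z hw h1 h2 h3 u
    have hN := norm_le_dP hp h1 h2 h3 u
    have hpot := h.pot_le hμ0 hμ1 hw
    set N₀ := |dP p w v| + |dQ p w v| with hN₀
    set N := |dP p z u| + |dQ p z u| with hNdef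
    have hNN : N ≤ N₀ * Real.exp (8 * κ / (1 - μ) * (pot p z - pot p w)) := by
      have t1 := abs_sub_abs_le_abs_sub (dP p z u) (dP p w v)
      have t2 := abs_sub_abs_le_abs_sub (dQ p z u) (dQ p w v)
      linarith
    have hm : 0 < 1 - μ := by linarith
    have hNn : 0 ≤ N := by positivity
    have hN₀n : 0 ≤ N₀ := by positivity
    have hu : κ * ‖u‖ ≤ 4 * κ / (1 - μ) * (pot p (f z) - pot p z) * N := by
      have e : 2 * (z.2 + |si p z| * |co p z|) ≤ 4 / (1 - μ) * (pot p (f z) - pot p z) := by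
        rw [div_mul_eq_mul_div, le_div_iff₀ hm]; linarith
      calc κ * ‖u‖ ≤ κ * (4 / (1 - μ) * (pot p (f z) - pot p z) * N) := by
            gcongr
            exact hN.trans (mul_le_mul_of_nonneg_right e hNn)
        _ = _ := by ring
    set E := Real.exp (8 * κ / (1 - μ) * (pot p z - pot p w))
    -- The inequality 1 + x ≤ exp x absorbs the factor of one more step into the exponential of the
    -- telescoping sum.
    have hE : E * (1 + 8 * κ / (1 - μ) * (pot p (f z) - pot p z)) ≤
        Real.exp (8 * κ / (1 - μ) * (pot p (f z) - pot p w)) := by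
      have e : 8 * κ / (1 - μ) * (pot p (f z) - pot p w) = 8 * κ / (1 - μ) * (pot p z - pot p w) +
        8 * κ / (1 - μ) * (pot p (f z) - pot p z) := by ring
      rw [e, Real.exp_add]
      refine mul_le_mul_of_nonneg_left ?_ (Real.exp_nonneg _)
      rw [add_comm]; exact Real.add_one_le_exp _
    have hd0 : 0 ≤ pot p (f z) - pot p z := by
      have : 0 ≤ (1 - μ) * (z.2 + |si p z| * |co p z|) := by positivity
      linarith
    have t3 := abs_sub_le (dP p (f z) (f' z u)) (dP p z u) (dP p w v)
    have t4 := abs_sub_le (dQ p (f z) (f' z u)) (dQ p z u) (dQ p w v)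
    have hB : 8 * κ / (1 - μ) * (pot p (f z) - pot p z) * N ≤
        8 * κ / (1 - μ) * (pot p (f z) - pot p z) * (N₀ * E) := by gcongr
    have hB2 : 8 * κ / (1 - μ) * (pot p (f z) - pot p z) * N =
      2 * (4 * κ / (1 - μ) * (pot p (f z) - pot p z) * N) := by ring
    have hEN := mul_le_mul_of_nonneg_left hE hN₀n
    linarith

end NearLinear

/-! Cones -/

theorem inner_toLp (v e : ℝ × ℝ) :
    inner ℝ (WithLp.toLp 2 v) (WithLp.toLp 2 e) = v.1 * e.1 + v.2 * e.2 := by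
  simp [WithLp.prod_inner_apply, mul_comm]

theorem eucl_sq (v : ℝ × ℝ) : eucl v ^ 2 = v.1 ^ 2 + v.2 ^ 2 := by
  simp [eucl, WithLp.prod_norm_sq_eq_of_L2]

theorem eucl_nonneg (v : ℝ × ℝ) : 0 ≤ eucl v := norm_nonneg _

theorem abs_snd_le_eucl (v : ℝ × ℝ) : |v.2| ≤ eucl v :=
  abs_le_of_sq_le_sq (by nlinarith [eucl_sq v]) (eucl_nonneg v)

theorem eucl_le (v : ℝ × ℝ) : eucl v ≤ |v.1| + |v.2| := by
  refine abs_le_of_sq_le_sq' ?_ (by positivity) |>.2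
  rw [eucl_sq, ← sq_abs v.1, ← sq_abs v.2]
  nlinarith [mul_nonneg (abs_nonneg v.1) (abs_nonneg v.2)]

/-- The coordinate `v.1 e.1 + v.2 e.2` of a vector of a cone around a unit vector. -/
theorem le_of_mem_cone {e v : ℝ × ℝ} (he : e.1 ^ 2 + e.2 ^ 2 = 1) {α : ℝ} (hα : α ≤ Real.pi)
    (hv : v ∈ cone e α) (h0 : v ≠ 0) : Real.cos α * eucl v < |v.1 * e.1 + v.2 * e.2| := by
  have hne : 0 < eucl v := by
    rw [eucl, norm_pos_iff]; simpa using h0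
  have key : ∀ e : ℝ × ℝ, e.1 ^ 2 + e.2 ^ 2 = 1 →
      InnerProductGeometry.angle (WithLp.toLp 2 v) (WithLp.toLp 2 e) < α →
      Real.cos α * eucl v < v.1 * e.1 + v.2 * e.2 := by
    intro e he h
    have h1 : eucl e = 1 := by
      have := eucl_sq e
      rw [he] at this
      nlinarith [eucl_nonneg e]
    have h2 := Real.cos_lt_cos_of_nonneg_of_le_pi (InnerProductGeometry.angle_nonneg _ _) hα h
    have h3 := InnerProductGeometry.cos_angle_mul_norm_mul_norm (WithLp.toLp 2 v) (WithLp.toLp 2 e)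
    rw [inner_toLp] at h3
    change _ * (eucl v * eucl e) = _ at h3
    rw [h1, mul_one] at h3
    rw [← h3]
    gcongr
  rcases hv with hv | hv | hv
  · exact absurd hv h0
  · exact (key e he hv).trans_le (le_abs_self _)
  · refine (key (-e) (by simpa using he) hv).trans_le ?_
    rw [show v.1 * (-e).1 + v.2 * (-e).2 = -(v.1 * e.1 + v.2 * e.2) by simp; ring]
    exact neg_le_abs _

theorem mem_cone_of_le {e v : ℝ × ℝ} (he : e.1 ^ 2 + e.2 ^ 2 = 1) {α : ℝ} (hα : 0 ≤ α)
    (h0 : v ≠ 0) (h : Real.cos α * eucl v < |v.1 * e.1 + v.2 * e.2|) : v ∈ cone e α := by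
  have hne : 0 < eucl v := by
    rw [eucl, norm_pos_iff]; simpa using h0
  have key : ∀ e : ℝ × ℝ, e.1 ^ 2 + e.2 ^ 2 = 1 → Real.cos α * eucl v < v.1 * e.1 + v.2 * e.2 →
      InnerProductGeometry.angle (WithLp.toLp 2 v) (WithLp.toLp 2 e) < α := by
    intro e he h
    by_contra hcon
    have h1 : eucl e = 1 := by
      have := eucl_sq e
      rw [he] at this
      nlinarith [eucl_nonneg e]
    have h2 := Real.cos_le_cos_of_nonneg_of_le_pi hα (InnerProductGeometry.angle_le_pi _ _)
      (not_lt.1 hcon)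
    have h3 := InnerProductGeometry.cos_angle_mul_norm_mul_norm (WithLp.toLp 2 v) (WithLp.toLp 2 e)
    rw [inner_toLp] at h3
    change _ * (eucl v * eucl e) = _ at h3
    rw [h1, mul_one] at h3
    rw [← h3] at h
    exact absurd h2 (not_le.2 (lt_of_mul_lt_mul_right h hne.le))
  rcases le_total 0 (v.1 * e.1 + v.2 * e.2) with hs | hs
  · rw [abs_of_nonneg hs] at h
    exact Or.inr (Or.inl (key e he h))
  · rw [abs_of_nonpos hs] at h
    refine Or.inr (Or.inr (key (-e) (by simpa using he) ?_))
    rw [show v.1 * (-e).1 + v.2 * (-e).2 = -(v.1 * e.1 + v.2 * e.2) by simp; ring]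
    exact h

theorem cos_half_ge : (7 : ℝ) / 8 ≤ Real.cos (1 / 2) := by
  have := Real.one_sub_sq_div_two_le_cos (x := 1 / 2)
  norm_num at this ⊢
  linarith

/-- Since cos(1/2) ≥ 7/8, the first coordinate carries at least 7/8 of the length; the slope bound 2
is generous. -/
theorem snd_le_of_mem_cone {v : ℝ × ℝ} (hv : v ∈ cone (1, 0) (1 / 2)) : |v.2| ≤ 2 * |v.1| := by
  rcases eq_or_ne v 0 with rfl | h0
  · simp
  · have := le_of_mem_cone (by norm_num) (by linarith [Real.pi_gt_three]) hv h0
    simp only [mul_one, mul_zero, add_zero] at this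
    nlinarith [abs_snd_le_eucl v, cos_half_ge, eucl_nonneg v]

/-- A nonzero common vector would have both coordinates larger than 7/8 of its length, whose squares
add up to too much. -/
theorem cone_inter : cone (1, 0) (1 / 2) ∩ cone (0, 1) (1 / 2) = {0} := by
  ext v
  simp only [mem_inter_iff, mem_singleton_iff]
  constructor
  · rintro ⟨h1, h2⟩
    by_contra h0
    have l1 := le_of_mem_cone (by norm_num) (by linarith [Real.pi_gt_three]) h1 h0
    have l2 := le_of_mem_cone (by norm_num) (by linarith [Real.pi_gt_three]) h2 h0
    simp only [mul_one, mul_zero, add_zero, zero_add] at l1 l2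
    have e := eucl_sq v
    have n := eucl_nonneg v
    have k : 7 / 8 * eucl v ≤ Real.cos (1 / 2) * eucl v := by
      have := cos_half_ge
      gcongr
    have q1 := pow_lt_pow_left₀ (k.trans_lt l1) (by positivity) two_ne_zero
    have q2 := pow_lt_pow_left₀ (k.trans_lt l2) (by positivity) two_ne_zero
    rw [sq_abs] at q1 q2
    nlinarith [sq_nonneg (eucl v)]
  · rintro rfl
    exact ⟨Or.inl rfl, Or.inl rfl⟩

/-- The slope that guarantees that a vector lies in the small cones. -/
theorem exists_slope : ∃ η : ℝ, 0 < η ∧ ∀ v : ℝ × ℝ, |v.1| ≤ η * |v.2| →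
    v ∈ cone (0, 1) (1 / 4) := by
  have hc1 : Real.cos (1 / 4) < 1 := by
    have := Real.cos_lt_cos_of_nonneg_of_le_pi (x := 0) (y := 1 / 4) le_rfl
      (by linarith [Real.pi_gt_three]) (by norm_num)
    simpa using this
  have hc0 : 0 < Real.cos (1 / 4) :=
    Real.cos_pos_of_mem_Ioo ⟨by linarith [Real.pi_gt_three], by linarith [Real.pi_gt_three]⟩
  -- With this η one has cos(1/4) · (1 + η) = (1 + cos(1/4))/2 < 1, so the length times cos(1/4)
  -- stays below the vertical coordinate.
  refine ⟨1 / Real.cos (1 / 4) / 2 - 1 / 2, ?_, fun v hv => ?_⟩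
  · have : 1 < 1 / Real.cos (1 / 4) := by rw [lt_div_iff₀ hc0]; linarith
    linarith
  · rcases eq_or_ne v.2 0 with h2 | h2
    · rw [h2, abs_zero, mul_zero] at hv
      left
      ext
      · simpa using abs_nonpos_iff.1 hv
      · simpa using h2
    · refine mem_cone_of_le (by norm_num) (by norm_num) (fun h => h2 (by rw [h]; rfl)) ?_
      simp only [mul_zero, mul_one, zero_add]
      have hp := abs_pos.2 h2
      have e := eucl_le v
      have : Real.cos (1 / 4) * (1 / Real.cos (1 / 4)) = 1 := by field_simp
      calc Real.cos (1 / 4) * eucl v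
          ≤ Real.cos (1 / 4) * ((1 / Real.cos (1 / 4) / 2 - 1 / 2) * |v.2| + |v.2|) := by
            gcongr; linarith
        _ = (Real.cos (1 / 4) * (1 / Real.cos (1 / 4)) / 2 + Real.cos (1 / 4) / 2) * |v.2| := by
            ring
        _ < 1 * |v.2| := by
            rw [this]
            gcongr
            linarith
        _ = _ := one_mul _

set_option maxHeartbeats 800000 in
/-- A vector that is nearly horizontal becomes nearly vertical and long, if the logarithmic
differentials do not change much. -/
theorem cone_block {p : ℕ} (hp : 1 ≤ p) {rm σ η : ℝ} (hrm : 0 < rm) (hσ0 : 0 < σ)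
    (hσ : σ ≤ 1 / 4) (hσ1 : σ * (10 / rm) ≤ η) (hσ2 : σ * (4 * (18 / rm + 8 * p)) ≤ p)
    {y s c y' s' c' P Q P' Q' : ℝ} {v v' : ℝ × ℝ} (hy : rm ≤ y) (hy' : rm ≤ y')
    (hsc : s ^ 2 + c ^ 2 = 1) (hsc' : s' ^ 2 + c' ^ 2 = 1) (hs0 : s ≠ 0) (hs : |s| ≤ σ)
    (hc' : |c'| ≤ σ)
    (hP : P = v.2 / y - p / 2 * (s / c) * v.1) (hQ : Q = v.2 / y + p / 2 * (c / s) * v.1)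
    (hv1 : v'.1 = 2 / p * (s' * c') * (Q' - P')) (hv2 : v'.2 = y' * (c' ^ 2 * P' + s' ^ 2 * Q'))
    (hPQ : |P' - P| + |Q' - Q| ≤ 1 / 7 * (|P| + |Q|)) (hv : |v.2| ≤ 2 * |v.1|) :
    |v'.1| ≤ η * |v'.2| ∧ 6 * |v.1| ≤ |v'.2| := by
  have hp' : (1 : ℝ) ≤ p := by exact_mod_cast hp
  have hy0 : 0 < y := hrm.trans_le hy
  have hs2 : s ^ 2 ≤ 1 / 16 := by
    rw [← sq_abs]; nlinarith [abs_nonneg s]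
  have hc2 : c'^ 2 ≤ 1 / 16 := by
    rw [← sq_abs]; nlinarith [abs_nonneg c']
  have hc : 1 / 2 ≤ |c| := by
    by_contra hcon
    have : |c| ^ 2 < (1 / 2) ^ 2 := by
      have := abs_nonneg c
      gcongr
      exact not_le.1 hcon
    rw [sq_abs] at this
    linarith
  have hsp : 0 < |s| := abs_pos.2 hs0
  have hcp : 0 < |c| := by linarith
  have n1 := abs_nonneg v.1
  have hvy : |v.2 / y| ≤ 2 / rm * |v.1| := by
    rw [abs_div, abs_of_pos hy0, div_mul_eq_mul_div]
    exact div_le_div₀ (by positivity) hv hrm hy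
  have hPle : |P| ≤ (2 / rm + p) * |v.1| := by
    rw [hP]
    refine (abs_sub _ _).trans ?_
    have : |(p : ℝ) / 2 * (s / c) * v.1| ≤ p * |v.1| := by
      rw [abs_mul, abs_mul, abs_of_nonneg (by positivity : (0 : ℝ) ≤ (p : ℝ) / 2), abs_div]
      have : |s| / |c| ≤ 2 := by rw [div_le_iff₀ hcp]; linarith
      calc (p : ℝ) / 2 * (|s| / |c|) * |v.1| ≤ p / 2 * 2 * |v.1| := by gcongr
        _ = _ := by ring
    linarith
  -- Near the starting line s is small, so c/s is huge and Q dominates: the constants are arranged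
  -- so that |Q| is at least 8 times the bound for |P|.
  have hQge : (16 / rm + 8 * p) * |v.1| ≤ |Q| := by
    have h1 : |(p : ℝ) / 2 * (c / s) * v.1| - |v.2 / y| ≤ |Q| := by
      have := abs_sub_abs_le_abs_sub ((p : ℝ) / 2 * (c / s) * v.1) (-(v.2 / y))
      rw [abs_neg, sub_neg_eq_add, add_comm (_ * v.1), ← hQ] at this
      exact this
    have h2 : (18 / rm + 8 * p) * |v.1| ≤ |(p : ℝ) / 2 * (c / s) * v.1| := by
      rw [abs_mul, abs_mul, abs_of_nonneg (by positivity : (0 : ℝ) ≤ (p : ℝ) / 2), abs_div]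
      have h3 : 18 / rm + 8 * p ≤ p / 2 * ((1 / 2) / σ) := by
        rw [show (p : ℝ) / 2 * ((1 / 2) / σ) = p / 4 / σ by ring, le_div_iff₀ hσ0]
        linarith
      have h4 : (1 / 2) / σ ≤ |c| / |s| := by gcongr
      calc _ ≤ p / 2 * ((1 / 2) / σ) * |v.1| := by gcongr
        _ ≤ _ := by gcongr
    have e : (16 / rm + 8 * p) * |v.1| = (18 / rm + 8 * p) * |v.1| - 2 / rm * |v.1| := by ring
    rw [e]; linarith
  have hPQ8 : |P| ≤ |Q| / 8 := by
    have : (16 / rm + 8 * p) * |v.1| = 8 * ((2 / rm + p) * |v.1|) := by ring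
    linarith
  have nQ := abs_nonneg Q
  have a1 := abs_nonneg (P' - P)
  have a2 := abs_nonneg (Q' - Q)
  have b1 := abs_sub_abs_le_abs_sub P' P
  have b2 := abs_sub_abs_le_abs_sub Q' Q
  have b3 := abs_sub_abs_le_abs_sub Q Q'
  rw [abs_sub_comm Q Q'] at b3
  have hP' : |P'| ≤ |Q| / 2 := by linarith
  have hQ' : 3 / 4 * |Q| ≤ |Q'| := by linarith
  have hQ'2 : |Q'| ≤ 2 * |Q| := by linarith
  -- Near the final line c' is small, so the vertical component is essentially y'Q', bounded below
  -- by the height `rm`.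
  have hw2 : rm / 2 * |Q| ≤ |v'.2| := by
    rw [hv2, abs_mul, abs_of_pos (hrm.trans_le hy')]
    have h1 : 1 / 2 * |Q| ≤ |c' ^ 2 * P' + s' ^ 2 * Q'| := by
      have := abs_sub_abs_le_abs_sub (s' ^ 2 * Q') (-(c' ^ 2 * P'))
      rw [abs_neg, sub_neg_eq_add, add_comm (s' ^ 2 * Q'), abs_mul, abs_mul,
        abs_of_nonneg (sq_nonneg s'), abs_of_nonneg (sq_nonneg c')] at this
      have hs'2 : 15 / 16 ≤ s' ^ 2 := by linarith
      have m1 : 15 / 16 * (3 / 4 * |Q|) ≤ s' ^ 2 * |Q'| := by gcongr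
      have m2 : c' ^ 2 * |P'| ≤ 1 / 16 * (|Q| / 2) := by gcongr
      linarith
    calc rm / 2 * |Q| = rm * (1 / 2 * |Q|) := by ring
      _ ≤ _ := mul_le_mul hy' h1 (by positivity) (hrm.le.trans hy')
  -- The horizontal component carries the factor c', which is at most σ.
  have hw1 : |v'.1| ≤ 5 * σ * |Q| := by
    rw [hv1, abs_mul, abs_mul, abs_mul, abs_of_nonneg (by positivity : (0 : ℝ) ≤ 2 / (p : ℝ))]
    have h1 : 2 / (p : ℝ) ≤ 2 := div_le_self (by norm_num) hp'
    have h2 : |s'| ≤ 1 := by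
      rw [← sq_le_one_iff_abs_le_one]; nlinarith
    have h3 : |Q' - P'| ≤ 5 / 2 * |Q| := (abs_sub _ _).trans (by linarith)
    calc _ ≤ 2 * (1 * σ) * (5 / 2 * |Q|) :=
          mul_le_mul (mul_le_mul h1 (mul_le_mul h2 hc' (abs_nonneg _) zero_le_one) (by positivity)
            zero_le_two) h3 (abs_nonneg _) (by positivity)
      _ = _ := by ring
  clear hP hQ hv1 hv2 hPQ hvy hPle hPQ8 a1 a2 b1 b2 b3 hP' hQ' hQ'2
  constructor
  · calc |v'.1| ≤ σ * (10 / rm) * (rm / 2 * |Q|) := by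
          refine hw1.trans (le_of_eq ?_)
          field_simp; ring
      _ ≤ η * |v'.2| := by
          have : 0 ≤ η := le_trans (by positivity) hσ1
          gcongr
  · refine le_trans ?_ hw2
    have : rm / 2 * ((16 / rm + 8 * p) * |v.1|) ≤ rm / 2 * |Q| := by gcongr
    have e : rm / 2 * ((16 / rm + 8 * p) * |v.1|) = 8 * |v.1| + 4 * rm * p * |v.1| := by
      field_simp; ring
    have : 0 ≤ 4 * rm * p * |v.1| := by positivity
    linarith

/-! The covering map -/

theorem cov_eq_iff {w w' : ℝ × ℝ} : cov w = cov w' ↔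
    ∃ n : ℤ, w'.1 = w.1 + 2 * Real.pi * n ∧ w'.2 = w.2 := by
  simp only [cov, Prod.mk.injEq]
  rw [Real.Angle.angle_eq_iff_two_pi_dvd_sub]
  constructor
  · rintro ⟨⟨k, hk⟩, h2⟩
    exact ⟨-k, by push_cast; linarith, h2.symm⟩
  · rintro ⟨n, h1, h2⟩
    exact ⟨⟨-n, by rw [h1]; push_cast; ring⟩, h2.symm⟩

theorem cov_surjective (z : Cylinder) : ∃ w, cov w = z := by
  obtain ⟨x, hx⟩ := QuotientAddGroup.mk_surjective z.1
  exact ⟨(x, z.2), Prod.ext hx rfl⟩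

theorem abs_co_of_cov (p : ℕ) {w w' : ℝ × ℝ} (h : cov w = cov w') : |co p w| = |co p w'| := by
  obtain ⟨n, h1, -⟩ := cov_eq_iff.1 h
  unfold co
  rw [h1, show (p : ℝ) * (w.1 + 2 * Real.pi * n) / 2 = p * w.1 / 2 + ((p * n : ℤ) : ℝ) * Real.pi by
    push_cast; ring, Real.cos_add_int_mul_pi, abs_mul, abs_zpow, abs_neg, abs_one, one_zpow, one_mul]

variable {p : ℕ} {μ Λ κ r : ℝ} {f : ℝ × ℝ → ℝ × ℝ} {f' : ℝ × ℝ → (ℝ × ℝ) →L[ℝ] (ℝ × ℝ)}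

/-! The sections around the lines -/

/-- Treats both kinds of lines at once: the phase jπ/2 turns the sine into ± sin(px/2) for even j
and into ± cos(px/2) for odd j. -/
theorem sin_ne_zero_of_rect (hp : 1 ≤ p) {j : ℕ} {ε : ℝ} (hε : ε ≤ Real.pi / p) {w : ℝ × ℝ}
    (hw : |w.1 - Real.pi * j / p| < ε) (hl : cov w ∉ line p j) :
    Real.sin (p * w.1 / 2 - j * (Real.pi / 2)) ≠ 0 ∧
      |Real.sin (p * w.1 / 2 - j * (Real.pi / 2))| ≤ p / 2 * ε := by
  have hp' : (0 : ℝ) < p := by exact_mod_cast hp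
  have e : p * w.1 / 2 - j * (Real.pi / 2) = p / 2 * (w.1 - Real.pi * j / p) := by
    field_simp
  rw [e]
  have ha : |(p : ℝ) / 2 * (w.1 - Real.pi * j / p)| ≤ p / 2 * ε := by
    rw [abs_mul, abs_of_pos (by positivity)]
    gcongr
  refine ⟨fun h0 => ?_, Real.abs_sin_le_abs.trans ha⟩
  have hb : |(p : ℝ) / 2 * (w.1 - Real.pi * j / p)| < Real.pi := by
    refine ha.trans_lt ?_
    calc p / 2 * ε ≤ p / 2 * (Real.pi / p) := by gcongr
      _ = Real.pi / 2 := by field_simp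
      _ < Real.pi := half_lt_self Real.pi_pos
  have := (Real.sin_eq_zero_iff_of_lt_of_lt (abs_lt.1 hb).1 (abs_lt.1 hb).2).1 h0
  apply hl
  have h1 : w.1 = Real.pi * j / p := by
    rcases mul_eq_zero.1 this with h | h
    · exact absurd h (by positivity)
    · linarith
  change ((w.1 : ℝ) : Real.Angle) = _
  rw [h1]

theorem of_mem_inputSection (hp : 1 ≤ p) {ε : ℕ → ℝ} {rm rp ε1 : ℝ} (hε : ∀ i, ε (2 * i) = ε1)
    (h1 : ε1 ≤ Real.pi / p) {z : Cylinder} (hz : z ∈ inputSection p ε rm rp) :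
    ∃ w, cov w = z ∧ si p w ≠ 0 ∧ |si p w| ≤ p / 2 * ε1 ∧ rm ≤ w.2 ∧ w.2 < rp := by
  simp only [inputSection, mem_iUnion, Finset.mem_range] at hz
  obtain ⟨i, -, ⟨w, ⟨hw1, hw2, hw3⟩, rfl⟩, hl⟩ := hz
  rw [hε] at hw1
  have := sin_ne_zero_of_rect hp h1 hw1 hl
  rw [show p * w.1 / 2 - ((2 * i : ℕ) : ℝ) * (Real.pi / 2) = p * w.1 / 2 - (i : ℕ) * Real.pi by
    push_cast; ring, Real.sin_sub_nat_mul_pi, abs_mul, abs_pow, abs_neg, abs_one, one_pow,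
    one_mul] at this
  exact ⟨w, rfl, right_ne_zero_of_mul this.1, this.2, hw2, hw3⟩

theorem of_mem_outputSection (hp : 1 ≤ p) {ε : ℕ → ℝ} {rm rp ε2 : ℝ}
    (hε : ∀ i, ε (2 * i + 1) = ε2)
    (h1 : ε2 ≤ Real.pi / p) {z : Cylinder} (hz : z ∈ outputSection p ε rm rp) :
    ∃ w, cov w = z ∧ co p w ≠ 0 ∧ |co p w| ≤ p / 2 * ε2 ∧ rm ≤ w.2 ∧ w.2 < rp := by
  simp only [outputSection, mem_iUnion, Finset.mem_range] at hz
  obtain ⟨i, -, ⟨w, ⟨hw1, hw2, hw3⟩, rfl⟩, hl⟩ := hz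
  rw [hε] at hw1
  have := sin_ne_zero_of_rect hp h1 hw1 hl
  rw [show p * w.1 / 2 - ((2 * i + 1 : ℕ) : ℝ) * (Real.pi / 2) =
    p * w.1 / 2 - Real.pi / 2 - (i : ℕ) * Real.pi by
    push_cast; ring, Real.sin_sub_nat_mul_pi, Real.sin_sub_pi_div_two, abs_mul, abs_pow, abs_neg,
    abs_one, one_pow, one_mul, abs_neg] at this
  exact ⟨w, rfl, neg_ne_zero.1 (right_ne_zero_of_mul this.1), this.2, hw2, hw3⟩

theorem mem_outputSection (hp : 1 ≤ p) {ε : ℕ → ℝ} {rm rp ε2 : ℝ}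
    (hε : ∀ i, ε (2 * i + 1) = ε2) {w : ℝ × ℝ} (h0 : co p w ≠ 0)
    (h1 : Real.pi / p * |co p w| < ε2) (h2 : rm ≤ w.2) (h3 : w.2 < rp) :
    cov w ∈ outputSection p ε rm rp := by
  have hp' : (0 : ℝ) < p := by exact_mod_cast hp
  have hpz : (0 : ℤ) < p := by exact_mod_cast hp
  obtain ⟨x₀, hx₀, hd⟩ := exists_zero_near hp (Real.pi / 2) w.1
  rw [Real.sin_add_pi_div_two] at hx₀ hd
  obtain ⟨i, hi⟩ := cos_zero_line hp x₀ hx₀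
  have hm := Int.emod_nonneg i hpz.ne'
  obtain ⟨m, hmi⟩ := Int.eq_ofNat_of_zero_le hm
  have hmp : m < p := by
    have := Int.emod_lt_of_pos i hpz
    rw [hmi] at this
    exact_mod_cast this
  have hdiv := Int.emod_add_mul_ediv i p
  rw [hmi] at hdiv
  have hcast : (i : ℝ) = m + p * (i / p : ℤ) := by exact_mod_cast hdiv.symm
  simp only [outputSection, mem_iUnion, Finset.mem_range]
  -- The index of the line is reduced modulo p, and the quotient is absorbed by a deck
  -- transformation.
  refine ⟨m, hmp, ⟨(w.1 - 2 * Real.pi * (i / p : ℤ), w.2), ⟨?_, h2, h3⟩, ?_⟩, ?_⟩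
  · rw [hε]
    refine lt_of_le_of_lt (le_of_eq ?_) (hd.trans_lt h1)
    rw [hi]
    congr 1
    push_cast
    rw [hcast]
    field_simp
    ring
  · exact cov_eq_iff.2 ⟨i / p, by simp, rfl⟩
  · intro hl
    have hl' : cov w = cov (Real.pi * ((2 * m + 1 : ℕ) : ℝ) / p, w.2) := Prod.ext hl rfl
    have := abs_co_of_cov p hl'
    have hc : co p (Real.pi * ((2 * m + 1 : ℕ) : ℝ) / p, w.2) = 0 := by
      unfold co
      rw [Real.cos_eq_zero_iff]
      exact ⟨m, by push_cast; field_simp⟩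
    rw [hc, abs_zero] at this
    exact h0 (abs_eq_zero.1 this)

/-! Iterates -/

theorem strip_mem_nhds {w : ℝ × ℝ} (h0 : 0 < w.2) (h1 : w.2 < r) : strip r ∈ 𝓝 w := by
  have : IsOpen {w : ℝ × ℝ | 0 < w.2 ∧ w.2 < r} :=
    (isOpen_lt continuous_const continuous_snd).inter (isOpen_lt continuous_snd continuous_const)
  exact mem_of_superset (this.mem_nhds ⟨h0, h1⟩) fun z hz => ⟨hz.1.le, hz.2⟩

theorem cov_iterate {F : Cylinder → Cylinder} (hF : ∀ w ∈ strip r, cov (f w) = F (cov w))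
    {w : ℝ × ℝ} (n : ℕ) (hn : ∀ k < n, f^[k] w ∈ strip r) : cov (f^[n] w) = F^[n] (cov w) := by
  induction n with
  | zero => rfl
  | succ n ih =>
    rw [Function.iterate_succ_apply', Function.iterate_succ_apply',
      hF _ (hn n (Nat.lt_succ_self n)), ih fun k hk => hn k (hk.trans (Nat.lt_succ_self n))]

theorem hasFDerivAt_iterate {F : Cylinder → Cylinder}
    (hF : ∀ w ∈ strip r, cov (f w) = F (cov w))
    (hf : ∀ w ∈ strip r, HasFDerivWithinAt f (f' w) (strip r) w) {w : ℝ × ℝ} (n : ℕ)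
    (hn : ∀ k < n, 0 < (f^[k] w).2 ∧ (f^[k] w).2 < r) :
    HasFDerivAt f^[n] (iterDeriv f f' n w) w ∧ ∀ᶠ x in 𝓝 w, cov (f^[n] x) = F^[n] (cov x) := by
  induction n with
  | zero => exact ⟨hasFDerivAt_id w, by simp⟩
  | succ n ih =>
    obtain ⟨h1, h2⟩ := ih fun k hk => hn k (hk.trans (Nat.lt_succ_self n))
    obtain ⟨g1, g2⟩ := hn n (Nat.lt_succ_self n)
    have hS := strip_mem_nhds g1 g2
    have hd := (hf _ ⟨g1.le, g2⟩).hasFDerivAt hS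
    rw [Function.iterate_succ']
    refine ⟨hd.comp w h1, ?_⟩
    filter_upwards [h2, h1.continuousAt.preimage_mem_nhds hS] with x hx hx2
    rw [Function.comp_apply, Function.iterate_succ_apply', hF _ hx2, hx]

/-! Passing from the input to the output section -/

namespace NearLinear

/-- Follow |Y| = |y sin|. It starts below rp · s and grows geometrically, so there is a first time
when it reaches `rm`, and then it is still below Λ rm. This takes at least K steps, because Λ^K rp s
< rm. Meanwhile |X| has shrunk to at most μ^K rp, so the point is near an odd line, at a height
between `rm` and `rp`. -/
theorem exists_transit (h : NearLinear p μ Λ κ r f f') (hμ0 : 0 < μ) (hμ1 : μ < 1) (hΛ : 1 ≤ Λ)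
    {rm rp s : ℝ} {K : ℕ} (hrm : 0 < rm) (hr : rp + Λ * rm ≤ r) (hK : μ ^ K * rp + Λ * rm < rp)
    (hs : Λ ^ K * (rp * s) < rm) {w : ℝ × ℝ} (hw0 : si p w ≠ 0) (hw1 : |si p w| ≤ s)
    (hc0 : co p w ≠ 0) (h2 : rm ≤ w.2) (h3 : w.2 < rp) :
    ∃ n : ℕ, 0 < n ∧ (∀ k ≤ n, f^[k] w ∈ strip r) ∧ rm ≤ (f^[n] w).2 ∧ (f^[n] w).2 < rp ∧
      |co p (f^[n] w)| ≤ μ ^ K * rp / rm := by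
  have hy : 0 < w.2 := hrm.trans_le h2
  have hrp : 0 < rp := hy.trans h3
  have hΛrm : rm ≤ Λ * rm := le_mul_of_one_le_left hrm.le hΛ
  have hX : |w.2 * co p w| ≤ rp := by
    rw [abs_mul, abs_of_pos hy]
    nlinarith [abs_co_le p w]
  have hYs : |w.2 * si p w| ≤ rp * s := by
    rw [abs_mul, abs_of_pos hy]
    exact mul_le_mul h3.le hw1 (abs_nonneg _) hrp.le
  have hs0 : 0 ≤ s := (abs_nonneg _).trans hw1
  have hheight : ∀ z : ℝ × ℝ, 0 ≤ z.2 → z.2 ≤ |z.2 * co p z| + |z.2 * si p z| := by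
    intro z hz
    rw [abs_mul, abs_mul, abs_of_nonneg hz]
    nlinarith [one_le_abs_si_add p z]
  -- The stopping time also allows for leaving the strip; the bound of the height by |X| + |Y|
  -- excludes this afterwards.
  have hex : ∃ n, ¬ (f^[n] w ∈ strip r ∧ |(f^[n] w).2 * si p (f^[n] w)| < rm) := by
    by_contra! hcon
    have hpos : 0 < |w.2 * si p w| := abs_pos.2 (mul_ne_zero hy.ne' hw0)
    obtain ⟨n, hn⟩ := exists_pow_lt_of_lt_one (div_pos hpos hrm) hμ1
    have := (h.orbit hμ0 (zero_le_one.trans hΛ) hy hc0 hw0 n fun k _ => (hcon k).1).2.2.1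
    rw [lt_div_iff₀ hrm] at hn
    have h5 : μ ^ n * |(f^[n] w).2 * si p (f^[n] w)| ≤ μ ^ n * rm := by
      have := (hcon n).2.le
      gcongr
    linarith
  classical
  obtain ⟨n, hn, hmin⟩ : ∃ n, ¬ (f^[n] w ∈ strip r ∧ |(f^[n] w).2 * si p (f^[n] w)| < rm) ∧
      ∀ k < n, f^[k] w ∈ strip r ∧ |(f^[k] w).2 * si p (f^[k] w)| < rm :=
    ⟨Nat.find hex, Nat.find_spec hex, fun k hk => not_not.1 (Nat.find_min hex hk)⟩
  obtain ⟨⟨g1, g2, g3⟩, o1, -, o3⟩ :=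
    h.orbit hμ0 (zero_le_one.trans hΛ) hy hc0 hw0 n fun k hk => (hmin k hk).1
  have hpow : μ ^ n ≤ 1 := pow_le_one₀ hμ0.le hμ1.le
  have hX1 : |(f^[n] w).2 * co p (f^[n] w)| ≤ μ ^ n * rp :=
    o1.trans (mul_le_mul_of_nonneg_left hX (by positivity))
  have h1K : (1 : ℝ) ≤ Λ ^ K := one_le_pow₀ hΛ
  have hY0 : |w.2 * si p w| < rm := by
    refine hYs.trans_lt (lt_of_le_of_lt ?_ hs)
    exact le_mul_of_one_le_left (by positivity) h1K
  have hn0 : 0 < n := by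
    rcases Nat.eq_zero_or_pos n with rfl | hn0
    · exact absurd ⟨⟨hy.le, by simp only [Function.iterate_zero, id]; linarith⟩, hY0⟩ hn
    · exact hn0
  have hYn : |(f^[n] w).2 * si p (f^[n] w)| < Λ * rm := by
    obtain ⟨m, rfl⟩ := Nat.exists_eq_succ_of_ne_zero hn0.ne'
    obtain ⟨i1, i2⟩ := hmin m (Nat.lt_succ_self m)
    rw [Function.iterate_succ_apply']
    refine (h.abs_y_le i1).trans_lt ?_
    exact mul_lt_mul_of_pos_left i2 (by linarith)
  have hin : f^[n] w ∈ strip r := by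
    refine ⟨g1.le, ?_⟩
    have := hheight _ g1.le
    have : μ ^ n * rp ≤ 1 * rp := by gcongr
    linarith
  have hYge : rm ≤ |(f^[n] w).2 * si p (f^[n] w)| := by
    by_contra hcon
    exact hn ⟨hin, not_le.1 hcon⟩
  -- In fewer than K steps |Y| cannot have grown by more than Λ^K, hence cannot have reached `rm`.
  have hKn : K ≤ n := by
    by_contra hcon
    have h5 : Λ ^ n ≤ Λ ^ K := pow_le_pow_right₀ hΛ (not_le.1 hcon).le
    have : Λ ^ n * |w.2 * si p w| ≤ Λ ^ K * (rp * s) := by gcongr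
    linarith
  have hX2 : |(f^[n] w).2 * co p (f^[n] w)| ≤ μ ^ K * rp := by
    refine hX1.trans ?_
    have := pow_le_pow_of_le_one hμ0.le hμ1.le hKn
    gcongr
  have hyn : rm ≤ (f^[n] w).2 := by
    refine hYge.trans ?_
    rw [abs_mul, abs_of_pos g1]
    exact mul_le_of_le_one_right g1.le (abs_si_le p _)
  refine ⟨n, hn0, fun k hk => ?_, hyn, ?_, ?_⟩
  · rcases hk.lt_or_eq with hk | rfl
    · exact (hmin k hk).1
    · exact hin
  · have := hheight _ g1.le
    linarith
  · rw [le_div_iff₀ hrm]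
    refine le_trans ?_ hX2
    rw [abs_mul, abs_of_pos g1, mul_comm]
    gcongr

/-- The derivative of a transit map has a hyperbolic cone structure. -/
theorem cone_transit (h : NearLinear p μ Λ κ r f f') (hp : 1 ≤ p) (hμ0 : 0 < μ) (hμ1 : μ < 1)
    (hΛ : 1 ≤ Λ) (hκ : 0 ≤ κ) (hκ1 : Real.exp (8 * κ / (1 - μ) * 3) - 1 ≤ 1 / 8) (hr : r ≤ 1)
    {rm σ η : ℝ} (hrm : 0 < rm) (hσ0 : 0 < σ)
    (hσ : σ ≤ 1 / 4) (hσ1 : σ * (10 / rm) ≤ η) (hσ2 : σ * (4 * (18 / rm + 8 * p)) ≤ p)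
    (hη : ∀ v : ℝ × ℝ, |v.1| ≤ η * |v.2| → v ∈ cone (0, 1) (1 / 4))
    {w : ℝ × ℝ} (n : ℕ) (hn : ∀ k ≤ n, f^[k] w ∈ strip r)
    (hs0 : si p w ≠ 0) (hs : |si p w| ≤ σ) (hy : rm ≤ w.2) (hc : |co p (f^[n] w)| ≤ σ)
    (hy' : rm ≤ (f^[n] w).2) :
    ∃ L : (ℝ × ℝ) ≃L[ℝ] (ℝ × ℝ), (L : (ℝ × ℝ) →L[ℝ] (ℝ × ℝ)) = iterDeriv f f' n w ∧
      (∀ v ∈ cone (1, 0) (1 / 2), L v ∈ cone (0, 1) (1 / 4) ∧ 2 * eucl v ≤ eucl (L v)) ∧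
      (∀ v ∈ cone (1, 0) (1 / 2), L.symm v ∈ cone (0, 1) (1 / 4) ∧
        2 * eucl v ≤ eucl (L.symm v)) := by
  have hy0 : 0 < w.2 := hrm.trans_le hy
  have hsc := si_sq_add_co_sq p w
  have hc0 : co p w ≠ 0 := by
    intro h0
    rw [h0, ← sq_abs] at hsc
    nlinarith [abs_nonneg (si p w)]
  have hn' : ∀ k < n, f^[k] w ∈ strip r := fun k hk => hn k hk.le
  obtain ⟨⟨g1, g2, g3⟩, -⟩ := h.orbit hμ0 (zero_le_one.trans hΛ) hy0 hc0 hs0 n hn'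
  have hd : ∀ v, |dP p (f^[n] w) (iterDeriv f f' n w v) - dP p w v| +
      |dQ p (f^[n] w) (iterDeriv f f' n w v) - dQ p w v| ≤ 1 / 8 * (|dP p w v| + |dQ p w v|) := by
    intro v
    refine (h.deriv_orbit hp hμ0 hμ1 (zero_le_one.trans hΛ) hκ hy0 hc0 hs0 n hn' v).trans ?_
    rw [mul_comm]
    refine mul_le_mul_of_nonneg_right (le_trans ?_ hκ1) (by positivity)
    have hw := hn 0 (Nat.zero_le _)
    have hm : 0 < 1 - μ := by linarith
    have hpot := pot_sub_le (p := p) (w := w) (z := f^[n] w)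
      (by rw [abs_of_pos hy0]; exact (hw.2.le.trans hr))
      (by rw [abs_of_pos g1]; exact ((hn n le_rfl).2.le.trans hr))
    gcongr
  -- If the image vanishes, then |dP| + |dQ| is at most an eighth of itself, hence zero, and so is
  -- the vector.
  have hinj : Function.Injective (iterDeriv f f' n w : (ℝ × ℝ) →ₗ[ℝ] (ℝ × ℝ)) := by
    rw [← LinearMap.ker_eq_bot, LinearMap.ker_eq_bot']
    intro v hv
    have hv' : iterDeriv f f' n w v = 0 := hv
    have h1 := hd v
    rw [hv'] at h1
    have z1 : dP p (f^[n] w) 0 = 0 := by simp [dP]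
    have z2 : dQ p (f^[n] w) 0 = 0 := by simp [dQ]
    rw [z1, z2, zero_sub, zero_sub, abs_neg, abs_neg] at h1
    have h2 := norm_le_dP hp hy0 hc0 hs0 v
    have h3 : |dP p w v| + |dQ p w v| = 0 := by
      have : 0 ≤ |dP p w v| + |dQ p w v| := by positivity
      linarith
    rw [h3, mul_zero] at h2
    exact norm_le_zero_iff.1 h2
  set L := (LinearEquiv.ofInjectiveEndo _ hinj).toContinuousLinearEquiv with hL
  have hLv : ∀ v, L v = iterDeriv f f' n w v := fun v => rfl
  have stretch : ∀ v v' : ℝ × ℝ, |v.2| ≤ 2 * |v.1| → |v'.1| ≤ η * |v'.2| ∧ 6 * |v.1| ≤ |v'.2| →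
      v' ∈ cone (0, 1) (1 / 4) ∧ 2 * eucl v ≤ eucl v' := by
    rintro v v' h1 ⟨h2, h3⟩
    refine ⟨hη _ h2, ?_⟩
    have := eucl_le v
    have := abs_snd_le_eucl v'
    linarith
  refine ⟨L, ContinuousLinearMap.ext hLv, fun v hv => ?_, fun u hu => ?_⟩
  · have hv2 := snd_le_of_mem_cone hv
    refine stretch _ _ hv2 ?_
    rw [hLv]
    refine cone_block (P := dP p w v) (Q := dQ p w v) hp hrm hσ0 hσ hσ1 hσ2 hy hy' hsc (si_sq_add_co_sq p _) hs0 hs hc rfl rfl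
      (fst_eq_dP hp g2 g3 _) (snd_eq_dP g1.ne' g2 g3 _) ?_ hv2
    have : 0 ≤ |dP p w v| + |dQ p w v| := by positivity
    linarith [hd v]
  · have hu2 := snd_le_of_mem_cone hu
    refine stretch _ _ hu2 ?_
    obtain ⟨v, rfl⟩ := L.surjective u
    rw [L.symm_apply_apply]
    have e : L v = iterDeriv f f' n w v := hLv v
    rw [e] at hu2 ⊢
    -- The inverse is the same estimate after a quarter turn of the angle: the pair (sin, cos)
    -- becomes (cos, −sin), and P and Q are exchanged.
    refine cone_block (s := co p (f^[n] w)) (c := -si p (f^[n] w)) (s' := co p w) (c' := -si p w)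
      (P := dQ p (f^[n] w) (iterDeriv f f' n w v)) (Q := dP p (f^[n] w) (iterDeriv f f' n w v))
      (P' := dQ p w v) (Q' := dP p w v) hp hrm hσ0 hσ hσ1 hσ2 hy' hy ?_ ?_ g2 hc ?_ ?_ ?_ ?_ ?_ ?_
      hu2
    · rw [neg_sq, add_comm]; exact si_sq_add_co_sq p _
    · rw [neg_sq, add_comm]; exact si_sq_add_co_sq p _
    · rwa [abs_neg]
    · rw [dQ, div_neg]; ring
    · rw [dP, neg_div]; ring
    · rw [fst_eq_dP hp hc0 hs0 v]; ring
    · rw [snd_eq_dP hy0.ne' hc0 hs0 v]; ring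
    -- The change is at most 1/8 of the initial size, hence at most (1/8)/(1 − 1/8) = 1/7 of the
    -- final size. This explains the constant of `cone_block`.
    · have h1 := hd v
      have t1 := abs_sub_abs_le_abs_sub (dP p w v) (dP p (f^[n] w) (iterDeriv f f' n w v))
      have t2 := abs_sub_abs_le_abs_sub (dQ p w v) (dQ p (f^[n] w) (iterDeriv f f' n w v))
      rw [abs_sub_comm] at t1 t2
      rw [abs_sub_comm (dQ p w v), abs_sub_comm (dP p w v)]
      linarith

end NearLinear

/-- The sign of g is locally constant away from its zeros. With g = cos(px), positive near even
lines and negative near odd ones, this makes line fields that are constant on each section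
continuous. -/
theorem continuousOn_ite_pos {X Y : Type*} [TopologicalSpace X] [TopologicalSpace Y] {g : X → ℝ}
    (hg : Continuous g) {S : Set X} (hS : ∀ z ∈ S, g z ≠ 0) (A B : Y) :
    ContinuousOn (fun z => if 0 < g z then A else B) S := by
  intro z hz
  refine ContinuousAt.continuousWithinAt ?_
  rcases lt_or_gt_of_ne (hS z hz) with h | h
  · refine (continuousAt_const (y := B)).congr ?_
    filter_upwards [(isOpen_lt hg continuous_const).mem_nhds h] with x hx
    exact (if_neg (not_lt.2 (le_of_lt hx))).symm
  · refine (continuousAt_const (y := A)).congr ?_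
    filter_upwards [(isOpen_lt continuous_const hg).mem_nhds h] with x hx
    exact (if_pos hx).symm

theorem cos_nsmul_cov (p : ℕ) (w : ℝ × ℝ) :
    (p • (cov w).1).cos = co p w ^ 2 - si p w ^ 2 := by
  change (p • ((w.1 : ℝ) : Real.Angle)).cos = _
  rw [← Real.Angle.coe_nsmul, Real.Angle.cos_coe, nsmul_eq_mul,
    show (p : ℝ) * w.1 = 2 * (p * w.1 / 2) by ring, Real.cos_two_mul']
  rfl

/-- The order of the choices matters: first the heights, then the aperture σ that the cone estimates
need, then the output width, then the number K of steps after which the cosine is below that width,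
and finally an input width so small that every transit takes at least K steps. -/
theorem exists_transition (hp : 1 ≤ p) (h : NearLinear p μ Λ κ r f f') (hμ0 : 0 < μ) (hμ1 : μ < 1)
    (hΛ : 1 ≤ Λ) (hκ : 0 ≤ κ) (hκ1 : Real.exp (8 * κ / (1 - μ) * 3) - 1 ≤ 1 / 8) (hr0 : 0 < r)
    (hr : r ≤ 1) {F : Cylinder → Cylinder} (hF : ∀ w ∈ strip r, cov (f w) = F (cov w))
    (hf : ∀ w ∈ strip r, HasFDerivWithinAt f (f' w) (strip r) w) :
    ∃ (rm rp : ℝ) (ε : ℕ → ℝ), 0 < rm ∧ rm < rp ∧ rp < 1 ∧ (∀ j, 0 < ε j) ∧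
    ∃ (n : Cylinder → ℕ) (DT : Cylinder → (ℝ × ℝ) ≃L[ℝ] (ℝ × ℝ)),
      (∀ z ∈ inputSection p ε rm rp,
        IsLeast {m : ℕ | 0 < m ∧ (∀ k ≤ m, F^[k] z ∈ Cyl 1) ∧
          F^[m] z ∈ outputSection p ε rm rp} (n z) ∧
        HasDerivAtPt F^[n z] (DT z : (ℝ × ℝ) →L[ℝ] (ℝ × ℝ)) z) ∧
      HasHyperbolicConeStructure (inputSection p ε rm rp) (outputSection p ε rm rp)
        (fun z => F^[n z] z) DT := by
  have hp' : (1 : ℝ) ≤ p := by exact_mod_cast hp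
  have hπ := Real.pi_gt_three
  have hΛ0 : 0 < Λ := zero_lt_one.trans_le hΛ
  obtain ⟨η, hη0, hη⟩ := exists_slope
  -- With these heights Λ rm = r/8, so rp + Λ rm < r, and μ^K rp + Λ rm < rp as soon as μ^K < 1/2.
  obtain ⟨rm, hrm⟩ : ∃ rm, rm = r / (8 * Λ) := ⟨_, rfl⟩
  obtain ⟨rp, hrp⟩ : ∃ rp, rp = r / 2 := ⟨_, rfl⟩
  have hΛrm : Λ * rm = r / 8 := by rw [hrm]; field_simp
  have hrm0 : 0 < rm := by rw [hrm]; positivity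
  have hrp0 : 0 < rp := by rw [hrp]; positivity
  have hrmΛ : rm ≤ Λ * rm := le_mul_of_one_le_left hrm0.le hΛ
  obtain ⟨σ, hσ0, hσ, hσ1, hσ2⟩ : ∃ σ : ℝ, 0 < σ ∧ σ ≤ 1 / 4 ∧ σ * (10 / rm) ≤ η ∧
      σ * (4 * (18 / rm + 8 * p)) ≤ p := by
    refine ⟨min (1 / 4) (min (η / (10 / rm)) (p / (4 * (18 / rm + 8 * p)))), by positivity,
      min_le_left _ _, ?_, ?_⟩
    · rw [← le_div_iff₀ (by positivity)]
      exact (min_le_right _ _).trans (min_le_left _ _)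
    · rw [← le_div_iff₀ (by positivity)]
      exact (min_le_right _ _).trans (min_le_right _ _)
  obtain ⟨ε2, hε2⟩ : ∃ ε2, ε2 = 2 * σ / p := ⟨_, rfl⟩
  have hε20 : 0 < ε2 := by rw [hε2]; positivity
  have hε2σ : p / 2 * ε2 = σ := by rw [hε2]; field_simp
  have hε2p : ε2 ≤ Real.pi / p := by
    rw [hε2]; gcongr; linarith
  obtain ⟨K, hK⟩ : ∃ K : ℕ, μ ^ K < min (1 / 2) (ε2 / (Real.pi / p * (rp / rm))) :=
    exists_pow_lt_of_lt_one (by positivity) hμ1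
  have hK1 : μ ^ K * rp + Λ * rm < rp := by
    have : μ ^ K * rp < 1 / 2 * rp :=
      mul_lt_mul_of_pos_right (hK.trans_le (min_le_left _ _)) hrp0
    rw [hΛrm]
    linarith
  have hK2 : Real.pi / p * (μ ^ K * rp / rm) < ε2 := by
    have := hK.trans_le (min_le_right _ _)
    rw [lt_div_iff₀ (by positivity)] at this
    calc _ = μ ^ K * (Real.pi / p * (rp / rm)) := by ring
      _ < _ := this
  obtain ⟨ε1, hε10, hε12, hε1⟩ : ∃ ε1 : ℝ, 0 < ε1 ∧ ε1 ≤ ε2 ∧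
      Λ ^ K * (rp * (p / 2 * ε1)) < rm := by
    refine ⟨min ε2 (rm / 2 / (Λ ^ K * (rp * (p / 2)))), by positivity, min_le_left _ _, ?_⟩
    have := min_le_right ε2 (rm / 2 / (Λ ^ K * (rp * (p / 2))))
    rw [le_div_iff₀ (by positivity)] at this
    calc _ = min ε2 (rm / 2 / (Λ ^ K * (rp * (p / 2)))) * (Λ ^ K * (rp * (p / 2))) := by ring
      _ ≤ rm / 2 := this
      _ < rm := half_lt_self hrm0
  set ε : ℕ → ℝ := fun j => if Even j then ε1 else ε2 with hε
  have hεe : ∀ i, ε (2 * i) = ε1 := fun i => by simp [hε]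
  have hεo : ∀ i, ε (2 * i + 1) = ε2 := fun i => by simp [hε, parity_simps]
  have hε1σ : p / 2 * ε1 ≤ σ := by rw [← hε2σ]; gcongr
  have hinp : ∀ z ∈ inputSection p ε rm rp, ∃ w, cov w = z ∧ si p w ≠ 0 ∧ |si p w| ≤ p / 2 * ε1 ∧
      rm ≤ w.2 ∧ w.2 < rp := fun z hz => of_mem_inputSection hp hεe (hε12.trans hε2p) hz
  have hout : ∀ z ∈ outputSection p ε rm rp, ∃ w, cov w = z ∧ co p w ≠ 0 ∧ |co p w| ≤ σ ∧
      rm ≤ w.2 ∧ w.2 < rp := fun z hz => by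
    rw [← hε2σ]; exact of_mem_outputSection hp hεo hε2p hz
  have hquarter : ∀ x : ℝ, |x| ≤ σ → x ^ 2 ≤ 1 / 16 := fun x hx => by
    rw [← sq_abs]; nlinarith [abs_nonneg x]
  set g : Cylinder → ℝ := fun z => (p • z.1).cos with hg
  have hgc : Continuous g := Real.Angle.continuous_cos.comp ((continuous_nsmul p).comp continuous_fst)
  have hgin : ∀ z ∈ inputSection p ε rm rp, 0 < g z := by
    intro z hz
    obtain ⟨w, rfl, -, hw, -⟩ := hinp z hz
    have := hquarter _ (hw.trans hε1σ)
    have := si_sq_add_co_sq p w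
    change 0 < (p • (cov w).1).cos
    rw [cos_nsmul_cov]
    linarith
  have hgout : ∀ z ∈ outputSection p ε rm rp, g z < 0 := by
    intro z hz
    obtain ⟨w, rfl, -, hw, -⟩ := hout z hz
    have := hquarter _ hw
    have := si_sq_add_co_sq p w
    change (p • (cov w).1).cos < 0
    rw [cos_nsmul_cov]
    linarith
  set A : Cylinder → Set ℕ := fun z => {m : ℕ | 0 < m ∧ (∀ k ≤ m, F^[k] z ∈ Cyl 1) ∧
    F^[m] z ∈ outputSection p ε rm rp} with hA
  have main : ∀ z, ∃ DT : (ℝ × ℝ) ≃L[ℝ] (ℝ × ℝ), z ∈ inputSection p ε rm rp →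
      (A z).Nonempty ∧ HasDerivAtPt F^[sInf (A z)] (DT : (ℝ × ℝ) →L[ℝ] (ℝ × ℝ)) z ∧
      (∀ v ∈ cone (1, 0) (1 / 2), DT v ∈ cone (0, 1) (1 / 4) ∧ 2 * eucl v ≤ eucl (DT v)) ∧
      (∀ v ∈ cone (1, 0) (1 / 2), DT.symm v ∈ cone (0, 1) (1 / 4) ∧
        2 * eucl v ≤ eucl (DT.symm v)) := by
    intro z
    by_cases hz : z ∈ inputSection p ε rm rp
    swap
    · exact ⟨ContinuousLinearEquiv.refl ℝ _, fun h => absurd h hz⟩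
    obtain ⟨w, rfl, hw0, hw1, hw2, hw3⟩ := hinp z hz
    have hc0 : co p w ≠ 0 := by
      intro h0
      have := hquarter _ (hw1.trans hε1σ)
      have := si_sq_add_co_sq p w
      rw [h0] at this
      linarith
    have hy0 := hrm0.trans_le hw2
    obtain ⟨n, hn0, hn, hn1, hn2, hn3⟩ := h.exists_transit hμ0 hμ1 hΛ hrm0
      (by rw [hΛrm]; linarith) hK1 hε1 hw0 hw1 hc0 hw2 hw3
    have hpos : ∀ k ≤ n, 0 < (f^[k] w).2 ∧ co p (f^[k] w) ≠ 0 := fun k hk =>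
      let H := (h.orbit hμ0 hΛ0.le hy0 hc0 hw0 k fun j hj => hn j (hj.le.trans hk)).1
      ⟨H.1, H.2.1⟩
    have hcov : ∀ k ≤ n, cov (f^[k] w) = F^[k] (cov w) := fun k hk =>
      cov_iterate hF k fun j hj => hn j (hj.le.trans hk)
    have hnA : n ∈ A (cov w) := by
      refine ⟨hn0, fun k hk => ?_, ?_⟩
      · rw [← hcov k hk]
        exact ⟨(hn k hk).1, (hn k hk).2.trans_le hr⟩
      · rw [← hcov n le_rfl]
        refine mem_outputSection hp hεo (hpos n le_rfl).2 (lt_of_le_of_lt ?_ hK2) hn1 hn2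
        gcongr
    -- The first arrival in the output section may precede the time n found above. The cone estimate
    -- holds at any time up to n at which the point is in that section.
    have hmA := Nat.sInf_mem (s := A (cov w)) ⟨n, hnA⟩
    have hmn : sInf (A (cov w)) ≤ n := Nat.sInf_le hnA
    set m := sInf (A (cov w)) with hm
    have hTm := hmA.2.2
    rw [← hcov m hmn] at hTm
    obtain ⟨w', e', -, hw'1, hw'2, -⟩ := hout _ hTm
    rw [abs_co_of_cov p e'] at hw'1
    have e2 : w'.2 = (f^[m] w).2 := congrArg (fun z : Cylinder => z.2) e'
    rw [e2] at hw'2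
    obtain ⟨L, hL, c1, c2⟩ := h.cone_transit hp hμ0 hμ1 hΛ hκ hκ1 hr hrm0 hσ0 hσ hσ1 hσ2 hη m
      (fun k hk => hn k (hk.trans hmn)) hw0 (hw1.trans hε1σ) hw2 hw'1 hw'2
    obtain ⟨d1, d2⟩ := hasFDerivAt_iterate hF hf (w := w) m fun k hk =>
      ⟨(hpos k (hk.le.trans hmn)).1, (hn k (hk.le.trans hmn)).2⟩
    refine ⟨L, fun _ => ⟨⟨n, hnA⟩, ⟨f^[m], w, rfl, d2.filter_mono nhdsWithin_le_nhds, ?_⟩, c1, c2⟩⟩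
    rw [hL]
    exact d1.hasFDerivWithinAt
  choose DT hDT using main
  have hT : MapsTo (fun z => F^[sInf (A z)] z) (inputSection p ε rm rp)
      (outputSection p ε rm rp) := fun z hz => (Nat.sInf_mem (hDT z hz).1).2.2
  have hne : ∀ z ∈ inputSection p ε rm rp ∪ outputSection p ε rm rp, g z ≠ 0 := by
    rintro z (hz | hz)
    · exact (hgin z hz).ne'
    · exact (hgout z hz).ne
  -- The apertures are 1/4 and 1/2, the expansion is 2. The unstable field is horizontal where g >
  -- 0, on the input section, and vertical on the output section; the stable field is the other one.
  refine ⟨rm, rp, ε, hrm0, by linarith, by linarith, fun j => ?_, fun z => sInf (A z), DT,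
    fun z hz => ⟨⟨Nat.sInf_mem (hDT z hz).1, fun m hm => Nat.sInf_le hm⟩, (hDT z hz).2.1⟩, ?_, hT,
    1 / 4, 1 / 2, 2, by norm_num, by norm_num, by norm_num, by norm_num,
    fun z => if 0 < g z then (1, 0) else (0, 1), fun z => if 0 < g z then (0, 1) else (1, 0),
    continuousOn_ite_pos hgc hne _ _, continuousOn_ite_pos hgc hne _ _, fun z hz => ?_,
    fun z hz => ?_, fun z hz => ?_⟩
  · simp only [hε]; split_ifs <;> assumption
  · rw [Set.disjoint_left]
    intro z h1 h2
    exact absurd (hgin z h1) (not_lt.2 (hgout z h2).le)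
  · beta_reduce
    split_ifs
    · exact ⟨by simp, by simp, cone_inter⟩
    · exact ⟨by simp, by simp, by rw [inter_comm]; exact cone_inter⟩
  · simp only [if_pos (hgin z hz), if_neg (not_lt.2 (hgout _ (hT hz)).le)]
    exact (hDT z hz).2.2.1
  · simp only [if_pos (hgin z hz), if_neg (not_lt.2 (hgout _ (hT hz)).le)]
    exact (hDT z hz).2.2.2

variable {p : ℕ} {lam k μ Λ κ r : ℝ} {f : ℝ × ℝ → ℝ × ℝ} {f' : ℝ × ℝ → (ℝ × ℝ) →L[ℝ] (ℝ × ℝ)}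
  {F : Cylinder → Cylinder}

/-! Distances to the lines -/

/-- The absolute value of `cos (p x / 2)`, on the cylinder. -/
noncomputable def aco (p : ℕ) (z : Cylinder) : ℝ := √((1 + (p • z.1).cos) / 2)

/-- The absolute value of `sin (p x / 2)`, on the cylinder. -/
noncomputable def asi (p : ℕ) (z : Cylinder) : ℝ := √((1 - (p • z.1).cos) / 2)

theorem aco_cov (p : ℕ) (w : ℝ × ℝ) : aco p (cov w) = |co p w| := by
  rw [aco, cos_nsmul_cov, ← Real.sqrt_sq_eq_abs]
  congr 1
  linarith [si_sq_add_co_sq p w]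

theorem asi_cov (p : ℕ) (w : ℝ × ℝ) : asi p (cov w) = |si p w| := by
  rw [asi, cos_nsmul_cov, ← Real.sqrt_sq_eq_abs]
  congr 1
  linarith [si_sq_add_co_sq p w]

theorem continuous_nsmul_cos (p : ℕ) : Continuous fun z : Cylinder => (p • z.1).cos :=
  Real.Angle.continuous_cos.comp ((continuous_nsmul p).comp continuous_fst)

theorem continuous_aco (p : ℕ) : Continuous (aco p) :=
  ((continuous_const.add (continuous_nsmul_cos p)).div_const 2).sqrt

theorem continuous_asi (p : ℕ) : Continuous (asi p) :=
  ((continuous_const.sub (continuous_nsmul_cos p)).div_const 2).sqrt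

theorem asi_sq_add_aco_sq (p : ℕ) (z : Cylinder) : asi p z ^ 2 + aco p z ^ 2 = 1 := by
  obtain ⟨w, rfl⟩ := cov_surjective z
  rw [asi_cov, aco_cov, sq_abs, sq_abs, si_sq_add_co_sq]

theorem aco_nonneg (p : ℕ) (z : Cylinder) : 0 ≤ aco p z := Real.sqrt_nonneg _

theorem asi_nonneg (p : ℕ) (z : Cylinder) : 0 ≤ asi p z := Real.sqrt_nonneg _

theorem aco_le_one (p : ℕ) (z : Cylinder) : aco p z ≤ 1 := by
  nlinarith [asi_sq_add_aco_sq p z, sq_nonneg (asi p z), aco_nonneg p z]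

theorem asi_le_one (p : ℕ) (z : Cylinder) : asi p z ≤ 1 := by
  nlinarith [asi_sq_add_aco_sq p z, sq_nonneg (aco p z), asi_nonneg p z]

theorem isClosed_line (p j : ℕ) : IsClosed (line p j) :=
  isClosed_singleton.preimage continuous_fst

theorem exists_nat_mod (hp : 1 ≤ p) (i : ℤ) : ∃ (m : ℕ) (q : ℤ), m < p ∧ i = m + p * q := by
  have hpz : (0 : ℤ) < p := by exact_mod_cast hp
  obtain ⟨m, hm⟩ := Int.eq_ofNat_of_zero_le (Int.emod_nonneg i hpz.ne')
  refine ⟨m, i / p, ?_, ?_⟩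
  · have := Int.emod_lt_of_pos i hpz
    rw [hm] at this
    exact_mod_cast this
  · have := Int.emod_add_mul_ediv i p
    rw [hm] at this
    exact this.symm

theorem mem_line_cov {w : ℝ × ℝ} {j : ℕ} {x : ℝ} {q : ℤ} (hx : w.1 = x)
    (h : x = Real.pi * j / p + 2 * Real.pi * q) : cov w ∈ line p j := by
  change ((w.1 : ℝ) : Real.Angle) = _
  rw [hx, Real.Angle.angle_eq_iff_two_pi_dvd_sub]
  exact ⟨q, by rw [h]; ring⟩

theorem exists_even_line (hp : 1 ≤ p) {z : Cylinder} (h : asi p z = 0) :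
    ∃ i : ℕ, i < p ∧ z ∈ line p (2 * i) := by
  have hp' : (0 : ℝ) < p := by exact_mod_cast hp
  obtain ⟨w, rfl⟩ := cov_surjective z
  rw [asi_cov, abs_eq_zero] at h
  obtain ⟨i, hi⟩ := sin_zero_line hp w.1 h
  obtain ⟨m, q, hm, rfl⟩ := exists_nat_mod hp i
  exact ⟨m, hm, mem_line_cov (q := q) hi (by push_cast; field_simp)⟩

theorem exists_odd_line (hp : 1 ≤ p) {z : Cylinder} (h : aco p z = 0) :
    ∃ i : ℕ, i < p ∧ z ∈ line p (2 * i + 1) := by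
  have hp' : (0 : ℝ) < p := by exact_mod_cast hp
  obtain ⟨w, rfl⟩ := cov_surjective z
  rw [aco_cov, abs_eq_zero] at h
  obtain ⟨i, hi⟩ := cos_zero_line hp w.1 h
  obtain ⟨m, q, hm, rfl⟩ := exists_nat_mod hp i
  exact ⟨m, hm, mem_line_cov (q := q) hi (by push_cast; field_simp; ring)⟩

theorem aco_eq_zero_of_line (hp : 1 ≤ p) {z : Cylinder} {i : ℕ} (h : z ∈ line p (2 * i + 1)) :
    aco p z = 0 := by
  have hp' : (0 : ℝ) < p := by exact_mod_cast hp
  have e : z = cov (Real.pi * ((2 * i + 1 : ℕ) : ℝ) / p, z.2) := Prod.ext h rfl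
  rw [e, aco_cov, abs_eq_zero, co, Real.cos_eq_zero_iff]
  exact ⟨i, by push_cast; field_simp⟩

theorem asi_eq_zero_of_line (hp : 1 ≤ p) {z : Cylinder} {i : ℕ} (h : z ∈ line p (2 * i)) :
    asi p z = 0 := by
  have hp' : (0 : ℝ) < p := by exact_mod_cast hp
  have e : z = cov (Real.pi * ((2 * i : ℕ) : ℝ) / p, z.2) := Prod.ext h rfl
  rw [e, asi_cov, abs_eq_zero, si, Real.sin_eq_zero_iff]
  exact ⟨i, by push_cast; field_simp⟩

/-! Contraction and expansion on the cylinder -/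

/-- The map `F` contracts `y cos (p x / 2)` and expands `y sin (p x / 2)` near the boundary circle,
which it preserves with all lines. -/
structure ContractsExpands (p : ℕ) (μ r : ℝ) (F : Cylinder → Cylinder) : Prop where
  x_le : ∀ z ∈ Cyl r, (F z).2 * aco p (F z) ≤ μ * (z.2 * aco p z)
  y_le : ∀ z ∈ Cyl r, z.2 * asi p z ≤ μ * ((F z).2 * asi p (F z))
  tan_le : ∀ z ∈ Cyl r, asi p z * aco p (F z) ≤ μ * (aco p z * asi p (F z))
  co_iff : ∀ z ∈ Cyl r, (aco p (F z) = 0 ↔ aco p z = 0)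
  si_iff : ∀ z ∈ Cyl r, (asi p (F z) = 0 ↔ asi p z = 0)
  line : ∀ z ∈ Cyl r, ∀ j, z ∈ line p j → F z ∈ line p j

theorem NearLinear.contractsExpands (h : NearLinear p μ Λ κ r f f') (hm : NearModel p lam k r f f')
    (hF : ∀ w ∈ strip r, cov (f w) = F (cov w)) : ContractsExpands p μ r F := by
  have key : ∀ z ∈ Cyl r, ∃ w ∈ strip r, z = cov w ∧ F z = cov (f w) := by
    intro z hz
    obtain ⟨w, rfl⟩ := cov_surjective z
    exact ⟨w, hz, rfl, (hF w hz).symm⟩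
  have habs : ∀ a b : ℝ, 0 ≤ a → a * |b| = |a * b| := fun a b ha => by
    rw [abs_mul, abs_of_nonneg ha]
  have hcov2 : ∀ w : ℝ × ℝ, (cov w).2 = w.2 := fun _ => rfl
  refine ⟨fun z hz => ?_, fun z hz => ?_, fun z hz => ?_, fun z hz => ?_, fun z hz => ?_,
    fun z hz j hj => ?_⟩ <;> obtain ⟨w, hw, rfl, e⟩ := key z hz <;> rw [e]
  · rw [aco_cov, aco_cov, hcov2, hcov2, habs _ _ (h.nonneg hw), habs _ _ hw.1]
    exact h.abs_x_le hw
  · rw [asi_cov, asi_cov, hcov2, hcov2, habs _ _ (h.nonneg hw), habs _ _ hw.1]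
    exact h.le_abs_y hw
  · rw [asi_cov, aco_cov, asi_cov, aco_cov]
    exact h.tan_le hw
  · rw [aco_cov, aco_cov, abs_eq_zero, abs_eq_zero]
    exact h.co_eq_zero_iff hw
  · rw [asi_cov, asi_cov, abs_eq_zero, abs_eq_zero]
    exact h.si_eq_zero_iff hw
  · have e2 : cov w = cov (Real.pi * (j : ℤ) / p, w.2) := Prod.ext (by rw [Int.cast_natCast]; exact hj) rfl
    rw [← e, e2, ← hF (Real.pi * (j : ℤ) / p, w.2) hw]
    change (((f _).1 : ℝ) : Real.Angle) = _
    rw [hm.lines j w.2 hw.1 hw.2]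
    simp

theorem iterate_shift (F : Cylinder → Cylinder) (N n : ℕ) (z : Cylinder) :
    F^[n] (F^[N] z) = F^[N + n] z := by
  rw [add_comm, Function.iterate_add_apply]

namespace ContractsExpands

/-- If |sin| did not increase, |cos| would not decrease, against the contraction of their quotient
by μ. So |sin| is a strict Lyapunov function off the lines; it excludes further fixed points and
gives the Morse-Smale property. -/
theorem lt_of_aco_asi_ne_zero (h : ContractsExpands p μ r F) (hμ0 : 0 < μ) (hμ1 : μ < 1)
    {z : Cylinder} (hz : z ∈ Cyl r) (h0 : asi p z * aco p z ≠ 0) : asi p z < asi p (F z) := by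
  have h1 := h.tan_le z hz
  have e1 := asi_sq_add_aco_sq p z
  have e2 := asi_sq_add_aco_sq p (F z)
  have n1 := asi_nonneg p z
  have n2 := aco_nonneg p z
  have n3 := asi_nonneg p (F z)
  have n4 := aco_nonneg p (F z)
  by_contra hcon
  have h2 := not_lt.1 hcon
  have h3 : aco p z ≤ aco p (F z) := by
    refine le_of_sq_le_sq ?_ n4
    nlinarith
  have h4 : asi p z * aco p z ≤ asi p z * aco p (F z) := by gcongr
  have h5 : μ * (aco p z * asi p (F z)) ≤ μ * (aco p z * asi p z) := by gcongr
  have h6 : 0 < asi p z * aco p z := lt_of_le_of_ne (by positivity) (Ne.symm h0)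
  nlinarith

theorem eq_zero_of_fixed (h : ContractsExpands p μ r F) (hμ0 : 0 < μ) (hμ1 : μ < 1)
    {z : Cylinder} (hz : z ∈ Cyl r) (hfix : F z = z) : asi p z = 0 ∨ aco p z = 0 := by
  by_contra! hcon
  have := h.lt_of_aco_asi_ne_zero hμ0 hμ1 hz (mul_ne_zero hcon.1 hcon.2)
  rw [hfix] at this
  exact lt_irrefl _ this

theorem asi_le (h : ContractsExpands p μ r F) (hμ0 : 0 < μ) (hμ1 : μ < 1)
    {z : Cylinder} (hz : z ∈ Cyl r) : asi p z ≤ asi p (F z) := by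
  by_cases h0 : asi p z * aco p z = 0
  · rcases mul_eq_zero.1 h0 with h1 | h1
    · rw [h1]; exact asi_nonneg _ _
    · have h2 := (h.co_iff z hz).2 h1
      have e1 := asi_sq_add_aco_sq p z
      have e2 := asi_sq_add_aco_sq p (F z)
      rw [h1] at e1; rw [h2] at e2
      refine le_of_sq_le_sq ?_ (asi_nonneg _ _)
      linarith
  · exact (h.lt_of_aco_asi_ne_zero hμ0 hμ1 hz h0).le

variable (h : ContractsExpands p μ r F)
include h

theorem iterate_forward (hμ0 : 0 < μ) {z : Cylinder} (hz : ∀ n, F^[n] z ∈ Cyl r) (n : ℕ) :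
    z.2 * asi p z ≤ μ ^ n * ((F^[n] z).2 * asi p (F^[n] z)) ∧
    asi p z * aco p (F^[n] z) ≤ μ ^ n * (aco p z * asi p (F^[n] z)) ∧
    (asi p (F^[n] z) = 0 ↔ asi p z = 0) ∧ (aco p (F^[n] z) = 0 ↔ aco p z = 0) ∧
    (∀ j, z ∈ CylinderDynamics.line p j → F^[n] z ∈ CylinderDynamics.line p j) := by
  induction n with
  | zero => simp [mul_comm]
  | succ n ih =>
    obtain ⟨i1, i2, i3, i4, i5⟩ := ih
    rw [Function.iterate_succ_apply']
    refine ⟨?_, ?_, (h.si_iff _ (hz n)).trans i3, (h.co_iff _ (hz n)).trans i4,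
      fun j hj => h.line _ (hz n) j (i5 j hj)⟩
    · refine i1.trans ?_
      rw [pow_succ, mul_assoc]
      have := h.y_le _ (hz n)
      gcongr
    · have h1 := h.tan_le _ (hz n)
      by_cases hc : aco p (F^[n] z) = 0
      · rw [(h.co_iff _ (hz n)).2 hc, mul_zero]
        have := aco_nonneg p z
        have := asi_nonneg p (F (F^[n] z))
        positivity
      by_cases hs : asi p (F^[n] z) = 0
      · rw [i3.1 hs, zero_mul]
        have := aco_nonneg p z
        have := asi_nonneg p (F (F^[n] z))
        positivity
      have c0 : 0 < aco p (F^[n] z) := lt_of_le_of_ne (aco_nonneg _ _) (Ne.symm hc)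
      have s0 : 0 < asi p (F^[n] z) := lt_of_le_of_ne (asi_nonneg _ _) (Ne.symm hs)
      refine le_of_mul_le_mul_right ?_ (mul_pos c0 s0)
      have n1 := asi_nonneg p z
      have n2 := aco_nonneg p (F (F^[n] z))
      have n3 := aco_nonneg p z
      have n4 := asi_nonneg p (F (F^[n] z))
      calc asi p z * aco p (F (F^[n] z)) * (aco p (F^[n] z) * asi p (F^[n] z))
          = (asi p z * aco p (F^[n] z)) * (asi p (F^[n] z) * aco p (F (F^[n] z))) := by ring
        _ ≤ (μ ^ n * (aco p z * asi p (F^[n] z))) *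
            (μ * (aco p (F^[n] z) * asi p (F (F^[n] z)))) := by gcongr
        _ = _ := by ring

end ContractsExpands

/-- A nonnegative number below a bounded sequence times a decaying power vanishes. -/
theorem eq_zero_of_le_pow {a C : ℝ} (hμ0 : 0 ≤ μ) (hμ1 : μ < 1) (ha : 0 ≤ a)
    (h : ∀ᶠ n : ℕ in atTop, a ≤ μ ^ n * C) : a = 0 := by
  have h1 : Tendsto (fun n : ℕ => μ ^ n * C) atTop (𝓝 (0 * C)) :=
    (tendsto_pow_atTop_nhds_zero_of_lt_one hμ0 hμ1).mul_const C
  rw [zero_mul] at h1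
  exact le_antisymm (ge_of_tendsto h1 h) ha

theorem eventually_mem_cyl {z : ℕ → Cylinder} {P : Cylinder} (hr : 0 < r) (hP : P.2 = 0)
    (h1 : ∀ n, z n ∈ Cyl 1) (hz : Tendsto z atTop (𝓝 P)) : ∃ N, ∀ n, z (N + n) ∈ Cyl r := by
  have h2 : Tendsto (fun n => (z n).2) atTop (𝓝 0) := by
    rw [← hP]; exact (continuous_snd.tendsto P).comp hz
  obtain ⟨N, hN⟩ := eventually_atTop.1 (h2.eventually (gt_mem_nhds hr))
  exact ⟨N, fun n => ⟨(h1 _).1, hN _ (Nat.le_add_right _ _)⟩⟩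

namespace ContractsExpands

/-- The tail of the orbit lies where the contraction estimates hold, and there |cos| tends to 1. The
contraction of |cos|/|sin| then forces sin = 0 on the tail, and convergence to P identifies the even
line. The finite initial piece is pulled back with `hback`, because it may leave the region of the
estimates. -/
theorem stable_even (h : ContractsExpands p μ r F) (hp : 1 ≤ p) (hμ0 : 0 < μ) (hμ1 : μ < 1)
    (hr : 0 < r)
    (hback : ∀ z ∈ Cyl 1, ∀ i, F z ∈ CylinderDynamics.line p (2 * i) → z ∈ CylinderDynamics.line p (2 * i))
    {P : Cylinder} (hP2 : P.2 = 0) {i : ℕ} (hP : P ∈ CylinderDynamics.line p (2 * i)) :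
    stableManifold 1 F P ⊆ CylinderDynamics.line p (2 * i) := by
  rintro z ⟨hz1, hz⟩
  obtain ⟨N, hN⟩ := eventually_mem_cyl hr hP2 hz1 hz
  have hN' : ∀ n, F^[n] (F^[N] z) ∈ Cyl r := fun n => by rw [iterate_shift]; exact hN n
  have hlim : Tendsto (fun n => F^[n] (F^[N] z)) atTop (𝓝 P) := by
    simp only [iterate_shift, add_comm N]
    exact (tendsto_add_atTop_iff_nat N).2 hz
  set w := F^[N] z with hw
  have hs : asi p w = 0 := by
    have hc : aco p P = 1 := by
      have := asi_sq_add_aco_sq p P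
      rw [asi_eq_zero_of_line hp hP] at this
      nlinarith [aco_nonneg p P]
    have hcl := ((continuous_aco p).tendsto P).comp hlim
    rw [hc] at hcl
    refine eq_zero_of_le_pow (C := 2) hμ0.le hμ1 (asi_nonneg _ _) ?_
    filter_upwards [hcl.eventually (lt_mem_nhds (by norm_num : (1 / 2 : ℝ) < 1))] with n hn
    have hn' : 1 / 2 < aco p (F^[n] w) := hn
    have h1 := (h.iterate_forward hμ0 hN' n).2.1
    have h2 : aco p w * asi p (F^[n] w) ≤ 1 :=
      mul_le_one₀ (aco_le_one _ _) (asi_nonneg _ _) (asi_le_one _ _)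
    have h3 : μ ^ n * (aco p w * asi p (F^[n] w)) ≤ μ ^ n * 1 := by gcongr
    nlinarith [asi_nonneg p w]
  obtain ⟨m, -, hm⟩ := exists_even_line hp hs
  have hPm : P ∈ CylinderDynamics.line p (2 * m) :=
    (isClosed_line p _).mem_of_tendsto hlim
      (Eventually.of_forall fun n => (h.iterate_forward hμ0 hN' n).2.2.2.2 _ hm)
  have hwi : w ∈ CylinderDynamics.line p (2 * i) := hm.trans (hPm.symm.trans hP)
  have key : ∀ n ≤ N, F^[N - n] z ∈ CylinderDynamics.line p (2 * i) := by
    intro n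
    induction n with
    | zero => intro _; exact hwi
    | succ n ih =>
      intro hn
      have h1 := ih (by omega)
      rw [show N - n = (N - (n + 1)) + 1 by omega, Function.iterate_succ_apply'] at h1
      exact hback _ (hz1 _) i h1
  simpa using key N le_rfl

/-- Along the bounded tail y|sin| would grow geometrically, so it is zero. The alternative sin = 0
would place the limit on an even line, hence the height vanishes; `hzero` pulls this back to z. -/
theorem stable_odd (h : ContractsExpands p μ r F) (hp : 1 ≤ p) (hμ0 : 0 < μ) (hμ1 : μ < 1)
    (hr : 0 < r) (hzero : ∀ z ∈ Cyl 1, ((F z).2 = 0 ↔ z.2 = 0))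
    {P : Cylinder} (hP2 : P.2 = 0) {i : ℕ} (hP : P ∈ CylinderDynamics.line p (2 * i + 1)) :
    stableManifold 1 F P ⊆ {w | w.2 = 0} := by
  rintro z ⟨hz1, hz⟩
  obtain ⟨N, hN⟩ := eventually_mem_cyl hr hP2 hz1 hz
  have hN' : ∀ n, F^[n] (F^[N] z) ∈ Cyl r := fun n => by rw [iterate_shift]; exact hN n
  have hlim : Tendsto (fun n => F^[n] (F^[N] z)) atTop (𝓝 P) := by
    simp only [iterate_shift, add_comm N]
    exact (tendsto_add_atTop_iff_nat N).2 hz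
  set w := F^[N] z with hw
  have hs : w.2 * asi p w = 0 := by
    refine eq_zero_of_le_pow (C := r) hμ0.le hμ1 (mul_nonneg (hN' 0).1 (asi_nonneg _ _))
      (Eventually.of_forall fun n => ?_)
    refine (h.iterate_forward hμ0 hN' n).1.trans ?_
    have h1 : (F^[n] w).2 * asi p (F^[n] w) ≤ r * 1 :=
      mul_le_mul (hN' n).2.le (asi_le_one _ _) (asi_nonneg _ _) hr.le
    rw [mul_one] at h1
    gcongr
  have hw0 : w.2 = 0 := by
    rcases mul_eq_zero.1 hs with h0 | h0
    · exact h0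
    exfalso
    have hsl := ((continuous_asi p).tendsto P).comp hlim
    have e : (asi p ∘ fun n => F^[n] w) = fun _ => 0 := by
      funext n
      exact (h.iterate_forward hμ0 hN' n).2.2.1.2 h0
    rw [e] at hsl
    have h1 := tendsto_nhds_unique hsl tendsto_const_nhds
    have := asi_sq_add_aco_sq p P
    rw [aco_eq_zero_of_line hp hP, h1] at this
    norm_num at this
  have key : ∀ n ≤ N, (F^[N - n] z).2 = 0 := by
    intro n
    induction n with
    | zero => intro _; exact hw0
    | succ n ih =>
      intro hn
      have h1 := ih (by omega)
      rw [show N - n = (N - (n + 1)) + 1 by omega, Function.iterate_succ_apply'] at h1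
      exact (hzero _ (hz1 _)).1 h1
  simpa using key N le_rfl

/-- A backward orbit read forwards: w 0 is the n-th iterate of w n, so y|cos| and the cotangent at w
0 are μ^n times smaller than at w n. -/
theorem iterate_backward (h : ContractsExpands p μ r F) (hμ0 : 0 < μ) {w : ℕ → Cylinder}
    (hw : ∀ n, w n ∈ Cyl r) (hF : ∀ n, F (w (n + 1)) = w n) (n : ℕ) :
    (w 0).2 * aco p (w 0) ≤ μ ^ n * ((w n).2 * aco p (w n)) ∧
    asi p (w n) * aco p (w 0) ≤ μ ^ n * (aco p (w n) * asi p (w 0)) ∧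
    (asi p (w n) = 0 ↔ asi p (w 0) = 0) ∧ (aco p (w n) = 0 ↔ aco p (w 0) = 0) ∧
    (∀ j, w n ∈ CylinderDynamics.line p j → w 0 ∈ CylinderDynamics.line p j) := by
  have hit : ∀ m, F^[m] (w m) = w 0 ∧ ∀ j ≤ m, F^[j] (w m) ∈ Cyl r := by
    intro m
    induction m with
    | zero => exact ⟨rfl, fun j hj => by
        obtain rfl := Nat.le_zero.1 hj
        exact hw 0⟩
    | succ m ih =>
      refine ⟨by rw [Function.iterate_succ_apply, hF]; exact ih.1, fun j hj => ?_⟩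
      cases j with
      | zero => exact hw _
      | succ j =>
        rw [Function.iterate_succ_apply, hF]
        exact ih.2 j (by omega)
  induction n with
  | zero => simp [mul_comm]
  | succ n ih =>
    obtain ⟨i1, i2, i3, i4, i5⟩ := ih
    have hx := h.x_le _ (hw (n + 1))
    have ht := h.tan_le _ (hw (n + 1))
    have hc := h.co_iff _ (hw (n + 1))
    have hs := h.si_iff _ (hw (n + 1))
    have hl := h.line _ (hw (n + 1))
    rw [hF] at hx ht hc hs hl
    refine ⟨?_, ?_, hs.symm.trans i3, hc.symm.trans i4, fun j hj => i5 j (hl j hj)⟩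
    · refine i1.trans ?_
      rw [pow_succ, mul_assoc]
      gcongr
    · have n1 := asi_nonneg p (w 0)
      have n2 := aco_nonneg p (w 0)
      have n3 := aco_nonneg p (w (n + 1))
      have n4 := asi_nonneg p (w (n + 1))
      by_cases hc0 : aco p (w n) = 0
      · rw [i4.1 hc0, mul_zero]
        positivity
      by_cases hs0 : asi p (w n) = 0
      · rw [hs.1 hs0, zero_mul]
        positivity
      have c0 : 0 < aco p (w n) := lt_of_le_of_ne (aco_nonneg _ _) (Ne.symm hc0)
      have s0 : 0 < asi p (w n) := lt_of_le_of_ne (asi_nonneg _ _) (Ne.symm hs0)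
      refine le_of_mul_le_mul_right ?_ (mul_pos c0 s0)
      calc asi p (w (n + 1)) * aco p (w 0) * (aco p (w n) * asi p (w n))
          = (asi p (w (n + 1)) * aco p (w n)) * (asi p (w n) * aco p (w 0)) := by ring
        _ ≤ (μ * (aco p (w (n + 1)) * asi p (w n))) * (μ ^ n * (aco p (w n) * asi p (w 0))) := by
            gcongr
        _ = _ := by ring

/-- The mirror of `stable_odd` in backward time: y|cos| must vanish, and cos = 0 would contradict
the limit on an even line. -/
theorem unstable_even (h : ContractsExpands p μ r F) (hp : 1 ≤ p) (hμ0 : 0 < μ) (hμ1 : μ < 1)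
    (hr : 0 < r) (hzero : ∀ z ∈ Cyl 1, ((F z).2 = 0 ↔ z.2 = 0))
    {P : Cylinder} (hP2 : P.2 = 0) {i : ℕ} (hP : P ∈ CylinderDynamics.line p (2 * i)) :
    unstableManifold 1 F P ⊆ {w | w.2 = 0} := by
  rintro z ⟨w, rfl, hw1, hwF, hwl⟩
  obtain ⟨N, hN⟩ := eventually_mem_cyl hr hP2 hw1 hwl
  have hlim : Tendsto (fun n => w (N + n)) atTop (𝓝 P) := by
    simp only [add_comm N]
    exact (tendsto_add_atTop_iff_nat N).2 hwl
  have hb := h.iterate_backward hμ0 hN fun n => hwF (N + n)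
  have hs : (w (N + 0)).2 * aco p (w (N + 0)) = 0 := by
    refine eq_zero_of_le_pow (C := r) hμ0.le hμ1 (mul_nonneg (hN 0).1 (aco_nonneg _ _))
      (Eventually.of_forall fun n => ?_)
    refine (hb n).1.trans ?_
    have h1 : (w (N + n)).2 * aco p (w (N + n)) ≤ r * 1 :=
      mul_le_mul (hN n).2.le (aco_le_one _ _) (aco_nonneg _ _) hr.le
    rw [mul_one] at h1
    gcongr
  have hw0 : (w N).2 = 0 := by
    rcases mul_eq_zero.1 hs with h0 | h0
    · exact h0
    exfalso
    have hsl := ((continuous_aco p).tendsto P).comp hlim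
    have e : (aco p ∘ fun n => w (N + n)) = fun _ => 0 := by
      funext n
      exact (hb n).2.2.2.1.2 h0
    rw [e] at hsl
    have h1 := tendsto_nhds_unique hsl tendsto_const_nhds
    have := asi_sq_add_aco_sq p P
    rw [asi_eq_zero_of_line hp hP, h1] at this
    norm_num at this
  have key : ∀ n ≤ N, (w (N - n)).2 = 0 := by
    intro n
    induction n with
    | zero => intro _; exact hw0
    | succ n ih =>
      intro hn
      have h1 := ih (by omega)
      rw [show N - n = (N - (n + 1)) + 1 by omega] at h1
      rw [← hwF (N - (n + 1))]
      exact (hzero _ (hw1 _)).2 h1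
  simpa using key N le_rfl

/-- The mirror of `stable_even`. The remote part of the backward orbit lies on the odd line of P,
and `hfwd` carries this forward as long as the orbit stays in the cylinder. -/
theorem unstable_odd (h : ContractsExpands p μ r F) (hp : 1 ≤ p) (hμ0 : 0 < μ) (hμ1 : μ < 1)
    (hr : 0 < r)
    (hfwd : ∀ z ∈ Cyl 1, ∀ i, z ∈ CylinderDynamics.line p (2 * i + 1) → F z ∈ Cyl 1 →
      F z ∈ CylinderDynamics.line p (2 * i + 1))
    {P : Cylinder} (hP2 : P.2 = 0) {i : ℕ} (hP : P ∈ CylinderDynamics.line p (2 * i + 1)) :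
    unstableManifold 1 F P ⊆ CylinderDynamics.line p (2 * i + 1) := by
  rintro z ⟨w, rfl, hw1, hwF, hwl⟩
  obtain ⟨N, hN⟩ := eventually_mem_cyl hr hP2 hw1 hwl
  have hlim : Tendsto (fun n => w (N + n)) atTop (𝓝 P) := by
    simp only [add_comm N]
    exact (tendsto_add_atTop_iff_nat N).2 hwl
  have hb := h.iterate_backward hμ0 hN fun n => hwF (N + n)
  have hs : aco p (w (N + 0)) = 0 := by
    have hc : asi p P = 1 := by
      have := asi_sq_add_aco_sq p P
      rw [aco_eq_zero_of_line hp hP] at this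
      nlinarith [asi_nonneg p P]
    have hcl := ((continuous_asi p).tendsto P).comp hlim
    rw [hc] at hcl
    refine eq_zero_of_le_pow (C := 2) hμ0.le hμ1 (aco_nonneg _ _) ?_
    filter_upwards [hcl.eventually (lt_mem_nhds (by norm_num : (1 / 2 : ℝ) < 1))] with n hn
    have hn' : 1 / 2 < asi p (w (N + n)) := hn
    have h1 := (hb n).2.1
    have h2 : aco p (w (N + n)) * asi p (w (N + 0)) ≤ 1 :=
      mul_le_one₀ (aco_le_one _ _) (asi_nonneg _ _) (asi_le_one _ _)
    have h3 : μ ^ n * (aco p (w (N + n)) * asi p (w (N + 0))) ≤ μ ^ n * 1 := by gcongr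
    nlinarith [aco_nonneg p (w (N + 0))]
  obtain ⟨m, -, hm⟩ := exists_odd_line hp hs
  -- Every point of the backward orbit lies on some odd line; lines are preserved forwards, so it is
  -- always the line of w N, and this line is closed.
  have hPm : P ∈ CylinderDynamics.line p (2 * m + 1) := by
    refine (isClosed_line p _).mem_of_tendsto hlim (Eventually.of_forall fun n => ?_)
    obtain ⟨m', -, hm'⟩ := exists_odd_line hp ((hb n).2.2.2.1.2 hs)
    exact hm'.trans (((hb n).2.2.2.2 _ hm').symm.trans hm)
  have hwi : w N ∈ CylinderDynamics.line p (2 * i + 1) := hm.trans (hPm.symm.trans hP)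
  have key : ∀ n ≤ N, w (N - n) ∈ CylinderDynamics.line p (2 * i + 1) := by
    intro n
    induction n with
    | zero => intro _; exact hwi
    | succ n ih =>
      intro hn
      have h1 := ih (by omega)
      rw [show N - n = (N - (n + 1)) + 1 by omega] at h1
      have h2 := hwF (N - (n + 1))
      rw [← h2]
      exact hfwd _ (hw1 _) i h1 (by rw [h2]; exact hw1 _)
  simpa using key N le_rfl

end ContractsExpands

variable {p : ℕ} {lam k r : ℝ} {f : ℝ × ℝ → ℝ × ℝ} {f' : ℝ × ℝ → (ℝ × ℝ) →L[ℝ] (ℝ × ℝ)}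
  {F : Cylinder → Cylinder}

/-- A lift that is close to the model commutes with the deck transformations. -/
theorem lift_add_two_pi (hp : 1 ≤ p) (hk : k ≤ 1)
    (hclose : ∀ w ∈ strip r, ‖f w - modelLift p lam w‖ ≤ k)
    (hF : ∀ w ∈ strip r, cov (f w) = F (cov w)) {w : ℝ × ℝ} (hw : w ∈ strip r) (n : ℤ) :
    f (w + (2 * Real.pi * n, 0)) = f w + (2 * Real.pi * n, 0) := by
  have hw' : w + (2 * Real.pi * n, 0) ∈ strip r := by simpa [strip] using hw
  have e : cov (f w) = cov (f (w + (2 * Real.pi * n, 0))) := by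
    rw [hF _ hw, hF _ hw']
    congr 1
    exact cov_eq_iff.2 ⟨n, by simp, by simp⟩
  obtain ⟨m, hm1, hm2⟩ := cov_eq_iff.1 e
  have h1 := (norm_fst_le _).trans (hclose _ hw)
  have h2 := (norm_fst_le _).trans (hclose _ hw')
  rw [modelLift_add_two_pi hp] at h2
  simp only [Prod.fst_sub, Prod.fst_add, Real.norm_eq_abs, hm1] at h1 h2
  have h3 := abs_sub ((f w).1 + 2 * Real.pi * m - ((modelLift p lam w).1 + 2 * Real.pi * n))
    ((f w).1 - (modelLift p lam w).1)
  have e3 : (f w).1 + 2 * Real.pi * m - ((modelLift p lam w).1 + 2 * Real.pi * n) -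
      ((f w).1 - (modelLift p lam w).1) = 2 * Real.pi * (m - n) := by ring
  rw [e3, abs_mul, abs_of_pos Real.two_pi_pos] at h3
  -- Both values are k-close to the model, which commutes with translations, so 2π|m − n| ≤ 2k ≤ 2 <
  -- 2π.
  have h4 : |(m : ℝ) - n| < 1 := by nlinarith [Real.pi_gt_three, abs_nonneg ((m : ℝ) - n)]
  have h5 : |m - n| < 1 := by exact_mod_cast h4
  have h6 : m = n := by rw [Int.abs_lt_one_iff] at h5; linarith
  subst h6
  ext
  · simp [hm1]
  · simp [hm2]

/-! Circle diffeomorphisms from lifts -/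

theorem isCircleDiffeo_of_lift {φ φ' : ℝ → ℝ} (hφ : ∀ t, HasDerivAt φ (φ' t) t)
    (hc : Continuous φ') (hpos : ∀ t, 0 < φ' t)
    (hper : ∀ (t : ℝ) (n : ℤ), φ (t + 2 * Real.pi * n) = φ t + 2 * Real.pi * n)
    {g : Real.Angle → Real.Angle} (hg : ∀ t : ℝ, ((φ t : ℝ) : Real.Angle) = g t) :
    IsCircleDiffeo g := by
  have hcφ : Continuous φ := continuous_iff_continuousAt.2 fun t => (hφ t).continuousAt
  have hmono : StrictMono φ := strictMono_of_deriv_pos fun t => by rw [(hφ t).deriv]; exact hpos t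
  refine ⟨⟨fun x y hxy => ?_, fun y => ?_⟩, fun x => ?_⟩
  · obtain ⟨s, rfl⟩ := QuotientAddGroup.mk_surjective x
    obtain ⟨t, rfl⟩ := QuotientAddGroup.mk_surjective y
    have h1 : ((φ s : ℝ) : Real.Angle) = (φ t : ℝ) := (hg s).trans (hxy.trans (hg t).symm)
    obtain ⟨n, hn⟩ := Real.Angle.angle_eq_iff_two_pi_dvd_sub.1 h1
    have h2 : φ s = φ (t + 2 * Real.pi * n) := by rw [hper]; linarith
    have h3 := hmono.injective h2
    exact Real.Angle.angle_eq_iff_two_pi_dvd_sub.2 ⟨n, by rw [h3]; ring⟩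
  · obtain ⟨t, rfl⟩ := QuotientAddGroup.mk_surjective y
    have hex : ∃ s, φ s = t := by
      have h0 := fun n : ℤ => hper 0 n
      obtain ⟨n, hn⟩ := exists_int_gt ((t - φ 0) / (2 * Real.pi))
      obtain ⟨m, hm⟩ := exists_int_lt ((t - φ 0) / (2 * Real.pi))
      rw [div_lt_iff₀ Real.two_pi_pos] at hn
      rw [lt_div_iff₀ Real.two_pi_pos] at hm
      exact mem_range_of_exists_le_of_exists_ge hcφ ⟨0 + 2 * Real.pi * m, by rw [h0]; linarith⟩
        ⟨0 + 2 * Real.pi * n, by rw [h0]; linarith⟩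
    obtain ⟨s, hs⟩ := hex
    refine ⟨(s : Real.Angle), (hg s).symm.trans ?_⟩
    rw [hs]; rfl
  · obtain ⟨s, rfl⟩ := QuotientAddGroup.mk_surjective x
    refine ⟨φ, s, rfl, Eventually.of_forall hg, ?_, by rw [(hφ s).deriv]; exact (hpos s).ne'⟩
    refine ContDiff.contDiffAt (contDiff_one_iff_deriv.2 ⟨fun t => (hφ t).differentiableAt, ?_⟩)
    rwa [show deriv φ = φ' from funext fun t => (hφ t).deriv]

/-- Morse-Smale criterion: away from finitely many hyperbolic fixed points a continuous function
increases along the orbits. -/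
theorem isMorseSmale_of_potential {g : Real.Angle → Real.Angle} (hg : IsCircleDiffeo g)
    (hgc : Continuous g) {S : Real.Angle → ℝ} (hS : Continuous S) {A : Set Real.Angle}
    (hA : A.Finite) (hfix : ∀ x ∈ A, g x = x ∧ ∃ c, HasCircleDerivAt g c x ∧ |c| ≠ 1)
    (hle : ∀ x, S x ≤ S (g x)) (hlt : ∀ x ∉ A, S x < S (g x)) : IsMorseSmale g := by
  have hsub : nonWandering g ⊆ A := by
    intro x hx
    by_contra hxA
    obtain ⟨m, hm1, hm2⟩ := exists_between (hlt x hxA)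
    -- Points of this neighbourhood are above the level m after one step and stay there, while the
    -- neighbourhood lies below m. So they never return.
    have hU : {y | S y < m ∧ m < S (g y)} ∈ 𝓝 x :=
      ((isOpen_lt hS continuous_const).inter
        (isOpen_lt continuous_const (hS.comp hgc))).mem_nhds ⟨hm1, hm2⟩
    obtain ⟨n, hn, _, ⟨y, hy, rfl⟩, hy2⟩ := hx _ hU
    have key : ∀ n : ℕ, m < S (g^[n + 1] y) := by
      intro n
      induction n with
      | zero => exact hy.2
      | succ n ih =>
        rw [Function.iterate_succ_apply']
        exact ih.trans_le (hle _)
    obtain ⟨n, rfl⟩ := Nat.exists_eq_succ_of_ne_zero hn.ne'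
    exact absurd (key n) (not_lt.2 hy2.1.le)
  refine ⟨hg, hA.subset hsub, fun x hx => ?_⟩
  obtain ⟨h1, h2⟩ := hfix x (hsub hx)
  exact ⟨1, one_pos, h1, h2⟩

/-! Derivatives at the boundary -/

theorem fderiv_modelLift_boundary (hp : 1 ≤ p) (hl : 0 < lam) (x : ℝ) :
    fderiv ℝ (modelLift p lam) (x, 0) (1, 0) = (1 / mult p lam x ^ 2, 0) ∧
      fderiv ℝ (modelLift p lam) (x, 0) (0, 1) = (0, mult p lam x) := by
  have hd : HasFDerivAt (modelLift p lam) (fderiv ℝ (modelLift p lam) (x, 0)) (x, 0) :=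
    ((contDiff_modelLift p hl 1).differentiable (by norm_num) _).hasFDerivAt
  constructor
  · have h1 := hd.comp_hasDerivAt x ((hasDerivAt_id x).prodMk (hasDerivAt_const x (0 : ℝ)))
    have h2 : HasDerivAt (modelLift p lam ∘ fun t => (id t, (0 : ℝ)))
        (1 / mult p lam x ^ 2, 0) x := by
      have e : (modelLift p lam ∘ fun t => (id t, (0 : ℝ))) =
          fun t => (modelAngle p lam t, (0 : ℝ)) := by
        funext t; simp [modelLift_eq]
      rw [e]
      exact (hasDerivAt_modelAngle hp hl x).prodMk (hasDerivAt_const x (0 : ℝ))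
    exact h1.unique h2
  · have h1 := hd.comp_hasDerivAt (0 : ℝ)
      ((hasDerivAt_const (0 : ℝ) x).prodMk (hasDerivAt_id (0 : ℝ)))
    have h2 : HasDerivAt (modelLift p lam ∘ fun t : ℝ => (x, id t)) (0, mult p lam x) 0 := by
      have e : (modelLift p lam ∘ fun t : ℝ => (x, id t)) =
          fun t => (modelAngle p lam x, t * mult p lam x) := by
        funext t; simp [modelLift_eq]
      rw [e]
      refine (hasDerivAt_const (0 : ℝ) _).prodMk ?_
      simpa using (hasDerivAt_id (0 : ℝ)).mul_const (mult p lam x)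
    exact h1.unique h2

theorem mult_of_sin_eq_zero (hl : 0 < lam) {x : ℝ} (h : Real.sin (p * x / 2) = 0) :
    mult p lam x = 1 / lam := by
  have h1 := mult_sq p hl x
  have h2 := Real.sin_sq_add_cos_sq (p * x / 2)
  rw [h] at h1 h2
  refine (sq_eq_sq₀ (mult_pos p hl x).le (by positivity)).1 ?_
  rw [h1]
  have : Real.cos (p * x / 2) ^ 2 = 1 := by linarith
  rw [this]; ring

theorem mult_of_cos_eq_zero (hl : 0 < lam) {x : ℝ} (h : Real.cos (p * x / 2) = 0) :
    mult p lam x = lam := by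
  have h1 := mult_sq p hl x
  have h2 := Real.sin_sq_add_cos_sq (p * x / 2)
  rw [h] at h1 h2
  refine (sq_eq_sq₀ (mult_pos p hl x).le hl.le).1 ?_
  rw [h1]
  have : Real.sin (p * x / 2) ^ 2 = 1 := by linarith
  rw [this]; ring

namespace NearModel

theorem abs_fderiv_sub_le (h : NearModel p lam k r f f') (hp : 1 ≤ p) (hl : 0 < lam) (hr : 0 < r)
    (x : ℝ) : |(f' (x, 0) (1, 0)).1 - 1 / mult p lam x ^ 2| ≤ k ∧
      |(f' (x, 0) (0, 1)).2 - mult p lam x| ≤ k := by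
  have hb := h.close.bound (x, 0) ⟨le_rfl, hr⟩
  obtain ⟨e1, e2⟩ := fderiv_modelLift_boundary hp hl x
  have k1 := ContinuousLinearMap.le_of_opNorm_le_of_le _ hb
    (show ‖((1 : ℝ), (0 : ℝ))‖ ≤ 1 by simp [Prod.norm_def])
  have k2 := ContinuousLinearMap.le_of_opNorm_le_of_le _ hb
    (show ‖((0 : ℝ), (1 : ℝ))‖ ≤ 1 by simp [Prod.norm_def])
  rw [sub_apply, e1, mul_one] at k1
  rw [sub_apply, e2, mul_one] at k2
  exact ⟨(norm_fst_le _).trans k1, (norm_snd_le _).trans k2⟩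

theorem hasDerivAt_boundary (h : NearModel p lam k r f f') (hl : 0 < lam) (hr : 0 < r) (x : ℝ) :
    HasDerivAt (fun t => f (t, 0)) (f' (x, 0) (1, 0)) x := by
  have hd := h.deriv hl (w := (x, 0)) ⟨le_rfl, hr⟩
  have h1 := hd.comp_hasDerivWithinAt x (s := univ) (f := fun t => (t, (0 : ℝ)))
    ((hasDerivAt_id x).prodMk (hasDerivAt_const x (0 : ℝ))).hasDerivWithinAt
    fun t _ => ⟨le_rfl, hr⟩
  exact h1.hasDerivAt univ_mem

/-- The derivative f' is the explicit continuous derivative of the model plus a Lipschitz function.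
-/
theorem continuous_deriv_boundary (h : NearModel p lam k r f f') (hp : 1 ≤ p) (hl : 0 < lam)
    (hr : 0 < r) : Continuous fun x => (f' (x, 0) (1, 0)).1 := by
  have hk := h.pos hr
  have h1 : Continuous fun x : ℝ => ((f' (x, 0) - fderiv ℝ (modelLift p lam) (x, 0)) (1, 0)).1 := by
    refine (LipschitzWith.of_dist_le_mul (K := ⟨k, hk⟩) fun x y => ?_).continuous
    have h2 := h.close.lip (x, 0) ⟨le_rfl, hr⟩ (y, 0) ⟨le_rfl, hr⟩
    have k1 := ContinuousLinearMap.le_of_opNorm_le_of_le _ h2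
      (show ‖((1 : ℝ), (0 : ℝ))‖ ≤ 1 by simp [Prod.norm_def])
    rw [mul_one] at k1
    rw [dist_eq_norm, dist_eq_norm, ← Prod.fst_sub]
    refine (norm_fst_le _).trans (k1.trans (le_of_eq ?_))
    rw [Prod.mk_sub_mk, sub_zero, Prod.norm_def, norm_zero, max_eq_left (norm_nonneg _)]
    rfl
  have h2 : Continuous fun x => 1 / mult p lam x ^ 2 := by
    have := (contDiff_mult p hl 1).continuous
    exact continuous_const.div (this.pow 2) fun x => (pow_pos (mult_pos p hl x) 2).ne'
  convert h1.add h2 using 2 with x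
  rw [Pi.add_apply, sub_apply, (fderiv_modelLift_boundary hp hl x).1]
  simp

theorem fixed (h : NearModel p lam k r f f') (hr : 0 < r)
    (hF : ∀ w ∈ strip r, cov (f w) = F (cov w)) (j : ℕ) :
    F (cov (Real.pi * j / p, 0)) = cov (Real.pi * j / p, 0) := by
  rw [← hF _ ⟨le_rfl, hr⟩]
  congr 1
  have := h.lines j 0 le_rfl hr
  rw [Int.cast_natCast] at this
  exact Prod.ext this (h.bdry _)

/-- Invariance of the boundary and of the line makes the derivative diagonal. Its entries are
k-close to λ² and 1/λ on even lines, and to 1/λ² and λ on odd lines. -/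
theorem isHyperbolicSaddle (h : NearModel p lam k r f f') (hp : 1 ≤ p) (hl : 1 < lam) (hr : 0 < r)
    (hk1 : k ≤ 1 / lam ^ 2 / 2) (hk2 : k ≤ (1 - 1 / lam) / 2)
    (hF : ∀ w ∈ strip r, cov (f w) = F (cov w)) (j : ℕ) :
    IsHyperbolicSaddle F (cov (Real.pi * j / p, 0)) ∧
      ∃ c, HasDerivAt (fun t => (f (t, 0)).1) c (Real.pi * j / p) ∧ |c| ≠ 1 := by
  have hp' : (0 : ℝ) < p := by exact_mod_cast hp
  have hl0 : 0 < lam := zero_lt_one.trans hl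
  set x := Real.pi * j / p with hx
  set w : ℝ × ℝ := (x, 0) with hw
  have hws : w ∈ strip r := ⟨le_rfl, hr⟩
  have hd := h.deriv hl0 hws
  obtain ⟨n1, n2⟩ := h.abs_fderiv_sub_le hp hl0 hr x
  have hbd := h.hasDerivAt_boundary hl0 hr x
  have s1 : (f' w (1, 0)).2 = 0 := by
    have h1 : HasDerivAt (fun t => (f (t, 0)).2) (f' w (1, 0)).2 x := hbd.snd
    have h2 : (fun t : ℝ => (f (t, 0)).2) = fun _ => 0 := funext h.bdry
    rw [h2] at h1
    exact h1.unique (hasDerivAt_const x 0)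
  have s2 : (f' w (0, 1)).1 = 0 := by
    have h1 : HasFDerivWithinAt (fun z => (f z).1 - x)
        ((ContinuousLinearMap.fst ℝ ℝ ℝ).comp (f' w)) (strip r) w :=
      ((ContinuousLinearMap.fst ℝ ℝ ℝ).hasFDerivAt.comp_hasFDerivWithinAt w hd).sub_const x
    refine fderiv_eq_zero_of_const h1 hws (Or.inr ⟨1, rfl⟩) fun t ht => ?_
    have e : w + t • ((0 : ℝ), (1 : ℝ)) = (x, t) := by simp [hw]
    rw [e] at ht ⊢
    have := h.lines j t ht.1 ht.2
    rw [Int.cast_natCast] at this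
    rw [this, sub_self]
  have e1 : f' w (1, 0) = (f' w (1, 0)).1 • (1, 0) := by ext <;> simp [s1]
  have e2 : f' w (0, 1) = (f' w (0, 1)).2 • (0, 1) := by ext <;> simp [s2]
  have v1 : Module.End.HasEigenvalue (f' w : (ℝ × ℝ) →ₗ[ℝ] (ℝ × ℝ)) (f' w (1, 0)).1 :=
    Module.End.hasEigenvalue_of_hasEigenvector
      (x := ((1 : ℝ), (0 : ℝ))) ⟨Module.End.mem_eigenspace_iff.2 e1, by simp⟩
  have v2 : Module.End.HasEigenvalue (f' w : (ℝ × ℝ) →ₗ[ℝ] (ℝ × ℝ)) (f' w (0, 1)).2 :=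
    Module.End.hasEigenvalue_of_hasEigenvector
      (x := ((0 : ℝ), (1 : ℝ))) ⟨Module.End.mem_eigenspace_iff.2 e2, by simp⟩
  have hD : HasDerivAtPt F (f' w) (cov w) := by
    refine ⟨f, w, rfl, ?_, ?_⟩
    · have : strip r ∈ 𝓝[upperHalf] w := by
        have : {z : ℝ × ℝ | z.2 < r} ∈ 𝓝 w :=
          (isOpen_lt continuous_snd continuous_const).mem_nhds hr
        filter_upwards [mem_nhdsWithin_of_mem_nhds this, self_mem_nhdsWithin] with z hz1 hz2
        exact ⟨hz2, hz1⟩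
      filter_upwards [this] with z hz
      exact hF z hz
    · refine hd.mono_of_mem_nhdsWithin ?_
      have : {z : ℝ × ℝ | z.2 < r} ∈ 𝓝 w :=
        (isOpen_lt continuous_snd continuous_const).mem_nhds hr
      filter_upwards [mem_nhdsWithin_of_mem_nhds this, self_mem_nhdsWithin] with z hz1 hz2
      exact ⟨hz2, hz1⟩
  have il : 1 / lam < 1 := by rw [div_lt_one hl0]; exact hl
  have il2 : 1 / lam ^ 2 = 1 / lam * (1 / lam) := by field_simp
  have ill : 1 / lam * lam = 1 := by field_simp
  have il0 : 0 < 1 / lam := by positivity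
  rw [abs_le] at n1 n2
  have hfx := h.fixed hr hF j
  rcases Nat.even_or_odd' j with ⟨i, hi | hi⟩
  · have hsin : Real.sin (p * x / 2) = 0 := by
      rw [Real.sin_eq_zero_iff]
      exact ⟨i, by rw [hx, hi]; push_cast; field_simp⟩
    rw [mult_of_sin_eq_zero hl0 hsin] at n1 n2
    have e3 : 1 / (1 / lam) ^ 2 = lam ^ 2 := by field_simp
    rw [e3] at n1
    have g1 : 1 < (f' w (1, 0)).1 := by nlinarith
    have g2 : 0 < (f' w (0, 1)).2 := by nlinarith
    have g3 : (f' w (0, 1)).2 < 1 := by linarith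
    refine ⟨⟨hfx, f' w, hD, _, _, ?_, ?_, ?_, v2, v1⟩, (f' w (1, 0)).1, hbd.fst, ?_⟩
    · exact abs_pos.2 g2.ne'
    · rwa [abs_of_pos g2]
    · rwa [abs_of_pos (zero_lt_one.trans g1)]
    · rw [abs_of_pos (zero_lt_one.trans g1)]; exact g1.ne'
  · have hcos : Real.cos (p * x / 2) = 0 := by
      rw [Real.cos_eq_zero_iff]
      exact ⟨i, by rw [hx, hi]; push_cast; field_simp⟩
    rw [mult_of_cos_eq_zero hl0 hcos] at n1 n2
    have g1 : 0 < (f' w (1, 0)).1 := by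
      have : 0 < 1 / lam ^ 2 := by positivity
      linarith
    have g2 : (f' w (1, 0)).1 < 1 := by nlinarith
    have g3 : 1 < (f' w (0, 1)).2 := by nlinarith
    refine ⟨⟨hfx, f' w, hD, _, _, ?_, ?_, ?_, v1, v2⟩, (f' w (1, 0)).1, hbd.fst, ?_⟩
    · exact abs_pos.2 g1.ne'
    · rwa [abs_of_pos g1]
    · rwa [abs_of_pos (zero_lt_one.trans g3)]
    · rw [abs_of_pos g1]; exact g2.ne

end NearModel

/-! ### Boundary structure of a map that preserves the lines. -/

/-- A map that is close to the model near the boundary, and preserves the boundary and the lines,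
is a boundary map in adapted coordinates. -/
theorem exists_hasBoundaryStructure (hp : 1 ≤ p) (hl : 1 < lam) : ∃ k₀ : ℝ, 0 < k₀ ∧
    ∀ (k r : ℝ) (f : ℝ × ℝ → ℝ × ℝ) (f' : ℝ × ℝ → (ℝ × ℝ) →L[ℝ] (ℝ × ℝ))
      (F : Cylinder → Cylinder), k ≤ k₀ → 0 < r → r ≤ 1 → NearModel p lam k r f f' →
      (∀ w ∈ strip r, cov (f w) = F (cov w)) →
      (∀ z ∈ Cyl 1, ((F z).2 = 0 ↔ z.2 = 0)) →
      (∀ z ∈ Cyl 1, ∀ i, F z ∈ line p (2 * i) → z ∈ line p (2 * i)) →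
      (∀ z ∈ Cyl 1, ∀ i, z ∈ line p (2 * i + 1) → F z ∈ Cyl 1 → F z ∈ line p (2 * i + 1)) →
      (∀ z ∈ Cyl 1, F z = z → z.2 = 0) → HasBoundaryStructure p 1 F := by
  have hp' : (0 : ℝ) < p := by exact_mod_cast hp
  have hl0 : 0 < lam := zero_lt_one.trans hl
  have il : 1 / lam < 1 := by rw [div_lt_one hl0]; exact hl
  have il0 : 0 < 1 / lam := by positivity
  obtain ⟨μ, hμ⟩ : ∃ μ, μ = (1 + 1 / lam) / 2 := ⟨_, rfl⟩
  have hμ0 : 0 < μ := by rw [hμ]; positivity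
  have hμ1 : μ < 1 := by rw [hμ]; linarith
  have hlog : 0 < Real.log (9 / 8) := Real.log_pos (by norm_num)
  -- Chosen so that the total distortion exp(3 · 8κ/(1 − μ)) equals 9/8; the 3 bounds the variation
  -- of the potential.
  obtain ⟨κ, hκ⟩ : ∃ κ, κ = (1 - μ) / 24 * Real.log (9 / 8) := ⟨_, rfl⟩
  have hm : 0 < 1 - μ := by linarith
  have hκ0 : 0 < κ := by rw [hκ]; positivity
  have hκ1 : Real.exp (8 * κ / (1 - μ) * 3) - 1 ≤ 1 / 8 := by
    have e : 8 * κ / (1 - μ) * 3 = Real.log (9 / 8) := by rw [hκ]; field_simp; ring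
    rw [e, Real.exp_log (by norm_num)]
    norm_num
  obtain ⟨k₀, hk₀, hlin⟩ := exists_nearLinear hp hl hκ0
  refine ⟨min k₀ (min (1 / lam ^ 2 / 2) ((1 - 1 / lam) / 2)),
    lt_min hk₀ (lt_min (by positivity) (by linarith)),
    fun k r f f' F hk hr hr1 hM hF hzero hback hfwd hfix => ?_⟩
  have hkk := hk.trans (min_le_left _ _)
  have hk1 := (hk.trans (min_le_right _ _)).trans (min_le_left _ _)
  have hk2 := (hk.trans (min_le_right _ _)).trans (min_le_right _ _)
  have hN := hlin k r f f' hkk hr hr1 hM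
  rw [← hμ] at hN
  have hC := hN.contractsExpands hM hF
  have hr01 : ∀ z ∈ Cyl r, z ∈ Cyl 1 := fun z hz => ⟨hz.1, hz.2.trans_le hr1⟩
  have h0r : ∀ x : Real.Angle, ((x, 0) : Cylinder) ∈ Cyl r := fun x => ⟨le_rfl, hr⟩
  have hb : ∀ x : Real.Angle, (F (x, 0)).2 = 0 := fun x => (hzero _ (hr01 _ (h0r x))).2 rfl
  have hcrit : ∀ z : Cylinder, z.2 = 0 → asi p z = 0 ∨ aco p z = 0 →
      ∃ j : ℕ, j ≤ 2 * p ∧ z ∈ line p j := by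
    rintro z hz (h | h)
    · obtain ⟨i, hi, hz⟩ := exists_even_line hp h
      exact ⟨2 * i, by omega, hz⟩
    · obtain ⟨i, hi, hz⟩ := exists_odd_line hp h
      exact ⟨2 * i + 1, by omega, hz⟩
  have hsad := fun j => hM.isHyperbolicSaddle hp hl hr hk1 hk2 hF j
  have hfixed : ∀ z ∈ Cyl 1, F z = z → z.2 = 0 ∧ ∃ j : ℕ, j ≤ 2 * p ∧ z ∈ line p j := by
    intro z hz hFz
    have h0 := hfix z hz hFz
    exact ⟨h0, hcrit z h0 (hC.eq_zero_of_fixed hμ0 hμ1 ⟨hz.1, by rw [h0]; exact hr⟩ hFz)⟩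
  have hgt : ∀ t : ℝ, (((f (t, 0)).1 : ℝ) : Real.Angle) = (F ((t : Real.Angle), 0)).1 := fun t =>
    congrArg (fun z : Cylinder => z.1) (hF (t, 0) ⟨le_rfl, hr⟩)
  have hFx : ∀ x : Real.Angle, F (x, 0) = ((F (x, 0)).1, 0) := fun x => Prod.ext rfl (hb x)
  refine ⟨?_, fun j _ => (hsad j).1, hb, ?_, fun z hz hFz => ?_, fun z hz hFz => ?_, ?_⟩
  · ext z
    constructor
    · rintro ⟨hz, hFz⟩
      obtain ⟨h0, j, hj, hl⟩ := hfixed z hz hFz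
      exact ⟨j, hj, Prod.ext hl h0⟩
    · rintro ⟨j, -, rfl⟩
      exact ⟨⟨le_rfl, one_pos⟩, hM.fixed hr hF j⟩
  · have hdiff : IsCircleDiffeo fun x : Real.Angle => (F (x, 0)).1 := by
      refine isCircleDiffeo_of_lift (φ := fun t => (f (t, 0)).1)
        (φ' := fun t => (f' (t, 0) (1, 0)).1) (fun t => (hM.hasDerivAt_boundary hl0 hr t).fst)
        (hM.continuous_deriv_boundary hp hl0 hr) (fun t => ?_) (fun t n => ?_) hgt
      · have h1 := (abs_le.1 (hM.abs_fderiv_sub_le hp hl0 hr t).1).1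
        have h2 : 1 / lam ^ 2 ≤ 1 / mult p lam t ^ 2 := by
          have := mult_pos p hl0 t
          have := mult_le p hl t
          gcongr
        have h3 : 0 < 1 / lam ^ 2 := by positivity
        linarith
      · have h1 : k ≤ 1 := by linarith
        have := lift_add_two_pi hp h1 hM.close.val hF (w := (t, 0)) ⟨le_rfl, hr⟩ n
        rw [Prod.mk_add_mk, add_zero] at this
        rw [this]; rfl
    have hgc : Continuous fun x : Real.Angle => (F (x, 0)).1 := by
      refine (QuotientAddGroup.isQuotientMap_mk (N := AddSubgroup.zmultiples (2 * Real.pi))).continuous_iff.2 ?_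
      have h1 : Continuous fun t : ℝ => (f (t, 0)).1 :=
        continuous_iff_continuousAt.2 fun t => (hM.hasDerivAt_boundary hl0 hr t).continuousAt.fst
      have h2 := Real.Angle.continuous_coe.comp h1
      exact h2.congr hgt
    have hi : Continuous fun x : Real.Angle => ((x, 0) : Cylinder) := by fun_prop
    -- The Lyapunov function is |sin(px/2)|, strictly increasing off the hyperbolic fixed points on
    -- the lines.
    refine isMorseSmale_of_potential hdiff hgc (S := fun x => asi p (x, 0))
      ((continuous_asi p).comp hi)
      (A := (fun j : ℕ => ((Real.pi * j / p : ℝ) : Real.Angle)) '' (Finset.range (2 * p + 1)))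
      ((Finset.finite_toSet _).image _) ?_ (fun x => ?_) (fun x hx => ?_)
    · rintro _ ⟨j, -, rfl⟩
      obtain ⟨-, c, hc, hc1⟩ := hsad j
      exact ⟨congrArg (fun z : Cylinder => z.1) (hM.fixed hr hF j), c,
        ⟨_, _, rfl, Eventually.of_forall hgt, hc⟩, hc1⟩
    · have := hC.asi_le hμ0 hμ1 (h0r x)
      rw [hFx] at this
      exact this
    · have := hC.lt_of_aco_asi_ne_zero hμ0 hμ1 (h0r x) fun h0 => hx ?_
      · rw [hFx] at this
        exact this
      · obtain ⟨j, hj, hl⟩ := hcrit (x, 0) rfl (mul_eq_zero.1 h0)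
        exact ⟨j, by simpa using Nat.lt_succ_of_le hj, hl.symm⟩
  · obtain ⟨h0, j, hj, hl⟩ := hfixed z hz hFz
    rcases Nat.even_or_odd' j with ⟨i, rfl | rfl⟩
    · exact Or.inr ⟨_, hj, hC.stable_even hp hμ0 hμ1 hr hback h0 hl⟩
    · exact Or.inl (hC.stable_odd hp hμ0 hμ1 hr hzero h0 hl)
  · obtain ⟨h0, j, hj, hl⟩ := hfixed z hz hFz
    rcases Nat.even_or_odd' j with ⟨i, rfl | rfl⟩
    · exact Or.inl (hC.unstable_even hp hμ0 hμ1 hr hzero h0 hl)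
    · exact Or.inr ⟨_, hj, hC.unstable_odd hp hμ0 hμ1 hr hfwd h0 hl⟩
  · exact exists_transition hp hN hμ0 hμ1 (by linarith) hκ0.le hκ1 hr hr1 hF
      fun w hw => hM.deriv hl0 hw

/-! Invariant curves of maps in cross form -/

/-- A rectangle with one side missing. -/
def box (R : ℝ) : Set (ℝ × ℝ) := {w | |w.1| ≤ R ∧ 0 ≤ w.2 ∧ w.2 < 1}

theorem box_eq (R : ℝ) : box R = Icc (-R) R ×ˢ Ico 0 1 := by
  ext w; simp [box, abs_le]

theorem uniqueDiffOn_box {R : ℝ} (hR : 0 < R) : UniqueDiffOn ℝ (box R) := by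
  rw [box_eq]
  exact (uniqueDiffOn_Icc (by linarith)).prod (uniqueDiffOn_Ico 0 1)

/-- The Lipschitz constants of a cross form `(K, L)`: the curve `x = h y` is invariant if
`h s = K (h (τ s), s)` where `τ s = L (h (τ s), s)`. -/
structure CrossForm (R l a b c d : ℝ) (K L : ℝ × ℝ → ℝ) : Prop where
  R_pos : 0 < R
  l_nonneg : 0 ≤ l
  a_nonneg : 0 ≤ a
  b_nonneg : 0 ≤ b
  c_nonneg : 0 ≤ c
  d_nonneg : 0 ≤ d
  graph : a * l + b ≤ l
  time : c * l + d ≤ 1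
  contr : a + l * c < 1
  mapsK : ∀ w ∈ box R, |K w| ≤ R
  mapsL : ∀ w ∈ box R, 0 ≤ L w ∧ L w ≤ w.2
  lipK : ∀ w ∈ box R, ∀ z ∈ box R, |K w - K z| ≤ a * |w.1 - z.1| + b * |w.2 - z.2|
  lipL : ∀ w ∈ box R, ∀ z ∈ box R, |L w - L z| ≤ c * |w.1 - z.1| + d * |w.2 - z.2|

/-- Geometrically decaying increments give uniform limits. -/
theorem exists_limit_of_geometric {S : Set ℝ} {u : ℕ → ℝ → ℝ} {C q : ℝ} (hq0 : 0 ≤ q) (hq : q < 1)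
    (h : ∀ n, ∀ s ∈ S, |u (n + 1) s - u n s| ≤ C * q ^ n) :
    ∃ U : ℝ → ℝ, TendstoUniformlyOn u U atTop S ∧
      ∀ s ∈ S, Tendsto (fun n => u n s) atTop (𝓝 (U s)) := by
  have h' : ∀ s ∈ S, ∀ n, dist (u n s) (u (n + 1) s) ≤ C * q ^ n := fun s hs n => by
    rw [dist_comm, Real.dist_eq]; exact h n s hs
  have hex : ∀ s, ∃ l, s ∈ S → Tendsto (fun n => u n s) atTop (𝓝 l) := by
    intro s
    by_cases hs : s ∈ S
    · obtain ⟨l, hl⟩ := cauchySeq_tendsto_of_complete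
        (cauchySeq_of_le_geometric q C hq (h' s hs))
      exact ⟨l, fun _ => hl⟩
    · exact ⟨0, fun h => absurd h hs⟩
  choose U hU using hex
  refine ⟨U, ?_, hU⟩
  rw [Metric.tendstoUniformlyOn_iff]
  intro ε hε
  have hlim : Tendsto (fun n : ℕ => C * q ^ n / (1 - q)) atTop (𝓝 (C * 0 / (1 - q))) :=
    ((tendsto_pow_atTop_nhds_zero_of_lt_one hq0 hq).const_mul C).div_const _
  rw [mul_zero, zero_div] at hlim
  filter_upwards [hlim.eventually (gt_mem_nhds hε)] with n hn s hs
  rw [dist_comm]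
  exact (dist_le_of_le_geometric_of_tendsto q C hq (h' s hs) (hU s hs) n).trans_lt hn

/-- The graph transform of a cross form, without solving for the time change in each step. -/
def crossIter (K L : ℝ × ℝ → ℝ) : ℕ → (ℝ → ℝ) × (ℝ → ℝ)
  | 0 => (fun _ => 0, fun _ => 0)
  | n + 1 => (fun s => K ((crossIter K L n).1 ((crossIter K L n).2 s), s),
      fun s => L ((crossIter K L n).1 ((crossIter K L n).2 s), s))

namespace CrossForm

variable {R l a b c d : ℝ} {K L : ℝ × ℝ → ℝ}

/-- Curve and time change are obtained together as limits of `crossIter`. The conditions `graph` and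
`time` preserve the Lipschitz constants l and 1, and the increments of the composition of curve and
time change contract by a + lc. -/
theorem exists_curve (h : CrossForm R l a b c d K L) : ∃ η τ : ℝ → ℝ,
    (∀ s ∈ Ico (0 : ℝ) 1, |η s| ≤ R ∧ 0 ≤ τ s ∧ τ s ≤ s ∧ η s = K (η (τ s), s) ∧
      τ s = L (η (τ s), s)) ∧
    ∀ s ∈ Ico (0 : ℝ) 1, ∀ t ∈ Ico (0 : ℝ) 1, |η s - η t| ≤ l * |s - t| ∧ |τ s - τ t| ≤ |s - t| := by
  have hl := h.l_nonneg
  have ha := h.a_nonneg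
  have hb := h.b_nonneg
  have hc := h.c_nonneg
  have hd := h.d_nonneg
  obtain ⟨u, hu⟩ : ∃ u : ℕ → ℝ → ℝ, u = fun n => (crossIter K L n).1 := ⟨_, rfl⟩
  obtain ⟨v, hv⟩ : ∃ v : ℕ → ℝ → ℝ, v = fun n => (crossIter K L n).2 := ⟨_, rfl⟩
  have hu1 : ∀ n s, u (n + 1) s = K (u n (v n s), s) := fun n s => by rw [hu, hv]; rfl
  have hv1 : ∀ n s, v (n + 1) s = L (u n (v n s), s) := fun n s => by rw [hu, hv]; rfl
  have hu0 : ∀ s, u 0 s = 0 := fun s => by rw [hu]; rfl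
  have hv0 : ∀ s, v 0 s = 0 := fun s => by rw [hv]; rfl
  have bd : ∀ n, ∀ s ∈ Ico (0 : ℝ) 1, |u n s| ≤ R ∧ 0 ≤ v n s ∧ v n s ≤ s := by
    intro n
    induction n with
    | zero => intro s hs; rw [hu0, hv0]; simpa using ⟨h.R_pos.le, hs.1⟩
    | succ n ih =>
      intro s hs
      obtain ⟨-, h2, h3⟩ := ih s hs
      have hm : (u n (v n s), s) ∈ box R :=
        ⟨(ih (v n s) ⟨h2, h3.trans_lt hs.2⟩).1, hs.1, hs.2⟩
      rw [hu1, hv1]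
      exact ⟨h.mapsK _ hm, h.mapsL _ hm⟩
  have vI : ∀ n, ∀ s ∈ Ico (0 : ℝ) 1, v n s ∈ Ico (0 : ℝ) 1 := fun n s hs =>
    ⟨(bd n s hs).2.1, (bd n s hs).2.2.trans_lt hs.2⟩
  have hbox : ∀ n, ∀ s ∈ Ico (0 : ℝ) 1, (u n (v n s), s) ∈ box R := fun n s hs =>
    ⟨(bd n _ (vI n s hs)).1, hs.1, hs.2⟩
  have lip : ∀ n, ∀ s ∈ Ico (0 : ℝ) 1, ∀ t ∈ Ico (0 : ℝ) 1,
      |u n s - u n t| ≤ l * |s - t| ∧ |v n s - v n t| ≤ |s - t| := by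
    intro n
    induction n with
    | zero => intro s _ t _; simp only [hu0, hv0, sub_self, abs_zero]; exact ⟨by positivity, by positivity⟩
    | succ n ih =>
      intro s hs t ht
      have h1 : |u n (v n s) - u n (v n t)| ≤ l * |s - t| :=
        ((ih _ (vI n s hs) _ (vI n t ht)).1).trans
          (mul_le_mul_of_nonneg_left (ih s hs t ht).2 hl)
      rw [hu1, hu1, hv1, hv1]
      have n1 := abs_nonneg (s - t)
      constructor
      · refine (h.lipK _ (hbox n s hs) _ (hbox n t ht)).trans ?_
        calc a * |u n (v n s) - u n (v n t)| + b * |s - t| ≤ a * (l * |s - t|) + b * |s - t| := by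
              gcongr
          _ = (a * l + b) * |s - t| := by ring
          _ ≤ l * |s - t| := mul_le_mul_of_nonneg_right h.graph n1
      · refine (h.lipL _ (hbox n s hs) _ (hbox n t ht)).trans ?_
        calc c * |u n (v n s) - u n (v n t)| + d * |s - t| ≤ c * (l * |s - t|) + d * |s - t| := by
              gcongr
          _ = (c * l + d) * |s - t| := by ring
          _ ≤ 1 * |s - t| := mul_le_mul_of_nonneg_right h.time n1
          _ = _ := one_mul _
  obtain ⟨q, hq⟩ : ∃ q, q = a + l * c := ⟨_, rfl⟩
  have hq0 : 0 ≤ q := by rw [hq]; positivity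
  have hq1 : q < 1 := hq ▸ h.contr
  have hR := h.R_pos
  have incK : ∀ n m, ∀ s ∈ Ico (0 : ℝ) 1, |u (n + 1) s - u (m + 1) s| ≤
      a * |u n (v n s) - u m (v m s)| := by
    intro n m s hs
    rw [hu1, hu1]
    refine (h.lipK _ (hbox n s hs) _ (hbox m s hs)).trans (le_of_eq ?_)
    simp
  have incL : ∀ n m, ∀ s ∈ Ico (0 : ℝ) 1, |v (n + 1) s - v (m + 1) s| ≤
      c * |u n (v n s) - u m (v m s)| := by
    intro n m s hs
    rw [hv1, hv1]
    refine (h.lipL _ (hbox n s hs) _ (hbox m s hs)).trans (le_of_eq ?_)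
    simp
  -- The increment of u ∘ v has two parts: the curve changes, with factor a, and it is evaluated at
  -- a changed time, with factor l times c.
  have inc : ∀ n, ∀ s ∈ Ico (0 : ℝ) 1,
      |u (n + 1) (v (n + 1) s) - u n (v n s)| ≤ 2 * R * q ^ n := by
    intro n
    induction n with
    | zero =>
      intro s hs
      have h1 := (hbox 1 s hs).1
      have h2 := (hbox 0 s hs).1
      refine (abs_sub _ _).trans ?_
      rw [pow_zero]; linarith
    | succ n ih =>
      intro s hs
      have h1 := incK (n + 1) n _ (vI (n + 2) s hs)
      have h2 := incL (n + 1) n s hs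
      have h3 := (lip (n + 1) _ (vI (n + 2) s hs) _ (vI (n + 1) s hs)).1
      have h4 := ih _ (vI (n + 2) s hs)
      have h5 := ih s hs
      calc |u (n + 2) (v (n + 2) s) - u (n + 1) (v (n + 1) s)|
          ≤ |u (n + 2) (v (n + 2) s) - u (n + 1) (v (n + 2) s)| +
            |u (n + 1) (v (n + 2) s) - u (n + 1) (v (n + 1) s)| := abs_sub_le _ _ _
        _ ≤ a * (2 * R * q ^ n) + l * (c * (2 * R * q ^ n)) := by
            refine add_le_add (h1.trans (by gcongr)) (h3.trans ?_)
            gcongr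
            exact h2.trans (by gcongr)
        _ = 2 * R * q ^ (n + 1) := by rw [pow_succ, hq]; ring
  obtain ⟨η, -, hη⟩ := exists_limit_of_geometric (S := Ico (0 : ℝ) 1) (u := fun n => u (n + 1))
    (C := a * (2 * R)) hq0 hq1 fun n s hs => by
      refine (incK (n + 1) n s hs).trans ?_
      rw [mul_assoc]
      exact mul_le_mul_of_nonneg_left (inc n s hs) ha
  obtain ⟨τ, -, hτ⟩ := exists_limit_of_geometric (S := Ico (0 : ℝ) 1) (u := fun n => v (n + 1))
    (C := c * (2 * R)) hq0 hq1 fun n s hs => by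
      refine (incL (n + 1) n s hs).trans ?_
      rw [mul_assoc]
      exact mul_le_mul_of_nonneg_left (inc n s hs) hc
  have hbd : ∀ s ∈ Ico (0 : ℝ) 1, |η s| ≤ R ∧ 0 ≤ τ s ∧ τ s ≤ s := fun s hs =>
    ⟨le_of_tendsto (hη s hs).abs (Eventually.of_forall fun n => (bd (n + 1) s hs).1),
      ge_of_tendsto (hτ s hs) (Eventually.of_forall fun n => (bd (n + 1) s hs).2.1),
      le_of_tendsto (hτ s hs) (Eventually.of_forall fun n => (bd (n + 1) s hs).2.2)⟩
  have hτI : ∀ s ∈ Ico (0 : ℝ) 1, τ s ∈ Ico (0 : ℝ) 1 := fun s hs =>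
    ⟨(hbd s hs).2.1, (hbd s hs).2.2.trans_lt hs.2⟩
  have hcomp : ∀ s ∈ Ico (0 : ℝ) 1,
      Tendsto (fun n => u (n + 1) (v (n + 1) s)) atTop (𝓝 (η (τ s))) := by
    intro s hs
    have h1 : Tendsto (fun n => l * |v (n + 1) s - τ s|) atTop (𝓝 (l * |τ s - τ s|)) :=
      (((hτ s hs).sub_const (τ s)).abs).const_mul l
    rw [sub_self, abs_zero, mul_zero] at h1
    have h2 := (hη _ (hτI s hs))
    have h3 : Tendsto (fun n => u (n + 1) (v (n + 1) s) - u (n + 1) (τ s)) atTop (𝓝 0) :=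
      squeeze_zero_norm (fun n => (lip (n + 1) _ (vI _ s hs) _ (hτI s hs)).1) h1
    simpa using h3.add h2
  have lim : ∀ s ∈ Ico (0 : ℝ) 1, η s = K (η (τ s), s) ∧ τ s = L (η (τ s), s) := by
    intro s hs
    have hm : (η (τ s), s) ∈ box R := ⟨(hbd _ (hτI s hs)).1, hs.1, hs.2⟩
    have h0 : Tendsto (fun n => |u (n + 1) (v (n + 1) s) - η (τ s)|) atTop (𝓝 0) := by
      have := ((hcomp s hs).sub_const (η (τ s))).abs
      rwa [sub_self, abs_zero] at this
    constructor
    · have h1 : Tendsto (fun n => u (n + 2) s - K (η (τ s), s)) atTop (𝓝 0) := by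
        have h2 := h0.const_mul a
        rw [mul_zero] at h2
        refine squeeze_zero_norm (fun n => ?_) h2
        rw [hu1]
        refine (h.lipK _ (hbox (n + 1) s hs) _ hm).trans (le_of_eq (by simp))
      have h2 := ((tendsto_add_atTop_iff_nat 1).2 (hη s hs)).sub_const (K (η (τ s), s))
      exact sub_eq_zero.1 (tendsto_nhds_unique h2 h1)
    · have h1 : Tendsto (fun n => v (n + 2) s - L (η (τ s), s)) atTop (𝓝 0) := by
        have h2 := h0.const_mul c
        rw [mul_zero] at h2
        refine squeeze_zero_norm (fun n => ?_) h2
        rw [hv1]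
        refine (h.lipL _ (hbox (n + 1) s hs) _ hm).trans (le_of_eq (by simp))
      have h2 := ((tendsto_add_atTop_iff_nat 1).2 (hτ s hs)).sub_const (L (η (τ s), s))
      exact sub_eq_zero.1 (tendsto_nhds_unique h2 h1)
  refine ⟨η, τ, fun s hs => ⟨(hbd s hs).1, (hbd s hs).2.1, (hbd s hs).2.2, lim s hs⟩,
    fun s hs t ht => ⟨?_, ?_⟩⟩
  · exact le_of_tendsto ((hη s hs).sub (hη t ht)).abs
      (Eventually.of_forall fun n => (lip (n + 1) s hs t ht).1)
  · exact le_of_tendsto ((hτ s hs).sub (hτ t ht)).abs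
      (Eventually.of_forall fun n => (lip (n + 1) s hs t ht).2)

end CrossForm

/-! ### Smoothness of invariant curves. -/

/-- A Lipschitz constant at a point bounds the derivative. -/
theorem abs_deriv_le_of_lip {φ : ℝ → ℝ} {m x C : ℝ} {S : Set ℝ} (h : HasDerivWithinAt φ m S x)
    (hS : UniqueDiffWithinAt ℝ S x) (hl : ∀ t ∈ S, |φ t - φ x| ≤ C * |t - x|) : |m| ≤ C := by
  have h1 := (hasDerivWithinAt_iff_tendsto_slope.1 h).abs
  have : NeBot (𝓝[S \ {x}] x) := accPt_principal_iff_nhdsWithin.1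
    (uniqueDiffWithinAt_iff_accPt.1 hS)
  refine le_of_tendsto h1 ?_
  filter_upwards [self_mem_nhdsWithin] with t ht
  have h2 : 0 < |t - x| := abs_pos.2 (sub_ne_zero.2 ht.2)
  rw [slope_def_field, abs_div, div_le_iff₀ h2]
  exact hl t ht.1

theorem abs_partial_le {R a b : ℝ} (hR : 0 < R) {K : ℝ × ℝ → ℝ} {K' : (ℝ × ℝ) →L[ℝ] ℝ} {w : ℝ × ℝ}
    (hw : w ∈ box R) (hK : HasFDerivWithinAt K K' (box R) w)
    (hl : ∀ z ∈ box R, |K z - K w| ≤ a * |z.1 - w.1| + b * |z.2 - w.2|) :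
    |K' (1, 0)| ≤ a ∧ |K' (0, 1)| ≤ b := by
  constructor
  · have h1 : HasDerivWithinAt (K ∘ fun t => (t, w.2)) (K' (1, 0)) (Icc (-R) R) w.1 :=
      HasFDerivWithinAt.comp_hasDerivWithinAt (t := box R) w.1 hK
        ((hasDerivWithinAt_id w.1 _).prodMk (hasDerivWithinAt_const w.1 _ w.2))
        fun t ht => ⟨abs_le.2 ht, hw.2⟩
    refine abs_deriv_le_of_lip h1 (uniqueDiffOn_Icc (by linarith) _ (abs_le.1 hw.1)) fun t ht => ?_
    have := hl (t, w.2) ⟨abs_le.2 ht, hw.2⟩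
    simpa using this
  · have h1 : HasDerivWithinAt (K ∘ fun t => (w.1, t)) (K' (0, 1)) (Ico 0 1) w.2 :=
      HasFDerivWithinAt.comp_hasDerivWithinAt (t := box R) w.2 hK
        ((hasDerivWithinAt_const w.2 _ w.1).prodMk (hasDerivWithinAt_id w.2 _))
        fun t ht => ⟨hw.1, ht⟩
    refine abs_deriv_le_of_lip h1 (uniqueDiffOn_Ico 0 1 _ hw.2) fun t ht => ?_
    have := hl (w.1, t) ⟨hw.1, ht⟩
    simpa using this

/-- First order expansion along a Lipschitz curve. -/
theorem expansion_along_curve {R l : ℝ} {K : ℝ × ℝ → ℝ} {K' : (ℝ × ℝ) →L[ℝ] ℝ} {ξ : ℝ → ℝ} {s : ℝ}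
    (hK : HasFDerivWithinAt K K' (box R) (ξ s, s)) (hl : 0 ≤ l)
    (hbox : ∀ t ∈ Ico (0 : ℝ) 1, (ξ t, t) ∈ box R)
    (hξ : ∀ t ∈ Ico (0 : ℝ) 1, |ξ t - ξ s| ≤ l * |t - s|) {ε : ℝ} (hε : 0 < ε) :
    ∀ᶠ t in 𝓝[Ico 0 1] s, |K (ξ t, t) - K (ξ s, s) -
      (K' (1, 0) * (ξ t - ξ s) + K' (0, 1) * (t - s))| ≤ ε * |t - s| := by
  have hn : ∀ t ∈ Ico (0 : ℝ) 1, ‖((ξ t, t) : ℝ × ℝ) - (ξ s, s)‖ ≤ (l + 1) * |t - s| := by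
    intro t ht
    have := abs_nonneg (t - s)
    rw [Prod.mk_sub_mk, Prod.norm_def]
    refine max_le ((hξ t ht).trans (by nlinarith)) ?_
    change |t - s| ≤ _
    nlinarith
  have htend : Tendsto (fun t => ((ξ t, t) : ℝ × ℝ)) (𝓝[Ico 0 1] s) (𝓝[box R] (ξ s, s)) := by
    refine tendsto_nhdsWithin_iff.2 ⟨?_, ?_⟩
    · rw [tendsto_iff_norm_sub_tendsto_zero]
      have h1 : Tendsto (fun t => (l + 1) * |t - s|) (𝓝[Ico 0 1] s) (𝓝 0) := by
        have : Continuous fun t => (l + 1) * |t - s| := by fun_prop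
        have h2 := (this.tendsto s).mono_left (nhdsWithin_le_nhds (s := Ico 0 1))
        simpa using h2
      refine squeeze_zero' (Eventually.of_forall fun _ => norm_nonneg _) ?_ h1
      filter_upwards [self_mem_nhdsWithin] with t ht using hn t ht
    · filter_upwards [self_mem_nhdsWithin] with t ht using hbox t ht
  have hε' : 0 < ε / (l + 1) := by positivity
  filter_upwards [htend.eventually ((hasFDerivWithinAt_iff_isLittleO.1 hK).def hε'),
    self_mem_nhdsWithin] with t ht hts
  have e : K' ((ξ t, t) - (ξ s, s)) = K' (1, 0) * (ξ t - ξ s) + K' (0, 1) * (t - s) := by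
    have : ((ξ t, t) : ℝ × ℝ) - (ξ s, s) = (ξ t - ξ s) • (1, 0) + (t - s) • (0, 1) := by
      ext <;> simp
    rw [this, map_add, map_smul, map_smul, smul_eq_mul, smul_eq_mul, mul_comm, mul_comm (t - s)]
  rw [e] at ht
  refine ht.trans ?_
  calc ε / (l + 1) * ‖((ξ t, t) : ℝ × ℝ) - (ξ s, s)‖ ≤ ε / (l + 1) * ((l + 1) * |t - s|) := by
        gcongr
        exact hn t hts
    _ = ε * |t - s| := by field_simp

namespace CrossForm

variable {R l a b c d : ℝ} {K L : ℝ × ℝ → ℝ}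

/-- The invariant curve of a continuously differentiable cross form is continuously
differentiable. -/
theorem exists_C1_curve (h : CrossForm R l a b c d K L)
    (hK : ContDiffOn ℝ 1 K (box R)) (hL : ContDiffOn ℝ 1 L (box R)) : ∃ η τ U V : ℝ → ℝ,
    (∀ s ∈ Ico (0 : ℝ) 1, |η s| ≤ R ∧ 0 ≤ τ s ∧ τ s ≤ s ∧ η s = K (η (τ s), s) ∧
      τ s = L (η (τ s), s)) ∧
    (∀ s ∈ Ico (0 : ℝ) 1, ∀ t ∈ Ico (0 : ℝ) 1,
      |η s - η t| ≤ l * |s - t| ∧ |τ s - τ t| ≤ |s - t|) ∧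
    ContinuousOn U (Ico 0 1) ∧ ContinuousOn V (Ico 0 1) ∧
    ∀ s ∈ Ico (0 : ℝ) 1, HasDerivWithinAt η (U s) (Ico 0 1) s ∧
      HasDerivWithinAt τ (V s) (Ico 0 1) s ∧ |U s| ≤ l ∧ |V s| ≤ 1 := by
  have hl := h.l_nonneg
  have ha := h.a_nonneg
  have hc := h.c_nonneg
  have hUD := uniqueDiffOn_box h.R_pos
  obtain ⟨η, τ, hητ, hlip⟩ := h.exists_curve
  set I : Set ℝ := Ico (0 : ℝ) 1 with hI
  have hτI : ∀ s ∈ I, τ s ∈ I := fun s hs =>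
    ⟨(hητ s hs).2.1, (hητ s hs).2.2.1.trans_lt hs.2⟩
  have hbox : ∀ s ∈ I, (η (τ s), s) ∈ box R := fun s hs => ⟨(hητ _ (hτI s hs)).1, hs.1, hs.2⟩
  have hτc : ContinuousOn τ I := by
    refine LipschitzOnWith.continuousOn (K := 1) (LipschitzOnWith.of_dist_le_mul fun s hs t ht => ?_)
    rw [NNReal.coe_one, one_mul]
    exact (hlip s hs t ht).2
  have hξl : ∀ s ∈ I, ∀ t ∈ I, |η (τ t) - η (τ s)| ≤ l * |t - s| := fun s hs t ht =>
    ((hlip _ (hτI t ht) _ (hτI s hs)).1).trans (mul_le_mul_of_nonneg_left (hlip t ht s hs).2 hl)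
  have hξc : ContinuousOn (fun s => ((η (τ s), s) : ℝ × ℝ)) I := by
    refine ContinuousOn.prodMk ?_ continuousOn_id
    refine LipschitzOnWith.continuousOn (K := ⟨l, hl⟩)
      (LipschitzOnWith.of_dist_le_mul fun s hs t ht => ?_)
    exact hξl t ht s hs
  have hKd : ∀ w ∈ box R, HasFDerivWithinAt K (fderivWithin ℝ K (box R) w) (box R) w :=
    fun w hw => ((hK.differentiableOn (by norm_num)) w hw).hasFDerivWithinAt
  have hLd : ∀ w ∈ box R, HasFDerivWithinAt L (fderivWithin ℝ L (box R) w) (box R) w :=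
    fun w hw => ((hL.differentiableOn (by norm_num)) w hw).hasFDerivWithinAt
  have coef : ∀ (M : ℝ × ℝ → ℝ), ContDiffOn ℝ 1 M (box R) → ∀ e : ℝ × ℝ,
      ContinuousOn (fun s => fderivWithin ℝ M (box R) (η (τ s), s) e) I := by
    intro M hM e
    exact ((hM.continuousOn_fderivWithin hUD le_rfl).comp hξc hbox).clm_apply continuousOn_const
  set k1 : ℝ → ℝ := fun s => fderivWithin ℝ K (box R) (η (τ s), s) (1, 0) with hk1
  set k2 : ℝ → ℝ := fun s => fderivWithin ℝ K (box R) (η (τ s), s) (0, 1) with hk2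
  set l1 : ℝ → ℝ := fun s => fderivWithin ℝ L (box R) (η (τ s), s) (1, 0) with hl1
  set l2 : ℝ → ℝ := fun s => fderivWithin ℝ L (box R) (η (τ s), s) (0, 1) with hl2
  have bk : ∀ s ∈ I, |k1 s| ≤ a ∧ |k2 s| ≤ b := fun s hs =>
    abs_partial_le h.R_pos (hbox s hs) (hKd _ (hbox s hs)) fun z hz => h.lipK z hz _ (hbox s hs)
  have bl : ∀ s ∈ I, |l1 s| ≤ c ∧ |l2 s| ≤ d := fun s hs =>
    abs_partial_le h.R_pos (hbox s hs) (hLd _ (hbox s hs)) fun z hz => h.lipL z hz _ (hbox s hs)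
  -- Formal differentiation of the invariance equations gives U = k₁ U(τ) V + k₂ and V = l₁ U(τ) V +
  -- l₂ for the candidate derivatives. They are solved by the same iteration, with the same
  -- contraction factor, within the continuous functions.
  obtain ⟨D, hD0, hD1⟩ : ∃ D : ℕ → (ℝ → ℝ) × (ℝ → ℝ), D 0 = (fun _ => 0, fun _ => 0) ∧
      ∀ n, D (n + 1) = (fun s => k1 s * ((D n).1 (τ s) * (D n).2 s) + k2 s,
        fun s => l1 s * ((D n).1 (τ s) * (D n).2 s) + l2 s) :=
    ⟨fun n => Nat.rec (fun _ => 0, fun _ => 0) (fun _ P => (fun s => k1 s * (P.1 (τ s) * P.2 s) +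
      k2 s, fun s => l1 s * (P.1 (τ s) * P.2 s) + l2 s)) n, rfl, fun _ => rfl⟩
  have hDc : ∀ n, ContinuousOn (D n).1 I ∧ ContinuousOn (D n).2 I := by
    intro n
    induction n with
    | zero => rw [hD0]; exact ⟨continuousOn_const, continuousOn_const⟩
    | succ n ih =>
      rw [hD1]
      have h1 := (ih.1.comp hτc hτI).mul ih.2
      exact ⟨((coef K hK _).mul h1).add (coef K hK _), ((coef L hL _).mul h1).add (coef L hL _)⟩
  have hDb : ∀ n, ∀ s ∈ I, |(D n).1 s| ≤ l ∧ |(D n).2 s| ≤ 1 := by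
    intro n
    induction n with
    | zero => intro s _; rw [hD0]; simpa using hl
    | succ n ih =>
      intro s hs
      rw [hD1]
      have h1 : |(D n).1 (τ s) * (D n).2 s| ≤ l := by
        rw [abs_mul, ← mul_one l]
        exact mul_le_mul (ih _ (hτI s hs)).1 (ih s hs).2 (abs_nonneg _) hl
      constructor
      · refine ((abs_add_le _ _).trans ?_).trans h.graph
        rw [abs_mul]
        exact add_le_add (mul_le_mul (bk s hs).1 h1 (abs_nonneg _) ha) (bk s hs).2
      · refine ((abs_add_le _ _).trans ?_).trans h.time
        rw [abs_mul]
        exact add_le_add (mul_le_mul (bl s hs).1 h1 (abs_nonneg _) hc) (bl s hs).2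
  obtain ⟨q, hq⟩ : ∃ q, q = a + l * c := ⟨_, rfl⟩
  have hq0 : 0 ≤ q := by rw [hq]; positivity
  have hq1 : q < 1 := hq ▸ h.contr
  have step1 : ∀ n m, ∀ s ∈ I, |(D (n + 1)).1 s - (D (m + 1)).1 s| ≤
      a * |(D n).1 (τ s) * (D n).2 s - (D m).1 (τ s) * (D m).2 s| := by
    intro n m s hs
    rw [hD1, hD1]
    simp only
    rw [add_sub_add_right_eq_sub, ← mul_sub, abs_mul]
    exact mul_le_mul_of_nonneg_right (bk s hs).1 (abs_nonneg _)
  have step2 : ∀ n m, ∀ s ∈ I, |(D (n + 1)).2 s - (D (m + 1)).2 s| ≤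
      c * |(D n).1 (τ s) * (D n).2 s - (D m).1 (τ s) * (D m).2 s| := by
    intro n m s hs
    rw [hD1, hD1]
    simp only
    rw [add_sub_add_right_eq_sub, ← mul_sub, abs_mul]
    exact mul_le_mul_of_nonneg_right (bl s hs).1 (abs_nonneg _)
  have inc : ∀ n, ∀ s ∈ I, |(D (n + 1)).1 (τ s) * (D (n + 1)).2 s - (D n).1 (τ s) * (D n).2 s| ≤
      2 * l * q ^ n := by
    intro n
    induction n with
    | zero =>
      intro s hs
      have key : ∀ n, |(D n).1 (τ s) * (D n).2 s| ≤ l := fun n => by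
        rw [abs_mul, ← mul_one l]
        exact mul_le_mul (hDb n _ (hτI s hs)).1 (hDb n s hs).2 (abs_nonneg _) hl
      refine (abs_sub _ _).trans ?_
      rw [pow_zero]
      linarith [key 0, key (0 + 1)]
    | succ n ih =>
      intro s hs
      have h1 := step1 (n + 1) n _ (hτI s hs)
      have h2 := step2 (n + 1) n s hs
      have h3 := ih _ (hτI s hs)
      have h4 := ih s hs
      have e : (D (n + 2)).1 (τ s) * (D (n + 2)).2 s - (D (n + 1)).1 (τ s) * (D (n + 1)).2 s =
        ((D (n + 2)).1 (τ s) - (D (n + 1)).1 (τ s)) * (D (n + 2)).2 s +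
          (D (n + 1)).1 (τ s) * ((D (n + 2)).2 s - (D (n + 1)).2 s) := by ring
      rw [e]
      refine (abs_add_le _ _).trans ?_
      rw [abs_mul, abs_mul]
      have t1 := (hDb (n + 2) s hs).2
      have t2 := (hDb (n + 1) _ (hτI s hs)).1
      have t3 := h1.trans (mul_le_mul_of_nonneg_left h3 ha)
      have t4 := h2.trans (mul_le_mul_of_nonneg_left h4 hc)
      calc _ ≤ a * (2 * l * q ^ n) * 1 + l * (c * (2 * l * q ^ n)) := by gcongr
        _ = 2 * l * q ^ (n + 1) := by rw [pow_succ, hq]; ring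
  obtain ⟨U, hUu, hU⟩ := exists_limit_of_geometric (S := I) (u := fun n => (D (n + 1)).1)
    (C := a * (2 * l)) hq0 hq1 fun n s hs => by
      refine (step1 (n + 1) n s hs).trans ?_
      rw [mul_assoc]
      exact mul_le_mul_of_nonneg_left (inc n s hs) ha
  obtain ⟨V, hVu, hV⟩ := exists_limit_of_geometric (S := I) (u := fun n => (D (n + 1)).2)
    (C := c * (2 * l)) hq0 hq1 fun n s hs => by
      refine (step2 (n + 1) n s hs).trans ?_
      rw [mul_assoc]
      exact mul_le_mul_of_nonneg_left (inc n s hs) hc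
  have hUc : ContinuousOn U I :=
    hUu.continuousOn (Eventually.of_forall fun n => (hDc (n + 1)).1).frequently
  have hVc : ContinuousOn V I :=
    hVu.continuousOn (Eventually.of_forall fun n => (hDc (n + 1)).2).frequently
  have hUb : ∀ s ∈ I, |U s| ≤ l := fun s hs =>
    le_of_tendsto (hU s hs).abs (Eventually.of_forall fun n => (hDb (n + 1) s hs).1)
  have hVb : ∀ s ∈ I, |V s| ≤ 1 := fun s hs =>
    le_of_tendsto (hV s hs).abs (Eventually.of_forall fun n => (hDb (n + 1) s hs).2)
  have hW : ∀ s ∈ I, Tendsto (fun n => (D (n + 1)).1 (τ s) * (D (n + 1)).2 s) atTop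
      (𝓝 (U (τ s) * V s)) := fun s hs => (hU _ (hτI s hs)).mul (hV s hs)
  have hUeq : ∀ s ∈ I, U s = k1 s * (U (τ s) * V s) + k2 s := by
    intro s hs
    have h1 := (tendsto_add_atTop_iff_nat 1).2 (hU s hs)
    have h2 := ((hW s hs).const_mul (k1 s)).add_const (k2 s)
    refine tendsto_nhds_unique h1 (h2.congr fun n => ?_)
    rw [hD1 (n + 1)]
  have hVeq : ∀ s ∈ I, V s = l1 s * (U (τ s) * V s) + l2 s := by
    intro s hs
    have h1 := (tendsto_add_atTop_iff_nat 1).2 (hV s hs)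
    have h2 := ((hW s hs).const_mul (l1 s)).add_const (l2 s)
    refine tendsto_nhds_unique h1 (h2.congr fun n => ?_)
    rw [hD1 (n + 1)]
  -- The error of the candidate derivative of the composition of curve and time change. The errors
  -- for η and τ separately are controlled by Z and a first order expansion of K and L.
  set Z : ℝ → ℝ → ℝ := fun s t => η (τ t) - η (τ s) - U (τ s) * V s * (t - s) with hZ
  have eη : ∀ s ∈ I, ∀ ε > 0, ∀ᶠ t in 𝓝[I] s,
      |η t - η s - U s * (t - s)| ≤ a * |Z s t| + ε * |t - s| := by
    intro s hs ε hε
    filter_upwards [expansion_along_curve (hKd _ (hbox s hs)) hl hbox (hξl s hs) hε,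
      self_mem_nhdsWithin] with t ht htI
    rw [← (hητ t htI).2.2.2.1, ← (hητ s hs).2.2.2.1] at ht
    have e : η t - η s - U s * (t - s) = k1 s * Z s t +
        (η t - η s - (k1 s * (η (τ t) - η (τ s)) + k2 s * (t - s))) := by
      rw [hUeq s hs]; simp only [hZ]; ring
    rw [e]
    refine (abs_add_le _ _).trans (add_le_add ?_ ht)
    rw [abs_mul]
    exact mul_le_mul_of_nonneg_right (bk s hs).1 (abs_nonneg _)
  have eτ : ∀ s ∈ I, ∀ ε > 0, ∀ᶠ t in 𝓝[I] s,
      |τ t - τ s - V s * (t - s)| ≤ c * |Z s t| + ε * |t - s| := by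
    intro s hs ε hε
    filter_upwards [expansion_along_curve (hLd _ (hbox s hs)) hl hbox (hξl s hs) hε,
      self_mem_nhdsWithin] with t ht htI
    rw [← (hητ t htI).2.2.2.2, ← (hητ s hs).2.2.2.2] at ht
    have e : τ t - τ s - V s * (t - s) = l1 s * Z s t +
        (τ t - τ s - (l1 s * (η (τ t) - η (τ s)) + l2 s * (t - s))) := by
      rw [hVeq s hs]; simp only [hZ]; ring
    rw [e]
    refine (abs_add_le _ _).trans (add_le_add ?_ ht)
    rw [abs_mul]
    exact mul_le_mul_of_nonneg_right (bl s hs).1 (abs_nonneg _)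
  -- A bound M on the relative error near every point improves to qM + ε, because the equations
  -- express the error at s through the errors at τ s and s.
  have improve : ∀ M : ℝ, 0 ≤ M → (∀ s ∈ I, ∀ᶠ t in 𝓝[I] s, |Z s t| ≤ M * |t - s|) →
      ∀ ε > 0, ∀ s ∈ I, ∀ᶠ t in 𝓝[I] s, |Z s t| ≤ (q * M + ε) * |t - s| := by
    intro M hM hP ε hε s hs
    have hε' : 0 < ε / (1 + l) := by positivity
    have htend : Tendsto τ (𝓝[I] s) (𝓝[I] (τ s)) :=
      tendsto_nhdsWithin_iff.2 ⟨hτc s hs, by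
        filter_upwards [self_mem_nhdsWithin] with t ht using hτI t ht⟩
    filter_upwards [htend.eventually (hP _ (hτI s hs)),
      htend.eventually (eη _ (hτI s hs) _ hε'), hP s hs, eτ s hs _ hε', self_mem_nhdsWithin]
      with t t1 t2 t3 t4 htI
    have e : Z s t = (η (τ t) - η (τ s) - U (τ s) * (τ t - τ s)) +
        U (τ s) * (τ t - τ s - V s * (t - s)) := by simp only [hZ]; ring
    have hτl := (hlip t htI s hs).2
    have n1 := abs_nonneg (t - s)
    rw [e]
    refine (abs_add_le _ _).trans ?_
    rw [abs_mul]
    have u1 : |η (τ t) - η (τ s) - U (τ s) * (τ t - τ s)| ≤ (a * M + ε / (1 + l)) * |t - s| := by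
      calc _ ≤ a * (M * |τ t - τ s|) + ε / (1 + l) * |τ t - τ s| := t2.trans (by gcongr)
        _ ≤ a * (M * |t - s|) + ε / (1 + l) * |t - s| := by gcongr
        _ = _ := by ring
    have u2 : |τ t - τ s - V s * (t - s)| ≤ (c * M + ε / (1 + l)) * |t - s| := by
      calc _ ≤ c * (M * |t - s|) + ε / (1 + l) * |t - s| := t4.trans (by gcongr)
        _ = _ := by ring
    calc _ ≤ (a * M + ε / (1 + l)) * |t - s| + l * ((c * M + ε / (1 + l)) * |t - s|) :=
          add_le_add u1 (mul_le_mul (hUb _ (hτI s hs)) u2 (abs_nonneg _) hl)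
      _ = (q * M + ε / (1 + l) * (1 + l)) * |t - s| := by rw [hq]; ring
      _ = _ := by rw [div_mul_cancel₀ _ (by positivity)]
  -- Iterating the improvement from the Lipschitz bound 2l gives q^n 2l + ε for every n. So the
  -- relative error is arbitrarily small, which is differentiability.
  have all : ∀ M > 0, ∀ s ∈ I, ∀ᶠ t in 𝓝[I] s, |Z s t| ≤ M * |t - s| := by
    have base : ∀ ε > 0, ∀ n : ℕ, ∀ s ∈ I, ∀ᶠ t in 𝓝[I] s,
        |Z s t| ≤ (q ^ n * (2 * l) + ε) * |t - s| := by
      intro ε hε n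
      induction n with
      | zero =>
        intro s hs
        filter_upwards [self_mem_nhdsWithin] with t ht
        have h1 := hξl s hs t ht
        have h2 : |U (τ s) * V s * (t - s)| ≤ l * 1 * |t - s| := by
          rw [abs_mul, abs_mul]
          have := hUb _ (hτI s hs)
          have := hVb s hs
          gcongr
        refine (abs_sub _ _).trans ?_
        nlinarith [mul_nonneg hε.le (abs_nonneg (t - s))]
      | succ n ih =>
        intro s hs
        have h1 := improve _ (by positivity) ih (ε * (1 - q)) (mul_pos hε (by linarith)) s hs
        filter_upwards [h1] with t ht
        refine ht.trans (le_of_eq ?_)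
        rw [pow_succ]; ring
    intro M hM s hs
    obtain ⟨n, hn⟩ := exists_pow_lt_of_lt_one
      (show 0 < M / 2 / (2 * l + 1) by positivity) hq1
    filter_upwards [base (M / 2) (by positivity) n s hs] with t ht
    refine ht.trans ?_
    rw [lt_div_iff₀ (by positivity)] at hn
    have : q ^ n * (2 * l) ≤ M / 2 := by
      have : 0 ≤ q ^ n := by positivity
      linarith
    gcongr
    linarith
  refine ⟨η, τ, U, V, hητ, hlip, hUc, hVc, fun s hs => ⟨?_, ?_, hUb s hs, hVb s hs⟩⟩
  · rw [hasDerivWithinAt_iff_isLittleO, Asymptotics.isLittleO_iff]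
    intro ε hε
    filter_upwards [all (ε / 2 / (a + 1)) (by positivity) s hs, eη s hs (ε / 2) (by positivity)]
      with t h1 h2
    rw [smul_eq_mul, mul_comm]
    refine h2.trans ?_
    have : a * (ε / 2 / (a + 1)) ≤ ε / 2 := by
      rw [mul_div_assoc', div_le_iff₀ (by positivity)]; nlinarith
    calc a * |Z s t| + ε / 2 * |t - s| ≤ a * (ε / 2 / (a + 1) * |t - s|) + ε / 2 * |t - s| := by
          gcongr
      _ = (a * (ε / 2 / (a + 1)) + ε / 2) * |t - s| := by ring
      _ ≤ (ε / 2 + ε / 2) * |t - s| := by gcongr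
      _ = ε * ‖t - s‖ := by rw [add_halves]; rfl
  · rw [hasDerivWithinAt_iff_isLittleO, Asymptotics.isLittleO_iff]
    intro ε hε
    filter_upwards [all (ε / 2 / (c + 1)) (by positivity) s hs, eτ s hs (ε / 2) (by positivity)]
      with t h1 h2
    rw [smul_eq_mul, mul_comm]
    refine h2.trans ?_
    have : c * (ε / 2 / (c + 1)) ≤ ε / 2 := by
      rw [mul_div_assoc', div_le_iff₀ (by positivity)]; nlinarith
    calc c * |Z s t| + ε / 2 * |t - s| ≤ c * (ε / 2 / (c + 1) * |t - s|) + ε / 2 * |t - s| := by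
          gcongr
      _ = (c * (ε / 2 / (c + 1)) + ε / 2) * |t - s| := by ring
      _ ≤ (ε / 2 + ε / 2) * |t - s| := by gcongr
      _ = ε * ‖t - s‖ := by rw [add_halves]; rfl

end CrossForm

/-- An inverse of a smooth map with invertible derivatives is smooth. -/
theorem contDiffOn_inverse {E : Type*} [NormedAddCommGroup E] [NormedSpace ℝ E] [CompleteSpace E]
    {n : ℕ} {Φ q : E → E} {D D' : Set E} (hΦ : ContDiffOn ℝ n Φ D) (hn : 1 ≤ n)
    (hD : UniqueDiffOn ℝ D) (hD' : UniqueDiffOn ℝ D') (hq : MapsTo q D' D)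
    (hinv : ∀ z ∈ D', Φ (q z) = z) (hc : ContinuousOn q D')
    (hder : ∀ w ∈ D, ∃ A : E ≃L[ℝ] E, (A : E →L[ℝ] E) = fderivWithin ℝ Φ D w) :
    ContDiffOn ℝ n q D' := by
  have hd : ∀ z ∈ D', HasFDerivWithinAt q (fderivWithin ℝ Φ D (q z)).inverse D' z := by
    intro z hz
    obtain ⟨A, hA⟩ := hder _ (hq hz)
    have h1 : HasFDerivWithinAt Φ (A : E →L[ℝ] E) D (q z) := by
      rw [hA]
      exact ((hΦ.differentiableOn (by exact_mod_cast (by omega : n ≠ 0))) _ (hq hz)).hasFDerivWithinAt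
    rw [← hA, ContinuousLinearMap.inverse_equiv]
    refine HasFDerivWithinAt.of_local_left_inverse (t := D) ?_ h1 hz ?_
    · exact tendsto_nhdsWithin_iff.2 ⟨hc z hz, eventually_mem_nhdsWithin.mono fun x hx => hq hx⟩
    · exact eventually_mem_nhdsWithin.mono fun x hx => hinv x hx
  -- Bootstrap: q' is the inverse of Φ' evaluated at q, so it is as regular as q up to order n − 1,
  -- and q gains one derivative at a time.
  have key : ∀ m : ℕ, m ≤ n → ContDiffOn ℝ m q D' := by
    intro m
    induction m with
    | zero => intro _; exact contDiffOn_zero.2 hc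
    | succ m ih =>
      intro hm
      have h1 := ih (by omega)
      rw [Nat.cast_add, Nat.cast_one, contDiffOn_succ_iff_hasFDerivWithinAt_of_uniqueDiffOn hD']
      refine ⟨fun h => absurd h (by simp), _, fun z hz => ?_, hd⟩
      have h2 : ContDiffOn ℝ m (fderivWithin ℝ Φ D) D :=
        hΦ.fderivWithin hD (by exact_mod_cast hm)
      obtain ⟨A, hA⟩ := hder _ (hq hz)
      have h3 := (h2.comp h1 hq) z hz
      have h4 : ContDiffAt ℝ m ContinuousLinearMap.inverse (fderivWithin ℝ Φ D (q z)) := by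
        rw [← hA]; exact contDiffAt_map_inverse A
      exact h4.comp_contDiffWithinAt z h3
  exact key n le_rfl

theorem exists_equiv_of_injective {T : (ℝ × ℝ) →L[ℝ] (ℝ × ℝ)} (h : ∀ v, T v = 0 → v = 0) :
    ∃ A : (ℝ × ℝ) ≃L[ℝ] (ℝ × ℝ), (A : (ℝ × ℝ) →L[ℝ] (ℝ × ℝ)) = T := by
  have hinj : Function.Injective (T : (ℝ × ℝ) →ₗ[ℝ] (ℝ × ℝ)) := by
    rw [← LinearMap.ker_eq_bot, LinearMap.ker_eq_bot']
    exact h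
  exact ⟨(LinearEquiv.ofInjectiveEndo _ hinj).toContinuousLinearEquiv,
    ContinuousLinearMap.ext fun _ => rfl⟩

theorem contDiffOn_Ico_succ {n : ℕ} {e e' : ℝ → ℝ}
    (h : ∀ s ∈ Ico (0 : ℝ) 1, HasDerivWithinAt e (e' s) (Ico 0 1) s)
    (h' : ContDiffOn ℝ n e' (Ico 0 1)) : ContDiffOn ℝ (n + 1) e (Ico 0 1) := by
  have hU := uniqueDiffOn_Ico (0 : ℝ) 1
  rw [contDiffOn_succ_iff_derivWithin hU]
  exact ⟨fun s hs => (h s hs).differentiableWithinAt, fun h => absurd h (by simp),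
    h'.congr fun s hs => (h s hs).derivWithin (hU s hs)⟩

/-! The slope of an invariant curve -/

theorem abs_num_le {θ δ ρ m11 m12 v : ℝ} (hθ : 0 ≤ θ) (hv : |v| ≤ ρ)
    (h11 : |m11| ≤ θ) (h12 : |m12| ≤ δ) : |m11 * v + m12| ≤ θ * ρ + δ := by
  refine (abs_add_le _ _).trans (add_le_add ?_ h12)
  rw [abs_mul]
  exact mul_le_mul h11 hv (abs_nonneg _) hθ

theorem one_le_denom {κ ρ m21 m22 v : ℝ} (hκ : 0 ≤ κ) (hρ : ρ ≤ 1) (hv : |v| ≤ ρ)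
    (h21 : |m21| ≤ κ) (h22 : 1 + κ ≤ m22) : 1 ≤ m21 * v + m22 := by
  have h1 : |m21 * v| ≤ κ * 1 := by
    rw [abs_mul]
    exact mul_le_mul h21 (hv.trans hρ) (abs_nonneg _) hκ
  linarith [(abs_le.1 h1).1]

/-- The difference of two values of a fractional linear map is the determinant times the difference
of the arguments, divided by the two denominators. Both denominators are at least 1, and one of them
absorbs the large entry m22 of the determinant. -/
theorem slope_lip_fst {θ κ δ ρ m11 m12 m21 m22 v v' : ℝ} (hθ : 0 ≤ θ) (hκ : 0 ≤ κ)
    (hδ : 0 ≤ δ) (hρ : ρ ≤ 1) (hv : |v| ≤ ρ) (hv' : |v'| ≤ ρ) (h11 : |m11| ≤ θ) (h12 : |m12| ≤ δ)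
    (h21 : |m21| ≤ κ) (h22 : 1 + κ ≤ m22) :
    |(m11 * v + m12) / (m21 * v + m22) - (m11 * v' + m12) / (m21 * v' + m22)| ≤
      (θ * (1 + κ) + δ * κ) * |v - v'| := by
  have hQ := one_le_denom hκ hρ hv h21 h22
  have hQ' := one_le_denom hκ hρ hv' h21 h22
  have hm : m22 ≤ m21 * v + m22 + κ := by
    have h1 : |m21 * v| ≤ κ * 1 := by
      rw [abs_mul]
      exact mul_le_mul h21 (hv.trans hρ) (abs_nonneg _) hκ
    linarith [(abs_le.1 h1).1]
  set Q := m21 * v + m22 with hQd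
  set Q' := m21 * v' + m22 with hQd'
  have hQ0 : 0 < Q := by linarith
  have hQ0' : 0 < Q' := by linarith
  have e : (m11 * v + m12) / Q - (m11 * v' + m12) / Q' =
      (m11 * m22 - m12 * m21) * (v - v') / (Q * Q') := by
    rw [div_sub_div _ _ hQ0.ne' hQ0'.ne', hQd, hQd']
    ring
  have hd : |m11 * m22 - m12 * m21| ≤ (θ * (1 + κ) + δ * κ) * (Q * Q') := by
    have h1 : |m11 * m22| ≤ θ * (Q + κ) := by
      rw [abs_mul, abs_of_pos (by linarith : 0 < m22)]
      exact mul_le_mul h11 hm (by linarith) hθ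
    have h2 : |m12 * m21| ≤ δ * κ := by
      rw [abs_mul]
      exact mul_le_mul h12 h21 (abs_nonneg _) hδ
    have h3 : Q ≤ Q * Q' := le_mul_of_one_le_right hQ0.le hQ'
    have h4 : 1 ≤ Q * Q' := hQ.trans h3
    have h5 : Q + κ ≤ (1 + κ) * (Q * Q') := by nlinarith
    have h6 := mul_le_mul_of_nonneg_left h5 hθ
    have h7 : δ * κ ≤ δ * κ * (Q * Q') := le_mul_of_one_le_right (mul_nonneg hδ hκ) h4
    refine (abs_sub _ _).trans ?_
    linarith
  rw [e, abs_div, abs_mul, abs_of_pos (mul_pos hQ0 hQ0'), div_le_iff₀ (mul_pos hQ0 hQ0')]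
  calc _ ≤ (θ * (1 + κ) + δ * κ) * (Q * Q') * |v - v'| := by gcongr
    _ = _ := by ring

/-- Variations of size N multiply either the slope or the numerator, both at most ρ; only the entry
m12 acts directly, and its variation is of size δ. So the bound can be made a small multiple of ρ.
-/
theorem slope_lip_snd {θ κ δ ρ N σ m11 m12 m21 m22 n11 n12 n21 n22 v : ℝ} (hθ : 0 ≤ θ) (hκ : 0 ≤ κ)
    (hN : 0 ≤ N) (hσ : 0 ≤ σ) (hρ0 : 0 ≤ ρ) (hρ : ρ ≤ 1) (hθρ : θ * ρ + δ ≤ ρ)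
    (hv : |v| ≤ ρ)
    (h21 : |m21| ≤ κ) (h22 : 1 + κ ≤ m22) (k11 : |n11| ≤ θ) (k12 : |n12| ≤ δ)
    (k21 : |n21| ≤ κ) (k22 : 1 + κ ≤ n22) (d11 : |m11 - n11| ≤ N * σ) (d12 : |m12 - n12| ≤ δ * σ)
    (d21 : |m21 - n21| ≤ N * σ) (d22 : |m22 - n22| ≤ N * σ) :
    |(m11 * v + m12) / (m21 * v + m22) - (n11 * v + n12) / (n21 * v + n22)| ≤
      (3 * N * ρ + δ) * σ := by
  have hQ := one_le_denom hκ hρ hv h21 h22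
  have hQ' := one_le_denom hκ hρ hv k21 k22
  have hn := (abs_num_le hθ hv k11 k12).trans hθρ
  have hQd : |n21 * v + n22 - (m21 * v + m22)| ≤ 2 * (N * σ) := by
    rw [show n21 * v + n22 - (m21 * v + m22) = -((m21 - n21) * v) - (m22 - n22) by ring]
    refine (abs_sub _ _).trans ?_
    rw [abs_neg, abs_mul]
    have : |m21 - n21| * |v| ≤ N * σ * 1 :=
      mul_le_mul d21 (hv.trans hρ) (abs_nonneg _) (by positivity)
    linarith
  have hnd : |(m11 - n11) * v + (m12 - n12)| ≤ N * σ * ρ + δ * σ :=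
    abs_num_le (by positivity) hv d11 d12
  set Q := m21 * v + m22
  set Q' := n21 * v + n22
  set n := n11 * v + n12 with hnn
  have hQ0 : 0 < Q := by linarith
  have hQ0' : 0 < Q' := by linarith
  have e : (m11 * v + m12) / Q - n / Q' =
      ((m11 - n11) * v + (m12 - n12)) / Q + n * (Q' - Q) / (Q * Q') := by
    rw [hnn]
    field_simp
    ring
  rw [e]
  refine (abs_add_le _ _).trans ?_
  rw [abs_div, abs_div, abs_mul, abs_of_pos hQ0, abs_of_pos (mul_pos hQ0 hQ0')]
  have t1 : |(m11 - n11) * v + (m12 - n12)| / Q ≤ N * σ * ρ + δ * σ :=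
    (div_le_self (abs_nonneg _) hQ).trans hnd
  have t2 : |n| * |Q' - Q| / (Q * Q') ≤ ρ * (2 * (N * σ)) :=
    (div_le_self (by positivity) (one_le_mul_of_one_le_of_one_le hQ hQ')).trans
      (mul_le_mul hn hQd (abs_nonneg _) hρ0)
  linarith

/-- The smallness conditions on the constants of a saddle. -/
structure SaddleConst (ρ θ κ δ N : ℝ) : Prop where
  ρ_pos : 0 < ρ
  ρ_le : ρ ≤ 1
  θ_pos : 0 < θ
  θ_lt : θ < 1
  κ_nonneg : 0 ≤ κ
  κ_le : κ ≤ (1 - θ) / 16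
  δ_nonneg : 0 ≤ δ
  δ_le : δ ≤ (1 - θ) * ρ / 16
  N_nonneg : 0 ≤ N
  N_le : N ≤ (1 - θ) / 16

/-- A bounded solution of the equation for the slope of an invariant curve is continuously
differentiable. -/
theorem SaddleConst.slope_C1 {ρ θ κ δ N : ℝ} (h : SaddleConst ρ θ κ δ N)
    {τ M11 M12 M21 M22 U : ℝ → ℝ} (hτc : ContDiffOn ℝ 1 τ (Ico 0 1))
    (hτ : ∀ s ∈ Ico (0 : ℝ) 1, 0 ≤ τ s ∧ τ s ≤ s)
    (hτl : ∀ s ∈ Ico (0 : ℝ) 1, ∀ t ∈ Ico (0 : ℝ) 1, |τ s - τ t| ≤ |s - t|)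
    (c11 : ContDiffOn ℝ 1 M11 (Ico 0 1)) (c12 : ContDiffOn ℝ 1 M12 (Ico 0 1))
    (c21 : ContDiffOn ℝ 1 M21 (Ico 0 1)) (c22 : ContDiffOn ℝ 1 M22 (Ico 0 1))
    (hb : ∀ s ∈ Ico (0 : ℝ) 1, |M11 s| ≤ θ ∧ |M12 s| ≤ δ ∧ |M21 s| ≤ κ ∧ 1 + κ ≤ M22 s)
    (hd : ∀ s ∈ Ico (0 : ℝ) 1, ∀ t ∈ Ico (0 : ℝ) 1, |M11 s - M11 t| ≤ N * |s - t| ∧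
      |M12 s - M12 t| ≤ δ * |s - t| ∧ |M21 s - M21 t| ≤ N * |s - t| ∧
      |M22 s - M22 t| ≤ N * |s - t|)
    (hU : ∀ s ∈ Ico (0 : ℝ) 1, |U s| ≤ ρ ∧
      U s * (M21 s * U (τ s) + M22 s) = M11 s * U (τ s) + M12 s) :
    ContDiffOn ℝ 1 U (Ico 0 1) ∧
      ∀ s ∈ Ico (0 : ℝ) 1, ∀ t ∈ Ico (0 : ℝ) 1, |U s - U t| ≤ ρ * |s - t| := by
  obtain ⟨hρ0, hρ1, hθ0, hθ1, hκ0, hκ, hδ0, hδ, hN0, hN⟩ := h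
  have hσ : 0 < 1 - θ := by linarith
  have hδ1 : δ ≤ (1 - θ) / 16 := hδ.trans (by nlinarith)
  have hθρ : θ * ρ + δ ≤ ρ := by nlinarith
  have ha : θ * (1 + κ) + δ * κ ≤ θ + (1 - θ) / 4 := by nlinarith
  have hb' : 3 * N * ρ + δ ≤ (1 - θ) / 2 * ρ := by nlinarith
  set K : ℝ × ℝ → ℝ := fun w => (M11 w.2 * w.1 + M12 w.2) / (M21 w.2 * w.1 + M22 w.2) with hK
  set L : ℝ × ℝ → ℝ := fun w => τ w.2 with hL
  have hsnd : MapsTo (fun w : ℝ × ℝ => w.2) (box ρ) (Ico 0 1) := fun w hw => hw.2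
  -- The equation for the slope is a cross form in which the time change is the given τ. Its
  -- invariant curve is the slope, and it inherits the Lipschitz constant ρ.
  have hC : CrossForm ρ ρ (θ + (1 - θ) / 4) ((1 - θ) / 2 * ρ) 0 1 K L := by
    refine ⟨hρ0, hρ0.le, by linarith, by positivity, le_rfl, zero_le_one, by nlinarith, by linarith,
      by linarith, fun w hw => ?_, fun w hw => hτ _ hw.2, fun w hw z hz => ?_, fun w hw z hz => ?_⟩
    · obtain ⟨b1, b2, b3, b4⟩ := hb _ (hsnd hw)
      have h1 := one_le_denom hκ0 hρ1 hw.1 b3 b4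
      rw [hK]
      simp only
      rw [abs_div, abs_of_pos (by linarith : 0 < M21 w.2 * w.1 + M22 w.2)]
      exact (div_le_self (abs_nonneg _) h1).trans ((abs_num_le hθ0.le hw.1 b1 b2).trans hθρ)
    · obtain ⟨b1, b2, b3, b4⟩ := hb _ (hsnd hw)
      obtain ⟨b1', b2', b3', b4'⟩ := hb _ (hsnd hz)
      obtain ⟨d1, d2, d3, d4⟩ := hd _ (hsnd hw) _ (hsnd hz)
      have t1 := slope_lip_fst hθ0.le hκ0 hδ0 hρ1 hw.1 hz.1 b1 b2 b3 b4
      have t2 := slope_lip_snd hθ0.le hκ0 hN0 (abs_nonneg (w.2 - z.2)) hρ0.le hρ1 hθρ hz.1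
        b3 b4 b1' b2' b3' b4' d1 d2 d3 d4
      refine (abs_sub_le _ _ _).trans (add_le_add (t1.trans ?_) (t2.trans ?_))
      · gcongr
      · gcongr
    · rw [zero_mul, zero_add, one_mul]
      exact hτl _ (hsnd hw) _ (hsnd hz)
  have hKc : ContDiffOn ℝ 1 K (box ρ) := by
    have m : ∀ M : ℝ → ℝ, ContDiffOn ℝ 1 M (Ico 0 1) →
        ContDiffOn ℝ 1 (fun w : ℝ × ℝ => M w.2) (box ρ) := fun M hM =>
      hM.comp contDiff_snd.contDiffOn hsnd
    have f : ContDiffOn ℝ 1 (fun w : ℝ × ℝ => w.1) (box ρ) := contDiff_fst.contDiffOn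
    refine (((m _ c11).mul f).add (m _ c12)).div (((m _ c21).mul f).add (m _ c22)) fun w hw => ?_
    obtain ⟨b1, b2, b3, b4⟩ := hb _ (hsnd hw)
    have h1 := one_le_denom hκ0 hρ1 hw.1 b3 b4
    exact (zero_lt_one.trans_le h1).ne'
  have hLc : ContDiffOn ℝ 1 L (box ρ) := hτc.comp contDiff_snd.contDiffOn hsnd
  obtain ⟨η, τ', U', V', h1, h2, h3, -, h4⟩ := hC.exists_C1_curve hKc hLc
  have hτI : ∀ s ∈ Ico (0 : ℝ) 1, τ s ∈ Ico (0 : ℝ) 1 := fun s hs =>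
    ⟨(hτ s hs).1, (hτ s hs).2.trans_lt hs.2⟩
  -- Uniqueness: two bounded solutions differ at s by at most a contraction factor times their
  -- difference at τ s, so they coincide.
  have heq : ∀ s ∈ Ico (0 : ℝ) 1, U s = η s := by
    have hstep : ∀ s ∈ Ico (0 : ℝ) 1, |U s - η s| ≤
        (θ + (1 - θ) / 4) * |U (τ s) - η (τ s)| := by
      intro s hs
      obtain ⟨-, -, -, e1, e2⟩ := h1 s hs
      rw [e2] at e1
      have e3 : U s = K (U (τ s), s) := by
        obtain ⟨b1, b2, b3, b4⟩ := hb _ hs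
        have h1 := one_le_denom hκ0 hρ1 (hU _ (hτI s hs)).1 b3 b4
        exact (eq_div_iff (zero_lt_one.trans_le h1).ne').2 (hU s hs).2
      rw [e1]
      nth_rewrite 1 [e3]
      refine (hC.lipK _ ⟨(hU _ (hτI s hs)).1, hs.1, hs.2⟩ _ ⟨(h1 _ (hτI s hs)).1, hs.1, hs.2⟩).trans (le_of_eq ?_)
      simp [hL]
    have key : ∀ n : ℕ, ∀ s ∈ Ico (0 : ℝ) 1, |U s - η s| ≤ (θ + (1 - θ) / 4) ^ n * (2 * ρ) := by
      intro n
      induction n with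
      | zero =>
        intro s hs
        refine (abs_sub _ _).trans ?_
        linarith [(hU s hs).1, (h1 s hs).1]
      | succ n ih =>
        intro s hs
        refine (hstep s hs).trans ?_
        rw [pow_succ', mul_assoc]
        exact mul_le_mul_of_nonneg_left (ih _ (hτI s hs)) (by linarith)
    intro s hs
    have := eq_zero_of_le_pow (μ := θ + (1 - θ) / 4) (by linarith) (by linarith)
      (abs_nonneg (U s - η s)) (Eventually.of_forall fun n => key n s hs)
    exact sub_eq_zero.1 (abs_eq_zero.1 this)
  constructor
  · have : ContDiffOn ℝ ((0 : ℕ) + 1) η (Ico 0 1) :=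
      contDiffOn_Ico_succ (fun s hs => (h4 s hs).1) (contDiffOn_zero.2 h3)
    rw [Nat.cast_zero, zero_add] at this
    exact this.congr heq
  · intro s hs t ht
    rw [heq s hs, heq t ht]
    exact (h2 s hs t ht).1

/-! ### Invariant curves of saddles at the boundary. -/

/-- A map close to the linear saddle `(x, y) ↦ (α₁ x, α₂ y)` that preserves the boundary `y = 0`. -/
structure SaddleBox (ρ κ δ N α₁ α₂ : ℝ) (P : ℝ × ℝ → ℝ × ℝ) : Prop where
  cd : ContDiffOn ℝ 2 P (box ρ)
  fst : ∀ w ∈ box ρ, ∀ z ∈ box ρ, |(P w).1 - (P z).1 - α₁ * (w.1 - z.1)| ≤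
    κ * |w.1 - z.1| + δ * |w.2 - z.2|
  snd : ∀ w ∈ box ρ, ∀ z ∈ box ρ, |(P w).2 - (P z).2 - α₂ * (w.2 - z.2)| ≤
    κ * |w.1 - z.1| + κ * |w.2 - z.2|
  zero : ∀ x, |x| ≤ ρ → (P (x, 0)).2 = 0
  center : ∀ y ∈ Ico (0 : ℝ) 1, |(P (0, y)).1| ≤ δ
  lip : ∀ w ∈ box ρ, ∀ z ∈ box ρ, |w.1 - z.1| ≤ ρ * |w.2 - z.2| →
    ‖fderivWithin ℝ P (box ρ) w - fderivWithin ℝ P (box ρ) z‖ ≤ N * |w.2 - z.2| ∧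
    |((fderivWithin ℝ P (box ρ) w - fderivWithin ℝ P (box ρ) z) (0, 1)).1| ≤ δ * |w.2 - z.2|

/-- The graph `x = e y` is an invariant curve of class `C^2` of the map `P`. -/
structure InvCurve (ρ : ℝ) (P : ℝ × ℝ → ℝ × ℝ) (e e' : ℝ → ℝ) : Prop where
  cd : ContDiffOn ℝ 2 e (Ico 0 1)
  deriv : ∀ s ∈ Ico (0 : ℝ) 1, HasDerivWithinAt e (e' s) (Ico 0 1) s
  val : ∀ s ∈ Ico (0 : ℝ) 1, |e s| ≤ ρ
  bound : ∀ s ∈ Ico (0 : ℝ) 1, |e' s| ≤ ρ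
  lip : ∀ s ∈ Ico (0 : ℝ) 1, ∀ t ∈ Ico (0 : ℝ) 1, |e' s - e' t| ≤ ρ * |s - t|
  inv : ∀ s ∈ Ico (0 : ℝ) 1, (P (e s, s)).2 < 1 → (P (e s, s)).1 = e (P (e s, s)).2

namespace SaddleBox

variable {ρ θ κ δ N α₁ α₂ : ℝ} {P : ℝ × ℝ → ℝ × ℝ}

theorem hasFDerivWithinAt (h : SaddleBox ρ κ δ N α₁ α₂ P) {w : ℝ × ℝ} (hw : w ∈ box ρ) :
    HasFDerivWithinAt P (fderivWithin ℝ P (box ρ) w) (box ρ) w :=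
  ((h.cd.differentiableOn (by norm_num)) w hw).hasFDerivWithinAt

theorem entries (h : SaddleBox ρ κ δ N α₁ α₂ P) (hρ : 0 < ρ) {w : ℝ × ℝ} (hw : w ∈ box ρ) :
    |(fderivWithin ℝ P (box ρ) w (1, 0)).1 - α₁| ≤ κ ∧
    |(fderivWithin ℝ P (box ρ) w (0, 1)).1| ≤ δ ∧
    |(fderivWithin ℝ P (box ρ) w (1, 0)).2| ≤ κ ∧
    |(fderivWithin ℝ P (box ρ) w (0, 1)).2 - α₂| ≤ κ := by
  have hd := h.hasFDerivWithinAt hw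
  have h1 : HasFDerivWithinAt (fun z => (P z).1 - α₁ * z.1)
      ((ContinuousLinearMap.fst ℝ ℝ ℝ).comp (fderivWithin ℝ P (box ρ) w) -
        α₁ • ContinuousLinearMap.fst ℝ ℝ ℝ) (box ρ) w :=
    ((ContinuousLinearMap.fst ℝ ℝ ℝ).hasFDerivAt.comp_hasFDerivWithinAt w hd).sub
      (hasFDerivWithinAt_fst.const_mul α₁)
  have h2 : HasFDerivWithinAt (fun z => (P z).2 - α₂ * z.2)
      ((ContinuousLinearMap.snd ℝ ℝ ℝ).comp (fderivWithin ℝ P (box ρ) w) -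
        α₂ • ContinuousLinearMap.snd ℝ ℝ ℝ) (box ρ) w :=
    ((ContinuousLinearMap.snd ℝ ℝ ℝ).hasFDerivAt.comp_hasFDerivWithinAt w hd).sub
      (hasFDerivWithinAt_snd.const_mul α₂)
  obtain ⟨a1, a2⟩ := abs_partial_le hρ hw h1 fun z hz => by
    rw [show (P z).1 - α₁ * z.1 - ((P w).1 - α₁ * w.1) = (P z).1 - (P w).1 - α₁ * (z.1 - w.1) by
      ring]
    exact h.fst z hz w hw
  obtain ⟨b1, b2⟩ := abs_partial_le hρ hw h2 fun z hz => by
    rw [show (P z).2 - α₂ * z.2 - ((P w).2 - α₂ * w.2) = (P z).2 - (P w).2 - α₂ * (z.2 - w.2) by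
      ring]
    exact h.snd z hz w hw
  refine ⟨by simpa using a1, by simpa using a2, by simpa using b1, by simpa using b2⟩

theorem entry_contDiffOn (h : SaddleBox ρ κ δ N α₁ α₂ P) (hρ : 0 < ρ) {γ : ℝ → ℝ × ℝ}
    (hγ : ContDiffOn ℝ 1 γ (Ico 0 1)) (hm : MapsTo γ (Ico 0 1) (box ρ)) (v : ℝ × ℝ) :
    ContDiffOn ℝ 1 (fun s => (fderivWithin ℝ P (box ρ) (γ s) v).1) (Ico 0 1) ∧
      ContDiffOn ℝ 1 (fun s => (fderivWithin ℝ P (box ρ) (γ s) v).2) (Ico 0 1) := by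
  have h1 : ContDiffOn ℝ 1 (fderivWithin ℝ P (box ρ)) (box ρ) :=
    h.cd.fderivWithin (uniqueDiffOn_box hρ) (by norm_num)
  have h2 := (h1.comp hγ hm).clm_apply (contDiffOn_const (c := v))
  exact ⟨h2.fst, h2.snd⟩

theorem entry_lip (h : SaddleBox ρ κ δ N α₁ α₂ P) {w z : ℝ × ℝ} (hw : w ∈ box ρ)
    (hz : z ∈ box ρ) (hwz : |w.1 - z.1| ≤ ρ * |w.2 - z.2|) {v : ℝ × ℝ} (hv : ‖v‖ ≤ 1) :
    |(fderivWithin ℝ P (box ρ) w v).1 - (fderivWithin ℝ P (box ρ) z v).1| ≤ N * |w.2 - z.2| ∧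
    |(fderivWithin ℝ P (box ρ) w v).2 - (fderivWithin ℝ P (box ρ) z v).2| ≤ N * |w.2 - z.2| := by
  have h1 := (h.lip w hw z hz hwz).1
  have h2 := ContinuousLinearMap.le_of_opNorm_le_of_le _ h1 hv
  rw [mul_one, sub_apply] at h2
  exact ⟨(norm_fst_le _).trans h2, (norm_snd_le _).trans h2⟩

theorem invCurve_of_C1 {e U : ℝ → ℝ}
    (hval : ∀ s ∈ Ico (0 : ℝ) 1, |e s| ≤ ρ)
    (hd : ∀ s ∈ Ico (0 : ℝ) 1, HasDerivWithinAt e (U s) (Ico 0 1) s ∧ |U s| ≤ ρ)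
    (hU : ContDiffOn ℝ 1 U (Ico 0 1))
    (hl : ∀ s ∈ Ico (0 : ℝ) 1, ∀ t ∈ Ico (0 : ℝ) 1, |U s - U t| ≤ ρ * |s - t|)
    (hinv : ∀ s ∈ Ico (0 : ℝ) 1, (P (e s, s)).2 < 1 → (P (e s, s)).1 = e (P (e s, s)).2) :
    InvCurve ρ P e U := by
  refine ⟨?_, fun s hs => (hd s hs).1, hval, fun s hs => (hd s hs).2, hl, hinv⟩
  have : ContDiffOn ℝ ((1 : ℕ) + 1) e (Ico 0 1) :=
    contDiffOn_Ico_succ (fun s hs => (hd s hs).1) (by exact_mod_cast hU)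
  norm_num at this
  exact this

/-- Chain rule along an invariant curve; it turns invariance of the curve into the equation for its
slope. -/
theorem deriv_curve (h : SaddleBox ρ κ δ N α₁ α₂ P) {s u v : ℝ}
    {γ : ℝ → ℝ × ℝ} {γ' : ℝ × ℝ} (hγ : HasDerivWithinAt γ γ' (Ico 0 1) s) (hs : s ∈ Ico (0 : ℝ) 1)
    (hm : MapsTo γ (Ico 0 1) (box ρ)) {η τ : ℝ → ℝ} (hη : HasDerivWithinAt η u (Ico 0 1) s)
    (hτ : HasDerivWithinAt τ v (Ico 0 1) s) (he : ∀ t ∈ Ico (0 : ℝ) 1, P (γ t) = (η t, τ t)) :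
    fderivWithin ℝ P (box ρ) (γ s) γ' = (u, v) := by
  have h1 := (h.hasFDerivWithinAt (hm hs)).comp_hasDerivWithinAt s hγ hm
  have h2 : HasDerivWithinAt (P ∘ γ) (u, v) (Ico 0 1) s :=
    (hη.prodMk hτ).congr he (he s hs)
  exact (uniqueDiffOn_Ico (0 : ℝ) 1 s hs).eq_deriv _ h1 h2

theorem apply_mk (T : (ℝ × ℝ) →L[ℝ] (ℝ × ℝ)) (a b : ℝ) :
    (T (a, b)).1 = (T (1, 0)).1 * a + (T (0, 1)).1 * b ∧
      (T (a, b)).2 = (T (1, 0)).2 * a + (T (0, 1)).2 * b := by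
  have e : ((a, b) : ℝ × ℝ) = a • (1, 0) + b • (0, 1) := by ext <;> simp
  rw [e, map_add, map_smul, map_smul]
  constructor <;> simp [mul_comm]

/-- A saddle that expands horizontally has an invariant curve through the boundary. -/
theorem exists_invCurve_of_expanding (h : SaddleBox ρ κ δ N α₁ α₂ P) (hc : SaddleConst ρ θ κ δ N)
    (h1 : 1 ≤ θ * (α₁ - κ)) (h2 : α₂ + κ ≤ θ) (h3 : κ ≤ α₂) : ∃ e e', InvCurve ρ P e e' := by
  obtain ⟨hρ0, hρ1, hθ0, hθ1, hκ0, hκ, hδ0, hδ, hN0, hN⟩ := id hc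
  have hσ : 0 < 1 - θ := by linarith
  have hδ1 : δ ≤ (1 - θ) / 16 := hδ.trans (by nlinarith)
  have hθρ : θ * ρ + δ ≤ ρ := by nlinarith
  have hβ : 1 + κ ≤ α₁ - κ := by nlinarith
  have hβ0 : 0 < α₁ - κ := by linarith
  have hUD := uniqueDiffOn_box hρ0
  have hexp : ∀ w ∈ box ρ, ∀ z ∈ box ρ,
      (α₁ - κ) * |w.1 - z.1| ≤ |(P w).1 - (P z).1| + δ * |w.2 - z.2| := by
    intro w hw z hz
    have t1 := h.fst w hw z hz
    have t2 := abs_sub_abs_le_abs_sub (α₁ * (w.1 - z.1)) ((P w).1 - (P z).1)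
    rw [abs_sub_comm (α₁ * (w.1 - z.1)), abs_mul, abs_of_pos (by linarith : 0 < α₁)] at t2
    linarith
  -- The cross form solves for the coordinate that is expanded: given the first coordinate of the
  -- image and the height of the point, the horizontal expansion yields the first coordinate of the
  -- point.
  have hex : ∀ w : ℝ × ℝ, ∃ x, w ∈ box ρ → |x| ≤ ρ ∧ (P (x, w.2)).1 = w.1 := by
    intro w
    by_cases hw : w ∈ box ρ
    swap
    · exact ⟨0, fun h => absurd h hw⟩
    have hcont : ContinuousOn (fun x => (P (x, w.2)).1) (Icc (-ρ) ρ) :=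
      continuous_fst.comp_continuousOn (h.cd.continuousOn.comp
        (continuous_id.prodMk continuous_const).continuousOn fun x hx => ⟨abs_le.2 hx, hw.2⟩)
    have m0 : ((0 : ℝ), w.2) ∈ box ρ := ⟨by simpa using hρ0.le, hw.2⟩
    have hc0 := abs_le.1 (h.center w.2 hw.2)
    have hδβ : ρ ≤ (α₁ - κ) * ρ - δ := by
      have : ρ ≤ (θ * (α₁ - κ)) * ρ := le_mul_of_one_le_left hρ0.le h1
      nlinarith
    have e1 : (P (-ρ, w.2)).1 ≤ w.1 := by
      have t := h.fst (-ρ, w.2) ⟨by simp [abs_of_pos hρ0], hw.2⟩ _ m0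
      simp only [sub_zero, sub_self, abs_zero, mul_zero, add_zero, abs_neg, abs_of_pos hρ0] at t
      linarith [(abs_le.1 t).2, (abs_le.1 hw.1).1]
    have e2 : w.1 ≤ (P (ρ, w.2)).1 := by
      have t := h.fst (ρ, w.2) ⟨by simp [abs_of_pos hρ0], hw.2⟩ _ m0
      simp only [sub_zero, sub_self, abs_zero, mul_zero, add_zero, abs_of_pos hρ0] at t
      linarith [(abs_le.1 t).1, (abs_le.1 hw.1).2]
    obtain ⟨x, hx, hxe⟩ := intermediate_value_Icc (by linarith) hcont ⟨e1, e2⟩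
    exact ⟨x, fun _ => ⟨abs_le.2 hx, hxe⟩⟩
  choose K hK using hex
  have hq : ∀ w ∈ box ρ, ((K w, w.2) : ℝ × ℝ) ∈ box ρ := fun w hw => ⟨(hK w hw).1, hw.2⟩
  set L : ℝ × ℝ → ℝ := fun w => (P (K w, w.2)).2 with hL
  have lipK : ∀ w ∈ box ρ, ∀ z ∈ box ρ, |K w - K z| ≤ θ * |w.1 - z.1| + δ * |w.2 - z.2| := by
    intro w hw z hz
    have t := hexp _ (hq w hw) _ (hq z hz)
    simp only at t
    rw [(hK w hw).2, (hK z hz).2] at t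
    have n1 := abs_nonneg (K w - K z)
    have n2 := abs_nonneg (w.2 - z.2)
    have t2 : |K w - K z| ≤ θ * (α₁ - κ) * |K w - K z| := le_mul_of_one_le_left n1 h1
    have t3 := mul_le_mul_of_nonneg_left t hθ0.le
    have t4 : θ * (δ * |w.2 - z.2|) ≤ 1 * (δ * |w.2 - z.2|) := by gcongr
    linarith
  have lipL : ∀ w ∈ box ρ, ∀ z ∈ box ρ, |L w - L z| ≤
      κ * |w.1 - z.1| + (θ + δ * κ) * |w.2 - z.2| := by
    intro w hw z hz
    have t := h.snd _ (hq w hw) _ (hq z hz)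
    simp only at t
    have tK := mul_le_mul_of_nonneg_left (lipK w hw z hz) hκ0
    have t2 := abs_sub_abs_le_abs_sub (L w - L z) (α₂ * (w.2 - z.2))
    rw [abs_mul, abs_of_nonneg (by linarith : 0 ≤ α₂)] at t2
    have n1 := abs_nonneg (w.1 - z.1)
    have n2 := abs_nonneg (w.2 - z.2)
    have t3 : (α₂ + κ) * |w.2 - z.2| ≤ θ * |w.2 - z.2| := by gcongr
    have t4 : κ * (θ * |w.1 - z.1|) ≤ κ * (1 * |w.1 - z.1|) := by gcongr
    linarith
  have hcf : CrossForm ρ ρ θ δ κ (θ + δ * κ) K L := by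
    refine ⟨hρ0, hρ0.le, hθ0.le, hδ0, hκ0, by positivity, hθρ, by nlinarith, by nlinarith,
      fun w hw => (hK w hw).1, fun w hw => ?_, lipK, lipL⟩
    have t := h.snd _ (hq w hw) (K w, 0) ⟨(hK w hw).1, le_rfl, one_pos⟩
    simp only [h.zero _ (hK w hw).1, sub_self, abs_zero, mul_zero, zero_add, sub_zero,
      abs_of_nonneg hw.2.1] at t
    obtain ⟨t1, t2⟩ := abs_le.1 t
    have hw0 := hw.2.1
    simp only [hL]
    constructor <;> nlinarith
  have hqc : ContDiffOn ℝ 1 (fun w => ((K w, w.2) : ℝ × ℝ)) (box ρ) := by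
    have hΦ : ContDiffOn ℝ (1 : ℕ) (fun w => ((P w).1, w.2)) (box ρ) :=
      ((h.cd.of_le (by norm_num)).fst).prodMk contDiff_snd.contDiffOn
    have hKc : ContinuousOn K (box ρ) := by
      refine LipschitzOnWith.continuousOn (K := ⟨θ + δ, by positivity⟩)
        (LipschitzOnWith.of_dist_le_mul fun w hw z hz => (lipK w hw z hz).trans ?_)
      have n1 : |w.1 - z.1| ≤ dist w z := le_max_left _ _
      have n2 : |w.2 - z.2| ≤ dist w z := le_max_right _ _
      calc θ * |w.1 - z.1| + δ * |w.2 - z.2| ≤ θ * dist w z + δ * dist w z := by gcongr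
        _ = _ := by rw [← add_mul]; rfl
    have := contDiffOn_inverse hΦ le_rfl hUD hUD (q := fun w => ((K w, w.2) : ℝ × ℝ)) hq
      (fun w hw => Prod.ext (hK w hw).2 rfl) (hKc.prodMk continuous_snd.continuousOn) ?_
    · exact_mod_cast this
    intro w hw
    have hd : HasFDerivWithinAt (fun w => ((P w).1, w.2))
        (((ContinuousLinearMap.fst ℝ ℝ ℝ).comp (fderivWithin ℝ P (box ρ) w)).prod
          (ContinuousLinearMap.snd ℝ ℝ ℝ)) (box ρ) w :=
      ((ContinuousLinearMap.fst ℝ ℝ ℝ).hasFDerivAt.comp_hasFDerivWithinAt w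
        (h.hasFDerivWithinAt hw)).prodMk hasFDerivWithinAt_snd
    rw [hd.fderivWithin (hUD w hw)]
    refine exists_equiv_of_injective fun v hv => ?_
    have v2 : v.2 = 0 := congrArg Prod.snd hv
    have v1 : (fderivWithin ℝ P (box ρ) w (v.1, v.2)).1 = 0 := congrArg Prod.fst hv
    rw [(apply_mk _ _ _).1, v2, mul_zero, add_zero] at v1
    have hA := abs_le.1 (h.entries hρ0 hw).1
    rcases mul_eq_zero.1 v1 with h0 | h0
    · rw [h0] at hA; linarith [hA.1]
    · exact Prod.ext h0 v2
  obtain ⟨η, τ, U, V, e1, e2, hUc, hVc, e3⟩ := hcf.exists_C1_curve hqc.fst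
    (((h.cd.of_le (by norm_num)).comp hqc hq).snd)
  have hτI : ∀ s ∈ Ico (0 : ℝ) 1, τ s ∈ Ico (0 : ℝ) 1 := fun s hs =>
    ⟨(e1 s hs).2.1, (e1 s hs).2.2.1.trans_lt hs.2⟩
  have hPη : ∀ s ∈ Ico (0 : ℝ) 1, P (η s, s) = (η (τ s), τ s) := by
    intro s hs
    obtain ⟨-, -, -, g1, g2⟩ := e1 s hs
    have hb : ((η (τ s), s) : ℝ × ℝ) ∈ box ρ := ⟨(e1 _ (hτI s hs)).1, hs.1, hs.2⟩
    refine Prod.ext ?_ ?_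
    · rw [g1]; exact (hK _ hb).2
    · rw [g1]; exact g2.symm
  have hγ : MapsTo (fun s => ((η s, s) : ℝ × ℝ)) (Ico 0 1) (box ρ) := fun s hs =>
    ⟨(e1 s hs).1, hs.1, hs.2⟩
  have hηc : ContDiffOn ℝ 1 η (Ico 0 1) := by
    have : ContDiffOn ℝ ((0 : ℕ) + 1) η (Ico 0 1) :=
      contDiffOn_Ico_succ (fun s hs => (e3 s hs).1) (contDiffOn_zero.2 hUc)
    rwa [Nat.cast_zero, zero_add] at this
  have hτc : ContDiffOn ℝ 1 τ (Ico 0 1) := by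
    have : ContDiffOn ℝ ((0 : ℕ) + 1) τ (Ico 0 1) :=
      contDiffOn_Ico_succ (fun s hs => (e3 s hs).2.1) (contDiffOn_zero.2 hVc)
    rwa [Nat.cast_zero, zero_add] at this
  have hγc : ContDiffOn ℝ 1 (fun s => ((η s, s) : ℝ × ℝ)) (Ico 0 1) := hηc.prodMk contDiffOn_id
  have n10 : ‖((1 : ℝ), (0 : ℝ))‖ ≤ 1 := by simp [Prod.norm_def]
  have n01 : ‖((0 : ℝ), (1 : ℝ))‖ ≤ 1 := by simp [Prod.norm_def]
  set T : ℝ → (ℝ × ℝ) →L[ℝ] (ℝ × ℝ) := fun s => fderivWithin ℝ P (box ρ) (η s, s) with hT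
  obtain ⟨g1, g2⟩ : ContDiffOn ℝ 1 U (Ico 0 1) ∧
      ∀ s ∈ Ico (0 : ℝ) 1, ∀ t ∈ Ico (0 : ℝ) 1, |U s - U t| ≤ ρ * |s - t| := by
    -- The tangent (U, 1) at s is mapped to V · (U(τ s), 1). Elimination of V expresses the slope at
    -- s through the slope at the image, so the coefficients are those of the adjugate of the
    -- derivative.
    refine hc.slope_C1 (τ := τ) (U := U) (M11 := fun s => (T s (0, 1)).2)
      (M12 := fun s => -(T s (0, 1)).1) (M21 := fun s => -(T s (1, 0)).2)
      (M22 := fun s => (T s (1, 0)).1) hτc (fun s hs => ⟨(e1 s hs).2.1, (e1 s hs).2.2.1⟩)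
      (fun s hs t ht => (e2 s hs t ht).2) (h.entry_contDiffOn hρ0 hγc hγ _).2
      (h.entry_contDiffOn hρ0 hγc hγ _).1.neg (h.entry_contDiffOn hρ0 hγc hγ _).2.neg
      (h.entry_contDiffOn hρ0 hγc hγ _).1 (fun s hs => ?_) (fun s hs t ht => ?_) (fun s hs => ?_)
    · obtain ⟨a1, a2, a3, a4⟩ := h.entries hρ0 (hγ hs)
      refine ⟨?_, by rwa [abs_neg], by rwa [abs_neg], by linarith [(abs_le.1 a1).1]⟩
      rw [abs_le] at a4 ⊢
      constructor <;> linarith [a4.1, a4.2]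
    · have hl := (e2 s hs t ht).1
      obtain ⟨b1, b2⟩ := h.entry_lip (hγ hs) (hγ ht) hl n10
      obtain ⟨b3, b4⟩ := h.entry_lip (hγ hs) (hγ ht) hl n01
      have b5 := (h.lip _ (hγ hs) _ (hγ ht) hl).2
      rw [sub_apply, Prod.fst_sub] at b5
      refine ⟨b4, ?_, ?_, b1⟩
      · rw [neg_sub_neg, abs_sub_comm]; exact b5
      · rw [neg_sub_neg, abs_sub_comm]; exact b2
    · obtain ⟨f1, f2, f3, f4⟩ := e3 s hs
      refine ⟨f3, ?_⟩
      have hcomp : HasDerivWithinAt (fun t => η (τ t)) (U (τ s) * V s) (Ico 0 1) s :=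
        (e3 _ (hτI s hs)).1.comp s f2 hτI
      have hd := h.deriv_curve (γ := fun s => (η s, s)) (f1.prodMk (hasDerivWithinAt_id s _)) hs hγ
        hcomp f2 hPη
      obtain ⟨j1, j2⟩ := apply_mk (T s) (U s) 1
      rw [show T s (U s, 1) = _ from hd] at j1 j2
      simp only at j1 j2
      rw [j2] at j1
      linear_combination -j1
  exact ⟨η, U, invCurve_of_C1 (fun s hs => (e1 s hs).1)
    (fun s hs => ⟨(e3 s hs).1, (e3 s hs).2.2.1⟩) g1 g2 fun s hs _ => by rw [hPη s hs]⟩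

/-- A saddle that expands vertically has an invariant curve through the boundary. -/
theorem exists_invCurve_of_contracting (h : SaddleBox ρ κ δ N α₁ α₂ P)
    (hc : SaddleConst ρ θ κ δ N)
    (h1 : 1 ≤ θ * (α₂ - κ)) (h2 : α₁ + κ ≤ θ) (h3 : κ ≤ α₁) : ∃ e e', InvCurve ρ P e e' := by
  obtain ⟨hρ0, hρ1, hθ0, hθ1, hκ0, hκ, hδ0, hδ, hN0, hN⟩ := id hc
  have hσ : 0 < 1 - θ := by linarith
  have hδ1 : δ ≤ (1 - θ) / 16 := hδ.trans (by nlinarith)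
  have hθρ : θ * ρ + δ ≤ ρ := by nlinarith
  have hβ : 1 + κ ≤ α₂ - κ := by nlinarith
  have hβ0 : 0 < α₂ - κ := by linarith
  have hUD := uniqueDiffOn_box hρ0
  have hexp : ∀ w ∈ box ρ, ∀ z ∈ box ρ,
      (α₂ - κ) * |w.2 - z.2| ≤ |(P w).2 - (P z).2| + κ * |w.1 - z.1| := by
    intro w hw z hz
    have t1 := h.snd w hw z hz
    have t2 := abs_sub_abs_le_abs_sub (α₂ * (w.2 - z.2)) ((P w).2 - (P z).2)
    rw [abs_sub_comm (α₂ * (w.2 - z.2)), abs_mul, abs_of_pos (by linarith : 0 < α₂)] at t2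
    linarith
  have hgrow : ∀ x y, |x| ≤ ρ → y ∈ Ico (0 : ℝ) 1 → y ≤ (P (x, y)).2 := by
    intro x y hx hy
    have t := h.snd (x, y) ⟨hx, hy⟩ (x, 0) ⟨hx, le_rfl, one_pos⟩
    simp only [h.zero x hx, sub_self, abs_zero, mul_zero, zero_add, sub_zero,
      abs_of_nonneg hy.1] at t
    have := hy.1
    nlinarith [(abs_le.1 t).1]
  -- Now the height is expanded, so the cross form solves for the height of the preimage, and τ s is
  -- the height of the preimage of the point of the curve at height s.
  have hex : ∀ w : ℝ × ℝ, ∃ y, w ∈ box ρ → 0 ≤ y ∧ y ≤ w.2 ∧ (P (w.1, y)).2 = w.2 := by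
    intro w
    by_cases hw : w ∈ box ρ
    swap
    · exact ⟨0, fun h => absurd h hw⟩
    have hcont : ContinuousOn (fun y => (P (w.1, y)).2) (Icc 0 w.2) :=
      continuous_snd.comp_continuousOn (h.cd.continuousOn.comp
        (continuous_const.prodMk continuous_id).continuousOn fun y hy =>
          ⟨hw.1, hy.1, hy.2.trans_lt hw.2.2⟩)
    obtain ⟨y, hy, hye⟩ := intermediate_value_Icc hw.2.1 hcont
      ⟨(h.zero _ hw.1).le.trans hw.2.1, hgrow _ _ hw.1 hw.2⟩
    exact ⟨y, fun _ => ⟨hy.1, hy.2, hye⟩⟩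
  choose L hL using hex
  have hq : ∀ w ∈ box ρ, ((w.1, L w) : ℝ × ℝ) ∈ box ρ := fun w hw =>
    ⟨hw.1, (hL w hw).1, (hL w hw).2.1.trans_lt hw.2.2⟩
  set K : ℝ × ℝ → ℝ := fun w => (P (w.1, L w)).1 with hK
  have lipL : ∀ w ∈ box ρ, ∀ z ∈ box ρ, |L w - L z| ≤ κ * |w.1 - z.1| + θ * |w.2 - z.2| := by
    intro w hw z hz
    have t := hexp _ (hq w hw) _ (hq z hz)
    simp only at t
    rw [(hL w hw).2.2, (hL z hz).2.2] at t
    have n1 := abs_nonneg (L w - L z)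
    have n2 := abs_nonneg (w.1 - z.1)
    have t2 : |L w - L z| ≤ θ * (α₂ - κ) * |L w - L z| := le_mul_of_one_le_left n1 h1
    have t3 := mul_le_mul_of_nonneg_left t hθ0.le
    have t4 : θ * (κ * |w.1 - z.1|) ≤ 1 * (κ * |w.1 - z.1|) := by gcongr
    linarith
  have lipK : ∀ w ∈ box ρ, ∀ z ∈ box ρ, |K w - K z| ≤
      (θ + δ * κ) * |w.1 - z.1| + δ * |w.2 - z.2| := by
    intro w hw z hz
    have t := h.fst _ (hq w hw) _ (hq z hz)
    simp only at t
    have tL := mul_le_mul_of_nonneg_left (lipL w hw z hz) hδ0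
    have t2 := abs_sub_abs_le_abs_sub (K w - K z) (α₁ * (w.1 - z.1))
    rw [abs_mul, abs_of_nonneg (by linarith : 0 ≤ α₁)] at t2
    have n1 := abs_nonneg (w.1 - z.1)
    have n2 := abs_nonneg (w.2 - z.2)
    have t3 : (α₁ + κ) * |w.1 - z.1| ≤ θ * |w.1 - z.1| := by gcongr
    have t4 : δ * (θ * |w.2 - z.2|) ≤ δ * (1 * |w.2 - z.2|) := by gcongr
    linarith
  have hcf : CrossForm ρ ρ (θ + δ * κ) δ κ θ K L := by
    have hδκ : δ * κ ≤ (1 - θ) / 16 := (mul_le_mul hδ1 hκ hκ0 (by linarith)).trans (by nlinarith)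
    refine ⟨hρ0, hρ0.le, by positivity, hδ0, hκ0, hθ0.le, by nlinarith, by nlinarith, by nlinarith,
      fun w hw => ?_, fun w hw => ⟨(hL w hw).1, (hL w hw).2.1⟩, lipK, lipL⟩
    have hLI : L w ∈ Ico (0 : ℝ) 1 := (hq w hw).2
    have t := h.fst _ (hq w hw) (0, L w) ⟨by simpa using hρ0.le, hLI⟩
    have tc := h.center _ hLI
    simp only [sub_zero, sub_self, abs_zero, mul_zero, add_zero] at t
    have t1 : |K w| ≤ |K w - (P (0, L w)).1 - α₁ * w.1| + |(P (0, L w)).1| + |α₁ * w.1| := by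
      have e : K w = (K w - (P (0, L w)).1 - α₁ * w.1) + (P (0, L w)).1 + α₁ * w.1 := by ring
      nth_rewrite 1 [e]
      exact (abs_add_le _ _).trans (add_le_add (abs_add_le _ _) le_rfl)
    rw [abs_mul, abs_of_nonneg (by linarith : 0 ≤ α₁)] at t1
    have t2 : (α₁ + κ) * |w.1| ≤ θ * ρ :=
      mul_le_mul h2 hw.1 (abs_nonneg _) hθ0.le
    linarith
  have hqc : ContDiffOn ℝ 1 (fun w => ((w.1, L w) : ℝ × ℝ)) (box ρ) := by
    have hΦ : ContDiffOn ℝ (1 : ℕ) (fun w => (w.1, (P w).2)) (box ρ) :=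
      contDiff_fst.contDiffOn.prodMk ((h.cd.of_le (by norm_num)).snd)
    have hLc : ContinuousOn L (box ρ) := by
      refine LipschitzOnWith.continuousOn (K := ⟨κ + θ, by positivity⟩)
        (LipschitzOnWith.of_dist_le_mul fun w hw z hz => (lipL w hw z hz).trans ?_)
      have n1 : |w.1 - z.1| ≤ dist w z := le_max_left _ _
      have n2 : |w.2 - z.2| ≤ dist w z := le_max_right _ _
      calc κ * |w.1 - z.1| + θ * |w.2 - z.2| ≤ κ * dist w z + θ * dist w z := by gcongr
        _ = _ := by rw [← add_mul]; rfl
    have := contDiffOn_inverse hΦ le_rfl hUD hUD (q := fun w : ℝ × ℝ => ((w.1, L w) : ℝ × ℝ)) hq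
      (fun w hw => Prod.ext rfl (hL w hw).2.2) ((continuous_fst.continuousOn (s := box ρ)).prodMk hLc) ?_
    · exact_mod_cast this
    intro w hw
    have hd : HasFDerivWithinAt (fun w => (w.1, (P w).2))
        ((ContinuousLinearMap.fst ℝ ℝ ℝ).prod
          ((ContinuousLinearMap.snd ℝ ℝ ℝ).comp (fderivWithin ℝ P (box ρ) w))) (box ρ) w :=
      hasFDerivWithinAt_fst.prodMk ((ContinuousLinearMap.snd ℝ ℝ ℝ).hasFDerivAt.comp_hasFDerivWithinAt w
        (h.hasFDerivWithinAt hw))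
    rw [hd.fderivWithin (hUD w hw)]
    refine exists_equiv_of_injective fun v hv => ?_
    have v1 : v.1 = 0 := congrArg Prod.fst hv
    have v2 : (fderivWithin ℝ P (box ρ) w (v.1, v.2)).2 = 0 := congrArg Prod.snd hv
    rw [(apply_mk _ _ _).2, v1, mul_zero, zero_add] at v2
    have hA := abs_le.1 (h.entries hρ0 hw).2.2.2
    rcases mul_eq_zero.1 v2 with h0 | h0
    · rw [h0] at hA; linarith [hA.1]
    · exact Prod.ext v1 h0
  obtain ⟨η, τ, U, V, e1, e2, hUc, hVc, e3⟩ := hcf.exists_C1_curve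
    (((h.cd.of_le (by norm_num)).comp hqc hq).fst) hqc.snd
  have hτI : ∀ s ∈ Ico (0 : ℝ) 1, τ s ∈ Ico (0 : ℝ) 1 := fun s hs =>
    ⟨(e1 s hs).2.1, (e1 s hs).2.2.1.trans_lt hs.2⟩
  have hPη : ∀ s ∈ Ico (0 : ℝ) 1, P (η (τ s), τ s) = (η s, s) := by
    intro s hs
    obtain ⟨-, -, -, g1, g2⟩ := e1 s hs
    have hb : ((η (τ s), s) : ℝ × ℝ) ∈ box ρ := ⟨(e1 _ (hτI s hs)).1, hs.1, hs.2⟩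
    refine Prod.ext ?_ ?_
    · rw [g1, hK]
      simp only
      rw [← g2]
    · have := (hL _ hb).2.2
      simp only at this
      rwa [← g2] at this
  have hηI : MapsTo (fun s => ((η s, s) : ℝ × ℝ)) (Ico 0 1) (box ρ) := fun s hs =>
    ⟨(e1 s hs).1, hs.1, hs.2⟩
  have hγ : MapsTo (fun s => ((η (τ s), τ s) : ℝ × ℝ)) (Ico 0 1) (box ρ) := fun s hs =>
    hηI (hτI s hs)
  have hηc : ContDiffOn ℝ 1 η (Ico 0 1) := by
    have : ContDiffOn ℝ ((0 : ℕ) + 1) η (Ico 0 1) :=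
      contDiffOn_Ico_succ (fun s hs => (e3 s hs).1) (contDiffOn_zero.2 hUc)
    rwa [Nat.cast_zero, zero_add] at this
  have hτc : ContDiffOn ℝ 1 τ (Ico 0 1) := by
    have : ContDiffOn ℝ ((0 : ℕ) + 1) τ (Ico 0 1) :=
      contDiffOn_Ico_succ (fun s hs => (e3 s hs).2.1) (contDiffOn_zero.2 hVc)
    rwa [Nat.cast_zero, zero_add] at this
  have hγc : ContDiffOn ℝ 1 (fun s => ((η (τ s), τ s) : ℝ × ℝ)) (Ico 0 1) :=
    (hηc.comp hτc hτI).prodMk hτc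
  have n10 : ‖((1 : ℝ), (0 : ℝ))‖ ≤ 1 := by simp [Prod.norm_def]
  have n01 : ‖((0 : ℝ), (1 : ℝ))‖ ≤ 1 := by simp [Prod.norm_def]
  set T : ℝ → (ℝ × ℝ) →L[ℝ] (ℝ × ℝ) := fun s => fderivWithin ℝ P (box ρ) (η (τ s), τ s) with hT
  obtain ⟨g1, g2⟩ : ContDiffOn ℝ 1 U (Ico 0 1) ∧
      ∀ s ∈ Ico (0 : ℝ) 1, ∀ t ∈ Ico (0 : ℝ) 1, |U s - U t| ≤ ρ * |s - t| := by
    -- Here the tangent at the preimage, of height τ s, is mapped to the tangent at height s, so the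
    -- coefficients are the entries of the derivative itself.
    refine hc.slope_C1 (τ := τ) (U := U) (M11 := fun s => (T s (1, 0)).1)
      (M12 := fun s => (T s (0, 1)).1) (M21 := fun s => (T s (1, 0)).2)
      (M22 := fun s => (T s (0, 1)).2) hτc (fun s hs => ⟨(e1 s hs).2.1, (e1 s hs).2.2.1⟩)
      (fun s hs t ht => (e2 s hs t ht).2) (h.entry_contDiffOn hρ0 hγc hγ _).1
      (h.entry_contDiffOn hρ0 hγc hγ _).1 (h.entry_contDiffOn hρ0 hγc hγ _).2
      (h.entry_contDiffOn hρ0 hγc hγ _).2 (fun s hs => ?_) (fun s hs t ht => ?_) (fun s hs => ?_)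
    · obtain ⟨a1, a2, a3, a4⟩ := h.entries hρ0 (hγ hs)
      refine ⟨?_, a2, a3, by linarith [(abs_le.1 a4).1]⟩
      rw [abs_le] at a1 ⊢
      constructor <;> linarith [a1.1, a1.2]
    · have hl := (e2 _ (hτI s hs) _ (hτI t ht)).1
      have hτl := (e2 s hs t ht).2
      obtain ⟨b1, b2⟩ := h.entry_lip (hγ hs) (hγ ht) hl n10
      obtain ⟨b3, b4⟩ := h.entry_lip (hγ hs) (hγ ht) hl n01
      have b5 := (h.lip _ (hγ hs) _ (hγ ht) hl).2
      rw [sub_apply, Prod.fst_sub] at b5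
      have u1 : N * |τ s - τ t| ≤ N * |s - t| := by gcongr
      have u2 : δ * |τ s - τ t| ≤ δ * |s - t| := by gcongr
      exact ⟨b1.trans u1, b5.trans u2, b2.trans u1, b4.trans u1⟩
    · obtain ⟨f1, f2, f3, f4⟩ := e3 s hs
      refine ⟨f3, ?_⟩
      have hcomp : HasDerivWithinAt (fun t => η (τ t)) (U (τ s) * V s) (Ico 0 1) s :=
        (e3 _ (hτI s hs)).1.comp s f2 hτI
      have hd := h.deriv_curve (γ := fun s => (η (τ s), τ s)) (hcomp.prodMk f2) hs hγ
        f1 (hasDerivWithinAt_id s _) hPη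
      obtain ⟨j1, j2⟩ := apply_mk (T s) (U (τ s) * V s) (V s)
      rw [show T s (U (τ s) * V s, V s) = _ from hd] at j1 j2
      simp only at j1 j2
      rw [j1]
      linear_combination (-((T s (1, 0)).1 * U (τ s) + (T s (0, 1)).1)) * j2
  refine ⟨η, U, invCurve_of_C1 (fun s hs => (e1 s hs).1)
    (fun s hs => ⟨(e3 s hs).1, (e3 s hs).2.2.1⟩) g1 g2 fun y hy hP1 => ?_⟩
  set s := (P (η y, y)).2 with hs
  have hsI : s ∈ Ico (0 : ℝ) 1 := ⟨hy.1.trans (hgrow _ _ (e1 y hy).1 hy), hP1⟩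
  -- Backward invariance gives forward invariance: points of the curve are separated vertically by
  -- the expansion, so the preimage at height τ s is the point at height y.
  have hτy : τ s = y := by
    have t := hexp _ (hηI (hτI s hsI)) _ (hηI hy)
    simp only at t
    rw [hPη s hsI, ← hs, sub_self, abs_zero, zero_add] at t
    have t2 := (e2 _ (hτI s hsI) _ hy).1
    have t3 : κ * |η (τ s) - η y| ≤ κ * (1 * |τ s - y|) := by
      gcongr
      exact t2.trans (by gcongr)
    have n1 := abs_nonneg (τ s - y)
    have : |τ s - y| ≤ 0 := by nlinarith
    exact sub_eq_zero.1 (abs_nonpos_iff.1 this)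
  have := hPη s hsI
  rw [hτy] at this
  rw [this]

end SaddleBox

/-! ### From closeness to the model to invariant curves near the lines. -/

theorem uniqueDiffOn_strip (r : ℝ) : UniqueDiffOn ℝ (strip r) := by
  have e : strip r = univ ×ˢ Ico 0 r := by ext w; simp [strip]
  rw [e]
  exact uniqueDiffOn_univ.prod (uniqueDiffOn_Ico 0 r)

/-- A uniform bound on the derivatives up to order two, in the sense of `C11`. -/
theorem C11.of_iteratedFDerivWithin {u : ℝ × ℝ → ℝ × ℝ} {δ r : ℝ}
    (hu : ContDiffOn ℝ 2 u (strip r))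
    (h : ∀ k : ℕ, k ≤ 2 → ∀ w ∈ strip r, ‖iteratedFDerivWithin ℝ k u (strip r) w‖ < δ) :
    C11 δ (strip r) u (fderivWithin ℝ u (strip r)) := by
  have hU := uniqueDiffOn_strip r
  have hu' : ContDiffOn ℝ 1 (fderivWithin ℝ u (strip r)) (strip r) :=
    hu.fderivWithin hU (by norm_num)
  refine ⟨⟨fun w hw => ((hu.differentiableOn (by norm_num)) w hw).hasFDerivWithinAt,
    fun w hw => ?_, fun w hw z hz => ?_⟩, fun w hw => ?_⟩
  · have := h 1 (by norm_num) w hw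
    rw [norm_iteratedFDerivWithin_one _ (hU w hw)] at this
    exact this.le
  · refine (convex_strip r).norm_image_sub_le_of_norm_fderivWithin_le
      (hu'.differentiableOn (by norm_num)) (fun x hx => ?_) hz hw
    have := h 2 le_rfl x hx
    rw [← norm_iteratedFDerivWithin_fderivWithin hU hx,
      norm_iteratedFDerivWithin_one _ (hU x hx)] at this
    exact this.le
  · have := h 0 (by norm_num) w hw
    rw [norm_iteratedFDerivWithin_zero] at this
    exact this.le

/-- A perturbation of a skew product over an interval map with a fixed point is a saddle box. -/
theorem saddleBox_of_perturbation {A m A' m' : ℝ → ℝ} {M ρ δ x₀ : ℝ} {g : ℝ × ℝ → ℝ × ℝ}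
    {u' : ℝ × ℝ → (ℝ × ℝ) →L[ℝ] (ℝ × ℝ)} (hM : 1 ≤ M) (hρ : 0 < ρ) (hρ1 : ρ ≤ 1)
    (hA : ∀ x, HasDerivAt A (A' x) x) (hm : ∀ x, HasDerivAt m (m' x) x)
    (hA' : ∀ x y, |A' x - A' y| ≤ M * |x - y|) (hm' : ∀ x y, |m' x - m' y| ≤ M * |x - y|)
    (hA0 : A x₀ = x₀) (hm0 : m' x₀ = 0)
    (hg : ContDiffOn ℝ 2 g (strip 1))
    (hu : C11 δ (strip 1) (fun w => g w - (A w.1, w.2 * m w.1)) u')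
    (h0 : ∀ x, (g (x, 0)).2 = 0) :
    SaddleBox ρ (M * ρ + δ) δ (5 * M * ρ + δ) (A' x₀) (m x₀)
      (fun w => g (w + (x₀, 0)) - (x₀, 0)) := by
  have hδ : 0 ≤ δ := (norm_nonneg _).trans (hu.val (0, 0) ⟨le_rfl, one_pos⟩)
  have hM0 : 0 ≤ M := by linarith
  have hs : MapsTo (fun w : ℝ × ℝ => w + (x₀, 0)) (box ρ) (strip 1) := fun w hw => by
    simpa [strip] using hw.2
  -- The derivative of m vanishes at x₀, so on the box the Lipschitz constant of m is proportional
  -- to ρ.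
  have hmL : ∀ x y, |x| ≤ ρ → |y| ≤ ρ → |m (x + x₀) - m (y + x₀)| ≤ M * ρ * |x - y| := by
    intro x y hx hy
    refine (convex_Icc (-ρ) ρ).norm_image_sub_le_of_norm_hasDerivWithin_le
      (f := fun x => m (x + x₀)) (f' := fun x => m' (x + x₀))
      (fun t _ => ((hm _).comp_add_const t x₀).hasDerivWithinAt) (fun t ht => ?_)
      (abs_le.1 hy) (abs_le.1 hx)
    have := hm' (t + x₀) x₀
    rw [hm0, sub_zero, add_sub_cancel_right] at this
    exact this.trans (by gcongr; exact abs_le.2 ht)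
  have hAL : ∀ x y, |x| ≤ ρ → |y| ≤ ρ →
      |A (x + x₀) - A (y + x₀) - A' x₀ * (x - y)| ≤ M * ρ * |x - y| := by
    intro x y hx hy
    have := (convex_Icc (-ρ) ρ).norm_image_sub_le_of_norm_hasDerivWithin_le
      (f := fun x => A (x + x₀) - A' x₀ * x) (f' := fun x => A' (x + x₀) - A' x₀ * 1) (C := M * ρ)
      (fun t _ => (((hA _).comp_add_const t x₀).sub
        ((hasDerivAt_id t).const_mul _)).hasDerivWithinAt) (fun t ht => ?_)
      (abs_le.1 hy) (abs_le.1 hx)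
    · rw [Real.norm_eq_abs, Real.norm_eq_abs] at this
      refine le_trans (le_of_eq ?_) this
      congr 1
      ring
    · have := hA' (t + x₀) x₀
      rw [add_sub_cancel_right] at this
      rw [mul_one]
      exact this.trans (by gcongr; exact abs_le.2 ht)
  set u : ℝ × ℝ → ℝ × ℝ := fun w => g w - (A w.1, w.2 * m w.1) with hu_def
  have huL : ∀ w ∈ box ρ, ∀ z ∈ box ρ, ‖u (w + (x₀, 0)) - u (z + (x₀, 0))‖ ≤
      δ * |w.1 - z.1| + δ * |w.2 - z.2| := by
    intro w hw z hz
    refine (hu.lipschitz (convex_strip 1) (hs hw) (hs hz)).trans ?_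
    rw [add_sub_add_right_eq_sub, ← mul_add]
    gcongr
    exact max_le (le_add_of_nonneg_right (abs_nonneg _)) (le_add_of_nonneg_left (abs_nonneg _))
  set D : ℝ × ℝ → (ℝ × ℝ) →L[ℝ] (ℝ × ℝ) := fun w =>
    (A' (w.1 + x₀) • ContinuousLinearMap.fst ℝ ℝ ℝ).prod
      (w.2 • m' (w.1 + x₀) • ContinuousLinearMap.fst ℝ ℝ ℝ +
        m (w.1 + x₀) • ContinuousLinearMap.snd ℝ ℝ ℝ) + u' (w + (x₀, 0)) with hD
  have hPD : ∀ w ∈ box ρ, HasFDerivWithinAt (fun w => g (w + (x₀, 0)) - (x₀, 0)) (D w) (box ρ) w := by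
    intro w hw
    have a1 : HasFDerivWithinAt (fun w : ℝ × ℝ => w.1 + x₀) (ContinuousLinearMap.fst ℝ ℝ ℝ)
        (box ρ) w := hasFDerivWithinAt_fst.add_const x₀
    have a2 := (hA (w.1 + x₀)).comp_hasFDerivWithinAt w a1
    have a3 := (hm (w.1 + x₀)).comp_hasFDerivWithinAt w a1
    have a4 : HasFDerivWithinAt (fun w => u (w + (x₀, 0))) (u' (w + (x₀, 0))) (box ρ) w :=
      (hu.deriv _ (hs hw)).comp w ((hasFDerivWithinAt_id w _).add_const _) hs
    refine (((a2.prodMk ((hasFDerivWithinAt_snd (p := w)).mul a3)).add a4).sub_const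
      (x₀, 0)).congr (fun z _ => ?_) ?_ <;> simp [hu_def]
  have hPf : ∀ w ∈ box ρ, fderivWithin ℝ (fun w => g (w + (x₀, 0)) - (x₀, 0)) (box ρ) w = D w :=
    fun w hw => (hPD w hw).fderivWithin (uniqueDiffOn_box hρ w hw)
  have split1 : ∀ w, g w = (A w.1, w.2 * m w.1) + u w := fun w => by simp [hu_def]
  refine ⟨?_, fun w hw z hz => ?_, fun w hw z hz => ?_, fun x _ => ?_, fun y hy => ?_,
    fun w hw z hz hwz => ?_⟩
  · exact (hg.comp (contDiff_id.add contDiff_const).contDiffOn hs).sub contDiffOn_const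
  · have h1 := (norm_fst_le _).trans (huL w hw z hz)
    have h2 := hAL _ _ hw.1 hz.1
    rw [split1, split1 (z + _)]
    simp only [Prod.fst_sub, Prod.fst_add, Real.norm_eq_abs] at h1 ⊢
    rw [show A (w.1 + x₀) + (u (w + (x₀, 0))).1 - x₀ - (A (z.1 + x₀) + (u (z + (x₀, 0))).1 - x₀) -
      A' x₀ * (w.1 - z.1) = (A (w.1 + x₀) - A (z.1 + x₀) - A' x₀ * (w.1 - z.1)) +
        ((u (w + (x₀, 0))).1 - (u (z + (x₀, 0))).1) by ring]
    refine (abs_add_le _ _).trans ?_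
    linarith
  · have h1 := (norm_snd_le _).trans (huL w hw z hz)
    have h2 := hmL _ _ hw.1 hz.1
    have h3 := hmL w.1 0 hw.1 (by simpa using hρ.le)
    rw [sub_zero, zero_add] at h3
    rw [split1, split1 (z + _)]
    simp only [Prod.snd_sub, Prod.snd_add, Prod.fst_add, Real.norm_eq_abs, sub_zero, add_zero]
      at h1 ⊢
    rw [show w.2 * m (w.1 + x₀) + (u (w + (x₀, 0))).2 - (z.2 * m (z.1 + x₀) + (u (z + (x₀, 0))).2) -
      m x₀ * (w.2 - z.2) = (m (w.1 + x₀) - m x₀) * (w.2 - z.2) +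
        z.2 * (m (w.1 + x₀) - m (z.1 + x₀)) + ((u (w + (x₀, 0))).2 - (u (z + (x₀, 0))).2) by ring]
    refine (abs_add_le _ _).trans ((add_le_add (abs_add_le _ _) h1).trans ?_)
    rw [abs_mul, abs_mul, abs_of_nonneg hz.2.1]
    have t1 : |m (w.1 + x₀) - m x₀| * |w.2 - z.2| ≤ M * ρ * |w.2 - z.2| := by
      gcongr
      refine h3.trans ?_
      have : M * ρ * |w.1| ≤ M * ρ * 1 := by gcongr; exact hw.1.trans hρ1
      linarith
    have t2 : z.2 * |m (w.1 + x₀) - m (z.1 + x₀)| ≤ 1 * (M * ρ * |w.1 - z.1|) :=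
      mul_le_mul hz.2.2.le h2 (abs_nonneg _) zero_le_one
    linarith
  · simp [h0]
  · rw [split1]
    have h1 := (norm_fst_le _).trans (hu.val (x₀, y) hy)
    simpa [hA0] using h1
  · have hN : ‖w - z‖ ≤ |w.2 - z.2| := by
      refine max_le (hwz.trans ?_) le_rfl
      exact mul_le_of_le_one_left (abs_nonneg _) hρ1
    have h1 : ‖u' (w + (x₀, 0)) - u' (z + (x₀, 0))‖ ≤ δ * |w.2 - z.2| := by
      refine (hu.lip _ (hs hw) _ (hs hz)).trans ?_
      rw [add_sub_add_right_eq_sub]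
      gcongr
    have n0 := abs_nonneg (w.2 - z.2)
    have e1 : |A' (w.1 + x₀) - A' (z.1 + x₀)| ≤ M * ρ * |w.2 - z.2| := by
      refine (hA' _ _).trans ?_
      rw [add_sub_add_right_eq_sub, mul_assoc]
      gcongr
    have e2 : |m (w.1 + x₀) - m (z.1 + x₀)| ≤ M * ρ * |w.2 - z.2| := by
      exact (hmL _ _ hw.1 hz.1).trans (mul_le_mul_of_nonneg_left
        (hwz.trans (mul_le_of_le_one_left n0 hρ1)) (by positivity))
    have e3 : |w.2 * m' (w.1 + x₀) - z.2 * m' (z.1 + x₀)| ≤ 2 * (M * ρ * |w.2 - z.2|) := by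
      have a1 := hm' (w.1 + x₀) x₀
      rw [hm0, sub_zero, add_sub_cancel_right] at a1
      have a2 := hm' (w.1 + x₀) (z.1 + x₀)
      rw [add_sub_add_right_eq_sub] at a2
      rw [show w.2 * m' (w.1 + x₀) - z.2 * m' (z.1 + x₀) = (w.2 - z.2) * m' (w.1 + x₀) +
        z.2 * (m' (w.1 + x₀) - m' (z.1 + x₀)) by ring]
      refine (abs_add_le _ _).trans ?_
      rw [abs_mul, abs_mul, abs_of_nonneg hz.2.1]
      have b1 : |w.2 - z.2| * |m' (w.1 + x₀)| ≤ |w.2 - z.2| * (M * ρ) := by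
        gcongr
        exact a1.trans (by gcongr; exact hw.1)
      have b2 : z.2 * |m' (w.1 + x₀) - m' (z.1 + x₀)| ≤ 1 * (M * (ρ * |w.2 - z.2|)) :=
        mul_le_mul hz.2.2.le (a2.trans (by gcongr)) (abs_nonneg _) zero_le_one
      linarith
    rw [hPf w hw, hPf z hz]
    constructor
    · refine ContinuousLinearMap.opNorm_le_bound _ (by positivity) fun v => ?_
      have hv1 : |v.1| ≤ ‖v‖ := norm_fst_le v
      have hv2 : |v.2| ≤ ‖v‖ := norm_snd_le v
      have e : (D w - D z) v = ((A' (w.1 + x₀) - A' (z.1 + x₀)) * v.1,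
          (w.2 * m' (w.1 + x₀) - z.2 * m' (z.1 + x₀)) * v.1 +
            (m (w.1 + x₀) - m (z.1 + x₀)) * v.2) + (u' (w + (x₀, 0)) - u' (z + (x₀, 0))) v := by
        ext <;> simp [hD] <;> ring
      rw [e]
      refine (norm_add_le _ _).trans ?_
      have c1 : ‖(u' (w + (x₀, 0)) - u' (z + (x₀, 0))) v‖ ≤ δ * |w.2 - z.2| * ‖v‖ :=
        ContinuousLinearMap.le_of_opNorm_le _ h1 v
      have c2 : ‖((A' (w.1 + x₀) - A' (z.1 + x₀)) * v.1,
          (w.2 * m' (w.1 + x₀) - z.2 * m' (z.1 + x₀)) * v.1 +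
            (m (w.1 + x₀) - m (z.1 + x₀)) * v.2)‖ ≤ 5 * M * ρ * |w.2 - z.2| * ‖v‖ := by
        have X : 0 ≤ M * ρ * |w.2 - z.2| * ‖v‖ := by positivity
        refine max_le ?_ ((abs_add_le _ _).trans ?_)
        · change |_| ≤ _
          rw [abs_mul]
          have := mul_le_mul e1 hv1 (abs_nonneg _) (by positivity)
          linarith
        · rw [abs_mul, abs_mul]
          have := mul_le_mul e2 hv2 (abs_nonneg _) (by positivity)
          have := mul_le_mul e3 hv1 (abs_nonneg _) (by positivity)
          linarith
      linarith
    -- In a skew product the first coordinate does not depend on the height, so this entry comes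
    -- from the perturbation alone and is of size δ, which can be chosen small compared with ρ.
    · have e : ((D w - D z) (0, 1)).1 = ((u' (w + (x₀, 0)) - u' (z + (x₀, 0))) (0, 1)).1 := by
        simp [hD]
      rw [e]
      refine (norm_fst_le _).trans ((ContinuousLinearMap.le_of_opNorm_le _ h1 _).trans ?_)
      simp [Prod.norm_def]

section

variable {p : ℕ} {lam : ℝ}

theorem modelAngle_pi_mul (hp : 1 ≤ p) (j : ℤ) :
    modelAngle p lam (Real.pi * j / p) = Real.pi * j / p := by
  have hp' : (0 : ℝ) < p := by exact_mod_cast hp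
  have e : Real.sin (p * (Real.pi * j / p) / 2) * Real.cos (p * (Real.pi * j / p) / 2) = 0 := by
    have h1 := Real.sin_two_mul (p * (Real.pi * j / p) / 2)
    rw [show 2 * (p * (Real.pi * j / p) / 2) = j * Real.pi by field_simp, Real.sin_int_mul_pi] at h1
    linarith
  simp [modelAngle, e]

theorem sin_or_cos_eq_zero (hp : 1 ≤ p) (j : ℤ) : Real.sin (p * (Real.pi * j / p) / 2) = 0 ∨
    Real.cos (p * (Real.pi * j / p) / 2) = 0 := by
  have hp' : (0 : ℝ) < p := by exact_mod_cast hp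
  have h1 := Real.sin_two_mul (p * (Real.pi * j / p) / 2)
  rw [show 2 * (p * (Real.pi * j / p) / 2) = j * Real.pi by field_simp, Real.sin_int_mul_pi] at h1
  rcases mul_eq_zero.1 h1.symm with h | h
  · left; simpa using h
  · exact Or.inr h

/-- The derivative of mult² is a multiple of sin · cos, which vanishes on all lines. -/
theorem deriv_mult_pi_mul (hp : 1 ≤ p) (hl : 0 < lam) (j : ℤ) :
    deriv (mult p lam) (Real.pi * j / p) = 0 := by
  set x := Real.pi * j / p
  have hd : HasDerivAt (mult p lam) (deriv (mult p lam) x) x :=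
    ((contDiff_mult p hl 1).differentiable (by norm_num) x).hasDerivAt
  have h1 : HasDerivAt (fun x => mult p lam x ^ 2) (2 * mult p lam x * deriv (mult p lam) x) x := by
    refine (hd.pow 2).congr_deriv ?_
    norm_num
  have hi : HasDerivAt (fun x : ℝ => (p : ℝ) * x / 2) ((p : ℝ) / 2) x := by
    simpa using ((hasDerivAt_id x).const_mul (p : ℝ)).div_const 2
  have h2 : HasDerivAt (fun x => mult p lam x ^ 2) _ x :=
    (((hi.cos.pow 2).div_const (lam ^ 2)).add ((hi.sin.pow 2).const_mul (lam ^ 2))).congr_of_eventuallyEq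
      (Eventually.of_forall fun y => by simp [mult_sq p hl])
  have h3 := h1.unique h2
  have h4 : Real.sin (p * x / 2) * Real.cos (p * x / 2) = 0 := by
    rcases sin_or_cos_eq_zero hp j with h | h
    · rw [h, zero_mul]
    · rw [h, mul_zero]
  have h5 : 2 * mult p lam x * deriv (mult p lam) x = 0 := by
    rw [h3]
    simp only [Nat.cast_ofNat, Nat.add_one_sub_one, pow_one]
    linear_combination (-(p : ℝ) / lam ^ 2 + lam ^ 2 * p) * h4
  have := mult_pos p hl x
  rcases mul_eq_zero.1 h5 with h | h
  · linarith
  · exact h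

/-- The regularity of the angular part and of the vertical multiplier of the model. -/
theorem exists_model_entry_bound (hp : 1 ≤ p) (hl : 0 < lam) : ∃ M : ℝ, 1 ≤ M ∧
    (∀ x, HasDerivAt (mult p lam) (deriv (mult p lam) x) x) ∧
    (∀ x y, |1 / mult p lam x ^ 2 - 1 / mult p lam y ^ 2| ≤ M * |x - y|) ∧
    ∀ x y, |deriv (mult p lam) x - deriv (mult p lam) y| ≤ M * |x - y| := by
  obtain ⟨M, hM1, hM, -⟩ := exists_model_bound hp hl
  have hd : ∀ x, HasDerivAt (mult p lam) (deriv (mult p lam) x) x := fun x =>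
    ((contDiff_mult p hl 1).differentiable (by norm_num) x).hasDerivAt
  have n10 : ‖((1 : ℝ), (0 : ℝ))‖ ≤ 1 := by simp [Prod.norm_def]
  have hf : ∀ x, fderiv ℝ (modelLift p lam) (x, 1) (1, 0) =
      (1 / mult p lam x ^ 2, deriv (mult p lam) x) := by
    intro x
    have hdf : HasFDerivAt (modelLift p lam) (fderiv ℝ (modelLift p lam) (x, 1)) (x, 1) :=
      ((contDiff_modelLift p hl 1).differentiable (by norm_num) _).hasFDerivAt
    have h1 := hdf.comp_hasDerivAt x ((hasDerivAt_id x).prodMk (hasDerivAt_const x (1 : ℝ)))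
    have h2 : HasDerivAt (fun x => (modelAngle p lam x, mult p lam x))
      (1 / mult p lam x ^ 2, deriv (mult p lam) x) x := (hasDerivAt_modelAngle hp hl x).prodMk (hd x)
    refine h1.unique (h2.congr_of_eventuallyEq (Eventually.of_forall fun y => ?_))
    simp [modelLift_eq]
  have hm : ∀ x : ℝ, ((x, 1) : ℝ × ℝ) ∈ {w : ℝ × ℝ | 0 ≤ w.2 ∧ w.2 ≤ 1} := fun x =>
    ⟨zero_le_one, le_rfl⟩
  have hL : ∀ x y, ‖((1 / mult p lam x ^ 2, deriv (mult p lam) x) : ℝ × ℝ) -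
      (1 / mult p lam y ^ 2, deriv (mult p lam) y)‖ ≤ M * |x - y| := by
    intro x y
    rw [← hf, ← hf, ← sub_apply]
    have := ContinuousLinearMap.le_of_opNorm_le_of_le _ (hM.lip _ (hm x) _ (hm y)) n10
    simpa [Prod.norm_def] using this
  refine ⟨M, hM1, hd, fun x y => (norm_fst_le _).trans (hL x y),
    fun x y => (norm_snd_le _).trans (hL x y)⟩

/-- A map that is close to the model has near each of the vertical lines an invariant curve. -/
theorem exists_invCurve (hp : 1 ≤ p) (hl : 1 < lam) : ∃ ρ₀ : ℝ, 0 < ρ₀ ∧ ∀ ρ, 0 < ρ → ρ ≤ ρ₀ →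
    ∃ δ₀ : ℝ, 0 < δ₀ ∧ ∀ δ ≤ δ₀, ∀ (g : ℝ × ℝ → ℝ × ℝ) (u' : ℝ × ℝ → (ℝ × ℝ) →L[ℝ] (ℝ × ℝ)),
      ContDiffOn ℝ 2 g (strip 1) → C11 δ (strip 1) (fun w => g w - modelLift p lam w) u' →
      (∀ x, (g (x, 0)).2 = 0) → ∀ j : ℤ, ∃ e e' : ℝ → ℝ, InvCurve ρ
        (fun w => g (w + (Real.pi * j / p, 0)) - (Real.pi * j / p, 0)) e e' := by
  have hl0 : 0 < lam := zero_lt_one.trans hl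
  obtain ⟨M, hM1, hd, hA', hm'⟩ := exists_model_entry_bound hp hl0
  obtain ⟨i, hi⟩ : ∃ i, i = 1 / lam := ⟨_, rfl⟩
  have hil : i * lam = 1 := by rw [hi]; field_simp
  have hi0 : 0 < i := by rw [hi]; positivity
  have hi1 : i < 1 := by rw [hi, div_lt_one hl0]; exact hl
  obtain ⟨θ, hθ⟩ : ∃ θ, θ = (1 + i) / 2 := ⟨_, rfl⟩
  have hs : 0 < 1 - θ := by linarith
  -- The three bounds serve the smallness conditions of `SaddleConst`, the positivity of the smaller
  -- multiplier up to the error κ, and the expansion of the larger one.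
  obtain ⟨c, hc⟩ : ∃ c, c = min ((1 - θ) / 16) (min (i ^ 2) ((lam - 1) / 2)) := ⟨_, rfl⟩
  have hc0 : 0 < c := by
    rw [hc]; exact lt_min (by linarith) (lt_min (by positivity) (by linarith))
  have hc1 : c ≤ (1 - θ) / 16 := hc ▸ min_le_left _ _
  have hc2 : c ≤ i ^ 2 := hc ▸ (min_le_right _ _).trans (min_le_left _ _)
  have hc3 : c ≤ (lam - 1) / 2 := hc ▸ (min_le_right _ _).trans (min_le_right _ _)
  refine ⟨min 1 (c / (10 * M)), lt_min one_pos (by positivity), fun ρ hρ hρ0 => ?_⟩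
  have hρ1 : ρ ≤ 1 := hρ0.trans (min_le_left _ _)
  have hρM : M * ρ ≤ c / 10 := by
    have := hρ0.trans (min_le_right _ _)
    rw [le_div_iff₀ (by positivity)] at this
    linarith
  refine ⟨min (c / 2) ((1 - θ) * ρ / 16), lt_min (by positivity) (by positivity),
    fun δ hδ g u' hg hu h0 j => ?_⟩
  have hδ0 : 0 ≤ δ := (norm_nonneg _).trans (hu.val (0, 0) ⟨le_rfl, one_pos⟩)
  have hδ1 : δ ≤ c / 2 := hδ.trans (min_le_left _ _)
  have hδ2 : δ ≤ (1 - θ) * ρ / 16 := hδ.trans (min_le_right _ _)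
  have hMρ : 0 ≤ M * ρ := by positivity
  have hsb := saddleBox_of_perturbation (x₀ := Real.pi * j / p) hM1 hρ hρ1
    (fun x => hasDerivAt_modelAngle hp hl0 x) hd hA' hm' (modelAngle_pi_mul hp j)
    (deriv_mult_pi_mul hp hl0 j) hg hu h0
  have hsc : SaddleConst ρ θ (M * ρ + δ) δ (5 * M * ρ + δ) :=
    ⟨hρ, hρ1, by linarith, by linarith, by linarith, by linarith, hδ0, hδ2, by linarith, by linarith⟩
  have hκ : M * ρ + δ ≤ c := by linarith
  have hii : i ^ 2 ≤ i := by nlinarith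
  rcases sin_or_cos_eq_zero hp j with h | h
  · have e2 : mult p lam (Real.pi * j / p) = i := by rw [mult_of_sin_eq_zero hl0 h, hi]
    have e1 : 1 / mult p lam (Real.pi * j / p) ^ 2 = lam ^ 2 := by
      rw [e2, hi]; field_simp
    rw [e1, e2] at hsb
    refine hsb.exists_invCurve_of_expanding hsc ?_ ?_ ?_
    · have t : lam ≤ lam ^ 2 - (M * ρ + δ) := by nlinarith
      calc (1 : ℝ) ≤ θ * lam := by rw [hθ]; linarith
        _ ≤ _ := mul_le_mul_of_nonneg_left t (by linarith)
    · linarith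
    · linarith
  · have e2 : mult p lam (Real.pi * j / p) = lam := mult_of_cos_eq_zero hl0 h
    have e1 : 1 / mult p lam (Real.pi * j / p) ^ 2 = i ^ 2 := by
      rw [e2, hi]; field_simp
    rw [e1, e2] at hsb
    refine hsb.exists_invCurve_of_contracting hsc ?_ ?_ ?_
    · have : θ * (M * ρ + δ) ≤ 1 * c := mul_le_mul (by linarith) hκ (by linarith) zero_le_one
      have : θ * lam = (lam + 1) / 2 := by rw [hθ]; linarith
      linarith
    · linarith
    · linarith

end

/-! ### Products and finite sums of small functions. -/

theorem C11.mul {E : Type*} [NormedAddCommGroup E] [NormedSpace ℝ E] {k B : ℝ} {D : Set E}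
    {u v : E → ℝ} {u' v' : E → E →L[ℝ] ℝ} (hk : 0 ≤ k) (hB : 0 ≤ B) (hD : Convex ℝ D)
    (hu : C11 k D u u') (hv : C11 B D v v') :
    C11 (4 * k * B) D (fun w => u w * v w) (fun w => u w • v' w + v w • u' w) := by
  have hkB : 0 ≤ k * B := mul_nonneg hk hB
  refine ⟨⟨fun w hw => (hu.deriv w hw).mul (hv.deriv w hw), fun w hw => ?_,
    fun w hw z hz => ?_⟩, fun w hw => ?_⟩
  · calc _ ≤ k * B + B * k := by
          refine (norm_add_le _ _).trans (add_le_add ?_ ?_) <;> rw [norm_smul]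
          · exact mul_le_mul (hu.val w hw) (hv.bound w hw) (norm_nonneg _) hk
          · exact mul_le_mul (hv.val w hw) (hu.bound w hw) (norm_nonneg _) hB
      _ ≤ _ := by linarith
  · have e : u w • v' w + v w • u' w - (u z • v' z + v z • u' z) =
        ((u w - u z) • v' w + u z • (v' w - v' z)) +
          ((v w - v z) • u' w + v z • (u' w - u' z)) := by module
    rw [e]
    calc _ ≤ (k * ‖w - z‖ * B + k * (B * ‖w - z‖)) + (B * ‖w - z‖ * k + B * (k * ‖w - z‖)) := by
          refine (norm_add_le _ _).trans (add_le_add ((norm_add_le _ _).trans (add_le_add ?_ ?_))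
            ((norm_add_le _ _).trans (add_le_add ?_ ?_))) <;> rw [norm_smul]
          · exact mul_le_mul (hu.lipschitz hD hw hz) (hv.bound w hw) (norm_nonneg _) (by positivity)
          · exact mul_le_mul (hu.val z hz) (hv.lip w hw z hz) (norm_nonneg _) hk
          · exact mul_le_mul (hv.lipschitz hD hw hz) (hu.bound w hw) (norm_nonneg _) (by positivity)
          · exact mul_le_mul (hv.val z hz) (hu.lip w hw z hz) (norm_nonneg _) hB
      _ = _ := by ring
  · rw [norm_mul]
    have := mul_le_mul (hu.val w hw) (hv.val w hw) (norm_nonneg _) hk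
    linarith

theorem C11.sum {E F : Type*} [NormedAddCommGroup E] [NormedSpace ℝ E] [NormedAddCommGroup F]
    [NormedSpace ℝ F] {k : ℝ} {D : Set E} {u : ℕ → E → F}
    (n : ℕ) (h : ∀ i < n, ∃ u', C11 k D (u i) u') :
    ∃ u', C11 (n * k) D (fun w => ∑ i ∈ Finset.range n, u i w) u' := by
  induction n with
  | zero =>
    refine ⟨fun _ => 0, ⟨⟨fun w _ => ?_, fun w _ => by simp, fun w _ z _ => by simp⟩,
      fun w _ => by simp⟩⟩
    simpa using hasFDerivWithinAt_const (0 : F) w D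
  | succ n ih =>
    obtain ⟨u', hu'⟩ := ih fun i hi => h i (by omega)
    obtain ⟨v', hv'⟩ := h n (by omega)
    refine ⟨_, ((hu'.add hv').mono (by push_cast; linarith)).congr fun w _ => ?_⟩
    rw [Finset.sum_range_succ]

/-! Interpolation of curves over the lines -/

/-- The normalized trigonometric kernel for interpolation at `2 p` equidistant points. -/
noncomputable def kernel (p : ℕ) (x : ℝ) : ℝ :=
  (∑ k ∈ Finset.range (2 * p), Real.cos (k * x)) / (2 * p)

/-- The sum is the real part of a geometric sum of powers of a 2p-th root of unity, which is 2p if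
the root is 1 and zero otherwise. -/
theorem kernel_pi_mul {p : ℕ} (hp : 1 ≤ p) (m : ℤ) :
    kernel p (Real.pi * m / p) = if (2 * p : ℤ) ∣ m then 1 else 0 := by
  have hp' : (0 : ℝ) < p := by exact_mod_cast hp
  have hpc : (p : ℂ) ≠ 0 := by exact_mod_cast hp'.ne'
  have hre : ∑ k ∈ Finset.range (2 * p), Real.cos (k * (Real.pi * m / p)) =
      (∑ k ∈ Finset.range (2 * p), Complex.exp (Real.pi * m / p * Complex.I) ^ k).re := by
    rw [Complex.re_sum]
    refine Finset.sum_congr rfl fun k _ => ?_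
    rw [← Complex.exp_nat_mul, ← mul_assoc]
    have := Complex.exp_ofReal_mul_I_re (k * (Real.pi * m / p))
    push_cast at this
    exact this.symm
  rw [kernel, hre]
  split_ifs with h
  · obtain ⟨n, rfl⟩ := h
    have e : Complex.exp (Real.pi * ((2 * p * n : ℤ) : ℂ) / p * Complex.I) = 1 :=
      Complex.exp_eq_one_iff.2 ⟨n, by push_cast; field_simp⟩
    rw [e]
    simp only [one_pow, Finset.sum_const, Finset.card_range, nsmul_eq_mul, mul_one]
    rw [Complex.natCast_re]
    push_cast
    field_simp
  · have hne : Complex.exp (Real.pi * m / p * Complex.I) - 1 ≠ 0 := by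
      rw [sub_ne_zero, Ne, Complex.exp_eq_one_iff]
      rintro ⟨n, hn⟩
      refine h ⟨n, ?_⟩
      have h1 : (Real.pi : ℂ) ≠ 0 := by exact_mod_cast Real.pi_ne_zero
      have h2 : ((Real.pi : ℂ) * Complex.I) ≠ 0 := mul_ne_zero h1 Complex.I_ne_zero
      have h3 : ((Real.pi : ℂ) * Complex.I) * m = (Real.pi * Complex.I) * (2 * p * n) := by
        field_simp at hn
        linear_combination ((Real.pi : ℂ) * Complex.I) * hn
      exact_mod_cast mul_left_cancel₀ h2 h3
    have h1 := geom_sum_mul (Complex.exp (Real.pi * m / p * Complex.I)) (2 * p)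
    have h2 : Complex.exp (Real.pi * m / p * Complex.I) ^ (2 * p) = 1 := by
      rw [← Complex.exp_nat_mul]
      exact Complex.exp_eq_one_iff.2 ⟨m, by push_cast; field_simp⟩
    rw [h2, sub_self] at h1
    rw [(mul_eq_zero.1 h1).resolve_right hne]
    simp

theorem kernel_add_two_pi (p : ℕ) (x : ℝ) (n : ℤ) :
    kernel p (x + 2 * Real.pi * n) = kernel p x := by
  unfold kernel
  congr 1
  refine Finset.sum_congr rfl fun k _ => ?_
  rw [← Real.cos_add_int_mul_two_pi (k * x) (k * n)]
  congr 1
  push_cast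
  ring

theorem contDiff_kernel (p : ℕ) (n : WithTop ℕ∞) : ContDiff ℝ n (kernel p) :=
  (ContDiff.sum fun _ _ => Real.contDiff_cos.comp (contDiff_const.mul contDiff_id)).div_const _

theorem abs_kernel_le {p : ℕ} (hp : 1 ≤ p) (x : ℝ) : |kernel p x| ≤ 1 := by
  have hp' : (0 : ℝ) < p := by exact_mod_cast hp
  rw [kernel, abs_div, abs_of_pos (by positivity : (0 : ℝ) < 2 * (p : ℝ)), div_le_one (by positivity)]
  refine (Finset.abs_sum_le_sum_abs _ _).trans
    ((Finset.sum_le_sum fun k _ => Real.abs_cos_le_one _).trans ?_)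
  simp

/-- The function that equals `e j` on the vertical line over `π j / p`. -/
noncomputable def interp (p : ℕ) (e : ℤ → ℝ → ℝ) (w : ℝ × ℝ) : ℝ :=
  ∑ i ∈ Finset.range (2 * p), e i w.2 * kernel p (w.1 - Real.pi * i / p)

section

variable {p : ℕ} {e e' : ℤ → ℝ → ℝ} {ρ : ℝ} {P : ℤ → ℝ × ℝ → ℝ × ℝ}

theorem interp_add_two_pi (p : ℕ) (e : ℤ → ℝ → ℝ) (w : ℝ × ℝ) (n : ℤ) :
    interp p e (w + (2 * Real.pi * n, 0)) = interp p e w := by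
  unfold interp
  refine Finset.sum_congr rfl fun i _ => ?_
  rw [← kernel_add_two_pi p (w.1 - _) n]
  simp only [Prod.fst_add, Prod.snd_add, add_zero]
  ring_nf

theorem eq_of_periodic (hper : ∀ j s, e (j + 2 * p) s = e j s) (j n : ℤ) (s : ℝ) :
    e (j + 2 * p * n) s = e j s := by
  have h : Function.Periodic (fun j => e j s) (2 * p : ℤ) := fun j => hper j s
  have := h.int_mul n j
  rwa [mul_comm] at this

theorem interp_pi_mul (hp : 1 ≤ p) (hper : ∀ j s, e (j + 2 * p) s = e j s) (j : ℤ) (y : ℝ) :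
    interp p e (Real.pi * j / p, y) = e j y := by
  have hz : (0 : ℤ) < 2 * p := by have : (1 : ℤ) ≤ p := by exact_mod_cast hp
                                  omega
  obtain ⟨i₀, hi₀⟩ := Int.eq_ofNat_of_zero_le (Int.emod_nonneg j hz.ne')
  have hlt := Int.emod_lt_of_pos j hz
  have hj := Int.emod_add_mul_ediv j (2 * p)
  rw [hi₀] at hlt hj
  have hmem : i₀ ∈ Finset.range (2 * p) := Finset.mem_range.2 (by exact_mod_cast hlt)
  have hker : ∀ i ∈ Finset.range (2 * p), e i y * kernel p (Real.pi * j / p - Real.pi * i / p) =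
      if i = i₀ then e i y else 0 := by
    intro i hi
    have hi' : (i : ℤ) < 2 * p := by exact_mod_cast Finset.mem_range.1 hi
    rw [show Real.pi * j / p - Real.pi * i / p = Real.pi * ((j - i : ℤ) : ℝ) / p by push_cast; ring,
      kernel_pi_mul hp]
    have : ((2 * p : ℤ) ∣ j - i) ↔ i = i₀ := by
      constructor
      · intro h
        have h1 : (2 * p : ℤ) ∣ (i₀ : ℤ) - i := by
          have : (i₀ : ℤ) - i = (j - i) - 2 * p * (j / (2 * p)) := by linarith
          rw [this]
          exact dvd_sub h (dvd_mul_right _ _)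
        have h2 := Int.eq_zero_of_abs_lt_dvd h1 (by rw [abs_lt]; constructor <;> omega)
        omega
      · rintro rfl
        exact ⟨j / (2 * p), by linarith⟩
    simp only [this]
    split_ifs <;> simp
  have h3 : e j y = e i₀ y := by rw [← eq_of_periodic hper i₀ (j / (2 * p)) y, hj]
  unfold interp
  simp only
  rw [Finset.sum_congr rfl hker, Finset.sum_ite_eq' _ _ (fun i : ℕ => e i y), if_pos hmem, h3]

theorem exists_kernel_bound (hp : 1 ≤ p) : ∃ B : ℝ, 1 ≤ B ∧ ∀ a : ℝ,
    ∃ b', C11 B (strip 1) (fun w : ℝ × ℝ => kernel p (w.1 - a)) b' := by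
  have hf : ContDiff ℝ 2 (fun w : ℝ × ℝ => kernel p w.1) := (contDiff_kernel p 2).comp contDiff_fst
  obtain ⟨M, hM⟩ := exists_ctl_of_periodic hf (c := 2 * Real.pi) (by positivity)
    (fderiv_add_period fun w => by
      have := kernel_add_two_pi p w.1 1
      simpa using this)
  refine ⟨max 1 M, le_max_left _ _, fun a => ⟨fun w => fderiv ℝ (fun w : ℝ × ℝ => kernel p w.1)
    (w - (a, 0)), ⟨⟨fun w hw => ?_, fun w hw => ?_, fun w hw z hz => ?_⟩, fun w _ => ?_⟩⟩⟩
  · have h1 : HasFDerivAt (fun w : ℝ × ℝ => kernel p w.1) _ (w - (a, 0)) :=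
      ((hf.differentiable (by norm_num)) _).hasFDerivAt
    have h2 := h1.comp w ((hasFDerivAt_id w).sub_const (a, 0))
    refine (h2.congr_of_eventuallyEq (Eventually.of_forall fun z => ?_)).hasFDerivWithinAt
    simp
  · exact (hM.bound _ (by simpa using strip_subset le_rfl hw)).trans (le_max_right _ _)
  · have := hM.lip (w - (a, 0)) (by simpa using strip_subset le_rfl hw) (z - (a, 0))
      (by simpa using strip_subset le_rfl hz)
    rw [sub_sub_sub_cancel_right] at this
    exact this.trans (by gcongr; exact le_max_right _ _)
  · exact (abs_kernel_le hp _).trans (le_max_left _ _)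

/-- The kernels are fixed smooth functions, so the interpolation of curves of size ρ is of size Cρ,
with C depending on p alone. This makes the displacement small independently of the perturbed map.
-/
theorem exists_interp_bound (hp : 1 ≤ p) : ∃ C : ℝ, 0 < C ∧ ∀ (ρ : ℝ) (e e' : ℤ → ℝ → ℝ)
    (P : ℤ → ℝ × ℝ → ℝ × ℝ), (∀ j, InvCurve ρ (P j) (e j) (e' j)) →
    ∃ i', C11 (C * ρ) (strip 1) (interp p e) i' := by
  have hp' : (0 : ℝ) < p := by exact_mod_cast hp
  obtain ⟨B, hB1, hB⟩ := exists_kernel_bound hp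
  refine ⟨2 * p * (4 * 4 * B), by positivity, fun ρ e e' P h => ?_⟩
  have hρ : 0 ≤ ρ := (abs_nonneg _).trans ((h 0).val 0 ⟨le_rfl, one_pos⟩)
  have he : ∀ j, C11 ρ (Ico 0 1) (e j) (fun s => ContinuousLinearMap.toSpanSingleton ℝ (e' j s)) := by
    intro j
    refine ⟨⟨fun s hs => ((h j).deriv s hs).hasFDerivWithinAt, fun s hs => ?_,
      fun s hs t ht => ?_⟩, (h j).val⟩
    · rw [ContinuousLinearMap.norm_toSpanSingleton]; exact (h j).bound s hs
    · rw [show ContinuousLinearMap.toSpanSingleton ℝ (e' j s) -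
        ContinuousLinearMap.toSpanSingleton ℝ (e' j t) =
        ContinuousLinearMap.toSpanSingleton ℝ (e' j s - e' j t) by ext; simp,
        ContinuousLinearMap.norm_toSpanSingleton]
      exact (h j).lip s hs t ht
  have hsnd : Ctl 1 (strip 1) (fun w : ℝ × ℝ => w.2) (fun _ => ContinuousLinearMap.snd ℝ ℝ ℝ) :=
    Ctl.id.clm (ContinuousLinearMap.snd ℝ ℝ ℝ) (ContinuousLinearMap.norm_snd_le _ _ _)
  have hmain : ∀ i < 2 * p, ∃ u', C11 (4 * (ρ * (1 + 1) ^ 2) * B) (strip 1)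
      (fun w => e i w.2 * kernel p (w.1 - Real.pi * i / p)) u' := by
    intro i _
    obtain ⟨b', hb'⟩ := hB (Real.pi * i / p)
    exact ⟨_, C11.mul (by positivity) (by linarith) (convex_strip 1)
      ((he i).comp hρ zero_le_one (convex_strip 1) hsnd fun w hw => hw) hb'⟩
  obtain ⟨u', hu'⟩ := C11.sum (2 * p) hmain
  exact ⟨u', hu'.mono (by push_cast; linarith)⟩

theorem contDiffOn_interp (h : ∀ j, InvCurve ρ (P j) (e j) (e' j)) :
    ContDiffOn ℝ 2 (interp p e) (strip 1) := by
  refine ContDiffOn.sum fun i _ => ContDiffOn.mul ?_ ?_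
  · exact (h i).cd.comp contDiff_snd.contDiffOn fun w hw => hw
  · exact ((contDiff_kernel p 2).comp (contDiff_fst.sub contDiff_const)).contDiffOn

end

/-! ### The change of coordinates that straightens the curves. -/

/-- A map of the universal cover that commutes with the deck transformations descends. -/
theorem exists_descent {f : ℝ × ℝ → ℝ × ℝ}
    (hf : ∀ w (n : ℤ), f (w + (2 * Real.pi * n, 0)) = f w + (2 * Real.pi * n, 0)) :
    ∃ F : Cylinder → Cylinder, ∀ w, F (cov w) = cov (f w) := by
  choose s hs using cov_surjective
  refine ⟨fun z => cov (f (s z)), fun w => ?_⟩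
  obtain ⟨n, h1, h2⟩ := cov_eq_iff.1 (hs (cov w))
  have e : w = s (cov w) + (2 * Real.pi * n, 0) := Prod.ext h1 (by simpa using h2)
  refine cov_eq_iff.2 ⟨n, ?_, ?_⟩
  · nth_rewrite 1 [e]; rw [hf]; rfl
  · nth_rewrite 1 [e]; rw [hf]; simp

theorem c2At_of_lift {r : ℝ} {f : ℝ × ℝ → ℝ × ℝ} {F : Cylinder → Cylinder}
    (hF : ∀ w, F (cov w) = cov (f w)) (hf : ContDiffOn ℝ 2 f (strip r)) :
    ∀ z ∈ Cyl r, C2At F z := by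
  intro z hz
  obtain ⟨w, rfl⟩ := cov_surjective z
  refine ⟨f, w, rfl, Eventually.of_forall fun v => (hF v).symm, (hf w hz).mono_of_mem_nhdsWithin ?_⟩
  have : {v : ℝ × ℝ | v.2 < r} ∈ 𝓝 w := (isOpen_lt continuous_snd continuous_const).mem_nhds hz.2
  exact mem_of_superset (inter_mem_nhdsWithin _ this) fun v hv => ⟨hv.1, hv.2⟩

/-- A small horizontal displacement of the strip defines a change of coordinates. -/
theorem exists_coordinates {ε : ℝ × ℝ → ℝ} {ε' : ℝ × ℝ → (ℝ × ℝ) →L[ℝ] ℝ} {k : ℝ} (hk : k ≤ 1 / 2)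
    (h : C11 k (strip 1) ε ε') (hcd : ContDiffOn ℝ 2 ε (strip 1))
    (hper : ∀ w (n : ℤ), ε (w + (2 * Real.pi * n, 0)) = ε w) (hout : ∀ w ∉ strip 1, ε w = 0) :
    ∃ (q : ℝ × ℝ → ℝ × ℝ) (H : Cylinder ≃ Cylinder), (∀ w, q (w + (ε w, 0)) = w) ∧
      (∀ w, q w + (ε (q w), 0) = w) ∧ (∃ q', Ctl 4 (strip 1) q q') ∧ IsC2Coordinates 1 H ∧
      (∀ w, H (cov w) = cov (q w)) ∧ ∀ w, H.symm (cov w) = cov (w + (ε w, 0)) := by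
  have hbd : ∀ w, |ε w| ≤ 1 / 2 := by
    intro w
    by_cases hw : w ∈ strip 1
    · exact (h.val w hw).trans hk
    · rw [hout w hw]; norm_num
  have hlip : ∀ y x x', |ε (x, y) - ε (x', y)| ≤ 1 / 2 * |x - x'| := by
    intro y x x'
    by_cases hy : ((x, y) : ℝ × ℝ) ∈ strip 1
    · refine (h.lipschitz (convex_strip 1) hy (z := (x', y)) hy).trans ?_
      have : ‖((x, y) : ℝ × ℝ) - (x', y)‖ = |x - x'| := by simp [Prod.norm_def]
      rw [this]
      gcongr
    · have hy' : ((x', y) : ℝ × ℝ) ∉ strip 1 := hy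
      rw [hout _ hy, hout _ hy']
      simp only [sub_self, abs_zero]
      positivity
  -- At each height the displacement has Lipschitz constant 1/2, so x ↦ x + ε is strictly
  -- increasing. This also holds outside the strip, where ε vanishes.
  have hinj : ∀ w z : ℝ × ℝ, w + (ε w, 0) = z + (ε z, 0) → w = z := by
    intro w z hwz
    have e2 : w.2 = z.2 := by simpa using congrArg Prod.snd hwz
    have e1 : w.1 + ε w = z.1 + ε z := congrArg Prod.fst hwz
    have t := hlip w.2 w.1 z.1
    nth_rewrite 2 [e2] at t
    rw [Prod.mk.eta, Prod.mk.eta, show ε w - ε z = -(w.1 - z.1) by linarith, abs_neg] at t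
    have : |w.1 - z.1| ≤ 0 := by linarith
    exact Prod.ext (sub_eq_zero.1 (abs_nonpos_iff.1 this)) e2
  have hex : ∀ w : ℝ × ℝ, ∃ x, x + ε (x, w.2) = w.1 := by
    intro w
    have hc : Continuous fun x => x + ε (x, w.2) := continuous_id.add
      (LipschitzWith.of_dist_le_mul (K := ⟨1 / 2, by norm_num⟩) fun x x' => hlip w.2 x x').continuous
    have h1 := (abs_le.1 (hbd (w.1 - 1, w.2))).2
    have h2 := (abs_le.1 (hbd (w.1 + 1, w.2))).1
    obtain ⟨x, -, hx⟩ := intermediate_value_Icc (by linarith : w.1 - 1 ≤ w.1 + 1) hc.continuousOn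
      (show w.1 ∈ Icc _ _ from ⟨by linarith, by linarith⟩)
    exact ⟨x, hx⟩
  choose s hs using hex
  set q : ℝ × ℝ → ℝ × ℝ := fun w => (s w, w.2) with hq
  have hr : ∀ w, q w + (ε (q w), 0) = w := fun w => Prod.ext (hs w) (by simp [hq])
  have hl : ∀ w, q (w + (ε w, 0)) = w := fun w => hinj _ _ (hr _)
  have hηper : ∀ w (n : ℤ), w + (2 * Real.pi * n, 0) + (ε (w + (2 * Real.pi * n, 0)), 0) =
      w + (ε w, 0) + (2 * Real.pi * n, 0) := fun w n => by rw [hper]; abel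
  have hqper : ∀ w (n : ℤ), q (w + (2 * Real.pi * n, 0)) = q w + (2 * Real.pi * n, 0) :=
    fun w n => hinj _ _ (by rw [hr, hηper, hr])
  obtain ⟨Hη, hHη⟩ := exists_descent (f := fun w => w + (ε w, 0)) hηper
  obtain ⟨Hq, hHq⟩ := exists_descent hqper
  let H : Cylinder ≃ Cylinder := ⟨Hq, Hη, fun z => by
      obtain ⟨w, rfl⟩ := cov_surjective z; rw [hHq, hHη, hr],
    fun z => by obtain ⟨w, rfl⟩ := cov_surjective z; rw [hHη, hHq, hl]⟩
  have hinl : ‖ContinuousLinearMap.inl ℝ ℝ ℝ‖ ≤ 1 :=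
    ContinuousLinearMap.opNorm_le_bound _ zero_le_one fun x => by simp [Prod.norm_def]
  have hε := h.clm (ContinuousLinearMap.inl ℝ ℝ ℝ) hinl
  have hqm : MapsTo q (strip 1) (strip 1) := fun w hw => hw
  obtain ⟨q', hq'⟩ := Ctl.inverse hk (convex_strip 1) hε hqm fun w _ => hr w
  have hηc : ContDiffOn ℝ 2 (fun w : ℝ × ℝ => w + (ε w, 0)) (strip 1) :=
    contDiffOn_id.add (hcd.prodMk contDiffOn_const)
  have hqc : ContDiffOn ℝ 2 q (strip 1) := by
    have := contDiffOn_inverse (n := 2) (Φ := fun w : ℝ × ℝ => w + (ε w, 0)) (q := q)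
      (by exact_mod_cast hηc) (by norm_num) (uniqueDiffOn_strip 1) (uniqueDiffOn_strip 1) hqm
      (fun w _ => hr w) (fun w hw => (hq'.deriv w hw).continuousWithinAt) ?_
    · exact_mod_cast this
    intro w hw
    have hd : HasFDerivWithinAt (fun w : ℝ × ℝ => w + (ε w, 0)) (ContinuousLinearMap.id ℝ (ℝ × ℝ) +
        (ContinuousLinearMap.inl ℝ ℝ ℝ).comp (ε' w)) (strip 1) w :=
      (hasFDerivWithinAt_id w _).add (hε.deriv w hw)
    rw [hd.fderivWithin (uniqueDiffOn_strip 1 w hw)]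
    refine exists_equiv_of_injective fun v hv => ?_
    have h1 : v = -((ContinuousLinearMap.inl ℝ ℝ ℝ).comp (ε' w) v) := eq_neg_of_add_eq_zero_left hv
    have h2 := ContinuousLinearMap.le_of_opNorm_le _ ((hε.bound w hw).trans hk) v
    rw [← norm_neg, ← h1] at h2
    exact norm_le_zero_iff.1 (by linarith)
  refine ⟨q, H, hl, hr, ⟨q', hq'⟩, ⟨fun z => ?_, c2At_of_lift hHq hqc, c2At_of_lift hHη hηc⟩, hHq, hHη⟩
  obtain ⟨w, rfl⟩ := cov_surjective z
  change Hq (cov w) ∈ _ ↔ _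
  rw [hHq]
  exact Iff.rfl

/-! ### Global consequences of closeness to the model. -/

section

variable {p : ℕ} {lam : ℝ}

theorem abs_modelAngle_sub_lt (hp : 1 ≤ p) (lam x : ℝ) : |modelAngle p lam x - x| < Real.pi := by
  have hp' : (1 : ℝ) ≤ p := by exact_mod_cast hp
  unfold modelAngle
  rw [add_sub_cancel_left, abs_mul, abs_of_nonneg (by positivity : (0 : ℝ) ≤ 2 / (p : ℝ))]
  have h1 : |Real.arctan ((lam ^ 2 - 1) * (Real.sin (p * x / 2) * Real.cos (p * x / 2)) /
    (Real.cos (p * x / 2) ^ 2 + lam ^ 2 * Real.sin (p * x / 2) ^ 2))| < Real.pi / 2 :=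
    abs_lt.2 ⟨Real.neg_pi_div_two_lt_arctan _, Real.arctan_lt_pi_div_two _⟩
  have h2 : 2 / (p : ℝ) ≤ 2 := div_le_self zero_le_two hp'
  calc _ ≤ 2 * |_| := mul_le_mul_of_nonneg_right h2 (abs_nonneg _)
    _ < 2 * (Real.pi / 2) := by gcongr
    _ = _ := by ring

/-- Where the model does not move the first coordinate it moves the second one. -/
theorem exists_displacement_bound (hp : 1 ≤ p) (hl : 1 < lam) : ∃ m : ℝ, 0 < m ∧
    ∀ x, m ≤ |modelAngle p lam x - x| + |mult p lam x - 1| := by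
  have hp' : (0 : ℝ) < p := by exact_mod_cast hp
  have hl0 : 0 < lam := zero_lt_one.trans hl
  have hc0 : 0 < 2 * Real.pi / p := by have := Real.pi_pos; positivity
  set h : ℝ → ℝ := fun x => |modelAngle p lam x - x| + |mult p lam x - 1| with hh
  have hc : Continuous h := ((contDiff_modelAngle p hl0 1).continuous.sub continuous_id).abs.add
    ((contDiff_mult p hl0 1).continuous.sub continuous_const).abs
  have hper : Function.Periodic h (2 * Real.pi / p) := by
    intro x
    have e := modelLift_add hp lam x 1
    have e1 : modelAngle p lam (x + 2 * Real.pi / p) = modelAngle p lam x + 2 * Real.pi / p :=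
      congrArg Prod.fst e
    have e2 : 1 * mult p lam (x + 2 * Real.pi / p) = 1 * mult p lam x + 0 := congrArg Prod.snd e
    rw [one_mul, one_mul, add_zero] at e2
    simp only [hh, e1, e2, add_sub_add_right_eq_sub]
  -- The angle is fixed only where sin · cos = 0, and there the multiplier is 1/λ or λ, never 1.
  have hpos : ∀ x, 0 < h x := by
    intro x
    by_contra hx
    have a1 := abs_nonneg (modelAngle p lam x - x)
    have a2 := abs_nonneg (mult p lam x - 1)
    have b1 : modelAngle p lam x - x = 0 := abs_nonpos_iff.1 (by simp only [hh] at hx; linarith)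
    have b2 : mult p lam x - 1 = 0 := abs_nonpos_iff.1 (by simp only [hh] at hx; linarith)
    unfold modelAngle at b1
    rw [add_sub_cancel_left, mul_eq_zero, Real.arctan_eq_zero_iff] at b1
    have b3 := div_eq_zero_iff.1 (b1.resolve_left (by positivity))
    have hd := angle_denom_pos p hl0 x
    have hl2 : lam ^ 2 - 1 ≠ 0 := by nlinarith
    rcases b3 with b1 | b1
    · rcases mul_eq_zero.1 ((mul_eq_zero.1 b1).resolve_left hl2) with b | b
      · rw [mult_of_sin_eq_zero hl0 b, sub_eq_zero, div_eq_one_iff_eq hl0.ne'] at b2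
        linarith
      · rw [mult_of_cos_eq_zero hl0 b] at b2
        linarith
    · linarith
  obtain ⟨x₀, -, hx₀⟩ := isCompact_Icc.exists_isMinOn
    (nonempty_Icc.2 hc0.le) hc.continuousOn
  refine ⟨h x₀, hpos x₀, fun x => ?_⟩
  obtain ⟨y, hy, hxy⟩ := hper.exists_mem_Ico₀ hc0 x
  change _ ≤ h x
  rw [hxy]
  exact hx₀ ⟨hy.1, hy.2.le⟩

/-- The derivative 1/mult² of the angular part is at least 1/λ². -/
theorem abs_sub_le_modelAngle (hp : 1 ≤ p) (hl : 1 < lam) (x y : ℝ) :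
    |x - y| ≤ lam ^ 2 * |modelAngle p lam x - modelAngle p lam y| := by
  have hl0 : 0 < lam := zero_lt_one.trans hl
  have hd := fun x => hasDerivAt_modelAngle (lam := lam) hp hl0 x
  have key : ∀ x y, x ≤ y → y - x ≤ lam ^ 2 * (modelAngle p lam y - modelAngle p lam x) := by
    intro x y hxy
    have h1 := mul_sub_le_image_sub_of_le_deriv (C := 1 / lam ^ 2)
      (fun x => (hd x).differentiableAt) (fun x => ?_) hxy
    · have h2 := mul_le_mul_of_nonneg_left h1 (by positivity : 0 ≤ lam ^ 2)
      rwa [← mul_assoc, mul_one_div_cancel (by positivity), one_mul] at h2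
    · rw [(hd x).deriv]
      have := mult_pos p hl0 x
      have := mult_le p hl x
      gcongr
  have hl2 : 0 ≤ lam ^ 2 := by positivity
  rcases le_total x y with h | h
  · rw [abs_sub_comm, abs_of_nonneg (sub_nonneg.2 h), abs_sub_comm]
    exact (key x y h).trans (mul_le_mul_of_nonneg_left (le_abs_self _) hl2)
  · rw [abs_of_nonneg (sub_nonneg.2 h)]
    exact (key y x h).trans (mul_le_mul_of_nonneg_left (le_abs_self _) hl2)

/-- Points that are mapped into the invariant curve over an even line belong to the curve. -/
theorem InvCurve.mem_of_image_mem (hp : 1 ≤ p) (hl : 1 < lam) {M ρ δ x₀ : ℝ}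
    {g : ℝ × ℝ → ℝ × ℝ} {u' : ℝ × ℝ → (ℝ × ℝ) →L[ℝ] (ℝ × ℝ)} {e e' : ℝ → ℝ}
    (hM : Ctl M {w : ℝ × ℝ | 0 ≤ w.2 ∧ w.2 ≤ 1} (modelLift p lam) (fderiv ℝ (modelLift p lam)))
    (hu : C11 δ (strip 1) (fun w => g w - modelLift p lam w) u')
    (hx₀ : modelAngle p lam x₀ = x₀) (hsin : Real.sin (p * x₀ / 2) = 0)
    (h : InvCurve ρ (fun w => g (w + (x₀, 0)) - (x₀, 0)) e e') (he : ∀ s ∉ Ico (0 : ℝ) 1, e s = 0)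
    (hg : ∀ w ∈ strip 1, 0 ≤ (g w).2)
    (hk1 : M * (lam ^ 2 * (ρ + δ)) + δ < 1 - 1 / lam) (hk2 : lam ^ 2 * (δ + ρ * (M + δ)) < 1)
    {v : ℝ × ℝ} (hv : v ∈ strip 1) (hgv : (g v).1 = x₀ + e (g v).2) : v.1 = x₀ + e v.2 := by
  have hl0 : 0 < lam := zero_lt_one.trans hl
  have hl2 : 1 ≤ lam ^ 2 := by nlinarith
  have hρ : 0 ≤ ρ := (abs_nonneg _).trans (h.val 0 ⟨le_rfl, one_pos⟩)
  have hδ : 0 ≤ δ := (norm_nonneg _).trans (hu.val (0, 0) ⟨le_rfl, one_pos⟩)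
  have hM0 : 0 ≤ M := (norm_nonneg _).trans (hM.bound (0, 0) ⟨le_rfl, zero_le_one⟩)
  have hs1 : strip 1 ⊆ {w : ℝ × ℝ | 0 ≤ w.2 ∧ w.2 ≤ 1} := strip_subset le_rfl
  have hval : ∀ s, |e s| ≤ ρ := by
    intro s
    by_cases hs : s ∈ Ico (0 : ℝ) 1
    · exact h.val s hs
    · rw [he s hs, abs_zero]; exact hρ
  -- The curve exists only below height 1. Near an even line the height is multiplied by about 1/λ,
  -- so images of points near the line stay below that height and can be compared with the curve.
  have hheight : ∀ x, |x - x₀| ≤ lam ^ 2 * (ρ + δ) → (g (x, v.2)).2 ∈ Ico (0 : ℝ) 1 := by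
    intro x hx
    refine ⟨hg (x, v.2) hv, ?_⟩
    have h1 := (norm_snd_le _).trans (hu.val (x, v.2) hv)
    have h2 := (norm_snd_le _).trans (((hM.subset hs1).lipschitz (convex_strip 1)
      (w := (x, v.2)) (z := (x₀, v.2)) hv hv))
    have h3 : ‖((x, v.2) : ℝ × ℝ) - (x₀, v.2)‖ = |x - x₀| := by simp [Prod.norm_def]
    rw [h3, modelLift_eq, modelLift_eq, Prod.snd_sub, Real.norm_eq_abs] at h2
    rw [modelLift_eq, Prod.snd_sub, Real.norm_eq_abs] at h1
    simp only [mult_of_sin_eq_zero hl0 hsin] at h1 h2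
    have h4 : M * |x - x₀| ≤ M * (lam ^ 2 * (ρ + δ)) := by gcongr
    have h5 : v.2 * (1 / lam) ≤ 1 * (1 / lam) := by gcongr; exact hv.2.le
    linarith [(abs_le.1 h1).2, (abs_le.1 h2).2]
  have hv1 : |v.1 - x₀| ≤ lam ^ 2 * (ρ + δ) := by
    refine (abs_sub_le_modelAngle hp hl _ _).trans ?_
    gcongr
    have h1 := (norm_fst_le _).trans (hu.val v hv)
    rw [modelLift_eq, Prod.fst_sub, Real.norm_eq_abs, hgv, abs_sub_comm] at h1
    have h2 := abs_add_le (modelAngle p lam v.1 - (x₀ + e (g v).2)) (e (g v).2)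
    rw [show modelAngle p lam v.1 - (x₀ + e (g v).2) + e (g v).2 = modelAngle p lam v.1 - x₀ by ring]
      at h2
    simp only at h1
    rw [hx₀]
    linarith [hval (g v).2]
  set a := x₀ + e v.2 with ha
  have ha1 : |a - x₀| ≤ lam ^ 2 * (ρ + δ) := by
    rw [ha, add_sub_cancel_left]
    nlinarith [hval v.2]
  have hva := hheight _ hv1
  have haa := hheight _ ha1
  have hav : ((e v.2, v.2) : ℝ × ℝ) + (x₀, 0) = (a, v.2) := by
    ext <;> simp [ha, add_comm]
  have hga : (g (a, v.2)).1 = x₀ + e (g (a, v.2)).2 := by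
    have := h.inv v.2 hv (by rw [hav]; simpa using haa.2)
    rw [hav] at this
    simp only [Prod.fst_sub, Prod.snd_sub, sub_zero] at this
    linarith
  have hns : ‖v - (a, v.2)‖ = |v.1 - a| := by simp [Prod.norm_def]
  have hmv : ((a, v.2) : ℝ × ℝ) ∈ strip 1 := hv
  have d1 := (norm_fst_le _).trans (hu.lipschitz (convex_strip 1) hv hmv)
  have d2 := (norm_snd_le _).trans ((hu.toCtl.add (hM.subset hs1)).lipschitz (convex_strip 1) hv hmv)
  rw [hns] at d1 d2
  simp only [sub_add_cancel, Prod.snd_sub, Real.norm_eq_abs] at d2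
  simp only [modelLift_eq, Prod.fst_sub, Real.norm_eq_abs] at d1
  have d3 : |e (g v).2 - e (g (a, v.2)).2| ≤ ρ * |(g v).2 - (g (a, v.2)).2| :=
    (convex_Ico (0 : ℝ) 1).norm_image_sub_le_of_norm_hasDerivWithin_le h.deriv h.bound haa hva
  have d4 := abs_sub_le_modelAngle hp hl v.1 a
  have d5 : |modelAngle p lam v.1 - modelAngle p lam a| ≤
      |e (g v).2 - e (g (a, v.2)).2| + δ * |v.1 - a| := by
    rw [hgv, hga] at d1
    have := abs_sub (e (g v).2 - e (g (a, v.2)).2)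
      (x₀ + e (g v).2 - modelAngle p lam v.1 - (x₀ + e (g (a, v.2)).2 - modelAngle p lam a))
    rw [show e (g v).2 - e (g (a, v.2)).2 - (x₀ + e (g v).2 - modelAngle p lam v.1 -
      (x₀ + e (g (a, v.2)).2 - modelAngle p lam a)) = modelAngle p lam v.1 - modelAngle p lam a by ring]
      at this
    linarith
  have d6 : |modelAngle p lam v.1 - modelAngle p lam a| ≤ (δ + ρ * (M + δ)) * |v.1 - a| := by
    have := mul_le_mul_of_nonneg_left d2 hρ
    linarith
  -- The point v and the point of the curve at the same height have images on the curve, which is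
  -- nearly vertical, so these images are horizontally close. Pulled back, this bounds the
  -- horizontal distance by a factor less than 1 times itself.
  have d7 : |v.1 - a| ≤ lam ^ 2 * (δ + ρ * (M + δ)) * |v.1 - a| := by
    rw [mul_assoc]
    exact d4.trans (by gcongr)
  by_contra hne
  have d8 : 0 < |v.1 - a| := abs_pos.2 (sub_ne_zero.2 hne)
  nlinarith

/-- The invariant curves over the vertical lines can be chosen periodically. -/
theorem exists_periodic_invCurve (hp : 1 ≤ p) {g : ℝ × ℝ → ℝ × ℝ} {ρ : ℝ}
    (hg : ∀ w ∈ strip 1, ∀ n : ℤ, g (w + (2 * Real.pi * n, 0)) = g w + (2 * Real.pi * n, 0))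
    (hpos : ∀ w ∈ strip 1, 0 ≤ (g w).2) (h : ∀ j : ℤ, ∃ e e' : ℝ → ℝ, InvCurve ρ
      (fun w => g (w + (Real.pi * j / p, 0)) - (Real.pi * j / p, 0)) e e') :
    ∃ e e' : ℤ → ℝ → ℝ, (∀ j s, e (j + 2 * p) s = e j s) ∧ (∀ j, ∀ s ∉ Ico (0 : ℝ) 1, e j s = 0) ∧
      ∀ j : ℤ, InvCurve ρ (fun w => g (w + (Real.pi * j / p, 0)) - (Real.pi * j / p, 0)) (e j) (e' j) := by
  have hp' : (0 : ℝ) < p := by exact_mod_cast hp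
  classical
  choose c c' hc using h
  -- One curve is chosen for each residue modulo 2p. The value 0 outside [0, 1) makes the
  -- displacement vanish outside the strip.
  refine ⟨fun j s => if s ∈ Ico (0 : ℝ) 1 then c (j % (2 * p)) s else 0,
    fun j => c' (j % (2 * p)), fun j s => by simp, fun j s hs => by simp [hs], fun j => ?_⟩
  have h1 := hc (j % (2 * p))
  have e1 : ∀ s ∈ Ico (0 : ℝ) 1, (if s ∈ Ico (0 : ℝ) 1 then c (j % (2 * p)) s else 0) =
      c (j % (2 * p)) s := fun s hs => if_pos hs
  have hx : Real.pi * j / p = Real.pi * ((j % (2 * p) : ℤ) : ℝ) / p + 2 * Real.pi *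
      ((j / (2 * p) : ℤ) : ℝ) := by
    have := Int.emod_add_mul_ediv j (2 * p)
    have h2 : (j : ℝ) = ((j % (2 * p) : ℤ) : ℝ) + 2 * p * ((j / (2 * p) : ℤ) : ℝ) := by
      exact_mod_cast this.symm
    nth_rewrite 1 [h2]
    field_simp
  have hP : ∀ w ∈ strip 1, g (w + (Real.pi * j / p, 0)) - (Real.pi * j / p, 0) =
      g (w + (Real.pi * ((j % (2 * p) : ℤ) : ℝ) / p, 0)) -
        (Real.pi * ((j % (2 * p) : ℤ) : ℝ) / p, 0) := by
    intro w hw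
    have hadd : ((Real.pi * j / p, 0) : ℝ × ℝ) = (Real.pi * ((j % (2 * p) : ℤ) : ℝ) / p, 0) +
        (2 * Real.pi * ((j / (2 * p) : ℤ) : ℝ), 0) := by rw [hx]; ext <;> simp
    rw [hadd, ← add_assoc, hg _ (by simpa [strip] using hw), add_sub_add_right_eq_sub]
  refine ⟨h1.cd.congr e1, fun s hs => (h1.deriv s hs).congr e1 (e1 s hs),
    fun s hs => (congrArg abs (e1 s hs)).trans_le (h1.val s hs), h1.bound, h1.lip, fun s hs hlt => ?_⟩
  simp only [e1 s hs] at hlt ⊢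
  have hw : ((c (j % (2 * p)) s, s) : ℝ × ℝ) ∈ strip 1 := hs
  rw [hP _ hw] at hlt ⊢
  have h2 := h1.inv s hs hlt
  rw [if_pos (show _ ∈ Ico (0 : ℝ) 1 from ⟨?_, hlt⟩)]
  · exact h2
  · simpa using hpos _ (by simpa [strip] using hs)

end

section

variable {p : ℕ} {lam : ℝ}

/-- A near-identity change of coordinates keeps a map close to the model. -/
theorem C11.conjugate {M k δ r : ℝ} {g ε q : ℝ × ℝ → ℝ × ℝ}
    {u' ε' q' : ℝ × ℝ → (ℝ × ℝ) →L[ℝ] (ℝ × ℝ)} (hM1 : 1 ≤ M)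
    (hM : Ctl M {w : ℝ × ℝ | 0 ≤ w.2 ∧ w.2 ≤ 1} (modelLift p lam) (fderiv ℝ (modelLift p lam)))
    (hM' : Ctl M {w : ℝ × ℝ | 0 ≤ w.2 ∧ w.2 ≤ 1} (fderiv ℝ (modelLift p lam))
      (fderiv ℝ (fderiv ℝ (modelLift p lam))))
    (hε : C11 k (strip 1) ε ε') (hu : C11 δ (strip 1) (fun w => g w - modelLift p lam w) u')
    (hq : Ctl 4 (strip 1) q q') (hinv : ∀ w ∈ strip 1, q w + ε (q w) = w)
    (hηm : MapsTo (fun w => w + ε w) (strip 1) (strip 1)) (hqm : MapsTo q (strip 1) (strip 1))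
    (hgm : MapsTo (fun w => g (w + ε w)) (strip r) (strip 1)) (hr : r ≤ 1) (hk : k ≤ 1)
    (hδ : δ ≤ 1) : ∃ S, C11 (k * (16 * M + 25 * (10 + 9 * M) ^ 2) + 9 * δ) (strip r)
      (fun w => q (g (w + ε w)) - modelLift p lam w) S := by
  have hk0 : 0 ≤ k := (norm_nonneg _).trans (hε.val (0, 0) ⟨le_rfl, one_pos⟩)
  have hδ0 : 0 ≤ δ := (norm_nonneg _).trans (hu.val (0, 0) ⟨le_rfl, one_pos⟩)
  have hsr : strip r ⊆ strip 1 := fun w hw => ⟨hw.1, hw.2.trans_le hr⟩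
  have hs1 : strip 1 ⊆ {w : ℝ × ℝ | 0 ≤ w.2 ∧ w.2 ≤ 1} := strip_subset le_rfl
  have c1 := convex_strip 1
  have hη : Ctl 2 (strip 1) (fun w => w + ε w) _ :=
    (Ctl.id.add hε.toCtl).mono (by linarith)
  have t1 := C11.perturb hk0 zero_le_one (by linarith) c1 c1 (hM.subset hs1) (hM'.subset hs1)
    (Ctl.id (D := strip 1)) hε (fun w hw => hw) hηm hk
  have t2 := hu.comp hδ0 zero_le_two c1 hη hηm
  have hg : Ctl (1 + M) (strip 1) g _ :=
    ((hu.toCtl.add (hM.subset hs1)).congr fun w _ => by simp).mono (by linarith)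
  have hgη := hg.comp (by linarith) zero_le_two c1 hη hηm
  have t3 := hε.comp hk0 (by norm_num) c1 hq hqm
  have t4 := t3.comp (by positivity) (by positivity) (convex_strip r) (hgη.subset hsr) hgm
  -- With η = id + ε and F the model, q ∘ g ∘ η − F = (F ∘ η − F) + (g − F) ∘ η − ε ∘ q ∘ g ∘ η,
  -- since q = id − ε ∘ q. The three terms give the constants 16Mk, 9δ and 25(10 + 9M)²k.
  refine ⟨_, (((t1.subset hsr).add (t2.subset hsr)).sub t4 |>.mono ?_).congr fun w hw => ?_⟩
  · apply le_of_eq; ring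
  · have := hinv _ (hgm hw)
    have h2 : q (g (w + ε w)) = g (w + ε w) - ε (q (g (w + ε w))) := eq_sub_of_add_eq this
    generalize ε (q (g (w + ε w))) = a at h2
    rw [h2]
    abel

theorem eventually_mul_le (c : ℝ) {d : ℝ} (hd : 0 < d) : ∀ᶠ t : ℝ in 𝓝[>] 0, c * t ≤ d := by
  have : Tendsto (fun t : ℝ => c * t) (𝓝[>] 0) (𝓝 (c * 0)) :=
    (tendsto_id.const_mul c).mono_left nhdsWithin_le_nhds
  rw [mul_zero] at this
  exact this.eventually_le_const hd

/-- A map close to the model has no fixed points off the boundary. -/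
theorem snd_eq_zero_of_fixed (hp : 1 ≤ p) {m δ : ℝ}
    (hm : ∀ x, m ≤ |modelAngle p lam x - x| + |mult p lam x - 1|) (hδ : 2 * δ < m) (hδ1 : δ ≤ 1)
    {g : ℝ × ℝ → ℝ × ℝ} {u' : ℝ × ℝ → (ℝ × ℝ) →L[ℝ] (ℝ × ℝ)}
    (hu : C11 δ (strip 1) (fun w => g w - modelLift p lam w) u') (h0 : ∀ x, (g (x, 0)).2 = 0)
    {v : ℝ × ℝ} (hv : v ∈ strip 1) (hfix : cov (g v) = cov v) : v.2 = 0 := by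
  by_contra hne
  have hv0 : 0 < v.2 := lt_of_le_of_ne hv.1 (Ne.symm hne)
  obtain ⟨n, h1, h2⟩ := cov_eq_iff.1 hfix
  have d1 := (norm_fst_le _).trans (hu.val v hv)
  simp only [modelLift_eq, Prod.fst_sub, Real.norm_eq_abs] at d1
  have hA := abs_modelAngle_sub_lt hp lam v.1
  have hpi := Real.pi_gt_three
  -- The model moves the angle by less than π and the perturbation adds at most 1, which is less
  -- than 2π together, so a fixed point is fixed by the lift.
  have hn : n = 0 := by
    rw [abs_le] at d1
    rw [abs_lt] at hA
    have a1 : (n : ℝ) < 1 := by nlinarith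
    have a2 : (-1 : ℝ) < n := by nlinarith
    have b1 : n < 1 := by exact_mod_cast a1
    have b2 : -1 < n := by exact_mod_cast a2
    omega
  rw [hn, Int.cast_zero, mul_zero, add_zero] at h1
  have hv' : ((v.1, 0) : ℝ × ℝ) ∈ strip 1 := ⟨le_rfl, one_pos⟩
  -- The vertical error vanishes on the boundary and is δ-Lipschitz, hence at most δ times the
  -- height. Division by the height gives a multiplier δ-close to 1.
  have d2 := (norm_snd_le _).trans (hu.lipschitz (convex_strip 1) hv hv')
  have h3 : ‖v - (v.1, 0)‖ = v.2 := by simp [Prod.norm_def, abs_of_pos hv0, hv0.le]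
  simp only [modelLift_eq, Prod.snd_sub, Real.norm_eq_abs, h0, zero_mul, sub_zero, ← h2, h3] at d2
  rw [show v.2 - v.2 * mult p lam v.1 = v.2 * (1 - mult p lam v.1) by ring, abs_mul,
    abs_of_pos hv0, mul_comm] at d2
  have d3 : |1 - mult p lam v.1| ≤ δ := le_of_mul_le_mul_right d2 hv0
  rw [← h1] at d1
  have := hm v.1
  rw [abs_sub_comm] at d1 d3
  linarith

/-- Small perturbations of the model have the boundary structure in suitable coordinates. -/
theorem exists_coordinates_hasBoundaryStructure (hp : 1 ≤ p) (hl : 1 < lam) : ∃ δ : ℝ, 0 < δ ∧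
    ∀ (G : Cylinder → Cylinder) (g : ℝ × ℝ → ℝ × ℝ)
      (u' : ℝ × ℝ → (ℝ × ℝ) →L[ℝ] (ℝ × ℝ)),
      ContDiffOn ℝ 2 g (strip 1) → (∀ w ∈ strip 1, cov (g w) = G (cov w)) →
      C11 δ (strip 1) (fun w => g w - modelLift p lam w) u' → (∀ z ∈ Cyl 1, 0 ≤ (G z).2) →
      (∀ z ∈ Cyl 1, ((G z).2 = 0 ↔ z.2 = 0)) →
      ∃ H : Cylinder ≃ Cylinder, IsC2Coordinates 1 H ∧
        HasBoundaryStructure p 1 (fun z => H (G (H.symm z))) := by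
  have hp' : (0 : ℝ) < p := by exact_mod_cast hp
  have hl0 : 0 < lam := zero_lt_one.trans hl
  have il0 : 0 < 1 - 1 / lam := by rw [sub_pos, div_lt_one hl0]; exact hl
  obtain ⟨k₀, hk₀, hstar⟩ := exists_hasBoundaryStructure hp hl
  obtain ⟨ρ₀, hρ₀, hcurve⟩ := exists_invCurve hp hl
  obtain ⟨C, hC, hinterp⟩ := exists_interp_bound hp
  obtain ⟨M, hM1, hM, hM'⟩ := exists_model_bound hp hl0
  obtain ⟨m, hm0, hm⟩ := exists_displacement_bound hp hl
  -- The size ρ of the curves is fixed first, depending on p and λ only: small enough for the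
  -- displacement to be invertible, for the conjugate map to be near the model, and for
  -- `InvCurve.mem_of_image_mem`. The closeness δ is chosen afterwards, because the curves exist
  -- only for perturbations small compared with ρ.
  obtain ⟨ρ, ⟨⟨⟨⟨⟨hρa, hρb⟩, hρc⟩, hρd⟩, hρe⟩, hρ0⟩⟩ := ((((((eventually_mul_le 1 hρ₀).and
    (eventually_mul_le C (by norm_num : (0 : ℝ) < 1 / 2))).and
    (eventually_mul_le (C * (16 * M + 25 * (10 + 9 * M) ^ 2)) (half_pos hk₀))).and
    (eventually_mul_le (M * lam ^ 2) (by positivity : 0 < (1 - 1 / lam) / 4))).and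
    (eventually_mul_le (lam ^ 2 * (M + 1)) (by norm_num : (0 : ℝ) < 1 / 4))).and
    self_mem_nhdsWithin).exists
  replace hρ0 : 0 < ρ := hρ0
  obtain ⟨δ₀, hδ₀, hcurve⟩ := hcurve ρ hρ0 (by linarith)
  obtain ⟨δ, ⟨⟨⟨⟨⟨⟨hδa, hδb⟩, hδc⟩, hδd⟩, hδe⟩, hδf⟩, hδ0⟩⟩ := (((((((eventually_mul_le 1 hδ₀).and
    (eventually_mul_le 9 (half_pos hk₀))).and (eventually_mul_le 1 (by norm_num : (0 : ℝ) < 1 / 4))).and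
    (eventually_mul_le 4 hm0)).and
    (eventually_mul_le (M * lam ^ 2 + 1) (by positivity : 0 < (1 - 1 / lam) / 4))).and
    (eventually_mul_le (lam ^ 2) (by norm_num : (0 : ℝ) < 1 / 4))).and
    self_mem_nhdsWithin).exists
  replace hδ0 : 0 < δ := hδ0
  refine ⟨δ, hδ0, fun G g u' hg hG hu hpos hbd => ?_⟩
  have hg0 : ∀ w ∈ strip 1, 0 ≤ (g w).2 := fun w hw => by
    have := hpos (cov w) hw
    rwa [← hG w hw] at this
  have hgb : ∀ x, (g (x, 0)).2 = 0 := fun x => by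
    have := (hbd (cov (x, 0)) ⟨le_rfl, one_pos⟩).2 rfl
    rwa [← hG (x, 0) ⟨le_rfl, one_pos⟩] at this
  have hgper : ∀ w ∈ strip 1, ∀ n : ℤ, g (w + (2 * Real.pi * n, 0)) = g w + (2 * Real.pi * n, 0) :=
    fun w hw n => lift_add_two_pi hp (by linarith : δ ≤ 1) (fun w hw => hu.val w hw) hG hw n
  obtain ⟨e, e', heper, heout, he⟩ := exists_periodic_invCurve hp hgper hg0
    (hcurve δ (by linarith) g u' hg hu hgb)
  obtain ⟨i', hi'⟩ := hinterp ρ e e' _ he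
  set ε := interp p e with hε
  obtain ⟨q, H, hql, hqr, ⟨q', hq'⟩, hH, hHq, hHη⟩ := exists_coordinates hρb hi'
    (contDiffOn_interp he) (interp_add_two_pi p e) fun w hw => by
      rw [hε, interp]
      exact Finset.sum_eq_zero fun i _ => by rw [heout i w.2 hw, zero_mul]
  set f : ℝ × ℝ → ℝ × ℝ := fun w => q (g (w + (ε w, 0))) with hf
  have hq2 : ∀ w, (q w).2 = w.2 := fun w => by
    have := congrArg Prod.snd (hqr w)
    simpa using this
  have hFf : ∀ w ∈ strip 1, cov (f w) = H (G (H.symm (cov w))) := by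
    intro w hw
    rw [hHη, ← hG _ (by simpa [strip] using hw), hHq]
  have hηm : MapsTo (fun w => w + (ε w, 0)) (strip 1) (strip 1) := fun w hw => by
    simpa [strip] using hw
  -- In the new coordinates the vertical line is the invariant curve. This holds over the whole
  -- height as long as the image remains below height 1, where the curve is defined.
  have hline : ∀ (j : ℤ) (y : ℝ), y ∈ Ico (0 : ℝ) 1 → (f (Real.pi * j / p, y)).2 < 1 →
      (f (Real.pi * j / p, y)).1 = Real.pi * j / p := by
    intro j y hy hlt
    have e1 : ε (Real.pi * j / p, y) = e j y := interp_pi_mul hp heper j y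
    simp only [hf, hq2, e1] at hlt ⊢
    have h1 := (he j).inv y hy
    have e2 : ((e j y, y) : ℝ × ℝ) + (Real.pi * j / p, 0) =
        (Real.pi * j / p, y) + (e j y, 0) := by ext <;> simp [add_comm]
    rw [e2] at h1
    simp only [Prod.snd_sub, sub_zero, Prod.fst_sub] at h1
    have h2 := h1 hlt
    set z := g ((Real.pi * j / p, y) + (e j y, 0))
    have e3 : z = (Real.pi * j / p, z.2) + (ε (Real.pi * j / p, z.2), 0) := by
      have : ε (Real.pi * j / p, z.2) = e j z.2 := interp_pi_mul hp heper j z.2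
      rw [this]
      ext
      · simp; linarith
      · simp
    rw [e3, hql]
  -- One step multiplies the height by at most about λ, so from below r the image stays below 1/2 +
  -- δ < 1 and the estimates on the strip apply to it.
  obtain ⟨r, hr⟩ : ∃ r, r = 1 / (2 * lam) := ⟨_, rfl⟩
  have hr0 : 0 < r := by rw [hr]; positivity
  have hrl : r * lam = 1 / 2 := by rw [hr]; field_simp
  have hr1 : r ≤ 1 := by nlinarith
  have hgm : MapsTo (fun w => g (w + (ε w, 0))) (strip r) (strip 1) := by
    intro w hw
    have hw1 : w + (ε w, 0) ∈ strip 1 := ⟨by simpa using hw.1, by simpa using hw.2.trans_le hr1⟩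
    refine ⟨hg0 _ hw1, ?_⟩
    have h1 := (norm_snd_le _).trans (hu.val _ hw1)
    simp only [modelLift_eq, Prod.snd_sub, Real.norm_eq_abs, Prod.snd_add, add_zero] at h1
    have h2 := mult_le p hl (w + (ε w, 0)).1
    have h3 : w.2 * mult p lam (w + (ε w, 0)).1 ≤ r * lam :=
      mul_le_mul hw.2.le h2 (mult_pos p hl0 _).le hr0.le
    linarith [(abs_le.1 h1).2]
  have hinl : ‖ContinuousLinearMap.inl ℝ ℝ ℝ‖ ≤ 1 :=
    ContinuousLinearMap.opNorm_le_bound _ zero_le_one fun x => by simp [Prod.norm_def]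
  obtain ⟨S, hS⟩ := C11.conjugate hM1 hM hM' (hi'.clm (ContinuousLinearMap.inl ℝ ℝ ℝ) hinl) hu hq'
    (fun w _ => hqr w) hηm
    (fun w hw => by simpa [strip, hq2] using hw) hgm hr1 (by linarith) (by linarith)
  have hnear : NearModel p lam (C * ρ * (16 * M + 25 * (10 + 9 * M) ^ 2) + 9 * δ) r f
      (fun w => S w + fderiv ℝ (modelLift p lam) w) := by
    refine ⟨?_, fun x => ?_, fun j y hy0 hyr => ?_⟩
    · simp only [add_sub_cancel_right]
      exact hS
    · simp only [hf, hq2]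
      rw [show ((x, 0) : ℝ × ℝ) + (ε (x, 0), 0) = (x + ε (x, 0), 0) by ext <;> simp, hgb]
    · refine hline j y ⟨hy0, hyr.trans_le hr1⟩ ?_
      simp only [hf, hq2]
      exact (hgm (x := (Real.pi * j / p, y)) ⟨hy0, hyr⟩).2
  refine ⟨H, hH, hstar _ r f _ _ (by linarith) hr0 hr1 hnear
    (fun w hw => hFf w ⟨hw.1, hw.2.trans_le hr1⟩) (fun z hz => ?_) (fun z hz i hi => ?_)
    (fun z hz i hi hF => ?_) fun z hz hfix => ?_⟩
  · obtain ⟨w, rfl⟩ := cov_surjective z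
    have hw : w + (ε w, 0) ∈ strip 1 := hηm hz
    rw [← hFf w hz]
    change (q _).2 = 0 ↔ _
    rw [hq2]
    have key : ∀ v ∈ strip 1, (g v).2 = 0 ↔ v.2 = 0 := fun v hv => by
      have := hbd (cov v) hv
      rwa [← hG v hv] at this
    refine (key _ hw).trans ?_
    simp [cov]
  · obtain ⟨w, rfl⟩ := cov_surjective z
    have hw : w + (ε w, 0) ∈ strip 1 := hηm hz
    rw [← hFf w hz] at hi
    have hi' : (((f w).1 : ℝ) : Real.Angle) = ((Real.pi * (2 * i : ℕ) / p : ℝ) : Real.Angle) := hi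
    obtain ⟨n, hn⟩ := Real.Angle.angle_eq_iff_two_pi_dvd_sub.1 hi'
    obtain ⟨j, hj⟩ : ∃ j : ℤ, j = 2 * (i + p * n) := ⟨_, rfl⟩
    have hfj : (f w).1 = Real.pi * j / p := by
      have : (f w).1 = Real.pi * (2 * i : ℕ) / p + 2 * Real.pi * n := by linarith
      rw [this, hj]
      push_cast
      field_simp
    -- In the original coordinates the image lies on the invariant curve over an even line; hence so
    -- does the point itself.
    have hgv : (g (w + (ε w, 0))).1 = Real.pi * j / p + e j (g (w + (ε w, 0))).2 := by
      have h1 := hqr (g (w + (ε w, 0)))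
      have h2 : q (g (w + (ε w, 0))) = (Real.pi * j / p, (g (w + (ε w, 0))).2) :=
        Prod.ext hfj (hq2 _)
      rw [h2] at h1
      rw [← interp_pi_mul hp heper j]
      exact (congrArg Prod.fst h1).symm
    have hsin : Real.sin (p * (Real.pi * j / p) / 2) = 0 := by
      rw [hj, show (p : ℝ) * (Real.pi * ((2 * (i + p * n) : ℤ) : ℝ) / p) / 2 =
        ((i + p * n : ℤ) : ℝ) * Real.pi by push_cast; field_simp]
      exact Real.sin_int_mul_pi _
    have := (he j).mem_of_image_mem hp hl hM hu (modelAngle_pi_mul hp j) hsin (heout j) hg0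
      (by nlinarith) (by nlinarith) hw hgv
    have h3 : w = (Real.pi * j / p, w.2) := by
      refine (hql w).symm.trans (Eq.trans ?_ (hql (Real.pi * j / p, w.2)))
      congr 1
      have e1 : ε (Real.pi * j / p, w.2) = e j w.2 := interp_pi_mul hp heper j _
      rw [e1]
      ext
      · simpa using this
      · simp
    refine mem_line_cov (x := Real.pi * j / p) (q := n) (congrArg Prod.fst h3) ?_
    rw [hj]
    push_cast
    field_simp
  · obtain ⟨w, rfl⟩ := cov_surjective z
    have hi' : ((w.1 : ℝ) : Real.Angle) = ((Real.pi * (2 * i + 1 : ℕ) / p : ℝ) : Real.Angle) := hi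
    obtain ⟨n, hn⟩ := Real.Angle.angle_eq_iff_two_pi_dvd_sub.1 hi'
    have hwj : w = (Real.pi * ((2 * i + 1 + 2 * p * n : ℤ) : ℝ) / p, w.2) := by
      refine Prod.ext ?_ rfl
      have : w.1 = Real.pi * (2 * i + 1 : ℕ) / p + 2 * Real.pi * n := by linarith
      rw [this]
      push_cast
      field_simp
    rw [← hFf w hz] at hF ⊢
    -- Odd lines only need forward invariance, and the hypothesis that the image stays in the
    -- cylinder provides the height condition.
    have h1 := hline (2 * i + 1 + 2 * p * n) w.2 hz (by rw [← hwj]; exact hF.2)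
    rw [← hwj] at h1
    refine mem_line_cov (q := n) h1 ?_
    push_cast
    field_simp
  · obtain ⟨w, rfl⟩ := cov_surjective z
    have hw : w + (ε w, 0) ∈ strip 1 := hηm hz
    have h1 : G (H.symm (cov w)) = H.symm (cov w) := by
      have := congrArg H.symm hfix
      rwa [H.symm_apply_apply] at this
    rw [hHη, ← hG _ hw] at h1
    have := snd_eq_zero_of_fixed hp hm (by linarith) (by linarith) hu hgb hw h1
    simpa [cov] using this

end

end CylinderDynamics

theorem mainTheorem9 (p : ℕ) (hp : 1 ≤ p) (lam : ℝ) (hlam : 1 < lam) :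
    ∃ δ : ℝ, 0 < δ ∧ ∀ G : CylinderDynamics.Cylinder → CylinderDynamics.Cylinder,
      CylinderDynamics.IsC2Embedding 1 G → CylinderDynamics.C2CloseToModel p lam δ G →
        CylinderDynamics.IsBoundaryMap p 1 G := by
  obtain ⟨δ, hδ, h⟩ := CylinderDynamics.exists_coordinates_hasBoundaryStructure hp hlam
  refine ⟨δ, hδ, fun G hG ⟨g, hg, hgG, hclose⟩ => ⟨hG, ?_⟩⟩
  exact h G g _ hg hgG (CylinderDynamics.C11.of_iteratedFDerivWithin (hg.sub
    (CylinderDynamics.contDiff_modelLift p (zero_lt_one.trans hlam) 2).contDiffOn) hclose) hG.nonneg hG.boundary
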